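/- Let $V=\mathbb C^6$ with its standard hermitian inner product, let $0\ne\mu\in\wedge^6V^*$, let $F$ be a homogeneous cubic polynomial on $V$ that is not a product of three linear forms (in particular $F\ne 0$), let $Y\subset\mathbb P(V)$ be the cubic fourfold $F=0$, and let $Y_{\rm reg}=\{[x]\in Y : dF(x)\ne 0\}$. Let $E$ be the Euler field on $V$, and let $N=\overline{\operatorname{grad}F}/|\operatorname{grad}F|^2$ (where $dF\neq 0$), which satisfies $dF(N)=1$ and is along $Y_{\rm reg}$ a Fubini--Study normal field. Let $\omega_F$ be the $4$-form on $Y_{\rm reg}$ defined by $\omega_F=\iota_N\,d(\iota_N\iota_E\mu)$, i.e. (up to a constant) the residue along $Y_{\rm reg}$, formed with the hermitian metric, of the rational $5$-form $F^{-2}\iota_E\mu$ on $\mathbb P(V)$. It is the sum of a form $\omega_F^{4,0}$ of type $(4,0)$ and a form $\omega_F^{3,1}$ of type $(3,1)$. Say that $f$ is a local-analytic equation of $Y$ at $p\in Y$ if $f$ is a convergent power series in $z_1,\dots,z_5$ that generates the ideal of $Y$ in some system $(z_1,\dots,z_5)$ of local-analytic coordinates of $\mathbb P(V)$ centred at $p$.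 A singular point of $Y$ is of type $A$, $D$ or $E$ if $Y$ has there one of the local-analytic equations $z_1^{n+1}+z_2^2+q$ ($n\ge1$), $z_1^{n-1}+z_1z_2^2+q$ ($n\ge 4$), $z_1^3+z_2^4+q$, $z_1^3+z_1z_2^3+q$, $z_1^3+z_2^5+q$, where $q=z_3^2+z_4^2+z_5^2$. Suppose that $Y$ has at least one singular point that is not of type $A$, $D$ or $E$, and that at every such point $Y$ admits a local-analytic equation $f$ that is weighted homogeneous of some degree $d$ with respect to real weights $w_1,\dots,w_5\ge 0$, not all zero, such that $2d\ge w_1+\dots+w_5$. Then condition (B1) holds: $\omega_F$ is not square integrable on $Y_{\rm reg}$ (for the Fubini--Study metric), and more precisely $$\int_{Y_{\rm reg}}\omega_F^{3,1}\wedge\overline{\omega_F^{3,1}}=-\infty ,$$ in the sense that the positive part of the integrand is integrable and its negative part is not. -/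

import Mathlib

open scoped Topology ENNReal

namespace CubicFourfold

noncomputable section

/-- The six-dimensional complex vector space `V`, with its hermitian inner product
(every hermitian 6-space is unitarily isomorphic to this one). -/
abbrev V : Type := EuclideanSpace ℂ (Fin 6)

/-- The value at `x ∈ V` of a polynomial in the coordinates. -/
def evalAt (F : MvPolynomial (Fin 6) ℂ) (x : V) : ℂ :=
  MvPolynomial.eval (fun i => x i) F

/-- The `i`-th partial derivative of `F` at `x`. -/
def partialAt (F : MvPolynomial (Fin 6) ℂ) (i : Fin 6) (x : V) : ℂ :=
  evalAt (MvPolynomial.pderiv i F) x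

/-! ### Singular points and local equations -/

/-- `[x] ∈ ℙ(V)` is a singular point of the hypersurface `F = 0` of positive degree
(`F x = 0` then follows by the Euler relation, and is stated for clarity). -/
def IsSingularPoint (F : MvPolynomial (Fin 6) ℂ) (x : V) : Prop :=
  x ≠ 0 ∧ evalAt F x = 0 ∧ ∀ i, partialAt F i x = 0

/-- `f = 0` is a local-analytic equation of the hypersurface `F = 0` at `[x] ∈ ℙ(V)`: in suitable
local-analytic coordinates `z` of `ℙ(V)` at `[x]`, the ideal of the hypersurface is generated by
`f`.  The coordinates are given by a lift `ψ` to `V` of the inverse of the coordinate system; that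
`ψ` induces a local isomorphism `(ℂ⁵, 0) ≃ (ℙ(V), [x])` means that its derivative at `0` is
injective modulo `ℂ x`. -/
def HasLocalEquation (F : MvPolynomial (Fin 6) ℂ) (x : V) (f : (Fin 5 → ℂ) → ℂ) : Prop :=
  ∃ (ψ : (Fin 5 → ℂ) → V) (u : (Fin 5 → ℂ) → ℂ),
    AnalyticAt ℂ ψ 0 ∧ ψ 0 = x ∧
    (∀ (v : Fin 5 → ℂ) (c : ℂ), fderiv ℂ ψ 0 v = c • x → v = 0) ∧
    AnalyticAt ℂ u 0 ∧ u 0 ≠ 0 ∧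
    ∀ᶠ z in 𝓝 (0 : Fin 5 → ℂ), evalAt F (ψ z) = u z * f z

/-- The normal forms of the simple hypersurface singularities of dimension four. -/
inductive IsADENormalForm : ((Fin 5 → ℂ) → ℂ) → Prop
  | A (n : ℕ) (hn : 1 ≤ n) :
      IsADENormalForm fun z => z 0 ^ (n + 1) + z 1 ^ 2 + z 2 ^ 2 + z 3 ^ 2 + z 4 ^ 2
  | D (n : ℕ) (hn : 4 ≤ n) :
      IsADENormalForm fun z => z 0 ^ (n - 1) + z 0 * z 1 ^ 2 + z 2 ^ 2 + z 3 ^ 2 + z 4 ^ 2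
  | E6 : IsADENormalForm fun z => z 0 ^ 3 + z 1 ^ 4 + z 2 ^ 2 + z 3 ^ 2 + z 4 ^ 2
  | E7 : IsADENormalForm fun z => z 0 ^ 3 + z 0 * z 1 ^ 3 + z 2 ^ 2 + z 3 ^ 2 + z 4 ^ 2
  | E8 : IsADENormalForm fun z => z 0 ^ 3 + z 1 ^ 5 + z 2 ^ 2 + z 3 ^ 2 + z 4 ^ 2

/-- The hypersurface `F = 0` has at `[x]` a singularity of type `A`, `D` or `E`. -/
def IsOfTypeADE (F : MvPolynomial (Fin 6) ℂ) (x : V) : Prop :=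
  ∃ f, IsADENormalForm f ∧ HasLocalEquation F x f

/-- The analytic germ `f` at `0` is weighted homogeneous of degree `d` for the nonnegative weights
`w`, i.e. `f (t ^ w₁ z₁, …, t ^ w₅ z₅) = t ^ d f (z)`; for an analytic germ this says that every
monomial in its Taylor expansion has weighted degree `d`. -/
def IsWeightedHomogeneousGerm (w : Fin 5 → ℝ) (d : ℝ) (f : (Fin 5 → ℂ) → ℂ) : Prop :=
  ∀ᶠ z in 𝓝 (0 : Fin 5 → ℂ), ∀ t : ℝ, 0 < t → t ≤ 1 →
    f (fun i => ((t ^ w i : ℝ) : ℂ) * z i) = ((t ^ d : ℝ) : ℂ) * f z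

/-- `F = 0` admits at `[x]` a weighted homogeneous local-analytic equation, with nonnegative
weights that are not all zero, such that twice its degree is at least the sum of the weights. -/
def HasGoodWeightedEquation (F : MvPolynomial (Fin 6) ℂ) (x : V) : Prop :=
  ∃ (f : (Fin 5 → ℂ) → ℂ) (w : Fin 5 → ℝ) (d : ℝ),
    (∀ i, 0 ≤ w i) ∧ (∃ i, w i ≠ 0) ∧ IsWeightedHomogeneousGerm w d f ∧
    ∑ i, w i ≤ 2 * d ∧ HasLocalEquation F x f

/-! ### The form `ω_F`

Differential forms on (open subsets of) `ℙ(V)` and of `Y_reg` are described by their pull-backs to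
the corresponding cones in `V`. -/

/-- The hermitian normal field `N` of type `(1,0)`, `N = conj (grad F) / |grad F|²`, so that
`dF (N) = 1`. On the cone over `Y_reg` it is orthogonal to the cone for the
hermitian inner product, so that it is normal to `Y_reg` for the Fubini-Study metric. -/
def normalField (F : MvPolynomial (Fin 6) ℂ) (x : V) : V :=
  WithLp.toLp 2 fun i =>
    (starRingEnd ℂ) (partialAt F i x) / ((∑ j, ‖partialAt F j x‖ ^ 2 : ℝ) : ℂ)

/-- The form `α = ι_N ι_E μ` on the open set `dF ≠ 0` of `V`, where `E` is the Euler field `x ↦ x`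
(up to sign: the first two arguments of `μ` are `x` and `N x`). -/
def alphaForm (F : MvPolynomial (Fin 6) ℂ) (μ : V [⋀^Fin 6]→L[ℂ] ℂ) (x : V) :
    V [⋀^Fin 4]→L[ℝ] ℂ :=
  ((μ.restrictScalars ℝ).curryLeft x).curryLeft (normalField F x)

/-- The `4`-form `ω_F` (pulled back to the cone over `Y_reg`), `ω_F = ι_N d α`.

Here `F⁻² μ` has as residue along the hyperplane at infinity the rational `5`-form
`F⁻² ι_E μ` on `ℙ(V)`, which has a second order pole along `Y`.  Now `F⁻¹ α` is basic
and scale-invariant, so it is a form near `Y_reg` in `ℙ(V)` minus `Y`, and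
`F⁻² ι_E μ + d (F⁻¹ α) = F⁻¹ (d α + 3 ι_N μ)` has a logarithmic pole along `Y_reg`.  Its residue is
the restriction to `Y_reg` of `ι_N (d α + 3 ι_N μ) = ι_N d α`.  It is the sum of a form of
type `(4,0)` and one of type `(3,1)`. Constant factors can be absorbed in `μ`. -/
def omega (F : MvPolynomial (Fin 6) ℂ) (μ : V [⋀^Fin 6]→L[ℂ] ℂ) (x : V) :
    V [⋀^Fin 4]→L[ℝ] ℂ :=
  (extDeriv (alphaForm F μ) x).curryLeft (normalField F x)

/-- Multiplication by a complex number, as a real linear map. -/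
def rotate (c : ℂ) : V →L[ℝ] V :=
  (c • ContinuousLinearMap.id ℂ V).restrictScalars ℝ

/-- The component of Hodge type `(3,1)` of a `4`-form at a point.  Multiplication of the tangent
vectors by `ζ = exp (iπ/4)` multiplies a form of type `(p,q)` by `ζ ^ (p - q)`; here `p + q = 4`
and `p - q = 2` modulo `8` only for `(p,q) = (3,1)`, so averaging against the character
`k ↦ ζ ^ (2k) = i ^ k` gives the projection onto type `(3,1)`. -/
def component31 (η : V [⋀^Fin 4]→L[ℝ] ℂ) : V [⋀^Fin 4]→L[ℝ] ℂ :=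
  (1 / 8 : ℂ) • ∑ k ∈ Finset.range 8,
    (-Complex.I) ^ k •
      η.compContinuousLinearMap (rotate (Complex.exp (Real.pi * Complex.I / 4) ^ k))

/-- The `8`-form `η ∧ conj η` attached to a `4`-form `η`. -/
def wedgeConj (η : V [⋀^Fin 4]→L[ℝ] ℂ) : V [⋀^Fin 4 ⊕ Fin 4]→ₗ[ℝ] ℂ :=
  (LinearMap.mul' ℝ ℂ).compAlternatingMap
    (η.toAlternatingMap.domCoprod
      ((Complex.conjCLE : ℂ →L[ℝ] ℂ).compContinuousAlternatingMap η).toAlternatingMap)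

/-! ### Integration over `Y_reg`

`Y_reg` carries the Fubini-Study metric, the quotient of the metric of the unit sphere by the
circle group.  The part of the unit sphere over `Y_reg` is a manifold of real dimension `9`,
a circle bundle over `Y_reg` all of whose fibres have length `2π`, and integrating a function over
`Y_reg` is, up to a positive constant factor, the same as integrating its pull-back over this
circle bundle for the `9`-dimensional Hausdorff measure. -/

/-- The part of the unit sphere of `V` that lies over `Y_reg`. -/
def regLink (F : MvPolynomial (Fin 6) ℂ) : Set V :=
  {x | ‖x‖ = 1 ∧ evalAt F x = 0 ∧ ∃ i, partialAt F i x ≠ 0}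

/-- For `x ∈ regLink F`, the space of vectors in the kernel of `dF` at `x` that are perpendicular
to `x`.  It maps isometrically onto the tangent space of `Y_reg` at `[x]`. -/
def tangent (F : MvPolynomial (Fin 6) ℂ) (x : V) : Submodule ℂ V :=
  LinearMap.ker (∑ i, partialAt F i x • (EuclideanSpace.proj i : V →L[ℂ] ℂ) : V →L[ℂ] ℂ).toLinearMap
    ⊓ (ℂ ∙ x)ᗮ

/-- A unitary basis of the (four-dimensional) tangent space of `Y_reg` at `[x]`. -/
def IsUnitaryFrame (F : MvPolynomial (Fin 6) ℂ) (x : V) (e : Fin 4 → V) : Prop :=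
  Orthonormal ℂ e ∧ ∀ j, e j ∈ tangent F x

open Classical in
/-- The density on `Y_reg` of the `8`-form `η ∧ conj η` with respect to the Fubini-Study volume and
the complex orientation: its value on `(e₁, …, e₄, i e₁, …, i e₄)`, with `e` a unitary basis of
the tangent space (this is a positively oriented orthonormal basis and the value, which is real,
does not depend on the choice of `e`). -/
def wedgeDensity (F : MvPolynomial (Fin 6) ℂ) (η : V → V [⋀^Fin 4]→L[ℝ] ℂ) (x : V) : ℝ :=
  if h : ∃ e : Fin 4 → V, IsUnitaryFrame F x e then
    (wedgeConj (η x) (Sum.elim h.choose fun j => Complex.I • h.choose j)).re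
  else 0

/-- The integral over `Y_reg` of the function with pull-back `g` to the circle bundle is `-∞`:
the positive part of `g` is integrable and the negative part is not. -/
def IntegralIsNegInfinite (F : MvPolynomial (Fin 6) ℂ) (g : V → ℝ) : Prop :=
  ∫⁻ x in regLink F, ENNReal.ofReal (g x) ∂(MeasureTheory.Measure.hausdorffMeasure 9) < ∞ ∧
  ∫⁻ x in regLink F, ENNReal.ofReal (-g x) ∂(MeasureTheory.Measure.hausdorffMeasure 9) = ∞

/-- The restriction of a `4`-form to the tangent space of `Y_reg` at `[x]`. -/
def restrictTangent (F : MvPolynomial (Fin 6) ℂ) (x : V) (η : V [⋀^Fin 4]→L[ℝ] ℂ) :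
    tangent F x [⋀^Fin 4]→L[ℝ] ℂ :=
  η.compContinuousLinearMap ((tangent F x).subtypeL.restrictScalars ℝ)

/-- The form `η` on `Y_reg` is square integrable. -/
def IsSquareIntegrable (F : MvPolynomial (Fin 6) ℂ) (η : V → V [⋀^Fin 4]→L[ℝ] ℂ) : Prop :=
  ∫⁻ x in regLink F, ‖restrictTangent F x (η x)‖ₑ ^ 2
    ∂(MeasureTheory.Measure.hausdorffMeasure 9) < ∞

/-- Condition (B1): `ω_F` is not square integrable on `Y_reg`; more precisely, the
integral over `Y_reg` of `ω ∧ conj ω`, with `ω` the component of `ω_F` of type `(3,1)`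
(for which this is a form of constant sign), is `-∞`. -/
def ConditionB1 (F : MvPolynomial (Fin 6) ℂ) (μ : V [⋀^Fin 6]→L[ℂ] ℂ) : Prop :=
  IntegralIsNegInfinite F (wedgeDensity F fun x => component31 (omega F μ x)) ∧
  ¬ IsSquareIntegrable F (omega F μ)

/-- The divisor `F = 0` is a union of (not necessarily distinct) hyperplanes (or `F = 0`). -/
def IsUnionOfHyperplanes (F : MvPolynomial (Fin 6) ℂ) : Prop :=
  ∃ L : Fin 3 → MvPolynomial (Fin 6) ℂ, (∀ i, (L i).IsHomogeneous 1) ∧ F = ∏ i, L i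

end

end CubicFourfold

/-! The form $\omega_F^{3,1}$ arises from the antiholomorphic part of the derivative of $N$, which
is the conjugate Hessian of $F$; so it represents the second fundamental form of $Y$. With $B$ the
polarization of $F$ and $e$ a unitary frame of the tangent space at the unit vector $x$,
`wedgeConj_frame` computes the density of $\omega_F^{3,1}\wedge\overline{\omega_F^{3,1}}$ as a
negative constant times $|\operatorname{grad}F|^{-6}\sum_{i,j}|B(x,e_i,e_j)|^2$. The sign is
constant because the Hessian is symmetric. Hence the positive part of the integrand is zero, and
both claims of (B1) follow once the integral of `curvature` is infinite
(`conditionB1_of_lintegral_curvature`); up to a constant, this function bounds the absolute value of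
the density from below, and it is visibly measurable.

Divergence is proved near one point $x$ by scaling. Let four of the five affine coordinates have
weights $W_i$, the fifth being found from $F=0$. A box at scale $\rho$ has volume of order
$\rho^{2\sum W}$. If the gradient is of order $\rho^a$ there, and the Hessian on some pair of
tangent vectors of order $\rho^m$, then the curvature is at least of order $\rho^{2m-6a}$. If $\sum
W+m\le 3a$, each of infinitely many disjoint boxes, with $\rho$ in geometric progression,
contributes at least a fixed amount (`lintegral_curvature_eq_top`,
`CubicFourfold.lintegral_curvature_of_scaling`). A Lipschitz chart is enough to compare Hausdorff
measure with the volume of the boxes.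

If $Y$ contains a hyperplane, $F=Lq$ with $q$ quadratic, and one approaches the hyperplane along the
quadric, at a point where the two are transversal or tangent; if neither is possible, $F$ is a
product of three linear forms (`IsProduct.lintegral_curvature`).

Otherwise let $r$ be the rank of the quadratic form $B(x,\cdot,\cdot)$ at the given singular point.
For $r=0$, $Y$ is a cone with vertex $[x]$ (`lintegral_curvature_of_cone`). For $r=1$ and $r=2$ the
affine equation is $3s^2+\dots$ or $6st+\dots$ with cubic remainder, and the lowest nonvanishing
coefficients of the cubic select a suitable scaling; if all relevant coefficients vanish, $Y$
contains a hyperplane (`RankOne.lintegral_curvature`, `RankTwo.lintegral_curvature`).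

The weights are needed for $r\ge 3$ (`lintegral_curvature_of_rank_three`). A quadratic form of rank
at least three does not vanish on any hyperplane, so the curvature is at least a constant times
$|\operatorname{grad}F|^{-6}$, and what is needed is a large supply of points with small gradient.
Nonzero second derivatives of the weighted homogeneous equation $f$ at $0$ occur only where
$w_i+w_j=d$. So the weights in a nondegenerate principal minor, with index set $P$, have mean $d/2$,
and may all be replaced by $d/2$ without changing the sum. If the $\partial_if$, $i\in P$, are taken
as coordinates, there are zeros of $f$ over the scaled boxes with $0\ne|df|=O(\rho^{d/2})$. One
coordinate of weight $d/2$ is eliminated, so that $2\sum W\le 2(2d-d/2)=3d$, the order of $|df|^6$.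
This is where $2d\ge\sum w$ enters. -/

open scoped Topology ENNReal NNReal

/-! ### Polarization of the cubic form -/

namespace CubicFourfold

/-- The trilinear form `B` is symmetric and polarizes the cubic form `F`. -/
structure IsPolarization (F : MvPolynomial (Fin 6) ℂ) (B : V → V → V → ℂ) : Prop where
  add_left : ∀ u u' v w, B (u + u') v w = B u v w + B u' v w
  smul_left : ∀ (c : ℂ) u v w, B (c • u) v w = c * B u v w
  cont : Continuous fun p : V × V × V => B p.1 p.2.1 p.2.2
  swap12 : ∀ u v w, B u v w = B v u w
  swap23 : ∀ u v w, B u v w = B u w v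
  eval_eq : ∀ x, evalAt F x = B x x x
  partial_eq : ∀ i x, partialAt F i x = 3 * B x x (EuclideanSpace.single i 1)

theorem evalAt_euler {F : MvPolynomial (Fin 6) ℂ} {n : ℕ} (hF : F.IsHomogeneous n) (x : V) :
    ∑ i, x i * evalAt (MvPolynomial.pderiv i F) x = n * evalAt F x := by
  have h := congrArg (MvPolynomial.eval fun i => x i) hF.sum_X_mul_pderiv
  simpa [evalAt] using h

/-- Third partial derivatives of a cubic form are constants `a i j k`, symmetric because derivations
commute. Euler's relation in degrees 1, 2 and 3 gives `6 F = ∑ a i j k xᵢ xⱼ xₖ`, so `B` has the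
coefficients `a / 6`. -/
theorem exists_isPolarization {F : MvPolynomial (Fin 6) ℂ} (hF : F.IsHomogeneous 3) :
    ∃ B, IsPolarization F B := by
  let a : Fin 6 → Fin 6 → Fin 6 → ℂ := fun i j k =>
    evalAt (MvPolynomial.pderiv k (MvPolynomial.pderiv j (MvPolynomial.pderiv i F))) 0
  have ha : ∀ i j k (x : V),
      evalAt (MvPolynomial.pderiv k (MvPolynomial.pderiv j (MvPolynomial.pderiv i F))) x
        = a i j k := by
    intro i j k x
    have h0 : (MvPolynomial.pderiv k (MvPolynomial.pderiv j
        (MvPolynomial.pderiv i F))).IsHomogeneous 0 := ((hF.pderiv).pderiv).pderiv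
    obtain ⟨c, hc⟩ : ∃ c, MvPolynomial.pderiv k (MvPolynomial.pderiv j
        (MvPolynomial.pderiv i F)) = MvPolynomial.C c :=
      ⟨_, MvPolynomial.totalDegree_eq_zero_iff_eq_C.1 (Nat.le_zero.1 h0.totalDegree_le)⟩
    simp [a, evalAt, hc]
  have h2 : ∀ i j (x : V), evalAt (MvPolynomial.pderiv j (MvPolynomial.pderiv i F)) x
      = ∑ k, x k * a i j k := by
    intro i j x
    have := evalAt_euler (n := 1) ((hF.pderiv (i := i)).pderiv (i := j)) x
    simp only [ha, Nat.cast_one, one_mul] at this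
    exact this.symm
  have h1 : ∀ i (x : V), 2 * evalAt (MvPolynomial.pderiv i F) x
      = ∑ j, x j * ∑ k, x k * a i j k := by
    intro i x
    have := evalAt_euler (n := 2) (hF.pderiv (i := i)) x
    simp only [h2] at this
    exact_mod_cast this.symm
  have h0 : ∀ x : V, 6 * evalAt F x = ∑ i, x i * ∑ j, x j * ∑ k, x k * a i j k := by
    intro x
    have := evalAt_euler (n := 3) hF x
    simp only [← h1]
    push_cast at this
    rw [show (6 : ℂ) = 2 * 3 by norm_num, mul_assoc, ← this, Finset.mul_sum]
    exact Finset.sum_congr rfl fun i _ => by ring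
  have hcomm : ∀ (i j : Fin 6) (G : MvPolynomial (Fin 6) ℂ),
      MvPolynomial.pderiv i (MvPolynomial.pderiv j G)
        = MvPolynomial.pderiv j (MvPolynomial.pderiv i G) := by
    intro i j G
    -- The commutator is itself a derivation, so it suffices that it kills the variables.
    have : ⁅MvPolynomial.pderiv (R := ℂ) i, MvPolynomial.pderiv (R := ℂ) j⁆ = 0 := by
      apply MvPolynomial.derivation_ext
      intro k
      simp [Derivation.commutator_apply, MvPolynomial.pderiv_X, Pi.single_apply]
      split_ifs <;> simp
    have h := congrArg (fun D => D G) this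
    simpa [Derivation.commutator_apply, sub_eq_zero] using h
  have a12 : ∀ i j k, a i j k = a j i k := fun i j k => by simp only [a, hcomm j i]
  have a23 : ∀ i j k, a i j k = a i k j := fun i j k => by simp only [a, hcomm k j]
  let B : V → V → V → ℂ := fun u v w => ∑ i, ∑ j, ∑ k, a i j k / 6 * (u i * (v j * w k))
  have hB : ∀ u v w, B u v w = ∑ i, ∑ j, ∑ k, a i j k / 6 * (u i * (v j * w k)) :=
    fun _ _ _ => rfl
  refine ⟨B, ⟨?_, ?_, by fun_prop, ?_, ?_, ?_, ?_⟩⟩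
  · intro u u' v w
    simp only [hB, ← Finset.sum_add_distrib, PiLp.add_apply]
    refine Finset.sum_congr rfl fun i _ => Finset.sum_congr rfl fun j _ =>
      Finset.sum_congr rfl fun k _ => ?_
    ring
  · intro c u v w
    simp only [hB, Finset.mul_sum, PiLp.smul_apply, smul_eq_mul]
    refine Finset.sum_congr rfl fun i _ => Finset.sum_congr rfl fun j _ =>
      Finset.sum_congr rfl fun k _ => ?_
    ring
  · intro u v w
    rw [hB, hB, Finset.sum_comm]
    refine Finset.sum_congr rfl fun i _ => Finset.sum_congr rfl fun j _ =>
      Finset.sum_congr rfl fun k _ => ?_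
    rw [a12 j i]; ring
  · intro u v w
    rw [hB, hB]
    refine Finset.sum_congr rfl fun i _ => ?_
    rw [Finset.sum_comm]
    refine Finset.sum_congr rfl fun j _ => Finset.sum_congr rfl fun k _ => ?_
    rw [a23 i k]; ring
  · intro x
    have : evalAt F x = (6 * evalAt F x) / 6 := by ring
    rw [this, h0, hB]
    simp only [Finset.mul_sum, Finset.sum_div]
    refine Finset.sum_congr rfl fun i _ => Finset.sum_congr rfl fun j _ =>
      Finset.sum_congr rfl fun k _ => ?_
    ring
  · intro i x
    have : partialAt F i x = (2 * evalAt (MvPolynomial.pderiv i F) x) / 2 := by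
      rw [partialAt]; ring
    rw [this, h1, hB]
    have hs : ∀ (f : Fin 6 → ℂ), ∑ k, f k * (EuclideanSpace.single i (1:ℂ) : V) k = f i := by
      intro f; simp
    have : ∀ l j, ∑ k, a l j k / 6 * (x l * (x j * (EuclideanSpace.single i (1:ℂ) : V) k))
        = a l j i / 6 * (x l * x j) := by
      intro l j
      rw [← hs fun k => a l j k / 6 * (x l * x j)]
      exact Finset.sum_congr rfl fun k _ => by ring
    simp only [this, Finset.mul_sum, Finset.sum_div]
    refine Finset.sum_congr rfl fun l _ => Finset.sum_congr rfl fun j _ => ?_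
    rw [a12 i l, a23 l i]; ring

namespace IsPolarization

variable {F : MvPolynomial (Fin 6) ℂ} {B : V → V → V → ℂ}

theorem swap13 (hB : IsPolarization F B) (u v w : V) : B u v w = B w v u := by
  rw [hB.swap12, hB.swap23, hB.swap12]

theorem add_mid (hB : IsPolarization F B) (u v v' w : V) : B u (v + v') w = B u v w + B u v' w := by
  rw [hB.swap12, hB.add_left, hB.swap12 v, hB.swap12 v']

theorem add_right (hB : IsPolarization F B) (u v w w' : V) : B u v (w + w') = B u v w + B u v w' := by
  rw [hB.swap23, hB.add_mid, hB.swap23 u w, hB.swap23 u w']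

theorem smul_mid (hB : IsPolarization F B) (c : ℂ) (u v w : V) : B u (c • v) w = c * B u v w := by
  rw [hB.swap12, hB.smul_left, hB.swap12 v]

theorem smul_right (hB : IsPolarization F B) (c : ℂ) (u v w : V) : B u v (c • w) = c * B u v w := by
  rw [hB.swap23, hB.smul_mid, hB.swap23 u w]

theorem zero_left (hB : IsPolarization F B) (v w : V) : B 0 v w = 0 := by
  have := hB.smul_left 0 0 v w
  simpa using this

theorem zero_right (hB : IsPolarization F B) (u v : V) : B u v 0 = 0 := by rw [hB.swap13, hB.zero_left]

theorem sum_right (hB : IsPolarization F B) {ι : Type*} (s : Finset ι) (f : ι → V) (u v : V) :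
    B u v (∑ i ∈ s, f i) = ∑ i ∈ s, B u v (f i) := by
  classical
  induction s using Finset.induction_on with
  | empty => simp [hB.zero_right]
  | insert i s hi ih => rw [Finset.sum_insert hi, Finset.sum_insert hi, hB.add_right, ih]

theorem sum_mid (hB : IsPolarization F B) {ι : Type*} (s : Finset ι) (f : ι → V) (u v : V) :
    B u (∑ i ∈ s, f i) v = ∑ i ∈ s, B u (f i) v := by
  rw [hB.swap23, hB.sum_right]
  exact Finset.sum_congr rfl fun i _ => hB.swap23 _ _ _

theorem sum_left (hB : IsPolarization F B) {ι : Type*} (s : Finset ι) (f : ι → V) (u v : V) :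
    B (∑ i ∈ s, f i) u v = ∑ i ∈ s, B (f i) u v := by
  rw [hB.swap12, hB.sum_mid]
  exact Finset.sum_congr rfl fun i _ => hB.swap12 _ _ _

theorem continuous_comp (hB : IsPolarization F B) {X : Type*} [TopologicalSpace X] {f g h : X → V} (hf : Continuous f)
    (hg : Continuous g) (hh : Continuous h) : Continuous fun x => B (f x) (g x) (h x) :=
  hB.cont.comp (hf.prodMk (hg.prodMk hh))

/-- The linear form `B u v ·`. -/
def lin (hB : IsPolarization F B) (u v : V) : V →ₗ[ℂ] ℂ where
  toFun := B u v
  map_add' := hB.add_right u v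
  map_smul' c w := by simp [hB.smul_right]

theorem coord_sum (v : V) : v = ∑ i, v i • (EuclideanSpace.single i (1:ℂ) : V) := by
  ext j
  simp [Pi.single_apply]

theorem eq_sum_partial (hB : IsPolarization F B) (p v : V) : 3 * B p p v = ∑ i, partialAt F i p * v i := by
  conv_lhs => rw [coord_sum v]
  simp only [hB.sum_right, hB.smul_right, hB.partial_eq, Finset.mul_sum]
  exact Finset.sum_congr rfl fun i _ => by ring

/-- Compactness of the product of unit balls and homogeneity in each argument. -/
theorem norm_le (hB : IsPolarization F B) : ∃ M : ℝ, 0 < M ∧ ∀ u v w, ‖B u v w‖ ≤ M * ‖u‖ * ‖v‖ * ‖w‖ := by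
  have hcomp : IsCompact (Metric.closedBall (0:V) 1 ×ˢ (Metric.closedBall (0:V) 1 ×ˢ
    Metric.closedBall (0:V) 1)) :=
    (isCompact_closedBall _ _).prod ((isCompact_closedBall _ _).prod (isCompact_closedBall _ _))
  obtain ⟨M, hM⟩ := hcomp.exists_bound_of_continuousOn hB.cont.continuousOn
  have hM' : ∀ u v w : V, ‖u‖ ≤ 1 → ‖v‖ ≤ 1 → ‖w‖ ≤ 1 → ‖B u v w‖ ≤ |M| + 1 := fun u v w hu hv hw =>
    ((hM (u, v, w) (by simp [hu, hv, hw])).trans (le_abs_self M)).trans (by linarith)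
  refine ⟨|M| + 1, by positivity, fun u v w => ?_⟩
  have key : ∀ u : V, ∃ u' : V, ‖u'‖ ≤ 1 ∧ u = (‖u‖ : ℂ) • u' := by
    intro u
    by_cases hu : u = 0
    · exact ⟨0, by simp, by simp [hu]⟩
    · refine ⟨((‖u‖ : ℂ)⁻¹) • u, ?_, ?_⟩
      · rw [norm_smul]; simp [hu]
      · rw [smul_smul, mul_inv_cancel₀ (by simpa using hu), one_smul]
  obtain ⟨u', hu', hu⟩ := key u
  obtain ⟨v', hv', hv⟩ := key v
  obtain ⟨w', hw', hw⟩ := key w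
  have : B u v w = ‖u‖ * (‖v‖ * (‖w‖ * B u' v' w')) := by
    conv_lhs => rw [hu, hv, hw, hB.smul_left, hB.smul_mid, hB.smul_right]
  rw [this]
  simp only [norm_mul, Complex.norm_real, norm_norm]
  calc ‖u‖ * (‖v‖ * (‖w‖ * ‖B u' v' w'‖)) = (‖u‖ * ‖v‖ * ‖w‖) * ‖B u' v' w'‖ := by ring
    _ ≤ (‖u‖ * ‖v‖ * ‖w‖) * (|M| + 1) := by gcongr; exact hM' _ _ _ hu' hv' hw'
    _ = _ := by ring

end IsPolarization

/-- The linear form `∑ aᵢ Xᵢ`. -/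
noncomputable def linearPoly (α : V →L[ℂ] ℂ) : MvPolynomial (Fin 6) ℂ :=
  ∑ i, MvPolynomial.C (α (EuclideanSpace.single i 1)) * MvPolynomial.X i

theorem evalAt_linearPoly (α : V →L[ℂ] ℂ) (x : V) : evalAt (linearPoly α) x = α x := by
  have hx : x = ∑ i, x i • (EuclideanSpace.single i (1:ℂ) : V) := by
    ext j
    simp [Pi.single_apply]
  conv_rhs => rw [hx]
  simp [evalAt, linearPoly, mul_comm]

/-- A polynomial over an infinite field is determined by its values. In the reducible case this
turns a failure of all scalings into a contradiction. -/
theorem isUnionOfHyperplanes_of_eq_mul {F : MvPolynomial (Fin 6) ℂ}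
    {B : V → V → V → ℂ} (hB : IsPolarization F B)
    (α β γ : V →L[ℂ] ℂ) (h : ∀ x, B x x x = α x * β x * γ x) : IsUnionOfHyperplanes F := by
  refine ⟨![linearPoly α, linearPoly β, linearPoly γ], ?_, ?_⟩
  · have : ∀ δ, (linearPoly δ).IsHomogeneous 1 := fun δ =>
      MvPolynomial.IsHomogeneous.sum _ _ _ fun i _ => by
        simpa using (MvPolynomial.isHomogeneous_C (Fin 6) (δ (EuclideanSpace.single i 1))).mul
          (MvPolynomial.isHomogeneous_X ℂ i)
    intro i
    fin_cases i <;> simp [this]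
  · refine MvPolynomial.funext fun y => ?_
    have h1 := (hB.eval_eq (WithLp.toLp 2 y)).trans (h _)
    have h2 := evalAt_linearPoly α (WithLp.toLp 2 y)
    have h3 := evalAt_linearPoly β (WithLp.toLp 2 y)
    have h4 := evalAt_linearPoly γ (WithLp.toLp 2 y)
    simp only [evalAt] at h1 h2 h3 h4
    simp [Fin.prod_univ_three, h1, h2, h3, h4]

end CubicFourfold

/-! ### Wedge products, and the pairing of forms of type (3,1) on ℂ⁴ with their conjugates -/

namespace CubicFourfold

section Wedge

variable {ι : Type*} [Fintype ι] [DecidableEq ι] {U W : Type*} [AddCommGroup U] [Module ℝ U] [AddCommGroup W] [Module ℝ W]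

/-- The wedge product of two complex valued alternating maps. -/
noncomputable def wedgeMul (a b : U [⋀^ι]→ₗ[ℝ] ℂ) : U [⋀^ι ⊕ ι]→ₗ[ℝ] ℂ :=
  (LinearMap.mul' ℝ ℂ).compAlternatingMap (a.domCoprod b)

theorem wedgeMul_apply (a b : U [⋀^ι]→ₗ[ℝ] ℂ) (v : ι ⊕ ι → U) :
    wedgeMul a b v = ∑ σ : Equiv.Perm.ModSumCongr ι ι,
      ((Equiv.Perm.sign (Quotient.out σ) : ℤ) : ℂ) *
        (a (fun i => v (Quotient.out σ (Sum.inl i))) *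
          b (fun i => v (Quotient.out σ (Sum.inr i)))) := by
  have h : (a.domCoprod b) v = ∑ σ : Equiv.Perm.ModSumCongr ι ι,
      AlternatingMap.domCoprod.summand a b σ v := by
    rw [AlternatingMap.domCoprod_apply, sum_apply]
  rw [wedgeMul, LinearMap.compAlternatingMap_apply, h, map_sum]
  refine Finset.sum_congr rfl fun σ _ => ?_
  conv_lhs => rw [← Quotient.out_eq' σ, AlternatingMap.domCoprod.summand_mk'']
  rw [smul_apply, MultilinearMap.domDomCongr_apply, MultilinearMap.domCoprod_apply,
    Units.smul_def, map_zsmul, LinearMap.mul'_apply, zsmul_eq_mul]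
  rfl

theorem wedgeMul_compLinearMap (a b : U [⋀^ι]→ₗ[ℝ] ℂ) (f : W →ₗ[ℝ] U)
    (v : ι ⊕ ι → W) :
    wedgeMul (a.compLinearMap f) (b.compLinearMap f) v = wedgeMul a b fun i => f (v i) := by
  simp only [wedgeMul_apply]
  rfl

omit [Fintype ι] [DecidableEq ι] in
theorem alternatingMap_sum_apply {α : Type*} (s : Finset α) (f : α → U [⋀^ι]→ₗ[ℝ] ℂ) (v : ι → U) :
    (∑ i ∈ s, f i) v = ∑ i ∈ s, f i v := by
  classical
  induction s using Finset.induction_on with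
  | empty => simp
  | insert i s hi ih => rw [Finset.sum_insert hi, Finset.sum_insert hi, AlternatingMap.add_apply, ih]

theorem wedgeMul_sum_smul {α κ : Type*} (s : Finset α) (t : Finset κ) (c : α → ℂ) (d : κ → ℂ)
    (a : α → U [⋀^ι]→ₗ[ℝ] ℂ) (b : κ → U [⋀^ι]→ₗ[ℝ] ℂ) (v : ι ⊕ ι → U) :
    wedgeMul (∑ i ∈ s, c i • a i) (∑ j ∈ t, d j • b j) v
      = ∑ i ∈ s, ∑ j ∈ t, c i * d j * wedgeMul (a i) (b j) v := by
  simp only [wedgeMul_apply, alternatingMap_sum_apply, Finset.sum_mul_sum]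
  simp only [Finset.mul_sum]
  rw [Finset.sum_comm]
  refine Finset.sum_congr rfl fun i _ => ?_
  rw [Finset.sum_comm]
  refine Finset.sum_congr rfl fun j _ => Finset.sum_congr rfl fun σ _ => ?_
  exact (by intros; ring : ∀ s c d x y : ℂ, s * (c * x * (d * y)) = c * d * (s * (x * y)))
    _ _ _ _ _

/-- The wedge product of linear forms. -/
noncomputable def wedgeForms (φ : ι → U →ₗ[ℝ] ℂ) : U [⋀^ι]→ₗ[ℝ] ℂ :=
  MultilinearMap.alternatization ((MultilinearMap.mkPiAlgebra ℝ (ι) ℂ).compLinearMap φ)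

theorem wedgeForms_apply (φ : ι → U →ₗ[ℝ] ℂ) (v : ι → U) :
    wedgeForms φ v = (Matrix.of fun p q => φ q (v p)).det := by
  rw [wedgeForms, MultilinearMap.alternatization_apply, Matrix.det_apply]
  simp

/-- The wedge product of two alternatizations is the alternatization of the product, so the wedge of
all the linear forms together is a single determinant. -/
theorem wedgeMul_wedgeForms (φ ψ : ι → U →ₗ[ℝ] ℂ) (v : ι ⊕ ι → U) :
    wedgeMul (wedgeForms φ) (wedgeForms ψ) v
      = (Matrix.of fun p q => Sum.elim φ ψ q (v p)).det := by
  rw [wedgeMul, LinearMap.compAlternatingMap_apply, wedgeForms, wedgeForms,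
    ← MultilinearMap.domCoprod_alternization, MultilinearMap.alternatization_apply,
    Matrix.det_apply, map_sum]
  refine Finset.sum_congr rfl fun σ _ => ?_
  rw [Units.smul_def, Units.smul_def, map_zsmul, MultilinearMap.domDomCongr_apply,
    MultilinearMap.domCoprod_apply, LinearMap.mul'_apply, MultilinearMap.compLinearMap_apply,
    MultilinearMap.compLinearMap_apply, MultilinearMap.mkPiAlgebra_apply,
    MultilinearMap.mkPiAlgebra_apply, Fintype.prod_sum_type]
  rfl

end Wedge

/-- The linear forms `z_q`, with the one in place `j` replaced by `conj z_i`. -/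
noncomputable def replacedForm (i j q : Fin 4) : (Fin 4 → ℂ) →ₗ[ℝ] ℂ :=
  if q = j then (Complex.conjCLE : ℂ →L[ℝ] ℂ).toLinearMap ∘ₗ LinearMap.proj i else LinearMap.proj q

/-- The linear forms `conj z_q`, with the one in place `l` replaced by `z_k`. -/
noncomputable def conjReplacedForm (k l q : Fin 4) : (Fin 4 → ℂ) →ₗ[ℝ] ℂ :=
  if q = l then LinearMap.proj k else (Complex.conjCLE : ℂ →L[ℝ] ℂ).toLinearMap ∘ₗ LinearMap.proj q

/-- The positively oriented real basis `e₁, …, e₄, i e₁, …, i e₄` of `ℂ⁴`. -/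
noncomputable def realFrame : Fin 4 ⊕ Fin 4 → (Fin 4 → ℂ) :=
  Sum.elim (fun j => Pi.single j 1) fun j => Complex.I • Pi.single j 1

/-- In blocks the matrix has rows `(1, 1)` and `(i, -i)`, and `(-2i)⁴ = 16`. -/
theorem det_realFrame :
    (Matrix.of fun p q => Sum.elim (fun q => (LinearMap.proj q : (Fin 4 → ℂ) →ₗ[ℝ] ℂ))
      (fun q => (Complex.conjCLE : ℂ →L[ℝ] ℂ).toLinearMap ∘ₗ LinearMap.proj q) q
        (realFrame p)).det = 16 := by
  have : (Matrix.of fun p q => Sum.elim (fun q => (LinearMap.proj q : (Fin 4 → ℂ) →ₗ[ℝ] ℂ))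
      (fun q => (Complex.conjCLE : ℂ →L[ℝ] ℂ).toLinearMap ∘ₗ LinearMap.proj q) q
        (realFrame p)) = Matrix.fromBlocks (1 : Matrix (Fin 4) (Fin 4) ℂ) 1
          (Complex.I • 1) (-Complex.I • 1) := by
    ext p q
    rcases p with p | p <;> rcases q with q | q <;>
      simp [realFrame, Matrix.one_apply, Pi.single_apply, eq_comm, apply_ite]
  rw [this, Matrix.det_fromBlocks_one₁₁, mul_one, ← sub_smul, Matrix.det_smul]
  simp only [Fintype.card_fin, Matrix.det_one, mul_one]
  have : (-Complex.I - Complex.I) ^ 4 = 16 * (Complex.I ^ 2) ^ 2 := by ring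
  rw [this, Complex.I_sq]; norm_num

/-- Among the eight linear forms, `z_k` occurs twice if `k ≠ j`, and `conj z_i` occurs twice if `k =
j` but `l ≠ i`. In the remaining case the list is `z, conj z` with two entries transposed, which is
the source of the negative sign in (B1). -/
theorem wedgeMul_replaced (i j k l : Fin 4) :
    wedgeMul (wedgeForms (replacedForm i j)) (wedgeForms (conjReplacedForm k l)) realFrame
      = if k = j ∧ l = i then -16 else 0 := by
  rw [wedgeMul_wedgeForms]
  set X : Fin 4 ⊕ Fin 4 → (Fin 4 → ℂ) →ₗ[ℝ] ℂ :=
    Sum.elim (replacedForm i j) (conjReplacedForm k l) with hX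
  set X0 : Fin 4 ⊕ Fin 4 → (Fin 4 → ℂ) →ₗ[ℝ] ℂ :=
    Sum.elim (fun q => (LinearMap.proj q : (Fin 4 → ℂ) →ₗ[ℝ] ℂ))
      (fun q => (Complex.conjCLE : ℂ →L[ℝ] ℂ).toLinearMap ∘ₗ LinearMap.proj q) with hX0
  have hrep : ∀ a b, a ≠ b → X a = X b →
      (Matrix.of fun p q => X q (realFrame p)).det = 0 := fun a b hab h =>
    Matrix.det_zero_of_column_eq hab fun p => by simp [h]
  by_cases hkj : k = j
  · by_cases hli : l = i
    · subst hkj hli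
      rw [if_pos ⟨rfl, rfl⟩]
      have hXX : ∀ q, X q = X0 (Equiv.swap (Sum.inl k) (Sum.inr l) q) := by
        intro q
        rcases q with q | q
        · by_cases hq : q = k
          · subst hq; simp [hX, hX0, replacedForm]
          · rw [Equiv.swap_apply_of_ne_of_ne (by simpa using hq) (by simp)]
            simp [hX, hX0, replacedForm, hq]
        · by_cases hq : q = l
          · subst hq; simp [hX, hX0, conjReplacedForm]
          · rw [Equiv.swap_apply_of_ne_of_ne (by simp) (by simpa using hq)]
            simp [hX, hX0, conjReplacedForm, hq]
      have := Matrix.det_permute' (Equiv.swap (Sum.inl k) (Sum.inr l))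
        (Matrix.of fun p q => X0 q (realFrame p))
      have h2 : (Matrix.of fun p q => X q (realFrame p)) =
        (Matrix.of fun p q => X0 q (realFrame p)).submatrix id
          (Equiv.swap (Sum.inl k) (Sum.inr l)) := by
        ext p q; simp [hXX]
      rw [h2, this, det_realFrame, Equiv.Perm.sign_swap (by simp)]
      simp
    · rw [if_neg (by tauto)]
      refine hrep (Sum.inl j) (Sum.inr i) (by simp) ?_
      simp [hX, replacedForm, conjReplacedForm, Ne.symm hli]
  · rw [if_neg (by tauto)]
    refine hrep (Sum.inl k) (Sum.inr l) (by simp) ?_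
    simp [hX, replacedForm, conjReplacedForm, hkj]

theorem conj_wedgeForms (i j : Fin 4) :
    (Complex.conjCLE : ℂ →L[ℝ] ℂ).toLinearMap.compAlternatingMap (wedgeForms (replacedForm i j))
      = wedgeForms (conjReplacedForm i j) := by
  ext v
  rw [LinearMap.compAlternatingMap_apply, wedgeForms_apply, wedgeForms_apply]
  have := RingHom.map_det (starRingEnd ℂ) (Matrix.of fun p q => replacedForm i j q (v p))
  simp only [ContinuousLinearMap.coe_coe, ContinuousLinearEquiv.coe_coe, Complex.conjCLE_apply]
  rw [this]
  congr 1
  ext p q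
  by_cases hq : q = j <;> simp [replacedForm, conjReplacedForm, hq]

/-- The pairing matches the coefficient at `(i, j)` with the conjugate of the one at `(j, i)`.
Symmetry of `h`, which expresses that the form is primitive, makes all the products squares of
absolute values. -/
theorem wedgeMul_conj_sum (h : Fin 4 → Fin 4 → ℂ) (hs : ∀ i j, h i j = h j i) (κ : ℂ)
    (η : (Fin 4 → ℂ) [⋀^Fin 4]→ₗ[ℝ] ℂ)
    (hη : η = ∑ p : Fin 4 × Fin 4,
      (κ * (starRingEnd ℂ) (h p.1 p.2)) • wedgeForms (replacedForm p.1 p.2)) :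
    wedgeMul η ((Complex.conjCLE : ℂ →L[ℝ] ℂ).toLinearMap.compAlternatingMap η) realFrame
      = ((-16 * ‖κ‖ ^ 2 * ∑ i, ∑ j, ‖h i j‖ ^ 2 : ℝ) : ℂ) := by
  have hc : (Complex.conjCLE : ℂ →L[ℝ] ℂ).toLinearMap.compAlternatingMap η
      = ∑ p : Fin 4 × Fin 4, ((starRingEnd ℂ) κ * h p.1 p.2) •
        wedgeForms (conjReplacedForm p.1 p.2) := by
    simp only [← conj_wedgeForms]
    ext v
    simp [hη, alternatingMap_sum_apply]
  rw [hc, hη, wedgeMul_sum_smul]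
  simp only [wedgeMul_replaced]
  have : ∀ p : Fin 4 × Fin 4, ∑ q : Fin 4 × Fin 4, κ * (starRingEnd ℂ) (h p.1 p.2) *
      ((starRingEnd ℂ) κ * h q.1 q.2) * (if q.1 = p.2 ∧ q.2 = p.1 then (-16:ℂ) else 0)
      = ((-16 * ‖κ‖ ^ 2 * ‖h p.1 p.2‖ ^ 2 : ℝ) : ℂ) := by
    intro p
    rw [Finset.sum_eq_single (p.2, p.1)]
    · simp only [and_self, if_true, hs p.2 p.1]
      push_cast
      rw [← Complex.mul_conj', ← Complex.mul_conj']
      ring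
    · intro q _ hq
      rw [if_neg (fun hh => hq (Prod.ext hh.1 hh.2)), mul_zero]
    · simp
  simp only [this, ← Complex.ofReal_sum, Fintype.sum_prod_type, Finset.mul_sum]

end CubicFourfold

/-! ### The derivative of the hermitian normal field -/

namespace CubicFourfold

/-- Both sides are the trace of `C.adjugate * A`, the derivative of the determinant. This exchanges
the replacement of one argument of a determinant for the replacement of one of the linear forms. -/
theorem sum_det_updateRow_eq_sum_det_updateCol {n : Type*} [Fintype n] [DecidableEq n]
    (C A : Matrix n n ℂ) :
    ∑ i, (C.updateRow i (A i)).det = ∑ j, (C.updateCol j fun i => A i j).det := by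
  have h1 : ∀ i, (C.updateRow i (A i)).det = ∑ j, C.adjugate j i * A i j := by
    intro i
    rw [← Matrix.cramer_transpose_apply, Matrix.cramer_eq_adjugate_mulVec,
      ← Matrix.adjugate_transpose]
    rfl
  have h2 : ∀ j, (C.updateCol j fun i => A i j).det = ∑ i, C.adjugate j i * A i j := by
    intro j
    rw [← Matrix.cramer_apply, Matrix.cramer_eq_adjugate_mulVec]
    rfl
  simp only [h1, h2]
  exact Finset.sum_comm

/-- `∑ᵢ |∂ᵢF|²`. -/
noncomputable def gradSq (F : MvPolynomial (Fin 6) ℂ) (x : V) : ℝ := ∑ j, ‖partialAt F j x‖ ^ 2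

/-- The conjugate gradient. -/
noncomputable def conjGrad (F : MvPolynomial (Fin 6) ℂ) (x : V) : V :=
  WithLp.toLp 2 fun i => (starRingEnd ℂ) (partialAt F i x)

theorem norm_conjGrad_sq (F : MvPolynomial (Fin 6) ℂ) (x : V) : ‖conjGrad F x‖ ^ 2 = gradSq F x := by
  rw [EuclideanSpace.norm_sq_eq]
  simp [conjGrad, gradSq]

theorem normalField_eq (F : MvPolynomial (Fin 6) ℂ) (x : V) :
    normalField F x = (gradSq F x)⁻¹ • conjGrad F x := by
  ext i
  simp [normalField, conjGrad, gradSq, div_eq_inv_mul]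

namespace IsPolarization

variable {F : MvPolynomial (Fin 6) ℂ} {B : V → V → V → ℂ}

theorem isBoundedBilinearMap (hB : IsPolarization F B) (w : V) :
    IsBoundedBilinearMap ℂ fun p : V × V => B p.1 p.2 w where
  add_left _ _ _ := hB.add_left _ _ _ _
  smul_left _ _ _ := hB.smul_left _ _ _ _
  add_right _ _ _ := hB.add_mid _ _ _ _
  smul_right _ _ _ := hB.smul_mid _ _ _ _
  bound := by
    obtain ⟨M, hM, h⟩ := hB.norm_le
    refine ⟨M * (‖w‖ + 1), by positivity, fun u v => (h u v w).trans ?_⟩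
    have : 0 ≤ M * ‖u‖ * ‖v‖ := by positivity
    nlinarith

theorem exists_hasStrictFDerivAt_sq (hB : IsPolarization F B) (x w : V) :
    ∃ L : V →L[ℂ] ℂ, (∀ h, L h = 2 * B x h w) ∧ HasStrictFDerivAt (fun y => B y y w) L x := by
  have hb := hB.isBoundedBilinearMap w
  have h1 : HasStrictFDerivAt (fun y : V => (y, y))
      ((ContinuousLinearMap.id ℂ V).prod (ContinuousLinearMap.id ℂ V)) x :=
    (hasStrictFDerivAt_id x).prodMk (hasStrictFDerivAt_id x)
  have h2 := HasStrictFDerivAt.comp (f := fun y : V => (y, y)) x (hb.hasStrictFDerivAt (x, x)) h1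
  refine ⟨_, fun h => ?_, h2⟩
  simp only [ContinuousLinearMap.comp_apply, ContinuousLinearMap.prod_apply,
    ContinuousLinearMap.id_apply, IsBoundedBilinearMap.deriv_apply]
  rw [hB.swap12 h x]; ring

/-- The vector representing the conjugate of the linear form `B u v ·`. -/
noncomputable def dualVec (_ : IsPolarization F B) (u v : V) : V :=
  WithLp.toLp 2 fun i => (starRingEnd ℂ) (B u v (EuclideanSpace.single i 1))

theorem dualVec_smul (hB : IsPolarization F B) (c : ℂ) (u v : V) :
    hB.dualVec u (c • v) = (starRingEnd ℂ) c • hB.dualVec u v := by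
  ext i
  simp [dualVec, hB.smul_mid]

theorem inner_dualVec (hB : IsPolarization F B) (u v w : V) :
    inner ℂ w (hB.dualVec u v) = (starRingEnd ℂ) (B u v w) := by
  conv_rhs => rw [coord_sum w, hB.sum_right, map_sum]
  simp [PiLp.inner_apply, dualVec, hB.smul_right, mul_comm]

theorem hasFDerivAt_partialAt (hB : IsPolarization F B) (i : Fin 6) (x : V) :
    ∃ L : V →L[ℂ] ℂ, (∀ h, L h = 6 * B x h (EuclideanSpace.single i 1)) ∧
      HasFDerivAt (fun y => partialAt F i y) L x := by
  obtain ⟨L, hL, h⟩ := hB.exists_hasStrictFDerivAt_sq x (EuclideanSpace.single i 1)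
  refine ⟨(3 : ℂ) • L, fun h => ?_, ?_⟩
  · simp [hL]; ring
  · simp only [hB.partial_eq]
    exact h.hasFDerivAt.const_mul 3

/-- The gradient is the holomorphic quadratic map `3 B x x ·`; so its conjugate has the antilinear
derivative given by the conjugate of `6 B x h ·`. -/
theorem hasFDerivAt_conjGrad (hB : IsPolarization F B) (x : V) :
    ∃ L : V →L[ℝ] V, (∀ h, L h = (6 : ℂ) • hB.dualVec x h) ∧ HasFDerivAt (conjGrad F) L x := by
  choose L hL hd using fun i => hB.hasFDerivAt_partialAt i x
  refine ⟨((PiLp.continuousLinearEquiv 2 ℝ fun _ : Fin 6 => ℂ).symm : (Fin 6 → ℂ) →L[ℝ] V).comp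
    (ContinuousLinearMap.pi fun i => (Complex.conjCLE : ℂ →L[ℝ] ℂ).comp ((L i).restrictScalars ℝ)),
    fun h => ?_, ?_⟩
  · ext i
    simp [dualVec, hL, Complex.conj_ofNat]
  · have : HasFDerivAt (fun y => fun i => (starRingEnd ℂ) (partialAt F i y))
        (ContinuousLinearMap.pi fun i =>
          (Complex.conjCLE : ℂ →L[ℝ] ℂ).comp ((L i).restrictScalars ℝ)) x :=
      hasFDerivAt_pi.2 fun i => (Complex.conjCLE : ℂ →L[ℝ] ℂ).hasFDerivAt.comp x
        ((hd i).restrictScalars ℝ)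
    exact ((PiLp.continuousLinearEquiv 2 ℝ fun _ : Fin 6 => ℂ).symm :
      (Fin 6 → ℂ) →L[ℝ] V).hasFDerivAt.comp x this

/-- The real factor `1 / gradSq` contributes only a multiple `r h` of the conjugate gradient, that
is, of `N`. This multiple does not reach the (3,1)-part after contraction with `N`, so no formula
for `r` is needed. -/
theorem hasFDerivAt_normalField (hB : IsPolarization F B) (x : V) (hx : gradSq F x ≠ 0) :
    ∃ (L : V →L[ℝ] V) (r : V → ℝ),
      (∀ h, L h = (gradSq F x)⁻¹ • ((6 : ℂ) • hB.dualVec x h) + r h • conjGrad F x) ∧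
      HasFDerivAt (normalField F) L x := by
  obtain ⟨L, hL, hd⟩ := hB.hasFDerivAt_conjGrad x
  have hs : DifferentiableAt ℝ (gradSq F) x := by
    have : gradSq F = fun y => ‖conjGrad F y‖ ^ 2 := funext fun y => (norm_conjGrad_sq F y).symm
    rw [this]
    exact hd.differentiableAt.norm_sq ℝ
  have hs' := (hs.inv hx).hasFDerivAt
  have h := hs'.smul hd
  have he : normalField F = (gradSq F)⁻¹ • conjGrad F := funext (normalField_eq F)
  refine ⟨_, fun h => fderiv ℝ (gradSq F)⁻¹ x h, fun v => ?_, he ▸ h⟩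
  simp only [add_apply, smul_apply, hL,
    ContinuousLinearMap.smulRight_apply]
  rfl

end IsPolarization

section Omega

variable {F : MvPolynomial (Fin 6) ℂ} {B : V → V → V → ℂ}

theorem fderiv_alphaForm {x : V} (μ : V [⋀^Fin 6]→L[ℂ] ℂ) {L : V →L[ℝ] V}
    (hL : HasFDerivAt (normalField F) L x) (h : V) (w : Fin 4 → V) :
    fderiv ℝ (alphaForm F μ) x h w = μ (Matrix.vecCons x (Matrix.vecCons (L h) w))
      + μ (Matrix.vecCons h (Matrix.vecCons (normalField F x) w)) := by
  let c : V →L[ℝ] V →L[ℝ] V [⋀^Fin 4]→L[ℝ] ℂ :=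
    (ContinuousAlternatingMap.curryLeftLI (𝕜 := ℝ) (E := V) (F := ℂ)
      (n := 4)).toContinuousLinearMap.comp (μ.restrictScalars ℝ).curryLeft
  have : HasFDerivAt (alphaForm F μ)
      ((c x).comp L + (c.flip (normalField F x))) x := by
    have := (c.hasFDerivAt (x := x)).clm_apply hL
    exact this
  rw [this.fderiv]
  rfl

end Omega
end CubicFourfold

/-! ### The component of type (3,1) of ω_F -/

namespace CubicFourfold

/-- The complex trilinear-alternating form `μ(x, a, b, ·)`. -/
noncomputable def curry3 (μ : V [⋀^Fin 6]→L[ℂ] ℂ) (x a b : V) : V [⋀^Fin 3]→L[ℂ] ℂ :=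
  ((μ.curryLeft x).curryLeft a).curryLeft b

/-- The form `μ(x, a, ·)`. -/
noncomputable def curry2 (μ : V [⋀^Fin 6]→L[ℂ] ℂ) (x a : V) : V [⋀^Fin 4]→L[ℂ] ℂ :=
  (μ.curryLeft x).curryLeft a

theorem curry2_cons (μ : V [⋀^Fin 6]→L[ℂ] ℂ) (x a b : V) (w : Fin 3 → V) :
    curry2 μ x a (Matrix.vecCons b w) = curry3 μ x a b w := rfl

theorem curry3_add_mid (μ : V [⋀^Fin 6]→L[ℂ] ℂ) (x a a' b : V) (w : Fin 3 → V) :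
    curry3 μ x (a + a') b w = curry3 μ x a b w + curry3 μ x a' b w := by
  simp [curry3, ContinuousAlternatingMap.curryLeft_add]

theorem curry3_smul_mid (μ : V [⋀^Fin 6]→L[ℂ] ℂ) (c : ℂ) (x a b : V) (w : Fin 3 → V) :
    curry3 μ x (c • a) b w = c * curry3 μ x a b w := by
  simp [curry3, ContinuousAlternatingMap.curryLeft_smul]

theorem curry3_add_right (μ : V [⋀^Fin 6]→L[ℂ] ℂ) (x a b b' : V) (w : Fin 3 → V) :
    curry3 μ x a (b + b') w = curry3 μ x a b w + curry3 μ x a b' w := by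
  simp [curry3]

theorem curry3_smul_right (μ : V [⋀^Fin 6]→L[ℂ] ℂ) (c : ℂ) (x a b : V) (w : Fin 3 → V) :
    curry3 μ x a (c • b) w = c * curry3 μ x a b w := by
  simp [curry3]

theorem curry3_self (μ : V [⋀^Fin 6]→L[ℂ] ℂ) (x a : V) (w : Fin 3 → V) :
    curry3 μ x a a w = 0 := by
  simp [curry3]

theorem curry3_swap (μ : V [⋀^Fin 6]→L[ℂ] ℂ) (x a b : V) (w : Fin 3 → V) :
    curry3 μ x a b w = -curry3 μ x b a w := by
  have h := curry3_self μ x (a + b) w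
  rw [curry3_add_mid, curry3_add_right, curry3_add_right, curry3_self, curry3_self] at h
  linear_combination h

variable {F : MvPolynomial (Fin 6) ℂ} {B : V → V → V → ℂ}

/-- In `d (ι_N ι_E μ)` either `E` or `N` is differentiated. The terms with the derivative of `E`
contain `N` twice after contraction with `N`. Of the rest, the term in which `N` is the direction of
differentiation is complex multilinear in `v`, hence of type (4,0). -/
theorem omega_apply {x : V} (μ : V [⋀^Fin 6]→L[ℂ] ℂ) {L : V →L[ℝ] V}
    (hL : HasFDerivAt (normalField F) L x) (v : Fin 4 → V) :
    omega F μ x v = curry2 μ x (L (normalField F x)) v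
      - ∑ i : Fin 4, (-1 : ℂ) ^ (i : ℕ) *
          curry3 μ x (L (v i)) (normalField F x) (i.removeNth v) := by
  have h0 : omega F μ x v
      = extDeriv (alphaForm F μ) x (Matrix.vecCons (normalField F x) v) := rfl
  rw [h0, extDeriv, ContinuousAlternatingMap.alternatizeUncurryFin_apply, Fin.sum_univ_succ,
    sub_eq_add_neg, ← Finset.sum_neg_distrib]
  have hN : ∀ w, μ (Matrix.vecCons (normalField F x) (Matrix.vecCons (normalField F x) w)) = 0 :=
    fun w => μ.map_eq_zero_of_eq _ (i := 0) (j := 1) rfl (by decide)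
  congr 1
  · simp only [Fin.val_zero, pow_zero, one_smul, Matrix.cons_val_zero, fderiv_alphaForm μ hL, hN,
      add_zero]
    rfl
  · refine Finset.sum_congr rfl fun i _ => ?_
    have hr : i.succ.removeNth (Matrix.vecCons (normalField F x) v)
        = Matrix.vecCons (normalField F x) (i.removeNth v) := by
      ext j
      refine Fin.cases ?_ (fun j => ?_) j
      · simp [Fin.removeNth]
      · simp [Fin.removeNth, Matrix.vecCons]
    rw [hr, fderiv_alphaForm μ hL]
    have h2 : μ (Matrix.vecCons (Matrix.vecCons (normalField F x) v i.succ)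
        (Matrix.vecCons (normalField F x) (Matrix.vecCons (normalField F x) (i.removeNth v))))
        = 0 := μ.map_eq_zero_of_eq _ (i := 1) (j := 2) rfl (by decide)
    rw [h2, add_zero, Fin.val_succ, pow_succ, Matrix.cons_val_succ, mul_neg_one, neg_smul,
      zsmul_eq_mul]
    push_cast
    rfl

/-- After the multiple of `N` in `L (v i)` has dropped out, the summands are antilinear in `v i` and
linear in the three other arguments, hence of type (3,1). -/
theorem component31_omega (hB : IsPolarization F B) {x : V} (hx : gradSq F x ≠ 0)
    (μ : V [⋀^Fin 6]→L[ℂ] ℂ) (v : Fin 4 → V) :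
    component31 (omega F μ x) v = ∑ i : Fin 4, (-1 : ℂ) ^ (i : ℕ) * 
      (6 * ((gradSq F x : ℂ)⁻¹) ^ 2 *
        curry3 μ x (conjGrad F x) (hB.dualVec x (v i)) (i.removeNth v)) := by
  obtain ⟨L, r, hL, hd⟩ := hB.hasFDerivAt_normalField x hx
  set ζ : ℂ := Complex.exp (Real.pi * Complex.I / 4) with hζ
  have hζ2 : ζ ^ 2 = Complex.I := by
    refine Eq.trans ?_ Complex.exp_pi_div_two_mul_I
    rw [hζ, ← Complex.exp_nat_mul]
    congr 1
    push_cast; ring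
  have hζn : ζ * (starRingEnd ℂ) ζ = 1 := by
    rw [Complex.mul_conj', hζ,
      show (Real.pi * Complex.I / 4 : ℂ) = ((Real.pi / 4 : ℝ) : ℂ) * Complex.I by push_cast; ring,
      Complex.norm_exp_ofReal_mul_I]
    simp
  set T : Fin 4 → ℂ := fun i => (-1 : ℂ) ^ (i : ℕ) * (6 * ((gradSq F x : ℂ)⁻¹) ^ 2 *
        curry3 μ x (conjGrad F x) (hB.dualVec x (v i)) (i.removeNth v)) with hT
  have hterm : ∀ (c : ℂ) (i : Fin 4), curry3 μ x (L (c • v i)) (normalField F x)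
      (i.removeNth fun j => c • v j) = - ((starRingEnd ℂ) c * c ^ 3 *
        (6 * ((gradSq F x : ℂ)⁻¹) ^ 2 *
        curry3 μ x (conjGrad F x) (hB.dualVec x (v i)) (i.removeNth v))) := by
    intro c i
    have e1 : L (c • v i) = ((gradSq F x : ℂ)⁻¹ * 6 * (starRingEnd ℂ) c) • hB.dualVec x (v i)
        + (r (c • v i) : ℂ) • conjGrad F x := by
      rw [hL, hB.dualVec_smul, ← Complex.coe_smul, ← Complex.coe_smul, smul_smul, smul_smul]
      push_cast
      rfl
    have e2 : normalField F x = ((gradSq F x : ℂ)⁻¹) • conjGrad F x := by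
      rw [normalField_eq, ← Complex.coe_smul]
      push_cast
      rfl
    have e3 : (i.removeNth fun j => c • v j) = fun j => c • (i.removeNth v) j := rfl
    rw [e1, e2, e3, (curry3 μ x _ _).map_smul_univ (fun _ => c), curry3_add_mid, curry3_smul_mid,
      curry3_smul_mid, curry3_smul_right, curry3_smul_right, curry3_self,
      curry3_swap μ x (hB.dualVec x (v i))]
    simp
    ring
  -- The first term acquires the factor `ζ ^ (4k) = (-1) ^ k`, the sum the factor `conj ζ ^ k * ζ ^
  -- (3k) = ζ ^ (2k) = I ^ k`. The average against `(-I) ^ k` over eight values of `k` kills the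
  -- former and keeps the latter.
  have hk : ∀ k : ℕ, omega F μ x (fun j => ζ ^ k • v j)
      = (-1) ^ k * curry2 μ x (L (normalField F x)) v + Complex.I ^ k * ∑ i, T i := by
    intro k
    rw [omega_apply μ hd, (curry2 μ x _).map_smul_univ (fun _ => ζ ^ k), sub_eq_add_neg,
      Finset.mul_sum, ← Finset.sum_neg_distrib]
    congr 1
    · simp only [Finset.prod_const, Finset.card_univ, Fintype.card_fin, smul_eq_mul]
      rw [← pow_mul, mul_comm k, pow_mul, show ζ ^ 4 = (ζ ^ 2) ^ 2 by ring, hζ2, Complex.I_sq]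
    · refine Finset.sum_congr rfl fun i _ => ?_
      rw [hterm, hT, map_pow]
      have : (starRingEnd ℂ) ζ ^ k * (ζ ^ k) ^ 3 = Complex.I ^ k := by
        rw [← hζ2, ← pow_mul, ← pow_mul, show k * 3 = k + k * 2 by ring, pow_add, ← mul_assoc,
          ← mul_pow, mul_comm _ ζ, hζn, one_pow, one_mul, mul_comm k]
      rw [this]
      ring
  have h31 : component31 (omega F μ x) v = (1 / 8 : ℂ) * ∑ k ∈ Finset.range 8,
      (-Complex.I) ^ k * omega F μ x (fun j => ζ ^ k • v j) := by
    simp only [component31, rotate]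
    rw [ContinuousAlternatingMap.smul_apply, ContinuousAlternatingMap.sum_apply]
    rfl
  rw [h31]
  simp only [hk, Finset.sum_range_succ, Finset.sum_range_zero]
  have i2 : Complex.I ^ 2 = -1 := Complex.I_sq
  have i4 : Complex.I ^ 4 = 1 := Complex.I_pow_four
  change _ = ∑ i, T i
  set S := ∑ i, T i
  set A := curry2 μ x (L (normalField F x)) v
  have i3 : Complex.I ^ 3 = -Complex.I := Complex.I_pow_three
  ring_nf
  simp only [show Complex.I ^ 12 = (Complex.I ^ 4) ^ 3 by ring,
    show Complex.I ^ 14 = (Complex.I ^ 4) ^ 3 * Complex.I ^ 2 by ring,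
    show Complex.I ^ 10 = (Complex.I ^ 4) ^ 2 * Complex.I ^ 2 by ring,
    show Complex.I ^ 8 = (Complex.I ^ 4) ^ 2 by ring,
    show Complex.I ^ 7 = Complex.I ^ 4 * Complex.I ^ 3 by ring,
    show Complex.I ^ 6 = Complex.I ^ 4 * Complex.I ^ 2 by ring,
    show Complex.I ^ 5 = Complex.I ^ 4 * Complex.I by ring, i4, i2, i3]
  ring

end CubicFourfold

/-! ### The density of ω ∧ conj ω in a unitary frame -/

namespace CubicFourfold

variable {F : MvPolynomial (Fin 6) ℂ} {B : V → V → V → ℂ}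

theorem inner_conjGrad (F : MvPolynomial (Fin 6) ℂ) (x v : V) :
    inner ℂ (conjGrad F x) v = ∑ i, partialAt F i x * v i := by
  simp [PiLp.inner_apply, conjGrad, mul_comm]

theorem mem_tangent {x v : V} :
    v ∈ tangent F x ↔ inner ℂ (conjGrad F x) v = 0 ∧ inner ℂ x v = 0 := by
  rw [tangent, Submodule.mem_inf, LinearMap.mem_ker, Submodule.mem_orthogonal_singleton_iff_inner_right,
    inner_conjGrad]
  simp

theorem gradSq_ne_zero {x : V} (hx : ∃ i, partialAt F i x ≠ 0) : gradSq F x ≠ 0 := by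
  obtain ⟨i, hi⟩ := hx
  have h : 0 < ∑ j, ‖partialAt F j x‖ ^ 2 :=
    Finset.sum_pos' (fun j _ => sq_nonneg _)
      ⟨i, Finset.mem_univ _, pow_pos (norm_pos_iff.2 hi) 2⟩
  exact h.ne'

theorem inner_conjGrad_self (hB : IsPolarization F B) {x : V} (hx : evalAt F x = 0) :
    inner ℂ (conjGrad F x) x = 0 := by
  rw [inner_conjGrad, ← hB.eq_sum_partial, ← hB.eval_eq, hx, mul_zero]

/-- The unit vectors in the directions of `x` and of the normal, together with a unitary frame,
form an orthonormal family. -/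
theorem orthonormal_frame (hB : IsPolarization F B) {x : V} (hx : x ∈ regLink F) {e : Fin 4 → V}
    (he : IsUnitaryFrame F x e) :
    Orthonormal ℂ (Matrix.vecCons x (Matrix.vecCons ((‖conjGrad F x‖ : ℂ)⁻¹ • conjGrad F x) e)) := by
  have hg := gradSq_ne_zero hx.2.2
  have hn : ‖conjGrad F x‖ ≠ 0 := by
    intro h
    exact hg (by rw [← norm_conjGrad_sq, h]; simp)
  have hxn := inner_conjGrad_self hB hx.2.1
  have hnx : inner ℂ x (conjGrad F x) = 0 := by rw [← inner_conj_symm, hxn, map_zero]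
  rw [orthonormal_vecCons_iff, orthonormal_vecCons_iff]
  refine ⟨hx.1, fun i => ?_, ?_, fun i => ?_, he.1⟩
  · refine Fin.cases ?_ (fun i => ?_) i
    · simp [inner_smul_right, hnx]
    · simpa using (mem_tangent.1 (he.2 i)).2
  · rw [norm_smul]
    simp [hn]
  · simp [inner_smul_left, (mem_tangent.1 (he.2 i)).1]

/-- By the Euler relation the conjugate gradient is perpendicular to `x`, so the tangent space is
the orthogonal complement of an orthonormal pair. -/
theorem exists_isUnitaryFrame (hB : IsPolarization F B) {x : V} (hx : x ∈ regLink F) :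
    ∃ e, IsUnitaryFrame F x e := by
  have hg := gradSq_ne_zero hx.2.2
  have hn : ‖conjGrad F x‖ ≠ 0 := by
    intro h
    exact hg (by rw [← norm_conjGrad_sq, h]; simp)
  have hxn := inner_conjGrad_self hB hx.2.1
  have hnx : inner ℂ x (conjGrad F x) = 0 := by rw [← inner_conj_symm, hxn, map_zero]
  set u : V := (‖conjGrad F x‖ : ℂ)⁻¹ • conjGrad F x with hu
  have ho : Orthonormal ℂ ![x, u] := by
    rw [orthonormal_vecCons_iff, orthonormal_vecCons_iff]
    refine ⟨hx.1, fun i => ?_, ?_, fun i => i.elim0, ?_⟩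
    · rw [Subsingleton.elim i 0]; simp [hu, inner_smul_right, hnx]
    · rw [hu, norm_smul]; simp [hn]
    · exact ⟨fun i => i.elim0, fun i => i.elim0⟩
  set W := Submodule.span ℂ (Set.range ![x, u]) with hW
  have h2 : Module.finrank ℂ W = 2 := by
    rw [hW, finrank_span_eq_card ho.linearIndependent]; simp
  have h4 : Module.finrank ℂ Wᗮ = 4 := by
    have := W.finrank_add_finrank_orthogonal
    rw [h2, finrank_euclideanSpace] at this
    simp at this
    omega
  let b := (stdOrthonormalBasis ℂ Wᗮ).reindex (finCongr h4)
  refine ⟨fun j => (b j : V), ?_, fun j => mem_tangent.2 ?_⟩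
  · exact b.orthonormal.comp_linearIsometry Wᗮ.subtypeₗᵢ
  · have hb := (b j).2
    rw [Submodule.mem_orthogonal] at hb
    have h1 := hb u (Submodule.subset_span ⟨1, rfl⟩)
    have h0 := hb x (Submodule.subset_span ⟨0, rfl⟩)
    refine ⟨?_, h0⟩
    rw [hu, inner_smul_left] at h1
    simpa [hn] using h1

/-- An orthonormal basis made of six orthonormal vectors. -/
theorem exists_orthonormalBasis {b : Fin 6 → V} (hb : Orthonormal ℂ b) :
    ∃ bb : OrthonormalBasis (Fin 6) ℂ V, ⇑bb = b := by
  have hc : Fintype.card (Fin 6) = Module.finrank ℂ V := by rw [finrank_euclideanSpace]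
  let b0 := basisOfOrthonormalOfCardEqFinrank hb hc
  have h0 : ⇑b0 = b := coe_basisOfOrthonormalOfCardEqFinrank hb hc
  exact ⟨b0.toOrthonormalBasis (by rw [h0]; exact hb), by rw [Module.Basis.coe_toOrthonormalBasis, h0]⟩

theorem coe_basisFun :
    ⇑(EuclideanSpace.basisFun (Fin 6) ℂ).toBasis = fun i => (EuclideanSpace.single i 1 : V) := by
  funext i
  simp

theorem curry2_smul (μ : V [⋀^Fin 6]→L[ℂ] ℂ) (c : ℂ) (x a : V) (w : Fin 4 → V) :
    curry2 μ x (c • a) w = c * curry2 μ x a w := by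
  simp [curry2]

/-- The absolute value of `μ` on a unitary basis. -/
noncomputable def volNorm (μ : V [⋀^Fin 6]→L[ℂ] ℂ) : ℝ :=
  ‖μ fun i => EuclideanSpace.single i 1‖

theorem volNorm_pos {μ : V [⋀^Fin 6]→L[ℂ] ℂ} (hμ : μ ≠ 0) : 0 < volNorm μ := by
  rw [volNorm, norm_pos_iff]
  intro h0
  apply hμ
  have h := AlternatingMap.eq_smul_basis_det (EuclideanSpace.basisFun (Fin 6) ℂ).toBasis
    μ.toAlternatingMap
  have h1 : μ.toAlternatingMap ⇑(EuclideanSpace.basisFun (Fin 6) ℂ).toBasis = 0 := by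
    rw [← h0, coe_basisFun]
    rfl
  rw [h1, zero_smul] at h
  ext v
  exact congrArg (fun f => f v) h

/-- The determinant of a unitary matrix has absolute value one. -/
theorem norm_apply_orthonormal (μ : V [⋀^Fin 6]→L[ℂ] ℂ) {b : Fin 6 → V} (hb : Orthonormal ℂ b) :
    ‖μ b‖ = volNorm μ := by
  obtain ⟨bb, rfl⟩ := exists_orthonormalBasis hb
  have h := AlternatingMap.eq_smul_basis_det (EuclideanSpace.basisFun (Fin 6) ℂ).toBasis
    μ.toAlternatingMap
  have h2 := congrArg (fun f => ‖f bb‖) h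
  have h3 := (EuclideanSpace.basisFun (Fin 6) ℂ).det_to_matrix_orthonormalBasis bb
  simp only [AlternatingMap.smul_apply, norm_smul, h3, mul_one] at h2
  refine h2.trans ?_
  rw [volNorm, coe_basisFun]
  rfl

theorem norm_curry2_frame (hB : IsPolarization F B) {x : V} (hx : x ∈ regLink F) {e : Fin 4 → V}
    (he : IsUnitaryFrame F x e) (μ : V [⋀^Fin 6]→L[ℂ] ℂ) :
    ‖curry2 μ x (conjGrad F x) e‖ ^ 2 = volNorm μ ^ 2 * gradSq F x := by
  have hg := gradSq_ne_zero hx.2.2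
  have hn : ‖conjGrad F x‖ ≠ 0 := by
    intro h
    exact hg (by rw [← norm_conjGrad_sq, h]; simp)
  have h1 := norm_apply_orthonormal μ (orthonormal_frame hB hx he)
  have h2 : conjGrad F x = (‖conjGrad F x‖ : ℂ) • ((‖conjGrad F x‖ : ℂ)⁻¹ • conjGrad F x) := by
    rw [smul_smul, mul_inv_cancel₀ (by simpa using hn), one_smul]
  have h3 : curry2 μ x (conjGrad F x) e = (‖conjGrad F x‖ : ℂ) *
      μ (Matrix.vecCons x (Matrix.vecCons ((‖conjGrad F x‖ : ℂ)⁻¹ • conjGrad F x) e)) := by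
    conv_lhs => rw [h2, curry2_smul]
    rfl
  rw [h3, norm_mul, h1, mul_pow, ← norm_conjGrad_sq]
  simp
  ring

/-- The linear map `ℂ⁴ → V` given by a frame. -/
noncomputable def frameMap (e : Fin 4 → V) : (Fin 4 → ℂ) →ₗ[ℂ] V := Fintype.linearCombination ℂ e

theorem wedgeConj_eq (η : V [⋀^Fin 4]→L[ℝ] ℂ) :
    wedgeConj η = wedgeMul η.toAlternatingMap ((Complex.conjCLE : ℂ →L[ℝ] ℂ).toLinearMap.compAlternatingMap
        η.toAlternatingMap) := rfl

theorem wedgeMul_conj_comp {ι M N : Type*} [Fintype ι] [DecidableEq ι] [AddCommGroup M] [Module ℝ M]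
    [AddCommGroup N] [Module ℝ N] (a : N [⋀^ι]→ₗ[ℝ] ℂ) (f : M →ₗ[ℝ] N) (v : ι ⊕ ι → M) :
    wedgeMul a ((Complex.conjCLE : ℂ →L[ℝ] ℂ).toLinearMap.compAlternatingMap a) (fun i => f (v i))
      = wedgeMul (a.compLinearMap f) ((Complex.conjCLE : ℂ →L[ℝ] ℂ).toLinearMap.compAlternatingMap
        (a.compLinearMap f)) v :=
  (wedgeMul_compLinearMap _ _ _ _).symm

theorem wedgeConj_of_pullback (η : V [⋀^Fin 4]→L[ℝ] ℂ) (E : (Fin 4 → ℂ) →ₗ[ℝ] V)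
    (h : Fin 4 → Fin 4 → ℂ) (hs : ∀ i j, h i j = h j i) (κ : ℂ)
    (hη : η.toAlternatingMap.compLinearMap E = ∑ p : Fin 4 × Fin 4,
      (κ * (starRingEnd ℂ) (h p.1 p.2)) • wedgeForms (replacedForm p.1 p.2))
    (v : Fin 4 ⊕ Fin 4 → V) (hv : v = fun i => E (realFrame i)) :
    wedgeConj η v = ((-16 * ‖κ‖ ^ 2 * ∑ i, ∑ j, ‖h i j‖ ^ 2 : ℝ) : ℂ) := by
  rw [wedgeConj_eq, hv, wedgeMul_conj_comp, wedgeMul_conj_sum h hs κ _ hη]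

/-- Put `D = μ (x, conj grad F, ·)`, a multiple of the determinant in the coordinates of the frame.
The (3,1)-part of `ω_F` replaces one argument of `D` by an antilinear image of it; by
`sum_det_updateRow_eq_sum_det_updateCol` this is the same as replacing one of the forms `z_j` by
`conj z_l`, with coefficients proportional to `conj B(x, e_l, e_j)`. The symmetry of the Hessian
then permits `wedgeMul_conj_sum`. -/
theorem wedgeConj_frame (hB : IsPolarization F B) {x : V} (hx : x ∈ regLink F) {e : Fin 4 → V}
    (he : IsUnitaryFrame F x e) (μ : V [⋀^Fin 6]→L[ℂ] ℂ) :
    wedgeConj (component31 (omega F μ x)) (Sum.elim e fun j => Complex.I • e j)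
      = ((-16 * (36 * volNorm μ ^ 2 / gradSq F x ^ 3) * 
          ∑ i, ∑ j, ‖B x (e i) (e j)‖ ^ 2 : ℝ) : ℂ) := by
  have hg := gradSq_ne_zero hx.2.2
  obtain ⟨bb, hbb⟩ := exists_orthonormalBasis (orthonormal_frame hB hx he)
  set n := conjGrad F x with hn
  set s := gradSq F x with hs
  set D : V [⋀^Fin 4]→L[ℂ] ℂ := curry2 μ x n with hD
  have hDx : ∀ (w : Fin 4 → V) (i : Fin 4), D (Function.update w i x) = 0 := fun w i =>
    μ.map_eq_zero_of_eq _ (i := 0) (j := i.succ.succ)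
      (by change x = Function.update w i x i; simp) (Fin.succ_ne_zero _).symm
  have hDn : ∀ (w : Fin 4 → V) (i : Fin 4), D (Function.update w i n) = 0 := fun w i =>
    μ.map_eq_zero_of_eq _ (i := 1) (j := i.succ.succ)
      (by change n = Function.update w i n i; simp)
      (fun h => (Fin.succ_ne_zero i).symm (Fin.succ_injective _ h))
  let E := frameMap e
  let η := component31 (omega F μ x)
  let h : Fin 4 → Fin 4 → ℂ := fun i j => B x (e i) (e j)
  let κ : ℂ := 6 * ((s : ℂ)⁻¹) ^ 2 * D e
  have hE1 : ∀ j, E (Pi.single j 1) = e j := fun j => by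
    simp [E, frameMap, Fintype.linearCombination_apply, Pi.single_apply]
  have hdet : ∀ c : Fin 4 → Fin 4 → ℂ, D (fun i => E (c i)) = D e * (Matrix.of c).det := by
    intro c
    have h1 := AlternatingMap.eq_smul_basis_det (Pi.basisFun ℂ (Fin 4))
      (D.toAlternatingMap.compLinearMap E)
    have h2 := congrArg (fun f => f c) h1
    simp only [AlternatingMap.smul_apply, smul_eq_mul, Pi.basisFun_det] at h2
    have h3 : (D.toAlternatingMap.compLinearMap E) ⇑(Pi.basisFun ℂ (Fin 4)) = D e := by
      change D (fun i => E (Pi.basisFun ℂ (Fin 4) i)) = _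
      simp only [Pi.basisFun_apply, hE1]
    rw [h3] at h2
    exact h2
  -- `D` vanishes when `x` or the normal is an argument, so only the component along the frame
  -- counts.
  have hcong : ∀ (w : Fin 4 → V) (i : Fin 4) (v : V), D (Function.update w i v)
      = D (Function.update w i (∑ j, inner ℂ (e j) v • e j)) := by
    intro w i v
    have h := bb.sum_repr' v
    rw [hbb, Fin.sum_univ_succ, Fin.sum_univ_succ] at h
    simp only [Matrix.cons_val_zero, Matrix.cons_val_succ] at h
    conv_lhs => rw [← h]
    rw [D.map_update_add, D.map_update_add, D.map_update_smul, D.map_update_smul,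
      D.map_update_smul, hDx, hDn]
    simp
  have hη : η.toAlternatingMap.compLinearMap (E.restrictScalars ℝ) = ∑ p : Fin 4 × Fin 4,
      (κ * (starRingEnd ℂ) (h p.1 p.2)) • wedgeForms (replacedForm p.1 p.2) := by
    ext c
    rw [alternatingMap_sum_apply]
    have h1 : (η.toAlternatingMap.compLinearMap (E.restrictScalars ℝ)) c
        = component31 (omega F μ x) (fun i => E (c i)) := rfl
    rw [h1, component31_omega hB hg]
    let A : Fin 4 → Fin 4 → ℂ := fun i j =>
      ∑ l, (starRingEnd ℂ) (c i l) * (starRingEnd ℂ) (h l j)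
    have h2 : ∀ i : Fin 4, (-1 : ℂ) ^ (i : ℕ) * (6 * ((gradSq F x : ℂ)⁻¹) ^ 2 *
        curry3 μ x (conjGrad F x) (hB.dualVec x (E (c i))) (i.removeNth fun i => E (c i)))
        = κ * ((Matrix.of c).updateRow i (A i)).det := by
      intro i
      rw [← curry2_cons]
      have h3 := D.toAlternatingMap.map_insertNth i (hB.dualVec x (E (c i)))
        (i.removeNth fun i => E (c i))
      rw [Fin.insertNth_removeNth] at h3
      have h4 : (∑ j, inner ℂ (e j) (hB.dualVec x (E (c i))) • e j) = E (A i) := by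
        simp only [E, frameMap, Fintype.linearCombination_apply, hB.inner_dualVec]
        refine Finset.sum_congr rfl fun j _ => ?_
        congr 1
        rw [hB.sum_mid, map_sum]
        refine Finset.sum_congr rfl fun l _ => ?_
        rw [hB.smul_mid, map_mul]
      have h5 : (Function.update (fun i => E (c i)) i (E (A i)))
          = fun k => E (Function.update c i (A i) k) := by
        ext1 k
        by_cases hk : k = i
        · subst hk; simp
        · simp [hk]
      have h6 : D (Function.update (fun i => E (c i)) i (hB.dualVec x (E (c i))))
          = D e * ((Matrix.of c).updateRow i (A i)).det := by
        rw [hcong, h4, h5, hdet]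
        rfl
      have h7 : D (Function.update (fun i => E (c i)) i (hB.dualVec x (E (c i))))
          = (-1 : ℤˣ) ^ (i : ℕ) • D (Matrix.vecCons (hB.dualVec x (E (c i)))
            (i.removeNth fun i => E (c i))) := h3
      rw [h6] at h7
      have h8 : (-1 : ℂ) ^ (i : ℕ) * D (Matrix.vecCons (hB.dualVec x (E (c i)))
            (i.removeNth fun i => E (c i))) = D e * ((Matrix.of c).updateRow i (A i)).det := by
        rw [h7, Units.smul_def, zsmul_eq_mul]
        push_cast
        rfl
      simp only [κ]
      linear_combination (6 * ((s : ℂ)⁻¹) ^ 2) * h8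
    rw [Finset.sum_congr rfl fun i _ => h2 i, ← Finset.mul_sum,
      sum_det_updateRow_eq_sum_det_updateCol (Matrix.of c) A, Fintype.sum_prod_type,
      Finset.sum_comm, Finset.mul_sum]
    refine Finset.sum_congr rfl fun j _ => ?_
    have h9 : (fun i => A i j) = ∑ l, (starRingEnd ℂ) (h l j) • fun i => (starRingEnd ℂ) (c i l) := by
      ext i
      simp [A, mul_comm]
    rw [← Matrix.cramer_apply, h9, map_sum, Finset.sum_apply, Finset.mul_sum]
    refine Finset.sum_congr rfl fun l _ => ?_
    rw [map_smul, Pi.smul_apply, Matrix.cramer_apply, AlternatingMap.smul_apply, wedgeForms_apply,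
      smul_eq_mul, smul_eq_mul, mul_assoc]
    have h10 : (Matrix.of c).updateCol j (fun i => (starRingEnd ℂ) (c i l))
        = Matrix.of fun p q => replacedForm l j q (c p) := by
      ext p q
      by_cases hq : q = j
      · subst hq; simp [replacedForm]
      · simp [replacedForm, hq]
    rw [h10]
    dsimp only [κ]
    ring
  have hframe : (Sum.elim e fun j => Complex.I • e j) = fun i => E.restrictScalars ℝ (realFrame i) := by
    ext1 i
    rcases i with i | i
    · exact (hE1 i).symm
    · change Complex.I • e i = E (Complex.I • Pi.single i 1)
      rw [map_smul, hE1]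
  have hsymm : ∀ i j, h i j = h j i := fun i j => hB.swap23 x (e i) (e j)
  have hval := wedgeConj_of_pullback η (E.restrictScalars ℝ) h hsymm κ hη
  have hval2 := hval _ hframe
  -- `|D e|² = volNorm² * s` by the orthonormality of `x`, the unit normal and `e`; so `36 s⁻⁴ * s`
  -- gives the exponent 3.
  have hκ : ‖κ‖ ^ 2 = 36 * volNorm μ ^ 2 / s ^ 3 := by
    simp only [κ, norm_mul, mul_pow]
    rw [norm_curry2_frame hB hx he, norm_pow, norm_inv, Complex.norm_real, Real.norm_eq_abs]
    rw [← hs]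
    have : |s| ^ 2 = s ^ 2 := sq_abs s
    have h4 : (|s|⁻¹ ^ 2) ^ 2 = (s ^ 2)⁻¹ ^ 2 := by rw [inv_pow, this]
    rw [h4]
    norm_num
    field_simp
  rw [hκ] at hval2
  dsimp only [h, η] at hval2
  rw [hval2]

/-- The tangent space is complex, so rotations by `ζ ^ k` preserve its unit vectors and the
averaging that defines `component31` does not increase the norm. The wedge product is a signed sum,
over shuffles, of products of values on unit vectors. This passes the divergence on to `ω_F` itself.
-/
theorem norm_wedgeConj_le {x : V} {e : Fin 4 → V}
    (he : IsUnitaryFrame F x e) (η : V [⋀^Fin 4]→L[ℝ] ℂ) :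
    ‖wedgeConj (component31 η) (Sum.elim e fun j => Complex.I • e j)‖
      ≤ Fintype.card (Equiv.Perm.ModSumCongr (Fin 4) (Fin 4)) * ‖restrictTangent F x η‖ ^ 2 := by
  have hT : ∀ v : Fin 4 → V, (∀ i, v i ∈ tangent F x ∧ ‖v i‖ = 1) →
      ‖component31 η v‖ ≤ ‖restrictTangent F x η‖ := by
    intro v hv
    set ζ : ℂ := Complex.exp (Real.pi * Complex.I / 4) with hζ
    have hζn : ‖ζ‖ = 1 := by
      rw [hζ, show (Real.pi * Complex.I / 4 : ℂ) = ((Real.pi / 4 : ℝ) : ℂ) * Complex.I by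
        push_cast; ring, Complex.norm_exp_ofReal_mul_I]
    have h31 : component31 η v = (1 / 8 : ℂ) * ∑ k ∈ Finset.range 8,
        (-Complex.I) ^ k * η (fun j => ζ ^ k • v j) := by
      simp only [component31, rotate]
      rw [ContinuousAlternatingMap.smul_apply, ContinuousAlternatingMap.sum_apply]
      rfl
    have hk : ∀ k : ℕ, ‖(-Complex.I) ^ k * η (fun j => ζ ^ k • v j)‖ ≤ ‖restrictTangent F x η‖ := by
      intro k
      have h := (restrictTangent F x η).le_opNorm
        (fun j => ⟨ζ ^ k • v j, Submodule.smul_mem _ _ (hv j).1⟩)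
      have h2 : restrictTangent F x η (fun j => ⟨ζ ^ k • v j, Submodule.smul_mem _ _ (hv j).1⟩)
        = η (fun j => ζ ^ k • v j) := rfl
      rw [h2] at h
      refine le_trans (le_of_eq ?_) (h.trans (le_of_eq ?_))
      · simp
      · simp [norm_smul, hζn, hv]
    rw [h31, norm_mul]
    calc ‖(1 / 8 : ℂ)‖ * _ ≤ ‖(1 / 8 : ℂ)‖ * ∑ k ∈ Finset.range 8, ‖restrictTangent F x η‖ := by
          gcongr
          exact norm_sum_le_of_le _ fun k _ => hk k
      _ = _ := by simp
  have hw : wedgeConj (component31 η) = wedgeMul (component31 η).toAlternatingMap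
      ((Complex.conjCLE : ℂ →L[ℝ] ℂ).toLinearMap.compAlternatingMap
        (component31 η).toAlternatingMap) := rfl
  rw [hw, wedgeMul_apply]
  have hmem : ∀ q, (Sum.elim e fun j => Complex.I • e j) q ∈ tangent F x ∧
      ‖(Sum.elim e fun j => Complex.I • e j) q‖ = 1 := by
    intro q
    rcases q with q | q
    · exact ⟨he.2 q, he.1.1 q⟩
    · exact ⟨Submodule.smul_mem _ _ (he.2 q), by simp [norm_smul, he.1.1 q]⟩
  refine (norm_sum_le _ _).trans ?_
  rw [Fintype.card, ← nsmul_eq_mul]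
  refine Finset.sum_le_card_nsmul _ _ _ fun σ _ => ?_
  have hs : ‖(((Equiv.Perm.sign (Quotient.out σ) : ℤ)) : ℂ)‖ = 1 := by
    rcases Int.units_eq_one_or (Equiv.Perm.sign (Quotient.out σ)) with h | h <;> simp [h]
  rw [norm_mul, hs, one_mul, norm_mul, sq]
  refine mul_le_mul (hT _ fun i => hmem _) ?_ (norm_nonneg _)
    (norm_nonneg (restrictTangent F x η))
  refine le_trans (le_of_eq ?_) (hT _ fun i => hmem (Quotient.out σ (Sum.inr i)))
  exact RCLike.norm_conj _

/-- The kernel of `dF` at `x` is spanned by `x` and the frame, and `x` contributes nothing because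
`B x x` vanishes on that kernel. The rest is the Cauchy–Schwarz and Bessel inequalities. -/
theorem sq_le_sum_frame (hB : IsPolarization F B) {x : V} (hx : x ∈ regLink F) {e : Fin 4 → V}
    (he : IsUnitaryFrame F x e) {v w : V} (hv : B x x v = 0) (hw : B x x w = 0) :
    ‖B x v w‖ ^ 2 ≤ ‖v‖ ^ 2 * ‖w‖ ^ 2 * ∑ i, ∑ j, ‖B x (e i) (e j)‖ ^ 2 := by
  obtain ⟨bb, hbb⟩ := exists_orthonormalBasis (orthonormal_frame hB hx he)
  have hxx : B x x x = 0 := by rw [← hB.eval_eq, hx.2.1]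
  have key : ∀ v, B x x v = 0 → v = inner ℂ x v • x + ∑ i, inner ℂ (e i) v • e i := by
    intro v hv
    have h := bb.sum_repr' v
    rw [hbb, Fin.sum_univ_succ, Fin.sum_univ_succ] at h
    have hn : inner ℂ (conjGrad F x) v = 0 := by
      rw [inner_conjGrad, ← hB.eq_sum_partial, hv, mul_zero]
    simp only [Matrix.cons_val_zero, Matrix.cons_val_succ, inner_smul_left, hn, mul_zero,
      zero_smul, zero_add] at h
    exact h.symm
  have hxv : ∀ v, B x v x = B x x v := fun v => hB.swap23 _ _ _
  have hexp : B x v w = ∑ i, ∑ j, (inner ℂ (e i) v * inner ℂ (e j) w) * B x (e i) (e j) := by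
    have h1 : B x v w = B x (∑ i, inner ℂ (e i) v • e i) w := by
      conv_lhs => rw [key v hv, hB.add_mid, hB.smul_mid, hw, mul_zero, zero_add]
    have h2 : ∀ v, B x x v = 0 → B x v w = B x v (∑ i, inner ℂ (e i) w • e i) := by
      intro v hv
      conv_lhs => rw [key w hw, hB.add_right, hB.smul_right, hxv, hv, mul_zero, zero_add]
    have h3 : ∀ i, B x x (e i) = 0 := by
      intro i
      have := (mem_tangent.1 (he.2 i)).1
      rw [inner_conjGrad, ← hB.eq_sum_partial] at this
      simpa using this
    rw [h1, h2, hB.sum_mid]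
    · refine Finset.sum_congr rfl fun i _ => ?_
      rw [hB.sum_right]
      refine Finset.sum_congr rfl fun j _ => ?_
      rw [hB.smul_mid, hB.smul_right]; ring
    · rw [hB.sum_right]
      simp [hB.smul_right, h3]
  have hbv : ∑ i, ‖inner ℂ (e i) v‖ ^ 2 ≤ ‖v‖ ^ 2 := he.1.sum_inner_products_le v
  have hbw : ∑ i, ‖inner ℂ (e i) w‖ ^ 2 ≤ ‖w‖ ^ 2 := he.1.sum_inner_products_le w
  have hcs : ‖B x v w‖ ^ 2 ≤ (∑ p : Fin 4 × Fin 4, (‖inner ℂ (e p.1) v‖ * ‖inner ℂ (e p.2) w‖) ^ 2)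
      * ∑ p : Fin 4 × Fin 4, ‖B x (e p.1) (e p.2)‖ ^ 2 := by
    refine le_trans ?_ (Finset.sum_mul_sq_le_sq_mul_sq _ _ _)
    rw [hexp, ← Fintype.sum_prod_type']
    refine pow_le_pow_left₀ (norm_nonneg _) ((norm_sum_le _ _).trans (le_of_eq ?_)) 2
    simp
  refine hcs.trans ?_
  rw [← Fintype.sum_prod_type']
  refine mul_le_mul_of_nonneg_right ?_ (Finset.sum_nonneg fun _ _ => sq_nonneg _)
  simp only [mul_pow]
  rw [Fintype.sum_prod_type]
  dsimp only
  rw [← Finset.sum_mul_sum]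
  exact mul_le_mul hbv hbw (Finset.sum_nonneg fun _ _ => sq_nonneg _) (by positivity)

end CubicFourfold

/-! ### The curvature function, and the reduction of (B1) to the divergence of its integral -/

namespace CubicFourfold

variable {F : MvPolynomial (Fin 6) ℂ} {B : V → V → V → ℂ}

/-- Spanning vectors of the kernel of `dF` at `x`. -/
noncomputable def kerVec (F : MvPolynomial (Fin 6) ℂ) (x : V) (p : Fin 6 × Fin 6) : V :=
  partialAt F p.1 x • EuclideanSpace.single p.2 1 - partialAt F p.2 x • EuclideanSpace.single p.1 1

/-- A homogeneous measurable function comparable from below with the squared norm of the second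
fundamental form of the cone `F = 0`, divided by the square of the gradient. -/
noncomputable def curvature (F : MvPolynomial (Fin 6) ℂ) (B : V → V → V → ℂ) (x : V) : ℝ :=
  (∑ p : Fin 6 × Fin 6, ∑ q : Fin 6 × Fin 6, ‖B x (kerVec F x p) (kerVec F x q)‖ ^ 2)
    / gradSq F x ^ 5

theorem continuous_partialAt (F : MvPolynomial (Fin 6) ℂ) (i : Fin 6) :
    Continuous (partialAt F i) := by
  unfold partialAt evalAt
  exact (MvPolynomial.continuous_eval _).comp (by fun_prop)

theorem continuous_evalAt (F : MvPolynomial (Fin 6) ℂ) : Continuous (evalAt F) := by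
  unfold evalAt
  exact (MvPolynomial.continuous_eval _).comp (by fun_prop)

theorem continuous_gradSq (F : MvPolynomial (Fin 6) ℂ) : Continuous (gradSq F) := by
  unfold gradSq
  have := continuous_partialAt F
  fun_prop

theorem measurable_curvature (hB : IsPolarization F B) : Measurable (curvature F B) := by
  unfold curvature
  have := continuous_partialAt F
  have hk : ∀ p, Continuous fun x => kerVec F x p := by
    intro p; unfold kerVec; fun_prop
  refine Measurable.div (Continuous.measurable ?_) ((continuous_gradSq F).pow 5).measurable
  refine continuous_finsetSum _ fun p _ => continuous_finsetSum _ fun q _ => ?_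
  exact (hB.continuous_comp continuous_id (hk p) (hk q)).norm.pow 2

theorem measurableSet_regLink (F : MvPolynomial (Fin 6) ℂ) : MeasurableSet (regLink F) := by
  refine (isClosed_eq continuous_norm continuous_const).measurableSet.inter
    ((isClosed_eq (continuous_evalAt F) continuous_const).measurableSet.inter ?_)
  have h : IsOpen {x : V | ∃ i, partialAt F i x ≠ 0} := by
    rw [Set.ofPred_exists]
    exact isOpen_iUnion fun i => isOpen_ne_fun (continuous_partialAt F i) continuous_const
  exact h.measurableSet

theorem gradSq_nonneg (x : V) : 0 ≤ gradSq F x := Finset.sum_nonneg fun _ _ => sq_nonneg _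

theorem curvature_nonneg (x : V) : 0 ≤ curvature F B x :=
  div_nonneg (Finset.sum_nonneg fun _ _ => Finset.sum_nonneg fun _ _ => sq_nonneg _)
    (pow_nonneg (gradSq_nonneg x) 5)

theorem sq_le_gradSq (x : V) (i : Fin 6) : ‖partialAt F i x‖ ^ 2 ≤ gradSq F x :=
  Finset.single_le_sum (f := fun i => ‖partialAt F i x‖ ^ 2) (fun _ _ => sq_nonneg _)
    (Finset.mem_univ i)

theorem kerVec_mem (hB : IsPolarization F B) (x : V) (p : Fin 6 × Fin 6) :
    B x x (kerVec F x p) = 0 := by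
  have h := hB.eq_sum_partial x (kerVec F x p)
  have h2 : ∑ i, partialAt F i x * (kerVec F x p) i = 0 := by
    simp [kerVec, mul_sub, Finset.sum_sub_distrib]
    ring
  rw [h2] at h
  simpa using h

theorem norm_kerVec_sq_le (x : V) (p : Fin 6 × Fin 6) : ‖kerVec F x p‖ ^ 2 ≤ 4 * gradSq F x := by
  have h : ‖kerVec F x p‖ ≤ ‖partialAt F p.1 x‖ + ‖partialAt F p.2 x‖ := by
    refine (norm_sub_le _ _).trans (le_of_eq ?_)
    simp [norm_smul]
  have h1 := sq_le_gradSq (F := F) x p.1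
  have h2 := sq_le_gradSq (F := F) x p.2
  have h3 := pow_le_pow_left₀ (norm_nonneg _) h 2
  nlinarith [sq_nonneg (‖partialAt F p.1 x‖ - ‖partialAt F p.2 x‖)]

/-- The vectors `kerVec` are the Koszul relations between the partial derivatives. Contraction with
the conjugate gradient yields coefficients without the choice of a nonvanishing partial derivative.
-/
theorem gradSq_smul_eq (hB : IsPolarization F B) {x v : V} (hv : B x x v = 0) :
    (gradSq F x : ℂ) • v = ∑ p : Fin 6 × Fin 6,
      ((starRingEnd ℂ) (partialAt F p.1 x) * v p.2) • kerVec F x p := by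
  have h0 : ∑ m, partialAt F m x * v m = 0 := by rw [← hB.eq_sum_partial, hv, mul_zero]
  rw [Fintype.sum_prod_type]
  ext j
  have : ∀ l m : Fin 6, ((starRingEnd ℂ) (partialAt F l x) * v m) * (kerVec F x (l, m)) j
      = ((starRingEnd ℂ) (partialAt F l x) * partialAt F l x) * (if j = m then v m else 0)
        - (if j = l then (starRingEnd ℂ) (partialAt F l x) else 0) * (partialAt F m x * v m) := by
    intro l m
    simp only [kerVec, PiLp.smul_apply, PiLp.sub_apply, smul_eq_mul, PiLp.single_apply]
    split_ifs <;> ring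
  simp only [PiLp.smul_apply, smul_eq_mul, WithLp.ofLp_sum, Finset.sum_apply]
  simp only [this, Finset.sum_sub_distrib, ← Finset.mul_sum, h0]
  simp [gradSq, Complex.conj_mul', Finset.sum_mul]

/-- Cauchy–Schwarz for the expansions of `gradSq F x • v` and `gradSq F x • w` in Koszul vectors.
All lower bounds of the curvature are obtained in this way, by exhibiting one pair of tangent
vectors on which the Hessian is not small. -/
theorem sq_le_curvature (hB : IsPolarization F B) {x v w : V} (hg : gradSq F x ≠ 0)
    (hv : B x x v = 0) (hw : B x x w = 0) :
    ‖B x v w‖ ^ 2 ≤ gradSq F x ^ 3 * ‖v‖ ^ 2 * ‖w‖ ^ 2 * curvature F B x := by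
  have hs : 0 < gradSq F x := lt_of_le_of_ne (gradSq_nonneg x) hg.symm
  set s := gradSq F x with hsdef
  have hn : ∀ v : V, ∑ p : Fin 6 × Fin 6, ‖(starRingEnd ℂ) (partialAt F p.1 x) * v p.2‖ ^ 2
      = s * ‖v‖ ^ 2 := by
    intro v
    rw [Fintype.sum_prod_type, EuclideanSpace.norm_sq_eq, hsdef, gradSq, Finset.sum_mul_sum]
    refine Finset.sum_congr rfl fun i _ => Finset.sum_congr rfl fun j _ => ?_
    rw [norm_mul, mul_pow, RCLike.norm_conj]
  have hexp : (s : ℂ) ^ 2 * B x v w = ∑ p : (Fin 6 × Fin 6) × (Fin 6 × Fin 6),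
      (((starRingEnd ℂ) (partialAt F p.1.1 x) * v p.1.2) *
        ((starRingEnd ℂ) (partialAt F p.2.1 x) * w p.2.2)) *
        B x (kerVec F x p.1) (kerVec F x p.2) := by
    have h1 : (s : ℂ) ^ 2 * B x v w = B x ((s : ℂ) • v) ((s : ℂ) • w) := by
      rw [hB.smul_mid, hB.smul_right]; ring
    rw [h1, gradSq_smul_eq hB hv, gradSq_smul_eq hB hw, hB.sum_mid]
    conv_rhs => rw [Fintype.sum_prod_type]
    refine Finset.sum_congr rfl fun p _ => ?_
    rw [hB.sum_right]
    refine Finset.sum_congr rfl fun q _ => ?_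
    rw [hB.smul_mid, hB.smul_right]; ring
  have hcs : (s ^ 2 * ‖B x v w‖) ^ 2 ≤ (s * ‖v‖ ^ 2 * (s * ‖w‖ ^ 2)) *
      (∑ p : Fin 6 × Fin 6, ∑ q : Fin 6 × Fin 6, ‖B x (kerVec F x p) (kerVec F x q)‖ ^ 2) := by
    have h1 : s ^ 2 * ‖B x v w‖ = ‖(s : ℂ) ^ 2 * B x v w‖ := by
      rw [norm_mul, norm_pow, Complex.norm_real, Real.norm_eq_abs, sq_abs]
    rw [h1, hexp, ← hn v, ← hn w, Finset.sum_mul_sum, ← Fintype.sum_prod_type',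
      ← Fintype.sum_prod_type']
    refine (pow_le_pow_left₀ (norm_nonneg _) (norm_sum_le _ _) 2).trans ?_
    simp only [norm_mul _ (B _ _ _)]
    refine (Finset.sum_mul_sq_le_sq_mul_sq _ _ _).trans (le_of_eq ?_)
    simp only [norm_mul, mul_pow]
  have hc : (∑ p : Fin 6 × Fin 6, ∑ q : Fin 6 × Fin 6, ‖B x (kerVec F x p) (kerVec F x q)‖ ^ 2)
      = s ^ 5 * curvature F B x := by
    rw [curvature, ← hsdef]; field_simp
  rw [hc] at hcs
  have h4 : 0 < s ^ 4 := pow_pos hs 4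
  refine le_of_mul_le_mul_left ?_ h4
  calc s ^ 4 * ‖B x v w‖ ^ 2 = (s ^ 2 * ‖B x v w‖) ^ 2 := by ring
    _ ≤ _ := hcs
    _ = _ := by ring

/-- Each Koszul vector has squared norm at most `4 * gradSq`, and there are `36²` pairs: `20736 =
36² * 4²`. The factor `gradSq²` from the two vectors reduces the exponent 5 of the definition to 3.
-/
theorem curvature_le_frame (hB : IsPolarization F B) {x : V} (hx : x ∈ regLink F) {e : Fin 4 → V}
    (he : IsUnitaryFrame F x e) :
    curvature F B x ≤ 20736 / gradSq F x ^ 3 * ∑ i, ∑ j, ‖B x (e i) (e j)‖ ^ 2 := by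
  have hg := gradSq_ne_zero hx.2.2
  have hs : 0 < gradSq F x := lt_of_le_of_ne (gradSq_nonneg x) hg.symm
  set S := ∑ i, ∑ j, ‖B x (e i) (e j)‖ ^ 2 with hS
  have hS0 : 0 ≤ S := Finset.sum_nonneg fun _ _ => Finset.sum_nonneg fun _ _ => sq_nonneg _
  have h : ∀ p q, ‖B x (kerVec F x p) (kerVec F x q)‖ ^ 2 ≤ 16 * gradSq F x ^ 2 * S := by
    intro p q
    refine (sq_le_sum_frame hB hx he (kerVec_mem hB x p) (kerVec_mem hB x q)).trans ?_
    refine mul_le_mul_of_nonneg_right ?_ hS0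
    calc _ ≤ (4 * gradSq F x) * (4 * gradSq F x) :=
          mul_le_mul (norm_kerVec_sq_le x p) (norm_kerVec_sq_le x q) (sq_nonneg _) (by positivity)
      _ = _ := by ring
  rw [curvature, div_le_iff₀ (pow_pos hs 5)]
  refine (Finset.sum_le_sum fun p _ => Finset.sum_le_sum fun q _ => h p q).trans (le_of_eq ?_)
  simp only [Finset.sum_const, Finset.card_univ, Fintype.card_prod, Fintype.card_fin, nsmul_eq_mul]
  field_simp
  norm_num
  ring

/-- The density `W` is nowhere positive. Its negative `- W` is squeezed between a multiple of the
curvature, with `16 * 36 / 20736 = 1 / 36`, and a multiple of the squared norm of `ω_F`; so the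
divergence of the first integral entails that of the two others. -/
theorem conditionB1_of_lintegral_curvature (hB : IsPolarization F B) {μ : V [⋀^Fin 6]→L[ℂ] ℂ}
    (hμ : μ ≠ 0)
    (h : ∫⁻ x in regLink F, ENNReal.ofReal (curvature F B x)
      ∂(MeasureTheory.Measure.hausdorffMeasure 9) = ∞) :
    ConditionB1 F μ := by
  have hv := volNorm_pos hμ
  set W := wedgeDensity F fun x => component31 (omega F μ x) with hW
  have hfr : ∀ x ∈ regLink F, W x ≤ 0 ∧ volNorm μ ^ 2 / 36 * curvature F B x ≤ - W x ∧
      - W x ≤ Fintype.card (Equiv.Perm.ModSumCongr (Fin 4) (Fin 4)) *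
        ‖restrictTangent F x (omega F μ x)‖ ^ 2 := by
    intro x hx
    have hg := gradSq_ne_zero hx.2.2
    have hs : 0 < gradSq F x := lt_of_le_of_ne (gradSq_nonneg x) hg.symm
    have hex := exists_isUnitaryFrame hB hx
    have hwd : W x = (wedgeConj (component31 (omega F μ x))
        (Sum.elim hex.choose fun j => Complex.I • hex.choose j)).re := by
      rw [hW, wedgeDensity, dif_pos hex]
    have h1 := wedgeConj_frame hB hx hex.choose_spec μ
    have h2 := norm_wedgeConj_le hex.choose_spec (omega F μ x)
    have h3 := curvature_le_frame hB hx hex.choose_spec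
    set S := ∑ i, ∑ j, ‖B x (hex.choose i) (hex.choose j)‖ ^ 2 with hS
    have hS0 : 0 ≤ S := Finset.sum_nonneg fun _ _ => Finset.sum_nonneg fun _ _ => sq_nonneg _
    have h4 : W x = -16 * (36 * volNorm μ ^ 2 / gradSq F x ^ 3) * S := by
      rw [hwd, h1, Complex.ofReal_re]
    refine ⟨?_, ?_, ?_⟩
    · rw [h4]
      have : 0 ≤ (36 * volNorm μ ^ 2 / gradSq F x ^ 3) * S :=
        mul_nonneg (div_nonneg (mul_nonneg (by norm_num) (sq_nonneg _)) (pow_nonneg hs.le 3)) hS0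
      linarith
    · rw [h4]
      refine (mul_le_mul_of_nonneg_left h3 (by positivity)).trans (le_of_eq ?_)
      ring
    · have h5 : ∀ (z : ℂ) (r : ℝ), ‖z‖ ≤ r → -z.re ≤ r := fun z r h =>
        ((neg_le_abs _).trans (Complex.abs_re_le_norm z)).trans h
      rw [hwd]
      exact h5 _ _ h2
  have hm := measurableSet_regLink F
  have hneg : ∫⁻ x in regLink F, ENNReal.ofReal (- W x)
      ∂(MeasureTheory.Measure.hausdorffMeasure 9) = ∞ := by
    have hc : ENNReal.ofReal (volNorm μ ^ 2 / 36) ≠ 0 := by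
      rw [Ne, ENNReal.ofReal_eq_zero, not_le]; positivity
    rw [eq_top_iff, ← ENNReal.mul_top hc, ← h,
      ← MeasureTheory.lintegral_const_mul' _ _ ENNReal.ofReal_ne_top]
    refine MeasureTheory.setLIntegral_mono' hm fun x hx => ?_
    rw [← ENNReal.ofReal_mul (by positivity)]
    exact ENNReal.ofReal_le_ofReal (hfr x hx).2.1
  refine ⟨⟨?_, hneg⟩, fun hsq => ?_⟩
  · rw [MeasureTheory.setLIntegral_congr_fun hm (g := fun _ => 0)
      fun x hx => ENNReal.ofReal_of_nonpos (hfr x hx).1]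
    simp
  · have hN : ((Fintype.card (Equiv.Perm.ModSumCongr (Fin 4) (Fin 4)) : ℝ≥0∞)) ≠ ∞ :=
      ENNReal.natCast_ne_top _
    have hle : ∫⁻ x in regLink F, ENNReal.ofReal (- W x)
        ∂(MeasureTheory.Measure.hausdorffMeasure 9) ≤
        Fintype.card (Equiv.Perm.ModSumCongr (Fin 4) (Fin 4)) *
        ∫⁻ x in regLink F, ‖restrictTangent F x (omega F μ x)‖ₑ ^ 2
          ∂(MeasureTheory.Measure.hausdorffMeasure 9) := by
      rw [← MeasureTheory.lintegral_const_mul' _ _ hN]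
      refine MeasureTheory.setLIntegral_mono' hm fun x hx => ?_
      refine (ENNReal.ofReal_le_ofReal (hfr x hx).2.2).trans (le_of_eq ?_)
      rw [ENNReal.ofReal_mul (Nat.cast_nonneg _), ENNReal.ofReal_natCast,
        ENNReal.ofReal_pow (norm_nonneg (restrictTangent F x (omega F μ x))),
        ofReal_norm]
    rw [hneg] at hle
    exact (ENNReal.mul_lt_top hN.lt_top hsq).not_ge hle

end CubicFourfold

/-! ### Hausdorff measure and Lipschitz charts of the unit sphere -/

namespace CubicFourfold

open MeasureTheory in
/-- A lower bound of an integral for the Hausdorff measure by means of a Lipschitz map. -/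
theorem lintegral_eq_top_of_lipschitzOnWith {X J : Type*} [MetricSpace X] [MeasurableSpace X]
    [BorelSpace X] [Fintype J] {n : ℝ} (hJ : Fintype.card J = n) {S N : Set X} (hS : MeasurableSet S)
    (hN : IsOpen N) {k : X → ℝ≥0∞} (hk : Measurable k) {P : X → J → ℝ} {K : ℝ≥0}
    (hP : LipschitzOnWith K P N) {b : ℕ → Set (J → ℝ)} (hb : ∀ j, IsOpen (b j))
    (hdisj : Pairwise (Function.onFun Disjoint b)) {θ : ℕ → ℝ≥0∞}
    (hsurj : ∀ j, ∀ q ∈ b j, ∃ p ∈ N ∩ S, P p = q ∧ θ j ≤ k p) {c : ℝ≥0∞} (hc : c ≠ 0)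
    (hvol : ∀ j, c ≤ θ j * volume (b j)) :
    ∫⁻ x in S, k x ∂(Measure.hausdorffMeasure n) = ∞ := by
  set A : ℕ → Set X := fun j => (N ∩ P ⁻¹' (b j)) ∩ (S ∩ {p | θ j ≤ k p}) with hA
  have hAm : ∀ j, MeasurableSet (A j) := fun j =>
    (hP.continuousOn.isOpen_inter_preimage hN (hb j)).measurableSet.inter
      (hS.inter (measurableSet_le measurable_const hk))
  have hAd : Pairwise (Function.onFun Disjoint A) := fun i j hij =>
    Disjoint.mono (fun x hx => hx.1.2) (fun x hx => hx.1.2) ((hdisj hij).preimage P)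
  have hn : 0 ≤ n := by rw [← hJ]; positivity
  -- A `K`-Lipschitz map enlarges `n`-dimensional Hausdorff measure at most by `K ^ n`, and
  -- Hausdorff measure on `J → ℝ` is Lebesgue measure. So it suffices that `P` maps `A j` onto `b
  -- j`; neither injectivity nor an area formula is required.
  have hAle : ∀ j, c ≤ (K : ℝ≥0∞) ^ n * ∫⁻ x in A j, k x ∂(Measure.hausdorffMeasure n) := by
    intro j
    have h1 : b j ⊆ P '' A j := by
      intro q hq
      obtain ⟨p, hp, hpq, hθ⟩ := hsurj j q hq
      exact ⟨p, ⟨⟨hp.1, by rwa [Set.mem_preimage, hpq]⟩, hp.2, hθ⟩, hpq⟩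
    have h2 : volume (b j) ≤ (K : ℝ≥0∞) ^ n * Measure.hausdorffMeasure n (A j) := by
      rw [← hausdorffMeasure_pi_real, hJ]
      exact (measure_mono h1).trans ((hP.mono fun x hx => hx.1.1).hausdorffMeasure_image_le hn)
    calc c ≤ θ j * volume (b j) := hvol j
      _ ≤ θ j * ((K : ℝ≥0∞) ^ n * Measure.hausdorffMeasure n (A j)) := by gcongr
      _ = (K : ℝ≥0∞) ^ n * ∫⁻ x in A j, θ j ∂(Measure.hausdorffMeasure n) := by
          rw [setLIntegral_const]; ring
      _ ≤ _ := mul_le_mul' le_rfl (setLIntegral_mono' (hAm j) fun x hx => hx.2.2)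
  have hsum : ∞ ≤ (K : ℝ≥0∞) ^ n * ∫⁻ x in S, k x ∂(Measure.hausdorffMeasure n) := by
    calc ∞ = ∑' _ : ℕ, c := (ENNReal.tsum_const_eq_top_of_ne_zero hc).symm
      _ ≤ ∑' j, (K : ℝ≥0∞) ^ n * ∫⁻ x in A j, k x ∂(Measure.hausdorffMeasure n) :=
          ENNReal.tsum_le_tsum hAle
      _ = (K : ℝ≥0∞) ^ n * ∫⁻ x in ⋃ j, A j, k x ∂(Measure.hausdorffMeasure n) := by
          rw [ENNReal.tsum_mul_left, lintegral_iUnion hAm hAd]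
      _ ≤ _ := by
          gcongr
          exact Set.iUnion_subset fun j x hx => hx.2.1
  by_contra h
  exact (ENNReal.mul_lt_top (ENNReal.rpow_lt_top_of_nonneg hn ENNReal.coe_ne_top)
    (lt_top_iff_ne_top.2 h)).not_ge hsum

variable {F : MvPolynomial (Fin 6) ℂ} {B : V → V → V → ℂ}

theorem partialAt_smul (hB : IsPolarization F B) (c : ℂ) (x : V) (i : Fin 6) :
    partialAt F i (c • x) = c ^ 2 * partialAt F i x := by
  rw [hB.partial_eq, hB.partial_eq, hB.smul_left, hB.smul_mid]; ring

theorem evalAt_smul (hB : IsPolarization F B) (c : ℂ) (x : V) :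
    evalAt F (c • x) = c ^ 3 * evalAt F x := by
  rw [hB.eval_eq, hB.eval_eq, hB.smul_left, hB.smul_mid, hB.smul_right]; ring

/-- `B x` is linear in `x` and `kerVec` is quadratic, so the numerator has degree `2 * (1 + 2 + 2) =
10`; the denominator has degree `5 * 4 = 20`. -/
theorem curvature_smul (hB : IsPolarization F B) {c : ℂ} (hc : c ≠ 0) (x : V) :
    curvature F B (c • x) = (‖c‖⁻¹) ^ 10 * curvature F B x := by
  have hc' : ‖c‖ ≠ 0 := norm_ne_zero_iff.2 hc
  have h1 : ∀ p, kerVec F (c • x) p = c ^ 2 • kerVec F x p := by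
    intro p
    rw [kerVec, kerVec, partialAt_smul hB, partialAt_smul hB, smul_sub, smul_smul, smul_smul]
  have h2 : gradSq F (c • x) = ‖c‖ ^ 4 * gradSq F x := by
    simp only [gradSq, partialAt_smul hB, norm_mul, norm_pow, Finset.mul_sum]
    exact Finset.sum_congr rfl fun i _ => by ring
  have h3 : ∀ p q, ‖B (c • x) (kerVec F (c • x) p) (kerVec F (c • x) q)‖ ^ 2
      = ‖c‖ ^ 10 * ‖B x (kerVec F x p) (kerVec F x q)‖ ^ 2 := by
    intro p q
    rw [h1, h1, hB.smul_left, hB.smul_mid, hB.smul_right]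
    simp only [norm_mul, norm_pow]
    ring
  rw [curvature, curvature, h2]
  simp only [h3, ← Finset.mul_sum]
  rw [mul_pow, inv_pow, mul_div_mul_comm]
  congr 1
  field_simp

/-- A chart of the projective space is a lift of a Lipschitz chart of the unit sphere. -/
theorem exists_lipschitz_chart {ι : Type*} [Fintype ι] (hι : Fintype.card ι = 4) {x : V} (hx : x ≠ 0)
    {Φ : (ι → ℂ) × ℂ → V} {Φ' : (ι → ℂ) × ℂ →L[ℂ] V} (hΦ : HasStrictFDerivAt Φ Φ' 0) (hΦ0 : Φ 0 = x)
    (hinj : ∀ v (c : ℂ), Φ' v = c • x → v = 0) :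
    ∃ (G : V → (ι → ℂ) × ℝ) (N : Set V) (K : ℝ≥0) (ε : ℝ), IsOpen N ∧ LipschitzOnWith K G N ∧ 0 < ε ∧
      ∀ (y : (ι → ℂ) × ℂ) (θ : ℝ), ‖y‖ < ε → |θ| < ε → ‖x‖ / 2 ≤ ‖Φ y‖ ∧
        ∃ l : ℂ, ‖l‖ = ‖Φ y‖⁻¹ ∧ l • Φ y ∈ N ∧ G (l • Φ y) = (y.1, θ) := by
  set r : ℝ := ‖x‖⁻¹ with hr
  have hxn : 0 < ‖x‖ := norm_pos_iff.2 hx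
  have hr0 : 0 < r := inv_pos.2 hxn
  -- A scalar as sixth coordinate makes `Φ` a local coordinate system of `V` near the unit vector `r
  -- • x`; its local inverse is Lipschitz.
  set Ξ : ((ι → ℂ) × ℂ) × ℂ → V := fun q => q.2 • Φ q.1 with hΞ
  set q0 : ((ι → ℂ) × ℂ) × ℂ := (0, (r : ℂ)) with hq0
  let Ξ' : ((ι → ℂ) × ℂ) × ℂ →L[ℂ] V :=
    (r : ℂ) • (Φ'.comp (ContinuousLinearMap.fst ℂ _ _)) +
      (ContinuousLinearMap.snd ℂ ((ι → ℂ) × ℂ) ℂ).smulRight x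
  have hd : HasStrictFDerivAt Ξ Ξ' q0 := by
    have h1 : HasStrictFDerivAt (fun q : ((ι → ℂ) × ℂ) × ℂ => q.2)
      (ContinuousLinearMap.snd ℂ ((ι → ℂ) × ℂ) ℂ) q0 := hasStrictFDerivAt_snd
    have h2 : HasStrictFDerivAt (fun q : ((ι → ℂ) × ℂ) × ℂ => Φ q.1)
      (Φ'.comp (ContinuousLinearMap.fst ℂ ((ι → ℂ) × ℂ) ℂ)) q0 :=
      HasStrictFDerivAt.comp q0 (show HasStrictFDerivAt Φ Φ' q0.1 from hΦ) hasStrictFDerivAt_fst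
    have h3 := h1.smul h2
    have h4 : Φ q0.1 = x := hΦ0
    rw [h4] at h3
    exact h3
  have hker : ∀ q, Ξ' q = 0 → q = 0 := by
    rintro ⟨y, l⟩ hq
    have h1 : (r : ℂ) • Φ' y + l • x = 0 := hq
    have h2 : Φ' ((r : ℂ) • y) = (-l) • x := by
      rw [map_smul, neg_smul]; exact eq_neg_of_add_eq_zero_left h1
    have h3 := hinj _ _ h2
    have h4 : y = 0 := (smul_eq_zero.1 h3).resolve_left (by exact_mod_cast hr0.ne')
    rw [h4, map_zero, smul_zero, zero_add] at h1
    rw [h4, (smul_eq_zero.1 h1).resolve_right hx]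
    rfl
  have hfin : Module.finrank ℂ (((ι → ℂ) × ℂ) × ℂ) = Module.finrank ℂ V := by
    simp [hι]
  let L : (((ι → ℂ) × ℂ) × ℂ) ≃L[ℂ] V := (LinearEquiv.ofInjectiveOfFinrankEq
    (Ξ' : ((ι → ℂ) × ℂ) × ℂ →ₗ[ℂ] V) ((injective_iff_map_eq_zero _).2 hker) hfin).toContinuousLinearEquiv
  have hL : (L : ((ι → ℂ) × ℂ) × ℂ →L[ℂ] V) = Ξ' := by
    ext q <;> rfl
  rw [← hL] at hd
  set g := hd.localInverse with hg
  have hgd : HasStrictFDerivAt g (L.symm : V →L[ℂ] ((ι → ℂ) × ℂ) × ℂ) (Ξ q0) := hd.to_localInverse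
  obtain ⟨K, N0, hN0, hK⟩ := hgd.exists_lipschitzOnWith
  obtain ⟨N, hNN, hNo, hN1⟩ := mem_nhds_iff.1 hN0
  have hleft : ∀ᶠ q in 𝓝 q0, g (Ξ q) = q := hd.eventually_left_inverse
  have hmem : ∀ᶠ q in 𝓝 q0, Ξ q ∈ N := hd.continuousAt.eventually (hNo.mem_nhds hN1)
  -- Given `y` and `θ`, the multiple of `Φ y` on the unit sphere is the one by the `l` with `Im l =
  -- θ` and `|l| = ‖Φ y‖⁻¹`. As `y.2` is left to the equation of the hypersurface and `Re l` to the
  -- norm, there remain the nine real coordinates `y.1` and `Im l`.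
  let l : (((ι → ℂ) × ℂ) × ℝ) → ℂ := fun q => ⟨Real.sqrt ((‖Φ q.1‖⁻¹) ^ 2 - q.2 ^ 2), q.2⟩
  have hΦc : ContinuousAt (fun q : ((ι → ℂ) × ℂ) × ℝ => Φ q.1) 0 :=
    ContinuousAt.comp (f := Prod.fst) (g := Φ) hΦ.continuousAt continuousAt_fst
  have hnc : ContinuousAt (fun q : ((ι → ℂ) × ℂ) × ℝ => ‖Φ q.1‖) 0 := hΦc.norm
  have hn0 : ‖Φ (0 : ((ι → ℂ) × ℂ) × ℝ).1‖ = ‖x‖ := by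
    change ‖Φ 0‖ = _
    rw [hΦ0]
  have hic : ContinuousAt (fun q : ((ι → ℂ) × ℂ) × ℝ => ‖Φ q.1‖⁻¹) 0 :=
    hnc.inv₀ (by rw [hn0]; exact hxn.ne')
  have hlc : ContinuousAt l 0 := by
    have h1 : ContinuousAt (fun q : ((ι → ℂ) × ℂ) × ℝ =>
      (((Real.sqrt ((‖Φ q.1‖⁻¹) ^ 2 - q.2 ^ 2) : ℝ) : ℂ) + (q.2 : ℂ) * Complex.I)) 0 := by
      refine ContinuousAt.add (Complex.continuous_ofReal.continuousAt.comp
        (Real.continuous_sqrt.continuousAt.comp ((hic.pow 2).sub (by fun_prop)))) (by fun_prop)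
    refine h1.congr (Filter.Eventually.of_forall fun q => ?_)
    exact (Complex.mk_eq_add_mul_I _ _).symm
  have hl0 : l 0 = (r : ℂ) := by
    apply Complex.ext
    · change Real.sqrt ((‖Φ (0 : ((ι → ℂ) × ℂ) × ℝ).1‖⁻¹) ^ 2 - (0 : ℝ) ^ 2) = r
      rw [hn0, ← hr]
      simp [Real.sqrt_sq hr0.le]
    · rfl
  have hhc : Filter.Tendsto (fun q : ((ι → ℂ) × ℂ) × ℝ => (q.1, l q)) (𝓝 0) (𝓝 q0) := by
    have h1 : ContinuousAt (fun q : ((ι → ℂ) × ℂ) × ℝ => (q.1, l q)) 0 :=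
      continuousAt_fst.prodMk hlc
    have h2 := h1.tendsto
    rw [hl0] at h2
    exact h2
  have hsm : ∀ᶠ q : ((ι → ℂ) × ℂ) × ℝ in 𝓝 0, q.2 ^ 2 < (‖Φ q.1‖⁻¹) ^ 2 := by
    refine Filter.Tendsto.eventually_lt (f := fun q : ((ι → ℂ) × ℂ) × ℝ => q.2 ^ 2)
      ((continuous_snd.pow 2).tendsto (0 : ((ι → ℂ) × ℂ) × ℝ)) (hic.pow 2) ?_
    change (0 : ℝ) ^ 2 < (‖Φ (0 : ((ι → ℂ) × ℂ) × ℝ).1‖⁻¹) ^ 2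
    rw [hn0, zero_pow two_ne_zero]
    positivity
  have hbig : ∀ᶠ q : ((ι → ℂ) × ℂ) × ℝ in 𝓝 0, ‖x‖ / 2 < ‖Φ q.1‖ := by
    refine hnc.eventually (lt_mem_nhds ?_)
    change ‖x‖ / 2 < ‖Φ (0 : ((ι → ℂ) × ℂ) × ℝ).1‖
    rw [hn0]; linarith
  have hall := (((hhc.eventually hleft).and (hhc.eventually hmem)).and (hsm.and hbig))
  obtain ⟨ε, hε, hball⟩ := Metric.eventually_nhds_iff_ball.1 hall
  refine ⟨fun p => ((g p).1.1, (g p).2.im), N, K, ε, hNo, ?_, hε, ?_⟩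
  · have hc : LipschitzWith 1 (fun q : ((ι → ℂ) × ℂ) × ℂ => (q.1.1, q.2.im)) := by
      refine LipschitzWith.of_dist_le_mul fun a b => ?_
      rw [NNReal.coe_one, one_mul, Prod.dist_eq, Prod.dist_eq (x := a), Prod.dist_eq (x := a.1)]
      refine max_le_max (le_max_left _ _) ?_
      rw [Real.dist_eq, Complex.dist_eq, ← Complex.sub_im]
      exact Complex.abs_im_le_norm _
    have := hc.comp_lipschitzOnWith (hK.mono hNN)
    rwa [one_mul] at this
  · intro y θ hy hθ
    have hq : ((y, θ) : ((ι → ℂ) × ℂ) × ℝ) ∈ Metric.ball 0 ε := by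
      rw [mem_ball_zero_iff, Prod.norm_def]
      exact max_lt hy hθ
    obtain ⟨⟨h1, h2⟩, h3, h4⟩ := hball _ hq
    refine ⟨h4.le, l (y, θ), ?_, h2, ?_⟩
    · have h5 : ‖l (y, θ)‖ ^ 2 = (‖Φ y‖⁻¹) ^ 2 := by
        rw [← Complex.normSq_eq_norm_sq, Complex.normSq_apply]
        change Real.sqrt ((‖Φ y‖⁻¹) ^ 2 - θ ^ 2) * Real.sqrt ((‖Φ y‖⁻¹) ^ 2 - θ ^ 2) + θ * θ = _
        rw [Real.mul_self_sqrt (by simpa using h3.le)]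
        ring
      exact (sq_eq_sq₀ (norm_nonneg _) (by positivity)).1 h5
    · change ((g (Ξ (y, l (y, θ)))).1.1, (g (Ξ (y, l (y, θ)))).2.im) = _
      rw [h1]

end CubicFourfold

/-! ### Divergence over a sequence of weighted boxes -/

namespace CubicFourfold

variable {F : MvPolynomial (Fin 6) ℂ} {B : V → V → V → ℂ}

/-- Real coordinates on `ℂ ^ ι × ℝ`. -/
def realCoord {ι : Type*} (q : (ι → ℂ) × ℝ) : (ι ⊕ ι) ⊕ Unit → ℝ :=
  Sum.elim (Sum.elim (fun i => (q.1 i).re) fun i => (q.1 i).im) fun _ => q.2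

theorem lipschitzWith_realCoord {ι : Type*} [Fintype ι] :
    LipschitzWith 1 (realCoord : (ι → ℂ) × ℝ → _) := by
  refine LipschitzWith.of_dist_le_mul fun a b => ?_
  rw [NNReal.coe_one, one_mul, dist_pi_le_iff dist_nonneg]
  have h1 : ∀ i, ‖a.1 i - b.1 i‖ ≤ dist a b := fun i => by
    rw [← Complex.dist_eq]
    exact (dist_le_pi_dist _ _ i).trans (le_max_left _ _)
  rintro ((i | i) | i)
  · refine le_trans ?_ (h1 i)
    change dist (a.1 i).re (b.1 i).re ≤ _
    rw [Real.dist_eq, ← Complex.sub_re]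
    exact Complex.abs_re_le_norm _
  · refine le_trans ?_ (h1 i)
    change dist (a.1 i).im (b.1 i).im ≤ _
    rw [Real.dist_eq, ← Complex.sub_im]
    exact Complex.abs_im_le_norm _
  · exact le_max_right _ _

/-- If, along a weighted homogeneous box in the space of the first four coordinates of a chart of
the projective space, there are points of the hypersurface whose curvature is sufficiently large,
then the integral of the curvature is infinite. -/
theorem lintegral_curvature_eq_top (hB : IsPolarization F B) {ι : Type*} [Fintype ι]
    (hι : Fintype.card ι = 4) {x : V} (hx : x ≠ 0)
    {Φ : (ι → ℂ) × ℂ → V} {Φ' : (ι → ℂ) × ℂ →L[ℂ] V} (hΦ : HasStrictFDerivAt Φ Φ' 0) (hΦ0 : Φ 0 = x)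
    (hinj : ∀ v (c : ℂ), Φ' v = c • x → v = 0)
    (h : ∀ ε : ℝ, 0 < ε → ∃ (W : ι → ℝ) (Z₀ : ι → ℂ) (c : ℝ), (∃ i, 0 < W i ∧ Z₀ i ≠ 0) ∧ 0 < c ∧
      ∀ᶠ q : ℝ × (ι → ℂ) in 𝓝[>] 0 ×ˢ 𝓝 Z₀, ∃ t : ℂ,
        ‖((fun i => ((q.1 ^ W i : ℝ) : ℂ) * q.2 i, t) : (ι → ℂ) × ℂ)‖ < ε ∧
        evalAt F (Φ (fun i => ((q.1 ^ W i : ℝ) : ℂ) * q.2 i, t)) = 0 ∧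
        (∃ i, partialAt F i (Φ (fun i => ((q.1 ^ W i : ℝ) : ℂ) * q.2 i, t)) ≠ 0) ∧
        c ≤ q.1 ^ (2 * ∑ i, W i) *
          curvature F B (Φ (fun i => ((q.1 ^ W i : ℝ) : ℂ) * q.2 i, t))) :
    ∫⁻ x in regLink F, ENNReal.ofReal (curvature F B x)
      ∂(MeasureTheory.Measure.hausdorffMeasure 9) = ∞ := by
  obtain ⟨G, N, K, ε, hNo, hG, hε, hchart⟩ := exists_lipschitz_chart hι hx hΦ hΦ0 hinj
  obtain ⟨W, Z₀, c, ⟨i₀, hW, hZ⟩, hc, hev⟩ := h ε hε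
  rw [Filter.eventually_prod_iff] at hev
  obtain ⟨pa, hpa, pb, hpb, hab⟩ := hev
  obtain ⟨ρ₀, hρ₀, hpa⟩ := (nhdsGT_basis (0 : ℝ)).eventually_iff.1 hpa
  obtain ⟨r₀, hr₀, hpb⟩ := Metric.eventually_nhds_iff_ball.1 hpb
  have hxn : 0 < ‖x‖ := norm_pos_iff.2 hx
  have hZn : 0 < ‖Z₀ i₀‖ := norm_pos_iff.2 hZ
  -- With this radius the coordinate `i₀` in the `j`-th box has absolute value between `1/2` and
  -- `3/2` times `‖Z₀ i₀‖ * ρ j ^ W i₀`. The ratio `κ` makes `ρ j ^ W i₀` decrease by the factor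
  -- `1/4`, and `3/2 * 1/4 < 1/2` makes the boxes disjoint.
  set r : ℝ := min (r₀ / 3) (‖Z₀ i₀‖ / 4) with hr
  have hr0 : 0 < r := lt_min (by linarith) (by linarith)
  have hr1 : 2 * r < r₀ := by have := min_le_left (r₀ / 3) (‖Z₀ i₀‖ / 4); linarith
  have hr2 : 2 * r ≤ ‖Z₀ i₀‖ / 2 := by have := min_le_right (r₀ / 3) (‖Z₀ i₀‖ / 4); linarith
  set κ : ℝ := (1 / 4 : ℝ) ^ (1 / W i₀) with hκ
  have hκ0 : 0 < κ := by positivity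
  have hκ1 : κ ≤ 1 := Real.rpow_le_one (by norm_num) (by norm_num) (by positivity)
  have hκW : κ ^ W i₀ = 1 / 4 := by
    rw [hκ, ← Real.rpow_mul (by norm_num), one_div_mul_cancel hW.ne', Real.rpow_one]
  set ρ : ℕ → ℝ := fun j => ρ₀ / 2 * κ ^ j with hρ
  have hρ0 : ∀ j, 0 < ρ j := fun j => by positivity
  have hρ1 : ∀ j, ρ j < ρ₀ := fun j => by
    have : κ ^ j ≤ 1 := pow_le_one₀ hκ0.le hκ1
    have h2 : ρ₀ / 2 * κ ^ j ≤ ρ₀ / 2 * 1 := mul_le_mul_of_nonneg_left this (by positivity)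
    simp only [hρ]
    linarith
  have hρW : ∀ j, ρ j ^ W i₀ = (ρ₀ / 2) ^ W i₀ * (1 / 4) ^ j := fun j => by
    simp only [hρ]
    rw [Real.mul_rpow (by positivity) (by positivity), ← Real.rpow_natCast κ j,
      ← Real.rpow_mul hκ0.le, mul_comm (j : ℝ), Real.rpow_mul hκ0.le, hκW, Real.rpow_natCast]
  let ctr : ℕ → (ι ⊕ ι) ⊕ Unit → ℝ := fun j =>
    Sum.elim (Sum.elim (fun i => ρ j ^ W i * (Z₀ i).re) fun i => ρ j ^ W i * (Z₀ i).im) fun _ => 0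
  let len : ℕ → (ι ⊕ ι) ⊕ Unit → ℝ := fun j =>
    Sum.elim (Sum.elim (fun i => ρ j ^ W i * r) fun i => ρ j ^ W i * r) fun _ => ε
  let b : ℕ → Set ((ι ⊕ ι) ⊕ Unit → ℝ) := fun j =>
    Set.pi Set.univ fun s => Set.Ioo (ctr j s - len j s) (ctr j s + len j s)
  have hrp : ∀ j i, 0 < ρ j ^ W i := fun j i => Real.rpow_pos_of_pos (hρ0 j) _
  -- the points of the boxes in weighted polar form
  have hbox : ∀ j, ∀ q ∈ b j, ∃ Z ∈ Metric.ball Z₀ r₀, ‖Z i₀ - Z₀ i₀‖ < 2 * r ∧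
      |q (Sum.inr ())| < ε ∧
      q = realCoord (fun i => ((ρ j ^ W i : ℝ) : ℂ) * Z i, q (Sum.inr ())) := by
    intro j q hq
    have hre : ∀ i, |q (Sum.inl (Sum.inl i)) - ρ j ^ W i * (Z₀ i).re| < ρ j ^ W i * r := fun i => by
      have h1 : q (Sum.inl (Sum.inl i)) ∈ Set.Ioo _ _ := hq (Sum.inl (Sum.inl i)) trivial
      rw [abs_lt]
      have h2 : ρ j ^ W i * (Z₀ i).re - ρ j ^ W i * r < q (Sum.inl (Sum.inl i)) := h1.1
      have h3 : q (Sum.inl (Sum.inl i)) < ρ j ^ W i * (Z₀ i).re + ρ j ^ W i * r := h1.2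
      constructor <;> linarith
    have him : ∀ i, |q (Sum.inl (Sum.inr i)) - ρ j ^ W i * (Z₀ i).im| < ρ j ^ W i * r := fun i => by
      have h1 : q (Sum.inl (Sum.inr i)) ∈ Set.Ioo _ _ := hq (Sum.inl (Sum.inr i)) trivial
      rw [abs_lt]
      have h2 : ρ j ^ W i * (Z₀ i).im - ρ j ^ W i * r < q (Sum.inl (Sum.inr i)) := h1.1
      have h3 : q (Sum.inl (Sum.inr i)) < ρ j ^ W i * (Z₀ i).im + ρ j ^ W i * r := h1.2
      constructor <;> linarith
    have hth : q (Sum.inr ()) ∈ Set.Ioo (0 - ε) (0 + ε) := hq (Sum.inr ()) trivial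
    let Z : ι → ℂ := fun i => ⟨(ρ j ^ W i)⁻¹ * q (Sum.inl (Sum.inl i)),
      (ρ j ^ W i)⁻¹ * q (Sum.inl (Sum.inr i))⟩
    have hZZ : ∀ i, ‖Z i - Z₀ i‖ < 2 * r := by
      intro i
      refine (Complex.norm_le_abs_re_add_abs_im _).trans_lt ?_
      have aux : ∀ a b : ℝ, |a - ρ j ^ W i * b| < ρ j ^ W i * r → |(ρ j ^ W i)⁻¹ * a - b| < r := by
        intro a b hab
        have h1 : (ρ j ^ W i)⁻¹ * a - b = (ρ j ^ W i)⁻¹ * (a - ρ j ^ W i * b) := by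
          field_simp [(hrp j i).ne']
        rw [h1, abs_mul, abs_of_pos (inv_pos.2 (hrp j i)), inv_mul_lt_iff₀ (hrp j i)]
        exact hab
      have h1 := aux _ _ (hre i)
      have h2 := aux _ _ (him i)
      change |(ρ j ^ W i)⁻¹ * q (Sum.inl (Sum.inl i)) - (Z₀ i).re| +
        |(ρ j ^ W i)⁻¹ * q (Sum.inl (Sum.inr i)) - (Z₀ i).im| < _
      linarith
    refine ⟨Z, ?_, hZZ i₀, abs_lt.2 ⟨by linarith [hth.1], by linarith [hth.2]⟩, ?_⟩
    · rw [Metric.mem_ball, dist_pi_lt_iff hr₀]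
      intro i
      rw [Complex.dist_eq]
      exact (hZZ i).trans hr1
    · ext s
      rcases s with (i | i) | i
      · change _ = (((ρ j ^ W i : ℝ) : ℂ) * Z i).re
        rw [Complex.re_ofReal_mul]
        exact (mul_inv_cancel_left₀ (hrp j i).ne' _).symm
      · change _ = (((ρ j ^ W i : ℝ) : ℂ) * Z i).im
        rw [Complex.im_ofReal_mul]
        exact (mul_inv_cancel_left₀ (hrp j i).ne' _).symm
      · rfl
  have hnormZ : ∀ j, ∀ q ∈ b j, ‖Z₀ i₀‖ / 2 * ρ j ^ W i₀ <
      ‖(⟨q (Sum.inl (Sum.inl i₀)), q (Sum.inl (Sum.inr i₀))⟩ : ℂ)‖ ∧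
      ‖(⟨q (Sum.inl (Sum.inl i₀)), q (Sum.inl (Sum.inr i₀))⟩ : ℂ)‖ <
        3 / 2 * ‖Z₀ i₀‖ * ρ j ^ W i₀ := by
    intro j q hq
    obtain ⟨Z, -, h1, -, h2⟩ := hbox j q hq
    have h3 : (⟨q (Sum.inl (Sum.inl i₀)), q (Sum.inl (Sum.inr i₀))⟩ : ℂ)
        = ((ρ j ^ W i₀ : ℝ) : ℂ) * Z i₀ := by
      rw [h2]; rfl
    rw [h3, norm_mul, Complex.norm_real, Real.norm_of_nonneg (hrp j i₀).le]
    have h4 : ‖Z₀ i₀‖ - ‖Z i₀‖ ≤ ‖Z i₀ - Z₀ i₀‖ := by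
      rw [norm_sub_rev]; exact norm_sub_norm_le _ _
    have h5 : ‖Z i₀‖ - ‖Z₀ i₀‖ ≤ ‖Z i₀ - Z₀ i₀‖ := norm_sub_norm_le _ _
    have h6 := hrp j i₀
    constructor
    · rw [mul_comm]; exact mul_lt_mul_of_pos_left (by linarith) h6
    · rw [mul_comm]; exact mul_lt_mul_of_pos_right (by linarith) h6
  have hdlt : ∀ i j, i < j → Disjoint (b i) (b j) := by
    intro i j hij
    rw [Set.disjoint_left]
    intro q hi hj
    have h1 := (hnormZ i q hi).1
    have h2 := (hnormZ j q hj).2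
    have h3 : ρ j ^ W i₀ ≤ 1 / 4 * ρ i ^ W i₀ := by
      rw [hρW, hρW]
      have : (1 / 4 : ℝ) ^ j ≤ (1 / 4) ^ (i + 1) :=
        pow_le_pow_of_le_one (by norm_num) (by norm_num) hij
      have h0 : 0 < (ρ₀ / 2) ^ W i₀ := Real.rpow_pos_of_pos (by linarith [hρ₀]) _
      rw [pow_succ] at this
      nlinarith
    have h4 : 3 / 2 * ‖Z₀ i₀‖ * ρ j ^ W i₀ ≤ 3 / 2 * ‖Z₀ i₀‖ * (1 / 4 * ρ i ^ W i₀) :=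
      mul_le_mul_of_nonneg_left h3 (by positivity)
    have h5 : 0 < ‖Z₀ i₀‖ * ρ i ^ W i₀ := mul_pos hZn (hrp i i₀)
    linarith
  have hdisj : Pairwise (Function.onFun Disjoint b) := by
    intro i j hij
    rcases lt_or_gt_of_ne hij with h | h
    · exact hdlt i j h
    · exact (hdlt j i h).symm
  -- Each weight is counted twice, for the real and the imaginary part; the factor `2 * ε` belongs
  -- to the unscaled phase coordinate.
  have hprod : ∀ j, ∏ s, (2 * len j s) = (2 * r) ^ 8 * (2 * ε) * ρ j ^ (2 * ∑ i, W i) := by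
    intro j
    rw [Fintype.prod_sum_type, Fintype.prod_sum_type]
    simp only [len, Sum.elim_inl, Sum.elim_inr, Finset.prod_const, Finset.card_univ,
      Fintype.card_unit, pow_one]
    have h1 : ∏ i, 2 * (ρ j ^ W i * r) = (2 * r) ^ 4 * ρ j ^ ∑ i, W i := by
      rw [Real.rpow_sum_of_pos (hρ0 j), ← hι, ← Finset.card_univ, ← Finset.prod_const,
        ← Finset.prod_mul_distrib]
      exact Finset.prod_congr rfl fun i _ => by ring
    rw [h1, two_mul (∑ i, W i), Real.rpow_add (hρ0 j)]
    ring
  have hvol : ∀ j, MeasureTheory.volume (b j) =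
      ENNReal.ofReal ((2 * r) ^ 8 * (2 * ε) * ρ j ^ (2 * ∑ i, W i)) := by
    intro j
    rw [← hprod j, ENNReal.ofReal_prod_of_nonneg]
    · rw [Real.volume_pi_Ioo]
      exact Finset.prod_congr rfl fun s _ => by congr 1; ring
    · rintro ((i | i) | i) -
      · exact mul_nonneg two_pos.le (mul_nonneg (hrp j i).le hr0.le)
      · exact mul_nonneg two_pos.le (mul_nonneg (hrp j i).le hr0.le)
      · exact mul_nonneg two_pos.le hε.le
  have hG' := lipschitzWith_realCoord.comp_lipschitzOnWith hG
  -- The curvature is homogeneous of degree -10, so passing from `Φ y` to the unit sphere multiplies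
  -- it by `‖Φ y‖ ^ 10`.
  set c' : ℝ := (‖x‖ / 2) ^ 10 * c with hc'
  have hc'0 : 0 < c' := by positivity
  have hrS : ∀ j, 0 < ρ j ^ (2 * ∑ i, W i) := fun j => Real.rpow_pos_of_pos (hρ0 j) _
  refine lintegral_eq_top_of_lipschitzOnWith (n := 9) (by simp [hι])
    (measurableSet_regLink F) hNo (measurable_curvature hB).ennreal_ofReal hG' (b := b)
    (fun j => isOpen_set_pi Set.finite_univ fun s _ => isOpen_Ioo) hdisj
    (θ := fun j => ENNReal.ofReal (c' * (ρ j ^ (2 * ∑ i, W i))⁻¹)) ?_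
    (c := ENNReal.ofReal (c' * ((2 * r) ^ 8 * (2 * ε)))) ?_ ?_
  · intro j q hq
    obtain ⟨Z, hZb, -, hth, hqe⟩ := hbox j q hq
    obtain ⟨t, ht, hF, hg, hk⟩ := hab (hpa ⟨hρ0 j, hρ1 j⟩) (hpb Z hZb)
    set y : (ι → ℂ) × ℂ := (fun i => ((ρ j ^ W i : ℝ) : ℂ) * Z i, t) with hy
    obtain ⟨hlow, l, hl, hlN, hlG⟩ := hchart y (q (Sum.inr ())) ht hth
    have hΦn : 0 < ‖Φ y‖ := by linarith
    have hl0 : l ≠ 0 := by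
      rw [← norm_pos_iff, hl]; exact inv_pos.2 hΦn
    refine ⟨l • Φ y, ⟨hlN, ?_, ?_, ?_⟩, ?_, ?_⟩
    · rw [norm_smul, hl, inv_mul_cancel₀ hΦn.ne']
    · rw [evalAt_smul hB, hF, mul_zero]
    · obtain ⟨i, hi⟩ := hg
      exact ⟨i, by rw [partialAt_smul hB]; exact mul_ne_zero (pow_ne_zero 2 hl0) hi⟩
    · rw [Function.comp_apply, hlG, hqe]
      rfl
    · refine ENNReal.ofReal_le_ofReal ?_
      rw [curvature_smul hB hl0, hl, inv_inv, hc', mul_assoc]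
      refine mul_le_mul (pow_le_pow_left₀ (by positivity) hlow 10) ?_ ?_ (by positivity)
      · rw [mul_inv_le_iff₀ (hrS j), mul_comm]
        exact hk
      · exact mul_nonneg hc.le (inv_nonneg.2 (hrS j).le)
  · rw [Ne, ENNReal.ofReal_eq_zero, not_le]
    positivity
  · intro j
    rw [hvol, ← ENNReal.ofReal_mul (by have := (hrS j).le; positivity)]
    refine ENNReal.ofReal_le_ofReal (le_of_eq ?_)
    have := (hrS j).ne'
    field_simp

end CubicFourfold

/-! ### Divergence from a weighted scaling of affine coordinates -/

namespace CubicFourfold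

/-- A simple root depends continuously on parameters. -/
theorem exists_continuousAt_root {X : Type*} [NormedAddCommGroup X] [NormedSpace ℝ X]
    [CompleteSpace X] {P : X × ℂ → ℂ} {q₀ : X} {T₀ D : ℂ} (hP : ContDiffAt ℝ 1 P (q₀, T₀))
    (hP0 : P (q₀, T₀) = 0) (hPT : HasDerivAt (fun T => P (q₀, T)) D T₀) (hD : D ≠ 0) :
    ∃ T : X → ℂ, Filter.Tendsto T (𝓝 q₀) (𝓝 T₀) ∧ ∀ᶠ q in 𝓝 q₀, P (q, T q) = 0 := by
  have hs := hP.hasStrictFDerivAt one_ne_zero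
  set P' := fderiv ℝ P (q₀, T₀) with hP'
  have h1 : HasFDerivAt (fun T => P (q₀, T)) (P' ∘L .inr ℝ X ℂ) T₀ :=
    HasFDerivAt.comp T₀ (show HasFDerivAt P P' (q₀, T₀) from hs.hasFDerivAt)
      (hasFDerivAt_prodMk_right q₀ T₀)
  -- The parameters include the real number `ρ`, so the implicit function theorem is used over `ℝ`;
  -- the partial derivative in `T` is multiplication by `D`, which is invertible.
  have h2 : P' ∘L .inr ℝ X ℂ =
      (ContinuousLinearEquiv.smulLeft (R₁ := ℝ) (Units.mk0 D hD) : ℂ ≃L[ℝ] ℂ) := by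
    rw [h1.unique (hPT.hasFDerivAt.restrictScalars ℝ)]
    ext; simp [mul_comm]
  have hinv : (P' ∘L .inr ℝ X ℂ).IsInvertible := ⟨_, h2.symm⟩
  refine ⟨hs.implicitFunctionOfProdDomain hinv, hs.tendsto_implicitFunctionOfProdDomain hinv, ?_⟩
  filter_upwards [hs.eventually_apply_implicitFunctionOfProdDomain hinv] with q hq
  rw [hq, hP0]

variable {F : MvPolynomial (Fin 6) ℂ} {B : V → V → V → ℂ}

/-- Vectors complementary to a line, together with that line, span the space. -/
theorem exists_coeff_of_independent {ι : Type*} [Fintype ι] (hι : Fintype.card ι = 4) {x : V}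
    (hx : x ≠ 0) {b : ι → V} {bt : V}
    (hli : ∀ (z : ι → ℂ) (t c : ℂ), ∑ i, z i • b i + t • bt = c • x → z = 0 ∧ t = 0) (v : V) :
    ∃ (z : ι → ℂ) (t c : ℂ), v = ∑ i, z i • b i + t • bt + c • x := by
  let f : ((ι → ℂ) × ℂ) × ℂ →ₗ[ℂ] V :=
    ((Fintype.linearCombination ℂ b).comp (LinearMap.fst ℂ _ _) +
      (LinearMap.toSpanSingleton ℂ V bt).comp (LinearMap.snd ℂ (ι → ℂ) ℂ)).comp (LinearMap.fst ℂ _ _)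
      + (LinearMap.toSpanSingleton ℂ V x).comp (LinearMap.snd ℂ ((ι → ℂ) × ℂ) ℂ)
  have hf : ∀ z t c, f ((z, t), c) = ∑ i, z i • b i + t • bt + c • x := fun z t c => by
    simp [f, Fintype.linearCombination_apply]
  have hinj : Function.Injective f := by
    rw [injective_iff_map_eq_zero]
    rintro ⟨⟨z, t⟩, c⟩ h
    rw [hf] at h
    have h1 : ∑ i, z i • b i + t • bt = (-c) • x := by
      rw [neg_smul]; exact eq_neg_of_add_eq_zero_left h
    obtain ⟨hz, ht⟩ := hli _ _ _ h1
    subst hz ht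
    have hc : c = 0 := by simpa [hx] using h
    rw [hc]; rfl
  have hfin : Module.finrank ℂ (((ι → ℂ) × ℂ) × ℂ) = Module.finrank ℂ V := by simp [hι]
  obtain ⟨⟨⟨z, t⟩, c⟩, h⟩ := (LinearMap.injective_iff_surjective_of_finrank_eq_finrank hfin).1 hinj v
  exact ⟨z, t, c, by rw [← h, hf]⟩

/-- Divergence of the integral of the curvature from a weighted homogeneous scaling of affine
coordinates, after which the equation, its gradient and its Hessian have nonzero limits. -/
theorem lintegral_curvature_of_scaling (hB : IsPolarization F B) {ι : Type*} [Fintype ι]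
    (hι : Fintype.card ι = 4) {x : V} (hx : x ≠ 0) {b : ι → V} {bt : V}
    (hli : ∀ (z : ι → ℂ) (t c : ℂ), ∑ i, z i • b i + t • bt = c • x → z = 0 ∧ t = 0)
    (W : ι → ℕ) {a m : ℕ} (hW : ∑ i, W i + m ≤ 3 * a) {Z₀ : ι → ℂ} {T₀ : ℂ}
    (hZ : ∃ i, W i ≠ 0 ∧ Z₀ i ≠ 0) (hZ0 : ∀ i, W i = 0 → Z₀ i = 0)
    {τ : (ℝ × (ι → ℂ)) × ℂ → ℂ} (hτ : ContinuousAt τ ((0, Z₀), T₀)) (hτ0 : τ ((0, Z₀), T₀) = 0)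
    {pt : (ℝ × (ι → ℂ)) × ℂ → V}
    (hpt : ∀ y, pt y = x + (∑ i, ((y.1.1 : ℂ) ^ W i * y.1.2 i) • b i + τ y • bt))
    {P : (ℝ × (ι → ℂ)) × ℂ → ℂ} (hP : ContDiffAt ℝ 1 P ((0, Z₀), T₀)) (hP0 : P ((0, Z₀), T₀) = 0)
    {D : ℂ} (hPT : HasDerivAt (fun T => P ((0, Z₀), T)) D T₀) (hD : D ≠ 0)
    (hF : ∀ y, P y = 0 → B (pt y) (pt y) (pt y) = 0)
    {g : ι → (ℝ × (ι → ℂ)) × ℂ → ℂ} (hg : ∀ i, ContinuousAt (g i) ((0, Z₀), T₀))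
    (hgB : ∀ i y, P y = 0 → B (pt y) (pt y) (b i) = (y.1.1 : ℂ) ^ a * g i y)
    {gt : (ℝ × (ι → ℂ)) × ℂ → ℂ} (hgt : ContinuousAt gt ((0, Z₀), T₀))
    (hgtB : ∀ y, P y = 0 → B (pt y) (pt y) bt = (y.1.1 : ℂ) ^ a * gt y) (hgt0 : gt ((0, Z₀), T₀) ≠ 0)
    (j k : ι) {K : (ℝ × (ι → ℂ)) × ℂ → ℂ} (hK : ContinuousAt K ((0, Z₀), T₀))
    (hK0 : K ((0, Z₀), T₀) ≠ 0)
    (hKB : ∀ y, P y = 0 → (y.1.1 : ℂ) ^ m * K y = gt y ^ 2 * B (pt y) (b j) (b k)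
      - gt y * g k y * B (pt y) (b j) bt - gt y * g j y * B (pt y) bt (b k)
      + g j y * g k y * B (pt y) bt bt) :
    ∫⁻ x in regLink F, ENNReal.ofReal (curvature F B x)
      ∂(MeasureTheory.Measure.hausdorffMeasure 9) = ∞ := by
  classical
  set y₀ : (ℝ × (ι → ℂ)) × ℂ := ((0, Z₀), T₀) with hy₀
  let A : (ι → ℂ) × ℂ →ₗ[ℂ] V := (Fintype.linearCombination ℂ b).comp (LinearMap.fst ℂ _ _) +
      (LinearMap.toSpanSingleton ℂ V bt).comp (LinearMap.snd ℂ (ι → ℂ) ℂ)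
  have hA : ∀ z t, A (z, t) = ∑ i, z i • b i + t • bt := fun z t => by
    simp [A, Fintype.linearCombination_apply]
  let A' : (ι → ℂ) × ℂ →L[ℂ] V := LinearMap.toContinuousLinearMap A
  have hd : HasStrictFDerivAt (fun y => x + A' y) A' 0 :=
    (A'.hasStrictFDerivAt).const_add x
  obtain ⟨T, hT, hroot⟩ := exists_continuousAt_root hP hP0 hPT hD
  have hY : Filter.Tendsto (fun q : ℝ × (ι → ℂ) => (q, T q)) (𝓝 (0, Z₀)) (𝓝 y₀) := by
    exact Filter.Tendsto.prodMk_nhds Filter.tendsto_id hT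
  -- the gradient
  choose cz ct cx hc using fun i : Fin 6 =>
    exists_coeff_of_independent hι hx hli (EuclideanSpace.single i (1 : ℂ))
  let S : Fin 6 → (ℝ × (ι → ℂ)) × ℂ → ℂ := fun l y => ∑ i, cz l i * g i y + ct l * gt y +
    cx l * (-(∑ i, ((y.1.1 : ℂ) ^ W i * y.1.2 i) * g i y + τ y * gt y))
  have hS : ∀ y, P y = 0 → ∀ l, partialAt F l (pt y) =
      3 * ((y.1.1 : ℂ) ^ a * S l y) := by
    intro y hy l
    -- The derivative in the direction of `x` is found from those along `b` and `bt` by the Euler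
    -- relation `B (pt y) (pt y) (pt y) = 0`.
    have h1 : B (pt y) (pt y) x = (y.1.1 : ℂ) ^ a *
        (-(∑ i, ((y.1.1 : ℂ) ^ W i * y.1.2 i) * g i y + τ y * gt y)) := by
      have h2 : B (pt y) (pt y) (pt y) = B (pt y) (pt y) (x +
        (∑ i, ((y.1.1 : ℂ) ^ W i * y.1.2 i) • b i + τ y • bt)) := congrArg _ (hpt y)
      rw [hF y hy, hB.add_right, hB.add_right, hB.sum_right, hB.smul_right, hgtB y hy] at h2
      simp only [hB.smul_right, hgB _ y hy] at h2
      have h3 : ∀ i, (y.1.1 : ℂ) ^ W i * y.1.2 i * ((y.1.1 : ℂ) ^ a * g i y)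
        = (y.1.1 : ℂ) ^ a * ((y.1.1 : ℂ) ^ W i * y.1.2 i * g i y) := fun i => by ring
      simp only [h3, ← Finset.mul_sum] at h2
      linear_combination -h2
    have h4 : ∑ i, cz l i * ((y.1.1 : ℂ) ^ a * g i y) = (y.1.1 : ℂ) ^ a * ∑ i, cz l i * g i y := by
      rw [Finset.mul_sum]; exact Finset.sum_congr rfl fun i _ => by ring
    rw [hB.partial_eq, hc l, hB.add_right, hB.add_right, hB.sum_right, hB.smul_right, hB.smul_right,
      hgtB y hy, h1]
    simp only [hB.smul_right, hgB _ y hy, S, h4]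
    ring
  have hSc : ∀ l, ContinuousAt (S l) y₀ := by
    intro l
    have h1 : ∀ i, ContinuousAt (fun y : (ℝ × (ι → ℂ)) × ℂ => (y.1.1 : ℂ) ^ W i * y.1.2 i) y₀ :=
      fun i => Continuous.continuousAt (by fun_prop)
    exact ((tendsto_finsetSum _ fun i _ => (hg i).const_mul (cz l i)).add (hgt.const_mul _)).add
      (((tendsto_finsetSum _ fun i _ => (h1 i).mul (hg i)).add (hτ.mul hgt)).neg.const_mul _)
  let s : (ℝ × (ι → ℂ)) × ℂ → ℝ := fun y => ∑ l, 9 * ‖S l y‖ ^ 2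
  have hsc : ContinuousAt s y₀ :=
    tendsto_finsetSum _ fun l _ => ((hSc l).norm.pow 2).const_mul 9
  have hsg : ∀ y, 0 ≤ y.1.1 → P y = 0 →
      gradSq F (pt y) = (y.1.1 ^ a) ^ 2 * s y := by
    intro y hy0 hy
    simp only [gradSq, s, Finset.mul_sum]
    refine Finset.sum_congr rfl fun l _ => ?_
    rw [hS y hy, norm_mul, norm_mul, norm_pow, Complex.norm_real, Real.norm_of_nonneg hy0]
    norm_num
    ring
  -- tangent vectors
  let v : ι → (ℝ × (ι → ℂ)) × ℂ → V := fun i y => b i - (g i y / gt y) • bt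
  have hvc : ∀ i, ContinuousAt (v i) y₀ := fun i =>
    continuousAt_const.sub (((hg i).div hgt hgt0).smul continuousAt_const)
  have hvB : ∀ i y, P y = 0 → gt y ≠ 0 → B (pt y) (pt y) (v i y) = 0 := by
    intro i y hP hy
    simp only [v]
    rw [sub_eq_add_neg, ← neg_smul, hB.add_right, hB.smul_right, hgB i y hP, hgtB y hP]
    field_simp
    ring
  have hvK : ∀ y, P y = 0 → gt y ≠ 0 → B (pt y) (v j y) (v k y) = (y.1.1 : ℂ) ^ m * (K y / gt y ^ 2) := by
    intro y hP hy
    rw [← mul_div_assoc, hKB y hP]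
    simp only [v]
    rw [sub_eq_add_neg, sub_eq_add_neg, ← neg_smul, ← neg_smul, hB.add_mid, hB.add_right,
      hB.add_right, hB.smul_mid, hB.smul_right, hB.smul_right]
    rw [hB.smul_mid]
    field_simp
    ring
  have hκc : ContinuousAt (fun y => ‖K y / gt y ^ 2‖) y₀ :=
    (hK.div (hgt.pow 2) (pow_ne_zero 2 hgt0)).norm
  have hκ0 : 0 < ‖K y₀ / gt y₀ ^ 2‖ := norm_pos_iff.2 (div_ne_zero hK0 (pow_ne_zero 2 hgt0))
  set η := ‖K y₀ / gt y₀ ^ 2‖ / 2 with hη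
  have hη0 : 0 < η := half_pos hκ0
  set M := s y₀ + 1 with hM
  have hM0 : 0 < M := add_pos_of_nonneg_of_pos (Finset.sum_nonneg fun _ _ => by positivity) one_pos
  set N := ‖v j y₀‖ + 1 with hN
  set N' := ‖v k y₀‖ + 1 with hN'
  have hN0 : 0 < N := by positivity
  have hN0' : 0 < N' := by positivity
  have hev : ∀ᶠ y in 𝓝 y₀, gt y ≠ 0 ∧ s y < M ∧ ‖v j y‖ < N ∧ ‖v k y‖ < N' ∧
      η < ‖K y / gt y ^ 2‖ := by
    refine (hgt.eventually_ne hgt0).and (((hsc.eventually (gt_mem_nhds (by simp [hM])))).and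
      (((hvc j).norm.eventually (gt_mem_nhds (by simp [hN]))).and
      (((hvc k).norm.eventually (gt_mem_nhds (by simp [hN']))).and
      (hκc.eventually (lt_mem_nhds (by simp only [hη]; linarith))))))
  refine lintegral_curvature_eq_top hB hι hx hd (by simp) ?_ ?_
  · rintro ⟨z, t⟩ c h
    obtain ⟨hz, ht⟩ := hli z t c (by rw [← hA]; exact h)
    rw [hz, ht]; rfl
  intro ε hε
  have hcoord : Filter.Tendsto (fun y : (ℝ × (ι → ℂ)) × ℂ =>
      ((fun i => (y.1.1 : ℂ) ^ W i * y.1.2 i, τ y) : (ι → ℂ) × ℂ)) (𝓝 y₀) (𝓝 0) := by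
    -- Coordinates of weight zero do not shrink with `ρ`; they are small because `Z₀` vanishes
    -- there.
    have h0 : ((fun i => (y₀.1.1 : ℂ) ^ W i * y₀.1.2 i, τ y₀) : (ι → ℂ) × ℂ) = 0 := by
      rw [hτ0]
      refine Prod.ext (funext fun i => ?_) rfl
      by_cases hi : W i = 0
      · simp [hy₀, hi, hZ0 i hi]
      · simp [hy₀, hi]
    rw [← h0]
    exact ContinuousAt.prodMk (f := fun y : (ℝ × (ι → ℂ)) × ℂ =>
      (fun i => (y.1.1 : ℂ) ^ W i * y.1.2 i)) (Continuous.continuousAt (by fun_prop)) hτ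
  have hsmall : ∀ᶠ y : (ℝ × (ι → ℂ)) × ℂ in 𝓝 y₀,
      ‖((fun i => (y.1.1 : ℂ) ^ W i * y.1.2 i, τ y) : (ι → ℂ) × ℂ)‖ < ε := by
    have := hcoord.norm.eventually (gt_mem_nhds (show ‖(0 : (ι → ℂ) × ℂ)‖ < ε by simpa using hε))
    exact this
  obtain ⟨i₀, hi₀, hZi₀⟩ := hZ
  refine ⟨fun i => (W i : ℝ), Z₀, η ^ 2 / (M ^ 3 * N ^ 2 * N' ^ 2),
    ⟨i₀, Nat.cast_pos.2 (Nat.pos_of_ne_zero hi₀), hZi₀⟩, by positivity, ?_⟩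
  have hle : 𝓝[>] (0 : ℝ) ×ˢ 𝓝 Z₀ ≤ 𝓝 (0, Z₀) := by
    rw [nhds_prod_eq]; exact Filter.prod_mono nhdsWithin_le_nhds le_rfl
  have hpos : ∀ᶠ q : ℝ × (ι → ℂ) in 𝓝[>] 0 ×ˢ 𝓝 Z₀, 0 < q.1 ∧ q.1 < 1 := by
    have h1 : ∀ᶠ ρ : ℝ in 𝓝[>] 0, 0 < ρ ∧ ρ < 1 := Ioo_mem_nhdsGT one_pos
    exact Filter.tendsto_fst.eventually h1
  filter_upwards [hpos, hle hroot, hle (hY.eventually hev), hle (hY.eventually hsmall)]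
    with q ⟨hq0, hq1⟩ hq hqe hqs
  change P (q, T q) = 0 at hq
  obtain ⟨h1, h2, h3, h4, h5⟩ : gt (q, T q) ≠ 0 ∧ s (q, T q) < M ∧ ‖v j (q, T q)‖ < N ∧
    ‖v k (q, T q)‖ < N' ∧ η < ‖K (q, T q) / gt (q, T q) ^ 2‖ := hqe
  set y := (q, T q) with hy
  have hpow : ∀ i, ((q.1 ^ (W i : ℝ) : ℝ) : ℂ) = (q.1 : ℂ) ^ W i := fun i => by
    rw [Real.rpow_natCast]; push_cast; rfl
  simp only [hpow]
  have hΦ : x + A' (fun i => (q.1 : ℂ) ^ W i * q.2 i, τ y) = pt y := by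
    change x + A _ = _
    rw [hA, hpt]
  have hpt0 : B (pt y) (pt y) (pt y) = 0 := hF y hq
  have hg0 : ∃ i, partialAt F i (pt y) ≠ 0 := by
    by_contra! hcon
    have h6 := hB.eq_sum_partial (pt y) bt
    simp only [hcon, zero_mul, Finset.sum_const_zero, hgtB y hq] at h6
    have hρ : (y.1.1 : ℂ) ≠ 0 := by exact_mod_cast hq0.ne'
    have := pow_ne_zero a hρ
    simp [h1] at h6
    exact hρ (by exact_mod_cast h6.1)
  refine ⟨τ y, hqs, ?_, ?_, ?_⟩
  · rw [hΦ, hB.eval_eq, hpt0]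
  · rw [hΦ]; exact hg0
  rw [hΦ]
  have hks := sq_le_curvature hB (gradSq_ne_zero hg0) (hvB j y hq h1) (hvB k y hq h1)
  set k' := curvature F B (pt y) with hk'
  have hk0 : 0 ≤ k' := curvature_nonneg _
  have hs0 : 0 ≤ s y := Finset.sum_nonneg fun _ _ => by positivity
  rw [hvK y hq h1, hsg y hq0.le hq, norm_mul, norm_pow, Complex.norm_real,
    Real.norm_of_nonneg hq0.le] at hks
  have hρ : 0 < q.1 ^ m := pow_pos hq0 m
  -- The Hessian value is at least `ρ ^ m * η` and `gradSq` at most `ρ ^ (2a) * M`, so the curvature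
  -- is at least of order `ρ ^ (2m - 6a)`. As `ρ < 1`, the inequality `∑ W + m ≤ 3a` turns this into
  -- the reciprocal of the order `ρ ^ (2 ∑ W)` of the volume.
  have hchain : (q.1 ^ m * η) ^ 2 ≤
      (q.1 ^ m) ^ 2 * ((q.1 ^ (2 * ∑ i, W i)) * (M ^ 3 * N ^ 2 * N' ^ 2 * k')) := by
    calc (q.1 ^ m * η) ^ 2 ≤ (q.1 ^ m * ‖K y / gt y ^ 2‖) ^ 2 := by gcongr
      _ ≤ ((q.1 ^ a) ^ 2 * s y) ^ 3 * ‖v j y‖ ^ 2 * ‖v k y‖ ^ 2 * k' := hks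
      _ ≤ ((q.1 ^ a) ^ 2 * M) ^ 3 * N ^ 2 * N' ^ 2 * k' := by gcongr
      _ = q.1 ^ (2 * (3 * a)) * (M ^ 3 * N ^ 2 * N' ^ 2 * k') := by ring
      _ ≤ q.1 ^ (2 * (∑ i, W i + m)) * (M ^ 3 * N ^ 2 * N' ^ 2 * k') := by
          refine mul_le_mul_of_nonneg_right ?_ (by positivity)
          exact pow_le_pow_of_le_one hq0.le hq1.le (by omega)
      _ = _ := by ring
  have hexp : q.1 ^ (2 * ∑ i, (W i : ℝ)) = q.1 ^ (2 * ∑ i, W i) := by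
    rw [← Real.rpow_natCast]; push_cast; rfl
  rw [hexp, div_le_iff₀ (by positivity)]
  rw [mul_pow] at hchain
  refine (le_of_mul_le_mul_left hchain (by positivity)).trans (le_of_eq ?_)
  ring

end CubicFourfold

/-! ### Calculus with the polarization, and bases adapted to the Hessian at a singular point -/

namespace CubicFourfold

variable {F : MvPolynomial (Fin 6) ℂ} {B : V → V → V → ℂ}

namespace IsPolarization

theorem apply_eq_sum (hB : IsPolarization F B) (u v w : V) :
    B u v w = ∑ i, ∑ j, ∑ k, u i * v j * w k *
      B (EuclideanSpace.single i 1) (EuclideanSpace.single j 1) (EuclideanSpace.single k 1) := by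
  conv_lhs => rw [coord_sum u, coord_sum v, coord_sum w]
  simp only [hB.sum_left, hB.sum_mid, hB.sum_right, hB.smul_left, hB.smul_mid, hB.smul_right]
  refine Finset.sum_congr rfl fun i _ => Finset.sum_congr rfl fun j _ =>
    Finset.sum_congr rfl fun k _ => by ring

theorem contDiff_comp (hB : IsPolarization F B) {X : Type*} [NormedAddCommGroup X] [NormedSpace ℝ X]
    {n : WithTop ℕ∞} {f g h : X → V} (hf : ContDiff ℝ n f) (hg : ContDiff ℝ n g)
    (hh : ContDiff ℝ n h) : ContDiff ℝ n fun y => B (f y) (g y) (h y) := by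
  have hc : ∀ {f : X → V}, ContDiff ℝ n f → ∀ i, ContDiff ℝ n fun y => f y i := fun hf i =>
    ((EuclideanSpace.proj i : V →L[ℂ] ℂ).restrictScalars ℝ).contDiff.comp hf
  have h1 : (fun y => B (f y) (g y) (h y)) = fun y => ∑ i, ∑ j, ∑ k, f y i * g y j * h y k *
      B (EuclideanSpace.single i 1) (EuclideanSpace.single j 1) (EuclideanSpace.single k 1) :=
    funext fun y => hB.apply_eq_sum _ _ _
  rw [h1]
  exact ContDiff.sum fun i _ => ContDiff.sum fun j _ => ContDiff.sum fun k _ =>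
    (((hc hf i).mul (hc hg j)).mul (hc hh k)).mul contDiff_const

theorem hasDerivAt_comp (hB : IsPolarization F B) {f g h : ℂ → V} {f' g' h' : V} {t : ℂ}
    (hf : HasDerivAt f f' t) (hg : HasDerivAt g g' t) (hh : HasDerivAt h h' t) :
    HasDerivAt (fun t => B (f t) (g t) (h t))
      (B f' (g t) (h t) + B (f t) g' (h t) + B (f t) (g t) h') t := by
  have hc : ∀ {f : ℂ → V} {f' : V}, HasDerivAt f f' t → ∀ i, HasDerivAt (fun y => f y i) (f' i) t :=
    fun hf i => (EuclideanSpace.proj i : V →L[ℂ] ℂ).hasFDerivAt.comp_hasDerivAt t hf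
  have h1 : (fun y => B (f y) (g y) (h y)) = fun y => ∑ i, ∑ j, ∑ k, f y i * g y j * h y k *
      B (EuclideanSpace.single i 1) (EuclideanSpace.single j 1) (EuclideanSpace.single k 1) :=
    funext fun y => hB.apply_eq_sum _ _ _
  rw [h1]
  have h2 := HasDerivAt.fun_sum fun i (_ : i ∈ Finset.univ) =>
    HasDerivAt.fun_sum fun j (_ : j ∈ Finset.univ) => HasDerivAt.fun_sum fun k (_ : k ∈ Finset.univ) =>
    (((hc hf i).mul (hc hg j)).mul (hc hh k)).mul_const
      (B (EuclideanSpace.single i 1) (EuclideanSpace.single j 1) (EuclideanSpace.single k 1))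
  refine h2.congr_deriv ?_
  rw [hB.apply_eq_sum f', hB.apply_eq_sum _ g', hB.apply_eq_sum _ _ h']
  simp only [← Finset.sum_add_distrib]
  refine Finset.sum_congr rfl fun i _ => Finset.sum_congr rfl fun j _ =>
    Finset.sum_congr rfl fun k _ => by simp only [Pi.mul_apply]; ring

theorem cube_add (hB : IsPolarization F B) (u v : V) :
    B (u + v) (u + v) (u + v) = B u u u + 3 * B u u v + 3 * B u v v + B v v v := by
  simp only [hB.add_left, hB.add_mid, hB.add_right]
  rw [hB.swap23 u v u, hB.swap12 v u u, hB.swap23 u v u, hB.swap23 v v u, hB.swap12 v u v]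
  ring

theorem sq_add (hB : IsPolarization F B) (u v w : V) :
    B (u + v) (u + v) w = B u u w + 2 * B u v w + B v v w := by
  simp only [hB.add_left, hB.add_mid]
  rw [hB.swap12 v u w]
  ring

/-- Polarization: the cubic form determines the trilinear form on a subspace. -/
theorem eq_zero_of_cube_eq_zero (hB : IsPolarization F B) {S : Submodule ℂ V}
    (h : ∀ v ∈ S, B v v v = 0) {u v w : V} (hu : u ∈ S) (hv : v ∈ S) (hw : w ∈ S) : B u v w = 0 := by
  have h1 : ∀ u ∈ S, ∀ v ∈ S, B u u v = 0 := by
    intro u hu v hv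
    have e1 := hB.cube_add u v
    have e2 := hB.cube_add u ((-1 : ℂ) • v)
    simp only [hB.smul_left, hB.smul_mid, hB.smul_right] at e2
    have e3 := h _ (S.add_mem hu hv)
    have e4 := h _ (S.add_mem hu (S.smul_mem (-1) hv))
    rw [h u hu, h v hv, e3] at e1
    rw [h u hu, h v hv, e4] at e2
    linear_combination (-e1 + e2) / 6
  have e := hB.sq_add u v w
  rw [h1 _ (S.add_mem hu hv) w hw, h1 u hu w hw, h1 v hv w hw] at e
  linear_combination (-e) / 2

end IsPolarization

/-- Either an orthonormal family for the quadratic form `B x · ·` can be extended, or its orthogonal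
complement is the radical. -/
theorem exists_adapted_basis (hB : IsPolarization F B) {x : V} (hx0 : x ≠ 0)
    (hx : ∀ v, B x x v = 0) {κ : Type*} [Fintype κ] [DecidableEq κ] {u : κ → V}
    (hu : ∀ i j, B x (u i) (u j) = if i = j then 1 else 0) {n : ℕ} (hn : n + Fintype.card κ = 5) :
    (∃ v, (∀ i, B x (u i) v = 0) ∧ B x v v = 1) ∨
    ∃ ζ : Fin n → V, (∀ i v, B x (ζ i) v = 0) ∧
      (∀ (z : Fin n → ℂ) (t : κ → ℂ) (c : ℂ), ∑ i, z i • ζ i + ∑ i, t i • u i = c • x →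
        z = 0 ∧ t = 0) ∧
      ∀ v, (∀ i, B x (u i) v = 0) → ∃ (z : Fin n → ℂ) (c : ℂ), v = ∑ i, z i • ζ i + c • x := by
  let f : V →ₗ[ℂ] (κ → ℂ) := LinearMap.pi fun i => (hB.lin x (u i))
  have hf : ∀ v i, f v i = B x (u i) v := fun v i => rfl
  have hfu : ∀ t : κ → ℂ, f (∑ i, t i • u i) = t := by
    intro t
    ext i
    rw [hf, hB.sum_right]
    simp [hB.smul_right, hu]
  have hsurj : LinearMap.range f = ⊤ := LinearMap.range_eq_top.2 fun t => ⟨_, hfu t⟩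
  have hfin := f.finrank_range_add_finrank_ker
  rw [hsurj, finrank_top, Module.finrank_pi, finrank_euclideanSpace, Fintype.card_fin] at hfin
  set O := LinearMap.ker f with hO
  have hmem : ∀ v, v ∈ O ↔ ∀ i, B x (u i) v = 0 := fun v => by
    rw [hO, LinearMap.mem_ker]
    exact ⟨fun h i => by rw [← hf, h]; rfl, fun h => funext h⟩
  -- If the form is not zero on `O`, a complex square root normalizes a vector. Otherwise `O` is
  -- totally isotropic, and is orthogonal to all of `V`, which is spanned by `O` and the `u i`. It
  -- contains `x` and has dimension `n + 1`.
  by_cases hdef : ∃ v ∈ O, B x v v ≠ 0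
  · left
    obtain ⟨v, hv, hvv⟩ := hdef
    obtain ⟨s, hs⟩ := IsAlgClosed.exists_pow_nat_eq (B x v v) two_pos
    have hs0 : s ≠ 0 := by rintro rfl; exact hvv (by rw [← hs]; simp)
    refine ⟨s⁻¹ • v, fun i => ?_, ?_⟩
    · rw [hB.smul_right, (hmem v).1 hv i, mul_zero]
    · rw [hB.smul_right, hB.smul_mid, ← hs]
      field_simp
  · right
    push Not at hdef
    have hOO : ∀ v ∈ O, ∀ w ∈ O, B x v w = 0 := by
      intro v hv w hw
      have e := hdef _ (O.add_mem hv hw)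
      rw [hB.add_mid, hB.add_right, hB.add_right, hdef v hv, hdef w hw, hB.swap23 x w v] at e
      linear_combination e / 2
    have hOV : ∀ v ∈ O, ∀ w, B x v w = 0 := by
      intro v hv w
      have h1 : w - ∑ i, f w i • u i ∈ O := by
        rw [hO, LinearMap.mem_ker, map_sub, hfu, sub_self]
      have h2 := hOO v hv _ h1
      rw [sub_eq_add_neg, ← neg_one_smul ℂ, hB.add_right, hB.smul_right, hB.sum_right] at h2
      have h3 : ∀ i, B x v (f w i • u i) = 0 := fun i => by
        rw [hB.smul_right, hB.swap23, (hmem v).1 hv i, mul_zero]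
      simpa [h3] using h2
    have hxO : x ∈ O := (hmem x).2 fun i => by rw [hB.swap23, hx]
    let x' : O := ⟨x, hxO⟩
    obtain ⟨Z, hZ⟩ := (ℂ ∙ x').exists_isCompl
    have hx' : x' ≠ 0 := fun h => hx0 (congrArg Subtype.val h)
    have hZn : Module.finrank ℂ Z = n := by
      have := Submodule.finrank_add_eq_of_isCompl hZ
      rw [finrank_span_singleton hx'] at this
      omega
    let e := Module.finBasisOfFinrankEq ℂ Z hZn
    have hcoe : ∀ z : Fin n → ℂ, (∑ i, z i • ((e i : O) : V)) = (((∑ i, z i • e i : Z) : O) : V) := by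
      intro z; simp
    refine ⟨fun i => ((e i : O) : V), fun i v => hOV _ (e i : O).2 v, ?_, ?_⟩
    · intro z t c h
      have ht : t = 0 := by
        rw [← hfu t]
        have h1 : f (∑ i, z i • ((e i : O) : V)) = 0 := by
          rw [hcoe]; exact ((∑ i, z i • e i : Z) : O).2
        have h2 := congrArg f h
        rw [map_add, h1, zero_add, map_smul, show f x = 0 from hxO, smul_zero] at h2
        exact h2
      refine ⟨?_, ht⟩
      rw [ht] at h
      simp only [Pi.zero_apply, zero_smul, Finset.sum_const_zero, add_zero] at h
      rw [hcoe] at h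
      have h1 : ((∑ i, z i • e i : Z) : O) = c • x' := Subtype.ext h
      have h2 : ((∑ i, z i • e i : Z) : O) = 0 := by
        have h3 : ((∑ i, z i • e i : Z) : O) ∈ (ℂ ∙ x') ⊓ Z :=
          ⟨Submodule.mem_span_singleton.2 ⟨c, h1.symm⟩, (∑ i, z i • e i : Z).2⟩
        rwa [hZ.inf_eq_bot, Submodule.mem_bot] at h3
      have h3 : (∑ i, z i • e i : Z) = 0 := Subtype.ext h2
      exact funext fun i => Fintype.linearIndependent_iff.1 e.linearIndependent z h3 i
    · intro v hv
      have h1 : (⟨v, (hmem v).2 hv⟩ : O) ∈ (ℂ ∙ x') ⊔ Z := by rw [hZ.sup_eq_top]; trivial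
      obtain ⟨a, ha, w, hw, haw⟩ := Submodule.mem_sup.1 h1
      obtain ⟨c, rfl⟩ := Submodule.mem_span_singleton.1 ha
      refine ⟨fun i => e.repr ⟨w, hw⟩ i, c, ?_⟩
      rw [hcoe, e.sum_repr]
      have := congrArg Subtype.val haw
      rw [add_comm]
      exact this.symm

/-- The hypersurface contains a hyperplane. -/
def ContainsHyperplane (B : V → V → V → ℂ) : Prop :=
  ∃ L : V →ₗ[ℂ] ℂ, L ≠ 0 ∧ ∀ v, L v = 0 → B v v v = 0

end CubicFourfold

/-! ### Hessian of rank two: hyperbolic coordinates and scaling -/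

namespace CubicFourfold

variable {F : MvPolynomial (Fin 6) ℂ} {B : V → V → V → ℂ}

@[fun_prop]
theorem contDiff_ofReal {n : WithTop ℕ∞} : ContDiff ℝ n Complex.ofReal :=
  Complex.ofRealCLM.contDiff

namespace IsPolarization

theorem cube_singular_add (hB : IsPolarization F B) {x : V} (hx : ∀ v, B x x v = 0) (q : V) :
    B (x + q) (x + q) (x + q) = 3 * B x q q + B q q q := by
  rw [hB.cube_add, hx, hx]; ring

theorem sq_singular_add (hB : IsPolarization F B) {x : V} (hx : ∀ v, B x x v = 0) (q w : V) :
    B (x + q) (x + q) w = 2 * B x q w + B q q w := by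
  rw [hB.sq_add, hx]; ring

end IsPolarization

/-- A hyperbolic basis of a complement of the radical of the quadratic form `B x · ·` of rank two. -/
structure RankTwo (B : V → V → V → ℂ) (x : V) (ζ : Fin 3 → V) (p q : V) : Prop where
  ne_zero : x ≠ 0
  singular : ∀ v, B x x v = 0
  radical : ∀ i v, B x (ζ i) v = 0
  pp : B x p p = 0
  qq : B x q q = 0
  pq : B x p q = 1
  indep : ∀ (z : Fin 3 → ℂ) (s t c : ℂ), ∑ i, z i • ζ i + (s • p + t • q) = c • x →
    z = 0 ∧ s = 0 ∧ t = 0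
  span : ∀ v, B x p v = 0 → B x q v = 0 → ∃ (z : Fin 3 → ℂ) (c : ℂ), v = ∑ i, z i • ζ i + c • x

namespace RankTwo

variable {x p q : V} {ζ : Fin 3 → V}

theorem swap (hB : IsPolarization F B) (R : RankTwo B x ζ p q) : RankTwo B x ζ q p :=
  ⟨R.ne_zero, R.singular, R.radical, R.qq, R.pp, by rw [hB.swap23, R.pq], fun z s t c h => by
    have := R.indep z t s c (by rw [← h, add_comm (t • p)])
    exact ⟨this.1, this.2.2, this.2.1⟩, fun v h1 h2 => R.span v h2 h1⟩

theorem apply_radical (hB : IsPolarization F B) (R : RankTwo B x ζ p q) (v : V) (i : Fin 3) :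
    B x v (ζ i) = 0 := by rw [hB.swap23, R.radical]

theorem sum_radical (hB : IsPolarization F B) (R : RankTwo B x ζ p q) (z : Fin 3 → ℂ) (v : V) :
    B x (∑ i, z i • ζ i) v = 0 := by
  rw [hB.sum_mid]
  simp [hB.smul_mid, R.radical]

theorem apply_p (hB : IsPolarization F B) (R : RankTwo B x ζ p q) (z : Fin 3 → ℂ) (s t : ℂ) :
    B x (∑ i, z i • ζ i + (s • p + t • q)) p = t := by
  rw [hB.add_mid, hB.add_mid, hB.smul_mid, hB.smul_mid, R.sum_radical hB, R.pp, hB.swap23, R.pq]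
  ring

theorem apply_q (hB : IsPolarization F B) (R : RankTwo B x ζ p q) (z : Fin 3 → ℂ) (s t : ℂ) :
    B x (∑ i, z i • ζ i + (s • p + t • q)) q = s := by
  rw [hB.add_mid, hB.add_mid, hB.smul_mid, hB.smul_mid, R.sum_radical hB, R.qq, R.pq]
  ring

theorem apply_self (hB : IsPolarization F B) (R : RankTwo B x ζ p q) (z : Fin 3 → ℂ) (s t : ℂ) :
    B x (∑ i, z i • ζ i + (s • p + t • q)) (∑ i, z i • ζ i + (s • p + t • q)) = 2 * s * t := by
  have h : B x (∑ i, z i • ζ i + (s • p + t • q)) (∑ i, z i • ζ i) = 0 := by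
    rw [hB.swap23, R.sum_radical hB]
  conv_lhs => rw [hB.add_right, hB.add_right, hB.smul_right, hB.smul_right, R.apply_p hB,
    R.apply_q hB, h]
  ring

/-- Divergence by scaling at a point of rank two, the scaling being nontrivial in all
directions. -/
theorem lintegral_curvature_of_scaling (hB : IsPolarization F B) (R : RankTwo B x ζ p q)
    {e f a : ℕ} (he : e ≠ 0) (ha : 4 * e + f ≤ 3 * a) {z₀ : Fin 3 → ℂ} {t₀ T₀ : ℂ}
    (hne : z₀ ≠ 0)
    {s : (ℝ × (Option (Fin 3) → ℂ)) × ℂ → ℂ}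
    (hs : ContinuousAt s ((0, fun o => o.elim t₀ z₀), T₀))
    {w : (ℝ × (Option (Fin 3) → ℂ)) × ℂ → V} (hwc : Continuous w)
    (hw : ∀ y, w y = ∑ i, y.1.2 (some i) • ζ i + (s y • p + ((y.1.1 : ℂ) ^ f * y.1.2 none) • q))
    {P : (ℝ × (Option (Fin 3) → ℂ)) × ℂ → ℂ} (hP : ContDiff ℝ 1 P)
    (hP0 : P ((0, fun o => o.elim t₀ z₀), T₀) = 0)
    {D : ℂ} (hPT : HasDerivAt (fun T => P ((0, fun o => o.elim t₀ z₀), T)) D T₀) (hD : D ≠ 0)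
    (hF : ∀ y, P y = 0 → 6 * s y * ((y.1.1 : ℂ) ^ f * y.1.2 none) +
      (y.1.1 : ℂ) ^ e * B (w y) (w y) (w y) = 0)
    {g : Fin 3 → (ℝ × (Option (Fin 3) → ℂ)) × ℂ → ℂ} (hg : ∀ i, Continuous (g i))
    (hgB : ∀ i y, P y = 0 → (y.1.1 : ℂ) ^ (2 * e) * B (w y) (w y) (ζ i) = (y.1.1 : ℂ) ^ a * g i y)
    {gp : (ℝ × (Option (Fin 3) → ℂ)) × ℂ → ℂ} (hgp : Continuous gp)
    (hgpB : ∀ y, P y = 0 → 2 * (y.1.1 : ℂ) ^ e * ((y.1.1 : ℂ) ^ f * y.1.2 none) +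
      (y.1.1 : ℂ) ^ (2 * e) * B (w y) (w y) p = (y.1.1 : ℂ) ^ a * gp y)
    (hgp0 : gp ((0, fun o => o.elim t₀ z₀), T₀) ≠ 0)
    {gq : (ℝ × (Option (Fin 3) → ℂ)) × ℂ → ℂ} (hgq : Continuous gq)
    (hgqB : ∀ y, P y = 0 → 2 * (y.1.1 : ℂ) ^ e * s y +
      (y.1.1 : ℂ) ^ (2 * e) * B (w y) (w y) q = (y.1.1 : ℂ) ^ a * gq y)
    (hgq0 : gq ((0, fun o => o.elim t₀ z₀), T₀) ≠ 0) :
    ∫⁻ x in regLink F, ENNReal.ofReal (curvature F B x)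
      ∂(MeasureTheory.Measure.hausdorffMeasure 9) = ∞ := by
  have hpt2 : ∀ (y : (ℝ × (Option (Fin 3) → ℂ)) × ℂ) u, B (x + (y.1.1 : ℂ) ^ e • w y)
      (x + (y.1.1 : ℂ) ^ e • w y) u = 2 * (y.1.1 : ℂ) ^ e * B x (w y) u +
        (y.1.1 : ℂ) ^ (2 * e) * B (w y) (w y) u := by
    intro y u
    rw [hB.sq_singular_add R.singular, hB.smul_mid, hB.smul_mid, hB.smul_left]
    ring
  have hpt1 : ∀ (y : (ℝ × (Option (Fin 3) → ℂ)) × ℂ) u v, B (x + (y.1.1 : ℂ) ^ e • w y) u v =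
      B x u v + (y.1.1 : ℂ) ^ e * B (w y) u v := by
    intro y u v
    rw [hB.add_left, hB.smul_left]
  obtain ⟨i₀, hi₀⟩ := Function.ne_iff.1 hne
  -- The coordinates are `ρ ^ e z` along the radical, `ρ ^ (e + f) N` along `q`, and `ρ ^ e s` along
  -- `p`, the last being found from the equation. On the tangent vector `q - (gq / gp) p` the
  -- Hessian tends to the value `-2 gq / gp` of the hyperbolic form; hence `m = 0`, and the
  -- condition reads `4e + f ≤ 3a`.
  refine CubicFourfold.lintegral_curvature_of_scaling hB (ι := Option (Fin 3)) (by simp) R.ne_zero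
    (b := fun o => o.elim q ζ) (bt := p) ?_ (fun o => o.elim (e + f) fun _ => e) (a := a) (m := 0)
    ?_ (Z₀ := fun o => o.elim t₀ z₀) (T₀ := T₀) ⟨some i₀, he, hi₀⟩ ?_
    (τ := fun y => (y.1.1 : ℂ) ^ e * s y) ?_ ?_ (pt := fun y => x + (y.1.1 : ℂ) ^ e • w y) ?_
    (P := P) hP.contDiffAt hP0 hPT hD ?_ (g := fun o => o.elim gq g) ?_ ?_ (gt := gp)
    hgp.continuousAt ?_ hgp0 none none
    (K := fun y => gp y ^ 2 * ((y.1.1 : ℂ) ^ e * B (w y) q q) -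
      2 * gp y * gq y * (1 + (y.1.1 : ℂ) ^ e * B (w y) p q) +
      gq y ^ 2 * ((y.1.1 : ℂ) ^ e * B (w y) p p)) ?_ ?_ ?_
  · intro z t c h
    rw [Fintype.sum_option] at h
    obtain ⟨h1, h2, h3⟩ := R.indep (fun i => z (some i)) t (z none) c (by rw [← h]; simp; abel)
    refine ⟨funext fun o => ?_, h2⟩
    cases o with
    | none => exact h3
    | some i => exact congrFun h1 i
  · rw [Fintype.sum_option]
    simp
    omega
  · rintro (_ | i) h
    · exact absurd h (by simp [he])
    · exact absurd h he
  · exact ContinuousAt.mul (Continuous.continuousAt (by fun_prop)) hs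
  · simp [he]
  · intro y
    rw [Fintype.sum_option, hw]
    simp only [Option.elim_none, Option.elim_some, smul_add, Finset.smul_sum, smul_smul, pow_add]
    rw [← mul_assoc]
    abel
  · intro y hy
    have h1 : B x (w y) (w y) = 2 * s y * ((y.1.1 : ℂ) ^ f * y.1.2 none) := by
      rw [hw, R.apply_self hB]
    rw [hpt2, hB.add_right, hB.smul_right, hB.add_right, hB.smul_right, h1, hB.swap23 x, R.singular,
      hB.swap23 (w y), hB.swap12 (w y), hB.swap23 x, h1]
    linear_combination ((y.1.1 : ℂ) ^ (2 * e)) * hF y hy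
  · rintro (_ | i)
    · exact hgq.continuousAt
    · exact (hg i).continuousAt
  · rintro (_ | i) y hy
    · change B _ _ q = _ * gq y
      rw [hpt2, ← hgqB y hy, hw, R.apply_q hB]
    · change B _ _ (ζ i) = _ * g i y
      rw [hpt2, ← hgB i y hy, R.apply_radical hB]
      ring
  · intro y hy
    rw [hpt2, ← hgpB y hy, hw, R.apply_p hB]
  · have h1 : ∀ u v, Continuous fun y => B (w y) u v := fun u v =>
      hB.continuous_comp hwc continuous_const continuous_const
    have hr : Continuous fun y : (ℝ × (Option (Fin 3) → ℂ)) × ℂ => (y.1.1 : ℂ) ^ e := by fun_prop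
    exact ((((hgp.pow 2).mul (hr.mul (h1 q q))).sub (((hgp.const_mul 2).mul hgq).mul
      ((hr.mul (h1 p q)).const_add 1))).add ((hgq.pow 2).mul (hr.mul (h1 p p)))).continuousAt
  · simp [he, hgp0, hgq0]
  · intro y hy
    simp only [Option.elim_none, hpt1, R.qq, R.pp, R.pq, hB.swap23 x q p, hB.swap23 (w y) q p]
    ring

end RankTwo

end CubicFourfold

/-! ### Rank two: quasi-homogeneous leading parts -/

namespace CubicFourfold

variable {F : MvPolynomial (Fin 6) ℂ} {B : V → V → V → ℂ}

namespace RankTwo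

variable {x p q : V} {ζ : Fin 3 → V}

/-- Let `z`, `s`, `t` be the coordinates along the radical, `p` and `q`, and `c(z)` the cubic on the
radical. For weight 2 of `z` and 3 of `s` and `t`, the leading part of the equation is `6st + c(z)`.
The gradient has order 3, and the sum of the weights without `s` is `3 * 2 + 3 = 9`. -/
theorem lintegral_curvature_of_cube_ne_zero (hB : IsPolarization F B) (R : RankTwo B x ζ p q)
    {z₀ : Fin 3 → ℂ} (hc : B (∑ i, z₀ i • ζ i) (∑ i, z₀ i • ζ i) (∑ i, z₀ i • ζ i) ≠ 0) :
    ∫⁻ x in regLink F, ENNReal.ofReal (curvature F B x)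
      ∂(MeasureTheory.Measure.hausdorffMeasure 9) = ∞ := by
  set c₀ := B (∑ i, z₀ i • ζ i) (∑ i, z₀ i • ζ i) (∑ i, z₀ i • ζ i) with hc₀
  let w : (ℝ × (Option (Fin 3) → ℂ)) × ℂ → V := fun y => ∑ i, y.1.2 (some i) • ζ i +
    (((y.1.1 : ℂ) * y.2) • p + ((y.1.1 : ℂ) ^ 1 * y.1.2 none) • q)
  have hw : ContDiff ℝ 1 w := by fun_prop
  have hw0 : ∀ T, w ((0, fun o => o.elim 1 z₀), T) = ∑ i, z₀ i • ζ i := fun T => by simp [w]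
  have hBw : ∀ u, Continuous fun y => B (w y) (w y) u := fun u =>
    hB.continuous_comp hw.continuous hw.continuous continuous_const
  have hρ : Continuous fun y : (ℝ × (Option (Fin 3) → ℂ)) × ℂ => (y.1.1 : ℂ) := by fun_prop
  refine R.lintegral_curvature_of_scaling hB (e := 2) (f := 1) (a := 3) two_ne_zero le_rfl
    (z₀ := z₀) (t₀ := 1) (T₀ := -c₀ / 6) ?_ (s := fun y => (y.1.1 : ℂ) * y.2)
    (Continuous.continuousAt (by fun_prop)) (w := w) hw.continuous (fun y => rfl)
    (P := fun y => 6 * y.2 * y.1.2 none + B (w y) (w y) (w y)) ?_ ?_ (D := 6) ?_ (by norm_num) ?_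
    (g := fun i y => (y.1.1 : ℂ) * B (w y) (w y) (ζ i)) ?_ ?_
    (gp := fun y => 2 * y.1.2 none + (y.1.1 : ℂ) * B (w y) (w y) p) ?_ ?_ ?_
    (gq := fun y => 2 * y.2 + (y.1.1 : ℂ) * B (w y) (w y) q) ?_ ?_ ?_
  · rintro rfl
    exact hc (by simp [hc₀, hB.zero_left])
  · exact ContDiff.add (by fun_prop) (hB.contDiff_comp hw hw hw)
  · simp only [hw0, ← hc₀, Option.elim_none]
    ring
  · simp only [hw0, ← hc₀, Option.elim_none]
    simpa using ((hasDerivAt_id (-c₀ / 6)).const_mul 6).add_const c₀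
  · intro y hy
    linear_combination (y.1.1 : ℂ) ^ 2 * hy
  · exact fun i => hρ.mul (hBw _)
  · intro i y _
    ring
  · exact Continuous.add (by fun_prop) (hρ.mul (hBw _))
  · intro y _
    ring
  · simp
  · exact Continuous.add (by fun_prop) (hρ.mul (hBw _))
  · intro y _
    ring
  · simpa using hc

/-- Without the cubic on the radical, the leading part for weight 1 of `z` and 2 of `s` and `t` is
`6st + 3s B(z,z,p) + 3t B(z,z,q)`. It vanishes for `s = t = 0`, and there its derivatives in `s` and
`t` do not. The gradient has order 2, and the weights without `s` have sum `5 ≤ 6`. -/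
theorem lintegral_curvature_of_sq_ne_zero (hB : IsPolarization F B) (R : RankTwo B x ζ p q)
    (hc : ∀ z : Fin 3 → ℂ, B (∑ i, z i • ζ i) (∑ i, z i • ζ i) (∑ i, z i • ζ i) = 0)
    {z₀ : Fin 3 → ℂ} (hp : B (∑ i, z₀ i • ζ i) (∑ i, z₀ i • ζ i) p ≠ 0)
    (hq : B (∑ i, z₀ i • ζ i) (∑ i, z₀ i • ζ i) q ≠ 0) :
    ∫⁻ x in regLink F, ENNReal.ofReal (curvature F B x)
      ∂(MeasureTheory.Measure.hausdorffMeasure 9) = ∞ := by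
  let u : (ℝ × (Option (Fin 3) → ℂ)) × ℂ → V := fun y => ∑ i, y.1.2 (some i) • ζ i
  let v : (ℝ × (Option (Fin 3) → ℂ)) × ℂ → V := fun y => y.2 • p + y.1.2 none • q
  let w : (ℝ × (Option (Fin 3) → ℂ)) × ℂ → V := fun y => ∑ i, y.1.2 (some i) • ζ i +
    (((y.1.1 : ℂ) * y.2) • p + ((y.1.1 : ℂ) ^ 1 * y.1.2 none) • q)
  have hu : ContDiff ℝ 1 u := by fun_prop
  have hv : ContDiff ℝ 1 v := by fun_prop
  have hw : ContDiff ℝ 1 w := by fun_prop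
  have hwuv : ∀ y, w y = u y + (y.1.1 : ℂ) • v y := fun y => by
    simp only [w, u, v, smul_add, smul_smul, pow_one]
  have hw0 : ∀ T, w ((0, fun o => o.elim 0 z₀), T) = ∑ i, z₀ i • ζ i := fun T => by simp [w]
  have hu0 : ∀ T, u ((0, fun o => o.elim 0 z₀), T) = ∑ i, z₀ i • ζ i := fun T => by simp [u]
  have hBw : ∀ u, Continuous fun y => B (w y) (w y) u := fun u =>
    hB.continuous_comp hw.continuous hw.continuous continuous_const
  have hρ : Continuous fun y : (ℝ × (Option (Fin 3) → ℂ)) × ℂ => (y.1.1 : ℂ) := by fun_prop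
  set A := B (∑ i, z₀ i • ζ i) (∑ i, z₀ i • ζ i) p with hA
  refine R.lintegral_curvature_of_scaling hB (e := 1) (f := 1) (a := 2) one_ne_zero (by norm_num)
    (z₀ := z₀) (t₀ := 0) (T₀ := 0) ?_ (s := fun y => (y.1.1 : ℂ) * y.2)
    (Continuous.continuousAt (by fun_prop)) (w := w) hw.continuous (fun y => rfl)
    (P := fun y => 6 * y.2 * y.1.2 none + (3 * B (u y) (u y) (v y) + 3 * ((y.1.1 : ℂ) *
      B (u y) (v y) (v y)) + (y.1.1 : ℂ) ^ 2 * B (v y) (v y) (v y))) ?_ ?_ (D := 3 * A) ?_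
    (mul_ne_zero three_ne_zero hp) ?_
    (g := fun i y => B (w y) (w y) (ζ i)) ?_ ?_
    (gp := fun y => 2 * y.1.2 none + B (w y) (w y) p) ?_ ?_ ?_
    (gq := fun y => 2 * y.2 + B (w y) (w y) q) ?_ ?_ ?_
  · rintro rfl
    exact hp (by simp [hA, hB.zero_left])
  · exact ContDiff.add (by fun_prop) (((contDiff_const.mul (hB.contDiff_comp hu hu hv)).add
      (contDiff_const.mul (ContDiff.mul (by fun_prop) (hB.contDiff_comp hu hv hv)))).add
      (ContDiff.mul (by fun_prop) (hB.contDiff_comp hv hv hv)))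
  · simp only [hu0, v]
    simp [hB.zero_right]
  · have h1 : ∀ T, v ((0, fun o => o.elim 0 z₀), T) = T • p := fun T => by simp [v]
    simp only [hu0, h1, hB.smul_right, Option.elim_none, Complex.ofReal_zero, ← hA]
    simpa [mul_comm, mul_assoc, mul_left_comm] using (hasDerivAt_id (0 : ℂ)).const_mul (3 * A)
  · intro y hy
    have h1 := hc fun i => y.1.2 (some i)
    have h2 : B (w y) (w y) (w y) = (y.1.1 : ℂ) * (3 * B (u y) (u y) (v y) + 3 * ((y.1.1 : ℂ) *
      B (u y) (v y) (v y)) + (y.1.1 : ℂ) ^ 2 * B (v y) (v y) (v y)) := by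
      rw [hwuv, hB.cube_add, show B (u y) (u y) (u y) = 0 from h1]
      simp only [hB.smul_right, hB.smul_mid, hB.smul_left]
      ring
    rw [h2]
    linear_combination (y.1.1 : ℂ) ^ 2 * hy
  · exact fun i => hBw _
  · intro i y _
    ring
  · exact Continuous.add (by fun_prop) (hBw _)
  · intro y _
    ring
  · simpa [hw0] using hp
  · exact Continuous.add (by fun_prop) (hBw _)
  · intro y _
    ring
  · simpa [hw0] using hq

end RankTwo

end CubicFourfold

/-! ### Rank two: scalings after a nonlinear change of coordinates -/

namespace CubicFourfold

variable {F : MvPolynomial (Fin 6) ℂ} {B : V → V → V → ℂ}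

namespace RankTwo

variable {x p q : V} {ζ : Fin 3 → V}

/-- The case in which `F` is of degree one along the radical, to first order in the direction
`p`, with nonzero second-order term. -/
theorem lintegral_curvature_of_linear_ne_zero (hB : IsPolarization F B) (R : RankTwo B x ζ p q)
    (hc : ∀ (z : Fin 3 → ℂ) i, B (∑ i, z i • ζ i) (∑ i, z i • ζ i) (ζ i) = 0)
    (hp : ∀ (z : Fin 3 → ℂ) i, B (∑ i, z i • ζ i) (ζ i) p = 0)
    {z₀ : Fin 3 → ℂ} (hq : B (∑ i, z₀ i • ζ i) (∑ i, z₀ i • ζ i) q ≠ 0)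
    (hl : B (∑ i, z₀ i • ζ i) p p ≠ 0) :
    ∫⁻ x in regLink F, ENNReal.ofReal (curvature F B x)
      ∂(MeasureTheory.Measure.hausdorffMeasure 9) = ∞ := by
  let u : (ℝ × (Option (Fin 3) → ℂ)) × ℂ → V := fun y => ∑ i, y.1.2 (some i) • ζ i
  have hu : ContDiff ℝ 1 u := by fun_prop
  -- With `E(z) = B(z,z,q)`, the lowest terms containing `t` are `3t (2s + E(z))`. Near `2s + E(z) =
  -- 0` the coordinate `s' = s + E(z) / 2` can be smaller than `s`. Weight 2 of `z` gives weight 4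
  -- to `s`; weight 5 for `t` and `s'` gives the same degree 10 to `6ts'` and to the term `3s²
  -- B(z,p,p)`. The condition is `11 ≤ 15`.
  let σ : (ℝ × (Option (Fin 3) → ℂ)) × ℂ → ℂ := fun y =>
    -B (u y) (u y) q / 2 + (y.1.1 : ℂ) * y.2
  have hBu : ContDiff ℝ 1 fun y => B (u y) (u y) q := hB.contDiff_comp hu hu contDiff_const
  have hσ : ContDiff ℝ 1 σ := (hBu.neg.div_const 2).add (by fun_prop)
  let v : (ℝ × (Option (Fin 3) → ℂ)) × ℂ → V := fun y => σ y • p + ((y.1.1 : ℂ) * y.1.2 none) • q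
  have hv : ContDiff ℝ 1 v := (hσ.smul contDiff_const).add (by fun_prop)
  let w : (ℝ × (Option (Fin 3) → ℂ)) × ℂ → V := fun y => ∑ i, y.1.2 (some i) • ζ i +
    (((y.1.1 : ℂ) ^ 2 * σ y) • p + ((y.1.1 : ℂ) ^ 3 * y.1.2 none) • q)
  have hρ : ContDiff ℝ 1 fun y : (ℝ × (Option (Fin 3) → ℂ)) × ℂ => (y.1.1 : ℂ) := by fun_prop
  have hw : ContDiff ℝ 1 w := hu.add ((((hρ.pow 2).mul hσ).smul contDiff_const).add (by fun_prop))
  have hwuv : ∀ y, w y = u y + (y.1.1 : ℂ) ^ 2 • v y := fun y => by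
    simp only [w, u, v, smul_add, smul_smul]
    congr 3
    ring
  have hu0 : ∀ T, u ((0, fun o => o.elim 1 z₀), T) = ∑ i, z₀ i • ζ i := fun T => by simp [u]
  set E := B (∑ i, z₀ i • ζ i) (∑ i, z₀ i • ζ i) q with hE
  set l := B (∑ i, z₀ i • ζ i) p p with hl'
  have hσ0 : ∀ T, σ ((0, fun o => o.elim 1 z₀), T) = -E / 2 := fun T => by simp [σ, hu0, hE]
  have hv0 : ∀ T, v ((0, fun o => o.elim 1 z₀), T) = (-E / 2) • p := fun T => by simp [v, hσ0]
  have huu : ∀ y i, B (u y) (u y) (ζ i) = 0 := fun y i => hc _ i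
  have huuu : ∀ y, B (u y) (u y) (u y) = 0 := fun y => by
    conv_lhs => arg 3; simp only [u]
    rw [hB.sum_right]
    simp [hB.smul_right, huu]
  have hup : ∀ y i, B (u y) p (ζ i) = 0 := fun y i => by rw [hB.swap23]; exact hp _ i
  have huup : ∀ y, B (u y) (u y) p = 0 := fun y => by
    rw [hB.swap23]
    conv_lhs => arg 3; simp only [u]
    rw [hB.sum_right]
    simp [hB.smul_right, hup]
  have hw2 : ∀ y r, B (w y) (w y) r = B (u y) (u y) r + 2 * ((y.1.1 : ℂ) ^ 2 * B (u y) (v y) r) +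
      (y.1.1 : ℂ) ^ 4 * B (v y) (v y) r := by
    intro y r
    rw [hwuv, hB.sq_add]
    simp only [hB.smul_mid, hB.smul_left]
    ring
  have huv : ∀ y r, B (u y) (v y) r = σ y * B (u y) p r + (y.1.1 : ℂ) * y.1.2 none * B (u y) q r := by
    intro y r
    simp only [v]
    rw [hB.add_mid, hB.smul_mid, hB.smul_mid]
  have hw3 : ∀ y, B (w y) (w y) (w y) = (y.1.1 : ℂ) ^ 2 * (3 * B (u y) (u y) (v y)) +
      (y.1.1 : ℂ) ^ 4 * (3 * B (u y) (v y) (v y)) + (y.1.1 : ℂ) ^ 6 * B (v y) (v y) (v y) := by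
    intro y
    rw [hwuv, hB.cube_add, huuu]
    simp only [hB.smul_right, hB.smul_mid, hB.smul_left]
    ring
  have huuv : ∀ y, B (u y) (u y) (v y) = (y.1.1 : ℂ) * y.1.2 none * B (u y) (u y) q := by
    intro y
    simp only [v]
    rw [hB.add_right, hB.smul_right, hB.smul_right, huup]
    ring
  have hσ2 : ∀ y, 2 * σ y + B (u y) (u y) q = 2 * ((y.1.1 : ℂ) * y.2) := fun y => by
    simp only [σ]; ring
  have cuv : ∀ r, Continuous fun y => B (u y) (v y) r := fun r =>
    hB.continuous_comp hu.continuous hv.continuous continuous_const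
  have cuq : ∀ r, Continuous fun y => B (u y) q r := fun r =>
    hB.continuous_comp hu.continuous continuous_const continuous_const
  have cup : ∀ r, Continuous fun y => B (u y) p r := fun r =>
    hB.continuous_comp hu.continuous continuous_const continuous_const
  have cvv : ∀ r, Continuous fun y => B (v y) (v y) r := fun r =>
    hB.continuous_comp hv.continuous hv.continuous continuous_const
  have hρc := hρ.continuous
  refine R.lintegral_curvature_of_scaling hB (e := 2) (f := 3) (a := 5) two_ne_zero (by norm_num)
    (z₀ := z₀) (t₀ := 1) (T₀ := -(E ^ 2 * l) / 8) ?_ (s := fun y => (y.1.1 : ℂ) ^ 2 * σ y)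
    ((hρc.pow 2).mul hσ.continuous).continuousAt (w := w) hw.continuous (fun y => rfl)
    (P := fun y => 6 * y.2 * y.1.2 none + (3 * B (u y) (v y) (v y) +
      (y.1.1 : ℂ) ^ 2 * B (v y) (v y) (v y))) ?_ ?_ (D := 6) ?_ (by norm_num) ?_
    (g := fun i y => 2 * ((y.1.1 : ℂ) ^ 2 * y.1.2 none * B (u y) q (ζ i)) +
      (y.1.1 : ℂ) ^ 3 * B (v y) (v y) (ζ i)) ?_ ?_
    (gp := fun y => 2 * y.1.2 none + ((y.1.1 : ℂ) * (2 * B (u y) (v y) p) +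
      (y.1.1 : ℂ) ^ 3 * B (v y) (v y) p)) ?_ ?_ ?_
    (gq := fun y => 2 * y.2 + ((y.1.1 : ℂ) * (2 * B (u y) (v y) q) +
      (y.1.1 : ℂ) ^ 3 * B (v y) (v y) q)) ?_ ?_ ?_
  · rintro rfl
    exact hl (by simp [hl', hB.zero_left])
  · exact ContDiff.add (by fun_prop) ((contDiff_const.mul (hB.contDiff_comp hu hv hv)).add
      ((hρ.pow 2).mul (hB.contDiff_comp hv hv hv)))
  · simp only [hu0, hv0, hB.smul_mid, hB.smul_right, ← hl']
    simp
    ring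
  · simp only [hu0, hv0, hB.smul_mid, hB.smul_right, ← hl']
    simpa using ((hasDerivAt_id (-(E ^ 2 * l) / 8)).const_mul 6).add_const
      (3 * (-E / 2 * (-E / 2 * l)))
  · intro y hy
    rw [hw3, huuv]
    linear_combination (y.1.1 : ℂ) ^ 6 * hy + 3 * (y.1.1 : ℂ) ^ 5 * y.1.2 none * hσ2 y
  · intro i
    exact (((Continuous.mul (by fun_prop) (cuq _)).const_mul 2)).add ((hρc.pow 3).mul (cvv _))
  · intro i y _
    rw [hw2, huu, huv, hup]
    ring
  · exact Continuous.add (by fun_prop) ((hρc.mul ((cuv p).const_mul 2)).add ((hρc.pow 3).mul (cvv p)))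
  · intro y _
    rw [hw2, huup]
    ring
  · simp
  · exact Continuous.add (by fun_prop) ((hρc.mul ((cuv q).const_mul 2)).add ((hρc.pow 3).mul (cvv q)))
  · intro y _
    rw [hw2]
    linear_combination (y.1.1 : ℂ) ^ 4 * hσ2 y
  · simpa using ⟨hq, hl⟩

/-- The case in which `F` is of degree one along the radical, to first order in the direction
`p`, with vanishing second-order term. -/
theorem lintegral_curvature_of_constant_ne_zero (hB : IsPolarization F B) (R : RankTwo B x ζ p q)
    (hc : ∀ (z : Fin 3 → ℂ) i, B (∑ i, z i • ζ i) (∑ i, z i • ζ i) (ζ i) = 0)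
    (hp : ∀ (z : Fin 3 → ℂ) i, B (∑ i, z i • ζ i) (ζ i) p = 0)
    (hl : ∀ i, B (ζ i) p p = 0)
    {z₀ : Fin 3 → ℂ} (hq : B (∑ i, z₀ i • ζ i) (∑ i, z₀ i • ζ i) q ≠ 0)
    (hk : B p p p ≠ 0) :
    ∫⁻ x in regLink F, ENNReal.ofReal (curvature F B x)
      ∂(MeasureTheory.Measure.hausdorffMeasure 9) = ∞ := by
  let u : (ℝ × (Option (Fin 3) → ℂ)) × ℂ → V := fun y => ∑ i, y.1.2 (some i) • ζ i
  have hu : ContDiff ℝ 1 u := by fun_prop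
  -- Now the term `s² B(z,p,p)` is absent and `s³ B(p,p,p)`, of degree 12, takes its place. Hence
  -- `t` and `s' = s + E(z) / 2` are given the weight 6, and `6st B(z,p,q)` has degree 12 as well.
  -- The condition is `12 ≤ 18`.
  let σ : (ℝ × (Option (Fin 3) → ℂ)) × ℂ → ℂ := fun y =>
    -B (u y) (u y) q / 2 + (y.1.1 : ℂ) ^ 2 * y.2
  have hBu : ContDiff ℝ 1 fun y => B (u y) (u y) q := hB.contDiff_comp hu hu contDiff_const
  have hσ : ContDiff ℝ 1 σ := (hBu.neg.div_const 2).add (by fun_prop)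
  let v : (ℝ × (Option (Fin 3) → ℂ)) × ℂ → V := fun y =>
    σ y • p + ((y.1.1 : ℂ) ^ 2 * y.1.2 none) • q
  have hv : ContDiff ℝ 1 v := (hσ.smul contDiff_const).add (by fun_prop)
  let w : (ℝ × (Option (Fin 3) → ℂ)) × ℂ → V := fun y => ∑ i, y.1.2 (some i) • ζ i +
    (((y.1.1 : ℂ) ^ 2 * σ y) • p + ((y.1.1 : ℂ) ^ 4 * y.1.2 none) • q)
  have hρ : ContDiff ℝ 1 fun y : (ℝ × (Option (Fin 3) → ℂ)) × ℂ => (y.1.1 : ℂ) := by fun_prop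
  have hw : ContDiff ℝ 1 w := hu.add ((((hρ.pow 2).mul hσ).smul contDiff_const).add (by fun_prop))
  have hwuv : ∀ y, w y = u y + (y.1.1 : ℂ) ^ 2 • v y := fun y => by
    simp only [w, u, v, smul_add, smul_smul]
    congr 3
    ring
  have hu0 : ∀ T, u ((0, fun o => o.elim 1 z₀), T) = ∑ i, z₀ i • ζ i := fun T => by simp [u]
  set E := B (∑ i, z₀ i • ζ i) (∑ i, z₀ i • ζ i) q with hE
  have hσ0 : ∀ T, σ ((0, fun o => o.elim 1 z₀), T) = -E / 2 := fun T => by simp [σ, hu0, hE]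
  have hv0 : ∀ T, v ((0, fun o => o.elim 1 z₀), T) = (-E / 2) • p := fun T => by simp [v, hσ0]
  have huu : ∀ y i, B (u y) (u y) (ζ i) = 0 := fun y i => hc _ i
  have huuu : ∀ y, B (u y) (u y) (u y) = 0 := fun y => by
    conv_lhs => arg 3; simp only [u]
    rw [hB.sum_right]
    simp [hB.smul_right, huu]
  have hup : ∀ y i, B (u y) p (ζ i) = 0 := fun y i => by rw [hB.swap23]; exact hp _ i
  have huup : ∀ y, B (u y) (u y) p = 0 := fun y => by
    rw [hB.swap23]
    conv_lhs => arg 3; simp only [u]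
    rw [hB.sum_right]
    simp [hB.smul_right, hup]
  have hupp : ∀ y, B (u y) p p = 0 := fun y => by
    simp only [u]
    rw [hB.sum_left]
    simp [hB.smul_left, hl]
  have hw2 : ∀ y r, B (w y) (w y) r = B (u y) (u y) r + 2 * ((y.1.1 : ℂ) ^ 2 * B (u y) (v y) r) +
      (y.1.1 : ℂ) ^ 4 * B (v y) (v y) r := by
    intro y r
    rw [hwuv, hB.sq_add]
    simp only [hB.smul_mid, hB.smul_left]
    ring
  have huv : ∀ y r, B (u y) (v y) r =
      σ y * B (u y) p r + (y.1.1 : ℂ) ^ 2 * y.1.2 none * B (u y) q r := by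
    intro y r
    simp only [v]
    rw [hB.add_mid, hB.smul_mid, hB.smul_mid]
  have huvv : ∀ y, B (u y) (v y) (v y) = (y.1.1 : ℂ) ^ 2 * (2 * (σ y * y.1.2 none * B (u y) p q) +
      (y.1.1 : ℂ) ^ 2 * y.1.2 none ^ 2 * B (u y) q q) := by
    intro y
    have h1 : ∀ r, B (u y) r (v y) =
        σ y * B (u y) r p + (y.1.1 : ℂ) ^ 2 * y.1.2 none * B (u y) r q := fun r => by
      simp only [v]
      rw [hB.add_right, hB.smul_right, hB.smul_right]
    rw [huv, h1, h1, hupp, hB.swap23 (u y) q p]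
    ring
  have hw3 : ∀ y, B (w y) (w y) (w y) = (y.1.1 : ℂ) ^ 2 * (3 * B (u y) (u y) (v y)) +
      (y.1.1 : ℂ) ^ 4 * (3 * B (u y) (v y) (v y)) + (y.1.1 : ℂ) ^ 6 * B (v y) (v y) (v y) := by
    intro y
    rw [hwuv, hB.cube_add, huuu]
    simp only [hB.smul_right, hB.smul_mid, hB.smul_left]
    ring
  have huuv : ∀ y, B (u y) (u y) (v y) = (y.1.1 : ℂ) ^ 2 * y.1.2 none * B (u y) (u y) q := by
    intro y
    simp only [v]
    rw [hB.add_right, hB.smul_right, hB.smul_right, huup]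
    ring
  have hσ2 : ∀ y, 2 * σ y + B (u y) (u y) q = 2 * ((y.1.1 : ℂ) ^ 2 * y.2) := fun y => by
    simp only [σ]; ring
  have kuq : ∀ r, ContDiff ℝ 1 fun y => B (u y) q r := fun r =>
    hB.contDiff_comp hu contDiff_const contDiff_const
  have kup : ∀ r, ContDiff ℝ 1 fun y => B (u y) p r := fun r =>
    hB.contDiff_comp hu contDiff_const contDiff_const
  have cuv : ∀ r, Continuous fun y => B (u y) (v y) r := fun r =>
    hB.continuous_comp hu.continuous hv.continuous continuous_const
  have cvv : ∀ r, Continuous fun y => B (v y) (v y) r := fun r =>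
    hB.continuous_comp hv.continuous hv.continuous continuous_const
  have hρc := hρ.continuous
  have hN : ContDiff ℝ 1 fun y : (ℝ × (Option (Fin 3) → ℂ)) × ℂ => y.1.2 none := by fun_prop
  -- The root of `6T - 3E B(z,p,q) - E³ B(p,p,p) / 8`, obtained from `s = -E / 2` and `t = 1`.
  set T₀ : ℂ := E * B (∑ i, z₀ i • ζ i) p q / 2 + E ^ 3 * B p p p / 48 with hT₀
  refine R.lintegral_curvature_of_scaling hB (e := 2) (f := 4) (a := 6) two_ne_zero (by norm_num)
    (z₀ := z₀) (t₀ := 1) (T₀ := T₀) ?_ (s := fun y => (y.1.1 : ℂ) ^ 2 * σ y)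
    ((hρc.pow 2).mul hσ.continuous).continuousAt (w := w) hw.continuous (fun y => rfl)
    (P := fun y => 6 * y.2 * y.1.2 none + (3 * (2 * (σ y * y.1.2 none * B (u y) p q) +
      (y.1.1 : ℂ) ^ 2 * y.1.2 none ^ 2 * B (u y) q q) + B (v y) (v y) (v y))) ?_ ?_ (D := 6) ?_
    (by norm_num) ?_
    (g := fun i y => 2 * ((y.1.1 : ℂ) ^ 2 * y.1.2 none * B (u y) q (ζ i)) +
      (y.1.1 : ℂ) ^ 2 * B (v y) (v y) (ζ i)) ?_ ?_
    (gp := fun y => 2 * y.1.2 none + ((y.1.1 : ℂ) ^ 2 * (2 * (y.1.2 none * B (u y) q p)) +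
      (y.1.1 : ℂ) ^ 2 * B (v y) (v y) p)) ?_ ?_ ?_
    (gq := fun y => 2 * y.2 + (2 * B (u y) (v y) q + (y.1.1 : ℂ) ^ 2 * B (v y) (v y) q)) ?_ ?_ ?_
  · rintro rfl
    exact hq (by simp [hE, hB.zero_left])
  · exact ContDiff.add (by fun_prop) ((contDiff_const.mul ((contDiff_const.mul ((hσ.mul hN).mul
      (kup q))).add (((hρ.pow 2).mul (hN.pow 2)).mul (kuq q)))).add (hB.contDiff_comp hv hv hv))
  · simp only [hu0, hv0, hσ0, hB.smul_mid, hB.smul_right, hB.smul_left, hT₀]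
    simp
    ring
  · simp only [hu0, hv0, hσ0, hB.smul_mid, hB.smul_right, hB.smul_left]
    simpa using ((hasDerivAt_id T₀).const_mul 6).add_const
      (3 * (2 * (-E / 2 * B (∑ i, z₀ i • ζ i) p q)) + -E / 2 * (-E / 2 * (-E / 2 * B p p p)))
  · intro y hy
    rw [hw3, huuv, huvv]
    linear_combination (y.1.1 : ℂ) ^ 8 * hy + 3 * (y.1.1 : ℂ) ^ 6 * y.1.2 none * hσ2 y
  · intro i
    exact ((Continuous.mul (by fun_prop) (kuq _).continuous).const_mul 2).add
      ((hρc.pow 2).mul (cvv _))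
  · intro i y _
    rw [hw2, huu, huv, hup]
    ring
  · exact Continuous.add (by fun_prop) (((hρc.pow 2).mul ((hN.continuous.mul
      (kuq p).continuous).const_mul 2)).add ((hρc.pow 2).mul (cvv p)))
  · intro y _
    rw [hw2, huup, huv, hupp]
    ring
  · simp
  · exact Continuous.add (by fun_prop) (((cuv q).const_mul 2).add ((hρc.pow 2).mul (cvv q)))
  · intro y _
    rw [hw2]
    linear_combination (y.1.1 : ℂ) ^ 4 * hσ2 y
  -- In the derivative along `q` the terms with `B(z,p,q)` cancel, and the cubic coefficient alone
  -- remains.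
  · have h1 : 2 * T₀ + 2 * (-E / 2 * B (∑ i, z₀ i • ζ i) p q) = E ^ 3 * B p p p / 24 := by
      rw [hT₀]; ring
    simp only [hu0, hv0, hB.smul_mid]
    simp only [Complex.ofReal_zero, zero_pow two_ne_zero, zero_mul, add_zero, h1]
    exact div_ne_zero (mul_ne_zero (pow_ne_zero 3 hq) hk) (by norm_num)

end RankTwo

end CubicFourfold

/-! ### Rank two: the radical lies in the singular locus -/

namespace CubicFourfold

variable {F : MvPolynomial (Fin 6) ℂ} {B : V → V → V → ℂ}

namespace RankTwo

variable {x p q : V} {ζ : Fin 3 → V}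

/-- Divergence by scaling at a point of rank two such that the radical is contained in the singular
locus. The scaling is transversal to the radical. -/
theorem lintegral_curvature_of_transversal_scaling (hB : IsPolarization F B)
    (R : RankTwo B x ζ p q)
    {s : (ℝ × (Option (Fin 3) → ℂ)) × ℂ → ℂ} {T₀ : ℂ}
    (hs : Continuous s) (hs0 : s ((0, fun o => o.elim 1 0), T₀) = 0)
    {w : (ℝ × (Option (Fin 3) → ℂ)) × ℂ → V}
    (hw : ∀ y, w y = ∑ i, y.1.2 (some i) • ζ i + (s y • p + ((y.1.1 : ℂ) * y.1.2 none) • q))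
    {P : (ℝ × (Option (Fin 3) → ℂ)) × ℂ → ℂ} (hP : ContDiff ℝ 1 P)
    (hP0 : P ((0, fun o => o.elim 1 0), T₀) = 0)
    {D : ℂ} (hPT : HasDerivAt (fun T => P ((0, fun o => o.elim 1 0), T)) D T₀) (hD : D ≠ 0)
    (hF : ∀ y, P y = 0 → 6 * s y * ((y.1.1 : ℂ) * y.1.2 none) + B (w y) (w y) (w y) = 0)
    {g : Fin 3 → (ℝ × (Option (Fin 3) → ℂ)) × ℂ → ℂ} (hg : ∀ i, Continuous (g i))
    (hgB : ∀ i y, B (w y) (w y) (ζ i) = (y.1.1 : ℂ) * g i y)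
    {gp : (ℝ × (Option (Fin 3) → ℂ)) × ℂ → ℂ} (hgp : Continuous gp)
    (hgpB : ∀ y, 2 * ((y.1.1 : ℂ) * y.1.2 none) + B (w y) (w y) p = (y.1.1 : ℂ) * gp y)
    (hgp0 : gp ((0, fun o => o.elim 1 0), T₀) ≠ 0)
    {gq : (ℝ × (Option (Fin 3) → ℂ)) × ℂ → ℂ} (hgq : Continuous gq)
    (hgqB : ∀ y, 2 * s y + B (w y) (w y) q = (y.1.1 : ℂ) * gq y)
    (j k : Option (Fin 3)) {K : (ℝ × (Option (Fin 3) → ℂ)) × ℂ → ℂ} (hK : Continuous K)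
    (hK0 : K ((0, fun o => o.elim 1 0), T₀) ≠ 0)
    (hKB : ∀ y, (y.1.1 : ℂ) * K y = gp y ^ 2 * B (x + w y) (j.elim q ζ) (k.elim q ζ)
      - gp y * k.elim (gq y) (fun i => g i y) * B (x + w y) (j.elim q ζ) p
      - gp y * j.elim (gq y) (fun i => g i y) * B (x + w y) p (k.elim q ζ)
      + j.elim (gq y) (fun i => g i y) * k.elim (gq y) (fun i => g i y) * B (x + w y) p p) :
    ∫⁻ x in regLink F, ENNReal.ofReal (curvature F B x)
      ∂(MeasureTheory.Measure.hausdorffMeasure 9) = ∞ := by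
  have hpt2 : ∀ (y : (ℝ × (Option (Fin 3) → ℂ)) × ℂ) u, B (x + w y) (x + w y) u =
      2 * B x (w y) u + B (w y) (w y) u := fun y u => hB.sq_singular_add R.singular _ _
  -- Only the directions transversal to the radical are scaled; `z` has weight 0 and stays near 0.
  -- Gradient and Hessian are both of order 1, and `1 + 1 ≤ 3`.
  refine CubicFourfold.lintegral_curvature_of_scaling hB (ι := Option (Fin 3)) (by simp) R.ne_zero
    (b := fun o => o.elim q ζ) (bt := p) ?_ (fun o => o.elim 1 fun _ => 0) (a := 1) (m := 1)
    ?_ (Z₀ := fun o => o.elim 1 0) (T₀ := T₀) ⟨none, one_ne_zero, one_ne_zero⟩ ?_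
    (τ := s) hs.continuousAt hs0 (pt := fun y => x + w y) ?_
    (P := P) hP.contDiffAt hP0 hPT hD ?_ (g := fun o y => o.elim (gq y) fun i => g i y) ?_ ?_
    (gt := gp) hgp.continuousAt ?_ hgp0 j k (K := K) hK.continuousAt hK0 ?_
  · intro z t c h
    rw [Fintype.sum_option] at h
    obtain ⟨h1, h2, h3⟩ := R.indep (fun i => z (some i)) t (z none) c (by rw [← h]; simp; abel)
    refine ⟨funext fun o => ?_, h2⟩
    cases o with
    | none => exact h3
    | some i => exact congrFun h1 i
  · rw [Fintype.sum_option]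
    simp
  · rintro (_ | i) h
    · exact absurd h one_ne_zero
    · rfl
  · intro y
    rw [Fintype.sum_option, hw]
    simp only [Option.elim_none, Option.elim_some, pow_one, pow_zero, one_mul]
    abel
  · intro y hy
    rw [hB.cube_singular_add R.singular, ← hF y hy]
    congr 1
    rw [hw, R.apply_self hB]
    ring
  · rintro (_ | i)
    · exact hgq.continuousAt
    · exact (hg i).continuousAt
  · rintro (_ | i) y hy
    · change B _ _ q = _ ^ 1 * gq y
      rw [hpt2, pow_one, ← hgqB y, hw, R.apply_q hB]
    · change B _ _ (ζ i) = _ ^ 1 * g i y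
      rw [hpt2, pow_one, ← hgB i y, R.apply_radical hB]
      ring
  · intro y hy
    rw [hpt2, pow_one, ← hgpB y, hw, R.apply_p hB]
  · intro y _
    rw [pow_one]
    exact hKB y

/-- All terms of the equation are at least quadratic in `(s, t)`. At points with `t = ρ` and `s` of
smaller order, the entry of the Hessian for `ζ i₀` and `q` is approximately `ρ B(ζ i₀, q, q)`. -/
theorem lintegral_curvature_of_singular_radical (hB : IsPolarization F B) (R : RankTwo B x ζ p q)
    (hc : ∀ (z : Fin 3 → ℂ) i, B (∑ i, z i • ζ i) (∑ i, z i • ζ i) (ζ i) = 0)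
    (hp : ∀ (z : Fin 3 → ℂ) i, B (∑ i, z i • ζ i) (ζ i) p = 0)
    (hq : ∀ (z : Fin 3 → ℂ) i, B (∑ i, z i • ζ i) (ζ i) q = 0)
    {i₀ : Fin 3} (hn : B (ζ i₀) q q ≠ 0) :
    ∫⁻ x in regLink F, ENNReal.ofReal (curvature F B x)
      ∂(MeasureTheory.Measure.hausdorffMeasure 9) = ∞ := by
  let u : (ℝ × (Option (Fin 3) → ℂ)) × ℂ → V := fun y => ∑ i, y.1.2 (some i) • ζ i
  let v : (ℝ × (Option (Fin 3) → ℂ)) × ℂ → V := fun y => y.2 • p + y.1.2 none • q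
  let w : (ℝ × (Option (Fin 3) → ℂ)) × ℂ → V := fun y => ∑ i, y.1.2 (some i) • ζ i +
    (((y.1.1 : ℂ) * y.2) • p + ((y.1.1 : ℂ) * y.1.2 none) • q)
  have hu : ContDiff ℝ 1 u := by fun_prop
  have hv : ContDiff ℝ 1 v := by fun_prop
  have hw : ContDiff ℝ 1 w := by fun_prop
  have hρ : ContDiff ℝ 1 fun y : (ℝ × (Option (Fin 3) → ℂ)) × ℂ => (y.1.1 : ℂ) := by fun_prop
  have hwuv : ∀ y, w y = u y + (y.1.1 : ℂ) • v y := fun y => by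
    simp only [w, u, v, smul_add, smul_smul]
  have hu0 : ∀ T, u ((0, fun o => o.elim 1 0), T) = 0 := fun T => by simp [u]
  have hv0 : ∀ T, v ((0, fun o => o.elim 1 0), T) = T • p + q := fun T => by simp [v]
  have hw0 : ∀ T, w ((0, fun o => o.elim 1 0), T) = 0 := fun T => by simp [w]
  have huu : ∀ y i, B (u y) (u y) (ζ i) = 0 := fun y i => hc _ i
  have hus : ∀ y r, (∀ i, B (u y) r (ζ i) = 0) → B (u y) (u y) r = 0 := fun y r h => by
    rw [hB.swap23]
    conv_lhs => arg 3; simp only [u]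
    rw [hB.sum_right]
    simp [hB.smul_right, h]
  have huuu : ∀ y, B (u y) (u y) (u y) = 0 := fun y => hus y _ (huu y)
  have hup : ∀ y i, B (u y) p (ζ i) = 0 := fun y i => by rw [hB.swap23]; exact hp _ i
  have huq : ∀ y i, B (u y) q (ζ i) = 0 := fun y i => by rw [hB.swap23]; exact hq _ i
  have huup : ∀ y, B (u y) (u y) p = 0 := fun y => hus y _ (hup y)
  have huuq : ∀ y, B (u y) (u y) q = 0 := fun y => hus y _ (huq y)
  have huv : ∀ y r, B (u y) (v y) r = y.2 * B (u y) p r + y.1.2 none * B (u y) q r := by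
    intro y r
    simp only [v]
    rw [hB.add_mid, hB.smul_mid, hB.smul_mid]
  have huuv : ∀ y, B (u y) (u y) (v y) = 0 := by
    intro y
    simp only [v]
    rw [hB.add_right, hB.smul_right, hB.smul_right, huup, huuq]
    ring
  have hw2 : ∀ y r, B (w y) (w y) r = B (u y) (u y) r + 2 * ((y.1.1 : ℂ) * B (u y) (v y) r) +
      (y.1.1 : ℂ) ^ 2 * B (v y) (v y) r := by
    intro y r
    rw [hwuv, hB.sq_add]
    simp only [hB.smul_mid, hB.smul_left]
    ring
  have hw1 : ∀ y r t, B (x + w y) r t = B x r t + B (w y) r t := fun y r t => hB.add_left _ _ _ _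
  have hwζ : ∀ y i r, B (u y) (ζ i) r = 0 → B (w y) (ζ i) r = (y.1.1 : ℂ) * B (v y) (ζ i) r := by
    intro y i r h
    rw [hwuv, hB.add_left, hB.smul_left, h, zero_add]
  have cuv : ∀ r, Continuous fun y => B (u y) (v y) r := fun r =>
    hB.continuous_comp hu.continuous hv.continuous continuous_const
  have cvv : ∀ r, Continuous fun y => B (v y) (v y) r := fun r =>
    hB.continuous_comp hv.continuous hv.continuous continuous_const
  have cv : ∀ r t, Continuous fun y => B (v y) r t := fun r t =>
    hB.continuous_comp hv.continuous continuous_const continuous_const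
  have cw : ∀ r t, Continuous fun y => B (w y) r t := fun r t =>
    hB.continuous_comp hw.continuous continuous_const continuous_const
  have hρc := hρ.continuous
  let gp : (ℝ × (Option (Fin 3) → ℂ)) × ℂ → ℂ := fun y => 2 * y.1.2 none +
    (2 * B (u y) (v y) p + (y.1.1 : ℂ) * B (v y) (v y) p)
  let gq : (ℝ × (Option (Fin 3) → ℂ)) × ℂ → ℂ := fun y => 2 * y.2 +
    (2 * B (u y) (v y) q + (y.1.1 : ℂ) * B (v y) (v y) q)
  have cgp : Continuous gp :=
    Continuous.add (by fun_prop) (((cuv p).const_mul 2).add (hρc.mul (cvv p)))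
  have cgq : Continuous gq :=
    Continuous.add (by fun_prop) (((cuv q).const_mul 2).add (hρc.mul (cvv q)))
  refine R.lintegral_curvature_of_transversal_scaling hB (s := fun y => (y.1.1 : ℂ) * y.2)
    (T₀ := 0) (by fun_prop) (by simp) (w := w) (fun y => rfl)
    (P := fun y => 6 * y.2 * y.1.2 none + (3 * B (u y) (v y) (v y) +
      (y.1.1 : ℂ) * B (v y) (v y) (v y))) ?_ ?_ (D := 6) ?_ (by norm_num) ?_
    (g := fun i y => (y.1.1 : ℂ) * B (v y) (v y) (ζ i)) (fun i => hρc.mul (cvv _)) ?_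
    (gp := gp) cgp ?_ ?_ (gq := gq) cgq ?_ (some i₀) none
    (K := fun y => gp y ^ 2 * B (v y) (ζ i₀) q - gp y * gq y * B (v y) (ζ i₀) p -
      gp y * B (v y) (v y) (ζ i₀) * (1 + B (w y) p q) +
      B (v y) (v y) (ζ i₀) * gq y * B (w y) p p) ?_ ?_ ?_
  · exact ContDiff.add (by fun_prop) ((contDiff_const.mul (hB.contDiff_comp hu hv hv)).add
      (hρ.mul (hB.contDiff_comp hv hv hv)))
  · simp [hu0, hB.zero_left]
  · simp only [hu0, hB.zero_left]
    simpa using (hasDerivAt_id (0 : ℂ)).const_mul 6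
  · intro y hy
    rw [hwuv, hB.cube_add, huuu]
    simp only [hB.smul_right, hB.smul_mid, hB.smul_left, huuv]
    linear_combination (y.1.1 : ℂ) ^ 2 * hy
  · intro i y
    rw [hw2, huu, huv, hup, huq]
    ring
  · intro y
    rw [hw2, huup]
    simp only [gp]
    ring
  · simp [gp, hu0, hB.zero_left]
  · intro y
    rw [hw2, huuq]
    simp only [gq]
    ring
  · exact (((((cgp.pow 2).mul (cv _ _)).sub ((cgp.mul cgq).mul (cv _ _))).sub
      ((cgp.mul (cvv _)).mul ((cw _ _).const_add 1))).add (((cvv _).mul cgq).mul (cw _ _)))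
  · have h1 : gp ((0, fun o => o.elim 1 0), 0) = 2 := by simp [gp, hu0, hB.zero_left]
    have h2 : gq ((0, fun o => o.elim 1 0), 0) = 0 := by simp [gq, hu0, hB.zero_left]
    rw [h1, h2, hv0, hw0, zero_smul, zero_add, hB.zero_left, hB.swap12 q, hB.swap13 q q]
    intro h
    exact hn (by linear_combination h / 2)
  · intro y
    simp only [Option.elim_none, Option.elim_some, hw1, R.radical, R.pq, R.pp]
    rw [hwζ y i₀ q (hq _ i₀), hwζ y i₀ p (hp _ i₀)]
    ring

/-- When the terms `t² B(z,q,q)` are absent too, the equation for `z = 0` starts with `6st + k t³`,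
where `k = B(q,q,q)`. On the solution `s = -k t² / 6` the Hessian in the tangent direction near `q`
has order 1; the limit of `K` is `4k - 8k/3`. -/
theorem lintegral_curvature_of_singular_radical' (hB : IsPolarization F B) (R : RankTwo B x ζ p q)
    (hc : ∀ (z : Fin 3 → ℂ) i, B (∑ i, z i • ζ i) (∑ i, z i • ζ i) (ζ i) = 0)
    (hp : ∀ (z : Fin 3 → ℂ) i, B (∑ i, z i • ζ i) (ζ i) p = 0)
    (hq : ∀ (z : Fin 3 → ℂ) i, B (∑ i, z i • ζ i) (ζ i) q = 0)
    (hn : ∀ i, B (ζ i) q q = 0) (hk : B q q q ≠ 0) :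
    ∫⁻ x in regLink F, ENNReal.ofReal (curvature F B x)
      ∂(MeasureTheory.Measure.hausdorffMeasure 9) = ∞ := by
  let u : (ℝ × (Option (Fin 3) → ℂ)) × ℂ → V := fun y => ∑ i, y.1.2 (some i) • ζ i
  let v : (ℝ × (Option (Fin 3) → ℂ)) × ℂ → V := fun y => ((y.1.1 : ℂ) * y.2) • p + y.1.2 none • q
  let w : (ℝ × (Option (Fin 3) → ℂ)) × ℂ → V := fun y => ∑ i, y.1.2 (some i) • ζ i +
    (((y.1.1 : ℂ) ^ 2 * y.2) • p + ((y.1.1 : ℂ) * y.1.2 none) • q)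
  have hu : ContDiff ℝ 1 u := by fun_prop
  have hv : ContDiff ℝ 1 v := by fun_prop
  have hw : ContDiff ℝ 1 w := by fun_prop
  have hρ : ContDiff ℝ 1 fun y : (ℝ × (Option (Fin 3) → ℂ)) × ℂ => (y.1.1 : ℂ) := by fun_prop
  have hN : ContDiff ℝ 1 fun y : (ℝ × (Option (Fin 3) → ℂ)) × ℂ => y.1.2 none := by fun_prop
  have hwuv : ∀ y, w y = u y + (y.1.1 : ℂ) • v y := fun y => by
    simp only [w, u, v, smul_add, smul_smul]
    congr 3
    ring
  have hu0 : ∀ T, u ((0, fun o => o.elim 1 0), T) = 0 := fun T => by simp [u]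
  have hv0 : ∀ T, v ((0, fun o => o.elim 1 0), T) = q := fun T => by simp [v]
  have hw0 : ∀ T, w ((0, fun o => o.elim 1 0), T) = 0 := fun T => by simp [w]
  have huu : ∀ y i, B (u y) (u y) (ζ i) = 0 := fun y i => hc _ i
  have hus : ∀ y r, (∀ i, B (u y) r (ζ i) = 0) → B (u y) (u y) r = 0 := fun y r h => by
    rw [hB.swap23]
    conv_lhs => arg 3; simp only [u]
    rw [hB.sum_right]
    simp [hB.smul_right, h]
  have huuu : ∀ y, B (u y) (u y) (u y) = 0 := fun y => hus y _ (huu y)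
  have hup : ∀ y i, B (u y) p (ζ i) = 0 := fun y i => by rw [hB.swap23]; exact hp _ i
  have huq : ∀ y i, B (u y) q (ζ i) = 0 := fun y i => by rw [hB.swap23]; exact hq _ i
  have huup : ∀ y, B (u y) (u y) p = 0 := fun y => hus y _ (hup y)
  have huuq : ∀ y, B (u y) (u y) q = 0 := fun y => hus y _ (huq y)
  have huqq : ∀ y, B (u y) q q = 0 := fun y => by
    simp only [u]
    rw [hB.sum_left]
    simp [hB.smul_left, hn]
  have huv : ∀ y r, B (u y) (v y) r =
      (y.1.1 : ℂ) * y.2 * B (u y) p r + y.1.2 none * B (u y) q r := by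
    intro y r
    simp only [v]
    rw [hB.add_mid, hB.smul_mid, hB.smul_mid]
  have huuv : ∀ y, B (u y) (u y) (v y) = 0 := by
    intro y
    simp only [v]
    rw [hB.add_right, hB.smul_right, hB.smul_right, huup, huuq]
    ring
  have huvv : ∀ y, B (u y) (v y) (v y) = (y.1.1 : ℂ) * ((y.1.1 : ℂ) * y.2 ^ 2 * B (u y) p p +
      2 * y.2 * y.1.2 none * B (u y) p q) := by
    intro y
    have h1 : ∀ r, B (u y) r (v y) =
        (y.1.1 : ℂ) * y.2 * B (u y) r p + y.1.2 none * B (u y) r q := fun r => by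
      simp only [v]
      rw [hB.add_right, hB.smul_right, hB.smul_right]
    rw [huv, h1, h1, huqq, hB.swap23 (u y) q p]
    ring
  have hw2 : ∀ y r, B (w y) (w y) r = B (u y) (u y) r + 2 * ((y.1.1 : ℂ) * B (u y) (v y) r) +
      (y.1.1 : ℂ) ^ 2 * B (v y) (v y) r := by
    intro y r
    rw [hwuv, hB.sq_add]
    simp only [hB.smul_mid, hB.smul_left]
    ring
  have hw1 : ∀ y r t, B (x + w y) r t = B x r t + B (w y) r t := fun y r t => hB.add_left _ _ _ _
  have hwqq : ∀ y, B (w y) q q = (y.1.1 : ℂ) * B (v y) q q := by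
    intro y
    rw [hwuv, hB.add_left, hB.smul_left, huqq, zero_add]
  have cu : ∀ r t, ContDiff ℝ 1 fun y => B (u y) r t := fun r t =>
    hB.contDiff_comp hu contDiff_const contDiff_const
  have cuv : ∀ r, Continuous fun y => B (u y) (v y) r := fun r =>
    hB.continuous_comp hu.continuous hv.continuous continuous_const
  have cvv : ∀ r, Continuous fun y => B (v y) (v y) r := fun r =>
    hB.continuous_comp hv.continuous hv.continuous continuous_const
  have cv : ∀ r t, Continuous fun y => B (v y) r t := fun r t =>
    hB.continuous_comp hv.continuous continuous_const continuous_const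
  have cw : ∀ r t, Continuous fun y => B (w y) r t := fun r t =>
    hB.continuous_comp hw.continuous continuous_const continuous_const
  have hρc := hρ.continuous
  set k := B q q q with hk'
  let gp : (ℝ × (Option (Fin 3) → ℂ)) × ℂ → ℂ := fun y => 2 * y.1.2 none +
    (2 * B (u y) (v y) p + (y.1.1 : ℂ) * B (v y) (v y) p)
  let γ : (ℝ × (Option (Fin 3) → ℂ)) × ℂ → ℂ := fun y => 2 * y.2 +
    (2 * (y.2 * B (u y) p q) + B (v y) (v y) q)
  have cgp : Continuous gp :=
    Continuous.add (by fun_prop) (((cuv p).const_mul 2).add (hρc.mul (cvv p)))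
  have cγ : Continuous γ :=
    Continuous.add (by fun_prop) (((continuous_snd.mul (cu p q).continuous).const_mul 2).add (cvv q))
  refine R.lintegral_curvature_of_transversal_scaling hB (s := fun y => (y.1.1 : ℂ) ^ 2 * y.2)
    (T₀ := -k / 6) (by fun_prop) (by simp) (w := w) (fun y => rfl)
    (P := fun y => 6 * y.2 * y.1.2 none + (3 * ((y.1.1 : ℂ) * y.2 ^ 2 * B (u y) p p +
      2 * y.2 * y.1.2 none * B (u y) p q) + B (v y) (v y) (v y))) ?_ ?_ (D := 6) ?_ (by norm_num) ?_
    (g := fun i y => (y.1.1 : ℂ) * B (v y) (v y) (ζ i)) (fun i => hρc.mul (cvv _)) ?_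
    (gp := gp) cgp ?_ ?_ (gq := fun y => (y.1.1 : ℂ) * γ y) (hρc.mul cγ) ?_ none none
    (K := fun y => gp y ^ 2 * B (v y) q q - 2 * gp y * γ y * (1 + B (w y) p q) +
      (y.1.1 : ℂ) * γ y ^ 2 * B (w y) p p) ?_ ?_ ?_
  · exact ContDiff.add (by fun_prop) ((contDiff_const.mul ((((hρ.mul (contDiff_snd.pow 2)).mul
      (cu p p))).add (((contDiff_const.mul contDiff_snd).mul hN).mul (cu p q)))).add
      (hB.contDiff_comp hv hv hv))
  · simp only [hu0, hv0, hB.zero_left, ← hk']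
    simp
    ring
  · simp only [hu0, hv0, hB.zero_left, ← hk']
    simpa using ((hasDerivAt_id (-k / 6)).const_mul 6).add_const k
  · intro y hy
    rw [hwuv, hB.cube_add, huuu]
    simp only [hB.smul_right, hB.smul_mid, hB.smul_left, huuv, huvv]
    linear_combination (y.1.1 : ℂ) ^ 3 * hy
  · intro i y
    rw [hw2, huu, huv, hup, huq]
    ring
  · intro y
    rw [hw2, huup]
    simp only [gp]
    ring
  · simp [gp, hu0, hB.zero_left]
  · intro y
    rw [hw2, huuq, huv, huqq]
    simp only [γ]
    ring
  · exact (((cgp.pow 2).mul (cv _ _)).sub (((cgp.const_mul 2).mul cγ).mul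
      ((cw _ _).const_add 1))).add ((hρc.mul (cγ.pow 2)).mul (cw _ _))
  · have h1 : gp ((0, fun o => o.elim 1 0), -k / 6) = 2 := by simp [gp, hu0, hB.zero_left]
    have h2 : γ ((0, fun o => o.elim 1 0), -k / 6) = 2 * k / 3 := by
      simp only [γ, hu0, hv0, hB.zero_left, ← hk']
      ring
    rw [h1, h2, hv0, hw0, hB.zero_left, ← hk']
    intro h
    simp only [Complex.ofReal_zero, zero_mul, add_zero] at h
    exact hk (by linear_combination 3 * h / 4)
  · intro y
    simp only [Option.elim_none, hw1, R.qq, R.pq, R.pp, hB.swap23 x q p, hB.swap23 (w y) q p, hwqq]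
    ring

end RankTwo

end CubicFourfold

/-! ### Rank two: the case distinction -/

namespace CubicFourfold

variable {F : MvPolynomial (Fin 6) ℂ} {B : V → V → V → ℂ}

/-- A product of two nonzero polynomials is not zero at every point of `ℂ`. Along a line `z₁ + s z₂`
this makes two forms nonzero simultaneously. -/
theorem exists_quadratic_ne_zero {a b c a' b' c' : ℂ} (h : a ≠ 0) (h' : b' ≠ 0 ∨ c' ≠ 0) :
    ∃ s : ℂ, a + b * s + c * s ^ 2 ≠ 0 ∧ a' + b' * s + c' * s ^ 2 ≠ 0 := by
  open Polynomial in
  let P : ℂ[X] := C a + C b * X + C c * X ^ 2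
  open Polynomial in
  let Q : ℂ[X] := C a' + C b' * X + C c' * X ^ 2
  have hP : P ≠ 0 := fun h0 => h (by simpa [P] using congrArg (fun p => p.eval 0) h0)
  have hQ : Q ≠ 0 := by
    intro h0
    rcases h' with h' | h'
    · have h1 := congrArg (fun p => p.coeff 1) h0
      exact h' (by simpa [Q, Polynomial.coeff_X, Polynomial.coeff_C] using h1)
    · have h1 := congrArg (fun p => p.coeff 2) h0
      exact h' (by simpa [Q, Polynomial.coeff_X, Polynomial.coeff_C] using h1)
  have hPQ : P * Q ≠ 0 := mul_ne_zero hP hQ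
  by_contra! hcon
  refine hPQ (Polynomial.funext fun s => ?_)
  rw [Polynomial.eval_mul, Polynomial.eval_zero, mul_eq_zero]
  by_cases hs : a + b * s + c * s ^ 2 = 0
  · left; simpa [P] using hs
  · right; simpa [Q] using hcon s hs

namespace RankTwo

variable {x p q : V} {ζ : Fin 3 → V}

/-- The hyperplane `B x p · = 0`, that is, `t = 0`, is spanned by `x`, the radical and `p`. The
hypotheses list the coefficients of `z³`, `z²s`, `zs²` and `s³`, which are all there is of `F` on
it. -/
theorem containsHyperplane (hB : IsPolarization F B) (R : RankTwo B x ζ p q)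
    (h0 : ∀ z : Fin 3 → ℂ, B (∑ i, z i • ζ i) (∑ i, z i • ζ i) (∑ i, z i • ζ i) = 0)
    (h1 : ∀ z : Fin 3 → ℂ, B (∑ i, z i • ζ i) (∑ i, z i • ζ i) p = 0)
    (h2 : ∀ z : Fin 3 → ℂ, B (∑ i, z i • ζ i) p p = 0) (h3 : B p p p = 0) :
    ContainsHyperplane B := by
  refine ⟨hB.lin x p, ?_, fun v hv => ?_⟩
  · intro h
    have h4 : hB.lin x p q = 0 := by rw [h]; rfl
    exact one_ne_zero (R.pq.symm.trans h4)
  · have hv' : B x p v = 0 := hv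
    set s := B x q v with hs
    obtain ⟨z, c, hz⟩ := R.span (v - s • p)
      (by rw [sub_eq_add_neg, ← neg_smul, hB.add_right, hB.smul_right, hv', R.pp]; ring)
      (by rw [sub_eq_add_neg, ← neg_smul, hB.add_right, hB.smul_right, ← hs, hB.swap23, R.pq]; ring)
    have hvw : v = c • x + (∑ i, z i • ζ i + (s • p + (0 : ℂ) • q)) := by
      rw [sub_eq_iff_eq_add] at hz
      rw [hz, zero_smul]
      abel
    have h5 := R.apply_self hB z s 0
    rw [hvw, hB.cube_add]
    simp only [hB.smul_left, hB.smul_mid, R.singular, h5]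
    rw [zero_smul, add_zero, hB.cube_add, h0]
    simp only [hB.smul_left, hB.smul_mid, hB.smul_right, h1, h2, h3]
    ring

/-- The coefficients of `z³` and `z²s` vanish. Since the hyperplane `t = 0` is not contained in `Y`,
the coefficient of `zs²` or that of `s³` does not vanish, and these are the two scalings with the
coordinate `s + E(z) / 2`. -/
theorem lintegral_curvature_aux (hB : IsPolarization F B) (R : RankTwo B x ζ p q)
    (hirr : ¬ ContainsHyperplane B)
    (h0 : ∀ z : Fin 3 → ℂ, B (∑ i, z i • ζ i) (∑ i, z i • ζ i) (∑ i, z i • ζ i) = 0)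
    (hc : ∀ (z : Fin 3 → ℂ) i, B (∑ i, z i • ζ i) (∑ i, z i • ζ i) (ζ i) = 0)
    (h1 : ∀ z : Fin 3 → ℂ, B (∑ i, z i • ζ i) (∑ i, z i • ζ i) p = 0)
    (hp : ∀ (z : Fin 3 → ℂ) i, B (∑ i, z i • ζ i) (ζ i) p = 0)
    {z₁ : Fin 3 → ℂ} (hq : B (∑ i, z₁ i • ζ i) (∑ i, z₁ i • ζ i) q ≠ 0) :
    ∫⁻ x in regLink F, ENNReal.ofReal (curvature F B x)
      ∂(MeasureTheory.Measure.hausdorffMeasure 9) = ∞ := by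
  by_cases hl : ∀ z : Fin 3 → ℂ, B (∑ i, z i • ζ i) p p = 0
  · refine R.lintegral_curvature_of_constant_ne_zero hB hc hp (fun i => ?_) hq fun hk =>
      hirr (R.containsHyperplane hB h0 h1 hl hk)
    simpa [Pi.single_apply] using hl (Pi.single i 1)
  · push Not at hl
    obtain ⟨z₂, hz₂⟩ := hl
    obtain ⟨s, hs1, hs2⟩ := exists_quadratic_ne_zero
      (b := 2 * B (∑ i, z₁ i • ζ i) (∑ i, z₂ i • ζ i) q)
      (c := B (∑ i, z₂ i • ζ i) (∑ i, z₂ i • ζ i) q) (a' := B (∑ i, z₁ i • ζ i) p p) (c' := 0)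
      hq (Or.inl hz₂)
    have hsum : ∑ i, (z₁ + s • z₂) i • ζ i = ∑ i, z₁ i • ζ i + s • ∑ i, z₂ i • ζ i := by
      simp [add_smul, Finset.sum_add_distrib, Finset.smul_sum, smul_smul]
    refine R.lintegral_curvature_of_linear_ne_zero hB hc hp (z₀ := z₁ + s • z₂) ?_ ?_
    · rw [hsum, hB.sq_add]
      simp only [hB.smul_mid, hB.smul_left]
      intro h
      exact hs1 (by linear_combination h)
    · rw [hsum, hB.add_left]
      simp only [hB.smul_left]
      intro h
      exact hs2 (by linear_combination h)

/-- The coefficients of `z³`, `z²s` and `z²t` decide which scaling applies; exchanging `p` and `q`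
halves the number of cases. Absence of a hyperplane provides the higher coefficients. -/
theorem lintegral_curvature (hB : IsPolarization F B) (R : RankTwo B x ζ p q)
    (hirr : ¬ ContainsHyperplane B) :
    ∫⁻ x in regLink F, ENNReal.ofReal (curvature F B x)
      ∂(MeasureTheory.Measure.hausdorffMeasure 9) = ∞ := by
  by_cases h0 : ∀ z : Fin 3 → ℂ, B (∑ i, z i • ζ i) (∑ i, z i • ζ i) (∑ i, z i • ζ i) = 0
  swap
  · push Not at h0
    obtain ⟨z₀, hz₀⟩ := h0
    exact R.lintegral_curvature_of_cube_ne_zero hB hz₀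
  have hmem : ∀ z : Fin 3 → ℂ, ∑ i, z i • ζ i ∈ Submodule.span ℂ (Set.range ζ) := fun z =>
    Submodule.sum_mem _ fun i _ => Submodule.smul_mem _ _ (Submodule.subset_span ⟨i, rfl⟩)
  have hc : ∀ (z : Fin 3 → ℂ) i, B (∑ i, z i • ζ i) (∑ i, z i • ζ i) (ζ i) = 0 := fun z i =>
    hB.eq_zero_of_cube_eq_zero (S := Submodule.span ℂ (Set.range ζ)) (fun v hv => by
      obtain ⟨z, rfl⟩ := (Submodule.mem_span_range_iff_exists_fun ℂ).1 hv
      exact h0 z) (hmem z) (hmem z) (Submodule.subset_span ⟨i, rfl⟩)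
  have hpol : ∀ r, (∀ z : Fin 3 → ℂ, B (∑ i, z i • ζ i) (∑ i, z i • ζ i) r = 0) →
      ∀ (z : Fin 3 → ℂ) i, B (∑ i, z i • ζ i) (ζ i) r = 0 := by
    intro r h z i
    have h1 := h (z + Pi.single i 1)
    have h2 := h (Pi.single i 1)
    have e1 : ∑ j, (z + Pi.single i 1 : Fin 3 → ℂ) j • ζ j = ∑ j, z j • ζ j + ζ i := by
      simp [add_smul, Finset.sum_add_distrib, Pi.single_apply]
    have e2 : ∑ j, (Pi.single i 1 : Fin 3 → ℂ) j • ζ j = ζ i := by simp [Pi.single_apply]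
    rw [e1, hB.sq_add, h z] at h1
    rw [e2] at h2
    rw [h2] at h1
    linear_combination h1 / 2
  by_cases hp : ∀ z : Fin 3 → ℂ, B (∑ i, z i • ζ i) (∑ i, z i • ζ i) p = 0
  · by_cases hq : ∀ z : Fin 3 → ℂ, B (∑ i, z i • ζ i) (∑ i, z i • ζ i) q = 0
    · by_cases hn : ∀ i, B (ζ i) q q = 0
      · refine R.lintegral_curvature_of_singular_radical' hB hc (hpol p hp) (hpol q hq) hn fun hk =>
          hirr ((R.swap hB).containsHyperplane hB h0 hq (fun z => ?_) hk)
        rw [hB.sum_left]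
        simp [hB.smul_left, hn]
      · push Not at hn
        obtain ⟨i₀, hi₀⟩ := hn
        exact R.lintegral_curvature_of_singular_radical hB hc (hpol p hp) (hpol q hq) hi₀
    · push Not at hq
      obtain ⟨z₁, hz₁⟩ := hq
      exact R.lintegral_curvature_aux hB hirr h0 hc hp (hpol p hp) hz₁
  · push Not at hp
    obtain ⟨z₁, hz₁⟩ := hp
    by_cases hq : ∀ z : Fin 3 → ℂ, B (∑ i, z i • ζ i) (∑ i, z i • ζ i) q = 0
    · exact (R.swap hB).lintegral_curvature_aux hB hirr h0 hc hq (hpol q hq) hz₁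
    · push Not at hq
      obtain ⟨z₂, hz₂⟩ := hq
      obtain ⟨s, hs1, hs2⟩ := exists_quadratic_ne_zero
        (b := 2 * B (∑ i, z₁ i • ζ i) (∑ i, z₂ i • ζ i) p)
        (c := B (∑ i, z₂ i • ζ i) (∑ i, z₂ i • ζ i) p)
        (a' := B (∑ i, z₁ i • ζ i) (∑ i, z₁ i • ζ i) q)
        (b' := 2 * B (∑ i, z₁ i • ζ i) (∑ i, z₂ i • ζ i) q) hz₁ (Or.inr hz₂)
      have hsum : ∑ i, (z₁ + s • z₂) i • ζ i = ∑ i, z₁ i • ζ i + s • ∑ i, z₂ i • ζ i := by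
        simp [add_smul, Finset.sum_add_distrib, Finset.smul_sum, smul_smul]
      refine R.lintegral_curvature_of_sq_ne_zero hB h0 (z₀ := z₁ + s • z₂) ?_ ?_
      · rw [hsum, hB.sq_add]
        simp only [hB.smul_mid, hB.smul_left]
        intro h
        exact hs1 (by linear_combination h)
      · rw [hsum, hB.sq_add]
        simp only [hB.smul_mid, hB.smul_left]
        intro h
        exact hs2 (by linear_combination h)

end RankTwo

end CubicFourfold

/-! ### Cubics that contain a hyperplane -/

namespace CubicFourfold

variable {F : MvPolynomial (Fin 6) ℂ} {B : V → V → V → ℂ}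

/-- A basis of a subspace modulo one of its vectors. -/
theorem exists_basis_mod {O : Submodule ℂ V} {x : V} (hx : x ∈ O) (hx0 : x ≠ 0) {n : ℕ}
    (hn : Module.finrank ℂ O = n + 1) :
    ∃ ζ : Fin n → V, (∀ i, ζ i ∈ O) ∧
      (∀ (z : Fin n → ℂ) (c : ℂ), ∑ i, z i • ζ i = c • x → z = 0) ∧
      ∀ v ∈ O, ∃ (z : Fin n → ℂ) (c : ℂ), v = ∑ i, z i • ζ i + c • x := by
  let x' : O := ⟨x, hx⟩
  obtain ⟨Z, hZ⟩ := (ℂ ∙ x').exists_isCompl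
  have hx' : x' ≠ 0 := fun h => hx0 (congrArg Subtype.val h)
  have hZn : Module.finrank ℂ Z = n := by
    have := Submodule.finrank_add_eq_of_isCompl hZ
    rw [finrank_span_singleton hx'] at this
    omega
  let e := Module.finBasisOfFinrankEq ℂ Z hZn
  have hcoe : ∀ z : Fin n → ℂ, (∑ i, z i • ((e i : O) : V)) = (((∑ i, z i • e i : Z) : O) : V) := by
    intro z; simp
  refine ⟨fun i => ((e i : O) : V), fun i => (e i : O).2, ?_, ?_⟩
  · intro z c h
    rw [hcoe] at h
    have h1 : ((∑ i, z i • e i : Z) : O) = c • x' := Subtype.ext h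
    have h2 : ((∑ i, z i • e i : Z) : O) = 0 := by
      have h3 : ((∑ i, z i • e i : Z) : O) ∈ (ℂ ∙ x') ⊓ Z :=
        ⟨Submodule.mem_span_singleton.2 ⟨c, h1.symm⟩, (∑ i, z i • e i : Z).2⟩
      rwa [hZ.inf_eq_bot, Submodule.mem_bot] at h3
    have h3 : (∑ i, z i • e i : Z) = 0 := Subtype.ext h2
    exact funext fun i => Fintype.linearIndependent_iff.1 e.linearIndependent z h3 i
  · intro v hv
    have h1 : (⟨v, hv⟩ : O) ∈ (ℂ ∙ x') ⊔ Z := by rw [hZ.sup_eq_top]; trivial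
    obtain ⟨a, ha, w, hw, haw⟩ := Submodule.mem_sup.1 h1
    obtain ⟨c, rfl⟩ := Submodule.mem_span_singleton.1 ha
    refine ⟨fun i => e.repr ⟨w, hw⟩ i, c, ?_⟩
    rw [hcoe, e.sum_repr]
    have := congrArg Subtype.val haw
    rw [add_comm]
    exact this.symm

/-- The cubic form is the product of the linear form `L` and the quadratic form `q`. -/
structure IsProduct (B : V → V → V → ℂ) (L : V →ₗ[ℂ] ℂ) (q : V →ₗ[ℂ] V →ₗ[ℂ] ℂ) : Prop where
  ne_zero : L ≠ 0
  symm : ∀ u v, q u v = q v u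
  eq : ∀ u v w, B u v w = (L u * q v w + L v * q u w + L w * q u v) / 3

/-- With `L w = 1` the vectors `u - L u • w` lie in the hyperplane, on which the trilinear form
vanishes. Expanding this gives `B` in terms of `L` and of the values of `B` with an argument `w`,
and these are collected in `q`. -/
theorem ContainsHyperplane.exists_isProduct (hB : IsPolarization F B) (h : ContainsHyperplane B) :
    ∃ L q, IsProduct B L q := by
  obtain ⟨L, hL, h0⟩ := h
  obtain ⟨w', hw'⟩ : ∃ w, L w ≠ 0 := by
    by_contra! hcon
    exact hL (LinearMap.ext hcon)
  obtain ⟨w, hw⟩ : ∃ w, L w = 1 := ⟨(L w')⁻¹ • w', by simp [hw']⟩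
  let q : V →ₗ[ℂ] V →ₗ[ℂ] ℂ := LinearMap.mk₂ ℂ
    (fun u v => 3 * B u v w - 3 / 2 * (L u * B v w w + L v * B u w w) + L u * L v * B w w w)
    (fun u u' v => by rw [hB.add_left, hB.add_left, map_add]; ring)
    (fun c u v => by rw [hB.smul_left, hB.smul_left, map_smul, smul_eq_mul, smul_eq_mul]; ring)
    (fun u v v' => by rw [hB.add_mid, hB.add_left, map_add]; ring)
    (fun c u v => by rw [hB.smul_mid, hB.smul_left, map_smul, smul_eq_mul, smul_eq_mul]; ring)
  have hq : ∀ u v, q u v =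
    3 * B u v w - 3 / 2 * (L u * B v w w + L v * B u w w) + L u * L v * B w w w := fun u v => rfl
  refine ⟨L, q, hL, fun u v => ?_, fun u v z => ?_⟩
  · rw [hq, hq, hB.swap12 u v]; ring
  · have hk : ∀ u, u - L u • w ∈ LinearMap.ker L := fun u => by simp [hw]
    have h1 := hB.eq_zero_of_cube_eq_zero (S := LinearMap.ker L) (fun v hv => h0 v hv) (hk u) (hk v)
      (hk z)
    simp only [sub_eq_add_neg, ← neg_smul, hB.add_left, hB.add_mid, hB.add_right, hB.smul_left,
      hB.smul_mid, hB.smul_right] at h1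
    rw [hB.swap12 w v z, hB.swap12 w v w, hB.swap23 w w z, hB.swap12 w z w, hB.swap23 u w z,
      hB.swap23 v w z, hB.swap23 u w w] at h1
    rw [hq, hq, hq]
    linear_combination h1

namespace IsProduct

variable {L : V →ₗ[ℂ] ℂ} {q : V →ₗ[ℂ] V →ₗ[ℂ] ℂ}

/-- The factors of the cubic meet transversally at `x`. -/
theorem lintegral_curvature_of_transversal (hB : IsPolarization F B)
    (hplanes : ¬ IsUnionOfHyperplanes F) (h : IsProduct B L q) {x y : V} (hxL : L x = 0)
    (hyL : L y = 0) (hxx : q x x = 0) (hyy : q y y = 0) (hxy : q x y = 1) :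
    ∫⁻ x in regLink F, ENNReal.ofReal (curvature F B x)
      ∂(MeasureTheory.Measure.hausdorffMeasure 9) = ∞ := by
  have hyx : q y x = 1 := by rw [h.symm, hxy]
  obtain ⟨w₀, hw₀⟩ : ∃ w, L w ≠ 0 := by
    by_contra! hcon
    exact h.ne_zero (LinearMap.ext hcon)
  let w : V := (L w₀)⁻¹ • (w₀ - q w₀ y • x - q w₀ x • y)
  have hwL : L w = 1 := by simp [w, hxL, hyL, hw₀]
  have hxw : q x w = 0 := by simp [w, hxx, hxy, h.symm x w₀]
  have hyw : q y w = 0 := by simp [w, hyy, hyx, h.symm y w₀]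
  let f : V →ₗ[ℂ] (Fin 3 → ℂ) := LinearMap.pi ![q x, q y, L]
  have hsurj : LinearMap.range f = ⊤ := by
    refine LinearMap.range_eq_top.2 fun t => ⟨t 0 • y + t 1 • x + t 2 • w, ?_⟩
    ext i
    fin_cases i
    · simp [f, hxx, hxy, hxw]
    · simp [f, hyy, hyx, hyw]
    · simp [f, hxL, hyL, hwL]
  have hfin := f.finrank_range_add_finrank_ker
  rw [hsurj, finrank_top, Module.finrank_pi, finrank_euclideanSpace, Fintype.card_fin,
    Fintype.card_fin] at hfin
  let e := Module.finBasisOfFinrankEq ℂ (LinearMap.ker f) (show _ = 3 by omega)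
  have he : ∀ i, q x (e i) = 0 ∧ q y (e i) = 0 ∧ L (e i) = 0 := fun i => by
    have h1 : f (e i) = 0 := (e i).2
    exact ⟨congrFun h1 0, congrFun h1 1, congrFun h1 2⟩
  let b : Option (Fin 3) → V := fun o => o.elim w fun i => e i
  have hbx : ∀ o, q x (b o) = 0 := by rintro (_ | i); exacts [hxw, (he i).1]
  have hby : ∀ o, q y (b o) = 0 := by rintro (_ | i); exacts [hyw, (he i).2.1]
  have hx0 : x ≠ 0 := by rintro rfl; simp at hxy
  -- If `q` vanished on the span of the `b o`, it would be the product of the linear forms `2 q x`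
  -- and `q y`, and `F` a product of three linear forms.
  obtain ⟨j, k, hjk⟩ : ∃ j k, q (b j) (b k) ≠ 0 := by
    by_contra! hcon
    apply hplanes
    refine isUnionOfHyperplanes_of_eq_mul hB (LinearMap.toContinuousLinearMap L)
      (LinearMap.toContinuousLinearMap ((2 : ℂ) • q x)) (LinearMap.toContinuousLinearMap (q y))
      fun v => ?_
    let v' : V := v - q y v • x - q x v • y - L v • w
    have hv' : v' ∈ LinearMap.ker f := by
      rw [LinearMap.mem_ker]
      ext i
      fin_cases i
      · simp [f, v', hxx, hxy, hxw]
      · simp [f, v', hyy, hyx, hyw]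
      · simp [f, v', hxL, hyL, hwL]
    have hv : v = q y v • x + q x v • y +
        (L v • w + ∑ i, e.repr ⟨v', hv'⟩ i • (e i : V)) := by
      have h1 : (∑ i, e.repr ⟨v', hv'⟩ i • (e i : V)) = v' := by
        have h2 := congrArg Subtype.val (e.sum_repr ⟨v', hv'⟩)
        rw [Submodule.coe_sum] at h2
        exact h2
      rw [h1]
      simp only [v']
      abel
    set r := L v • w + ∑ i, e.repr ⟨v', hv'⟩ i • (e i : V) with hr
    have hr' : r = ∑ o : Option (Fin 3), (o.elim (L v) (e.repr ⟨v', hv'⟩)) • b o := by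
      rw [Fintype.sum_option, hr]
      rfl
    have hxr : q x r = 0 := by rw [hr', map_sum]; simp [hbx]
    have hyr : q y r = 0 := by rw [hr', map_sum]; simp [hby]
    have hrr : q r r = 0 := by
      rw [hr']
      simp only [map_sum, LinearMap.sum_apply, map_smul, LinearMap.smul_apply, hcon]
      simp
    have hqv : q v v = 2 * q x v * q y v := by
      conv_lhs => rw [hv]
      simp only [map_add, map_smul, LinearMap.add_apply, LinearMap.smul_apply, smul_eq_mul, hxx, hyy,
        hxy, hyx, hxr, hyr, hrr, h.symm r x, h.symm r y]
      ring
    rw [h.eq, hqv]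
    simp only [LinearMap.coe_toContinuousLinearMap', LinearMap.smul_apply, smul_eq_mul]
    ring
  let z : (ℝ × (Option (Fin 3) → ℂ)) × ℂ → V := fun r =>
    ∑ o : Option (Fin 3), ((r.1.1 : ℂ) ^ (o.elim 1 fun _ => 0 : ℕ) * r.1.2 o) • b o
  have hz : ∀ r o, q (z r) (b o) = ∑ o', ((r.1.1 : ℂ) ^ (o'.elim 1 fun _ => 0 : ℕ) * r.1.2 o') *
      q (b o') (b o) := fun r o => by
    simp [z]
  have hzz : ∀ r, q (z r) (z r) = ∑ o, ((r.1.1 : ℂ) ^ (o.elim 1 fun _ => 0 : ℕ) * r.1.2 o) *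
      q (z r) (b o) := fun r => by
    conv_lhs => arg 2; simp only [z]
    simp
  have hxz : ∀ r, q x (z r) = 0 := fun r => by simp only [z]; rw [map_sum]; simp [hbx]
  have hyz : ∀ r, q y (z r) = 0 := fun r => by simp only [z]; rw [map_sum]; simp [hby]
  have hLz : ∀ r, L (z r) = (r.1.1 : ℂ) * r.1.2 none := fun r => by
    simp only [z]
    rw [Fintype.sum_option, map_add, map_sum]
    simp [b, hwL, he]
  let pt : (ℝ × (Option (Fin 3) → ℂ)) × ℂ → V := fun r => x + (z r + r.2 • y)
  have hLpt : ∀ r, L (pt r) = (r.1.1 : ℂ) * r.1.2 none := fun r => by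
    simp [pt, hxL, hyL, hLz]
  have hqy : ∀ r, q (pt r) y = 1 := fun r => by
    simp [pt, hxy, hyy, h.symm (z r) y, hyz]
  have hqb : ∀ r o, q (pt r) (b o) = q (z r) (b o) := fun r o => by
    simp [pt, hbx, hby]
  have hqq : ∀ r, q (pt r) (pt r) = 2 * r.2 + q (z r) (z r) := fun r => by
    simp only [pt, map_add, map_smul, LinearMap.add_apply, LinearMap.smul_apply, smul_eq_mul, hxx,
      hyx, hxy, hyy, hxz, hyz, h.symm (z r) x, h.symm (z r) y]
    ring
  have hzc : ∀ o, ContDiff ℝ 1 fun r => q (z r) (b o) := fun o => by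
    simp only [hz]
    fun_prop
  have hzzc : ContDiff ℝ 1 fun r => q (z r) (z r) := by
    simp only [hzz]
    exact ContDiff.sum fun o _ => ContDiff.mul (by fun_prop) (hzc o)
  have hz0 : ∀ T, z ((0, fun o => o.elim 1 fun _ => 0), T) = 0 := fun T => by
    simp only [z]
    rw [Fintype.sum_option]
    simp
  have hNc : Continuous fun r : (ℝ × (Option (Fin 3) → ℂ)) × ℂ => r.1.2 none := by fun_prop
  -- The points lie on the quadric `q = 0` and approach the hyperplane with `L = ρ` to first order.
  -- There `dF = L dq`, and the Hessian of `F` on the kernel of `dq` is `L` times that of `q`. So `a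
  -- = m = 1`, with a single weight 1.
  refine CubicFourfold.lintegral_curvature_of_scaling hB (ι := Option (Fin 3)) (by simp) hx0
    (b := b) (bt := y) ?_ (fun o => o.elim 1 fun _ => 0) (a := 1) (m := 1)
    ?_ (Z₀ := fun o => o.elim 1 fun _ => 0) (T₀ := 0) ⟨none, one_ne_zero, one_ne_zero⟩ ?_
    (τ := fun r => r.2) continuousAt_snd rfl (pt := pt) (fun r => rfl)
    (P := fun r => 2 * r.2 + q (z r) (z r)) ?_ ?_ (D := 2) ?_ two_ne_zero ?_
    (g := fun o r => 2 / 3 * r.1.2 none * q (z r) (b o)) ?_ ?_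
    (gt := fun r => 2 / 3 * r.1.2 none) (Continuous.continuousAt (by fun_prop)) ?_ ?_ j k
    (K := fun r => 1 / 3 * r.1.2 none * (2 / 3 * r.1.2 none) ^ 2 * q (b j) (b k))
    (Continuous.continuousAt (by fun_prop)) ?_ ?_
  · intro t s c hts
    have h1 : s = 0 := by
      have := congrArg (q x) hts
      rw [map_add, map_sum] at this
      simpa [hbx, hxy, hxx] using this
    have h2 : c = 0 := by
      have := congrArg (q y) hts
      rw [map_add, map_sum] at this
      simpa [hby, hyy, hyx] using this.symm
    have h3 : t none = 0 := by
      have := congrArg L hts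
      rw [map_add, map_sum, Fintype.sum_option] at this
      simpa [b, hwL, he, hyL, hxL] using this
    rw [Fintype.sum_option, h1, h2, h3] at hts
    have h4 : (∑ i, t (some i) • e i) = 0 := Subtype.ext (by simpa [b] using hts)
    have h5 := Fintype.linearIndependent_iff.1 e.linearIndependent _ h4
    refine ⟨funext fun o => ?_, h1⟩
    cases o with
    | none => exact h3
    | some i => exact h5 i
  · rw [Fintype.sum_option]
    simp
  · rintro (_ | i) h
    · exact absurd h one_ne_zero
    · rfl
  · exact (ContDiff.add (by fun_prop) hzzc).contDiffAt
  · simp [hz0]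
  · simp only [hz0]
    simpa using (hasDerivAt_id (0 : ℂ)).const_mul 2
  · intro r hr
    rw [h.eq, hqq, hr]
    ring
  · intro o
    exact ((continuous_const.mul hNc).mul (hzc o).continuous).continuousAt
  · intro o r hr
    rw [h.eq, hqq, hr, hqb, hLpt]
    ring
  · intro r hr
    rw [h.eq, hqq, hr, hqy, hLpt]
    ring
  · simp
  · simpa using hjk
  · intro r hr
    simp only [h.eq, hqb, hqy, hLpt, hyL, hby, hyy, h.symm _ y]
    ring

/-- The quadric is tangent to the hyperplane at `x`. -/
theorem lintegral_curvature_of_tangent (hB : IsPolarization F B)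
    (h : IsProduct B L q) {x m : V} (hxL : L x = 0) (hmL : L m = 0) (hmm : q m m ≠ 0) {c : ℂ}
    (hc : c ≠ 0) (hx : ∀ v, q x v = c * L v) :
    ∫⁻ x in regLink F, ENNReal.ofReal (curvature F B x)
      ∂(MeasureTheory.Measure.hausdorffMeasure 9) = ∞ := by
  obtain ⟨w₀, hw₀⟩ : ∃ w, L w ≠ 0 := by
    by_contra! hcon
    exact h.ne_zero (LinearMap.ext hcon)
  obtain ⟨w, hwL⟩ : ∃ w, L w = 1 := ⟨(L w₀)⁻¹ • w₀, by simp [hw₀]⟩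
  have hx0 : x ≠ 0 := by
    rintro rfl
    have := hx w
    simp [hwL, hc.symm] at this
  have hfin := L.finrank_range_add_finrank_ker
  rw [LinearMap.range_eq_top.2 (LinearMap.surjective h.ne_zero), finrank_top, Module.finrank_self,
    finrank_euclideanSpace, Fintype.card_fin] at hfin
  obtain ⟨b, hbL, hbi, hbs⟩ := exists_basis_mod (O := LinearMap.ker L) (n := 4) hxL hx0 (by omega)
  have hbL' : ∀ i, L (b i) = 0 := hbL
  have hxb : ∀ i, q x (b i) = 0 := fun i => by rw [hx, hbL', mul_zero]
  obtain ⟨z₀, c₀, hz₀⟩ := hbs m hmL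
  have hxs : ∀ t : Fin 4 → ℂ, q x (∑ i, t i • b i) = 0 := fun t => by rw [map_sum]; simp [hxb]
  have hzz₀ : q (∑ i, z₀ i • b i) (∑ i, z₀ i • b i) ≠ 0 := by
    have hxx : q x x = 0 := by rw [hx, hxL, mul_zero]
    rw [hz₀] at hmm
    simpa only [map_add, LinearMap.add_apply, map_smul, LinearMap.smul_apply, smul_eq_mul, hxs,
      hxx, h.symm _ x, mul_zero, add_zero] using hmm
  obtain ⟨j, k, hjk⟩ : ∃ j k, q (b j) (b k) ≠ 0 := by
    by_contra! hcon
    apply hzz₀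
    simp only [map_sum, LinearMap.sum_apply, map_smul, LinearMap.smul_apply, hcon]
    simp
  let z : (ℝ × (Fin 4 → ℂ)) × ℂ → V := fun r => ∑ i, r.1.2 i • b i
  let σ : (ℝ × (Fin 4 → ℂ)) × ℂ → ℂ := fun r => (r.1.1 : ℂ)
  have hσ : ContDiff ℝ 1 σ := by fun_prop
  let pt : (ℝ × (Fin 4 → ℂ)) × ℂ → V := fun r => x + (σ r • z r + (σ r ^ 2 * r.2) • w)
  have hzv : ∀ r v, q (z r) v = ∑ i, r.1.2 i * q (b i) v := fun r v => by simp [z]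
  have hzz : ∀ r, q (z r) (z r) = ∑ i, r.1.2 i * q (z r) (b i) := fun r => by
    conv_lhs => arg 2; simp only [z]
    simp
  have hzc : ∀ v, ContDiff ℝ 1 fun r => q (z r) v := fun v => by
    simp only [hzv]
    fun_prop
  have hzzc : ContDiff ℝ 1 fun r => q (z r) (z r) := by
    simp only [hzz]
    exact ContDiff.sum fun o _ => ContDiff.mul (by fun_prop) (hzc _)
  have hLz : ∀ r, L (z r) = 0 := fun r => by simp only [z]; rw [map_sum]; simp [hbL']
  have hLpt : ∀ r, L (pt r) = σ r ^ 2 * r.2 := fun r => by simp [pt, hxL, hLz, hwL]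
  have hqv : ∀ r v, q (pt r) v = q x v + σ r * q (z r) v + σ r ^ 2 * r.2 * q w v := fun r v => by
    simp only [pt, map_add, map_smul, LinearMap.add_apply, LinearMap.smul_apply, smul_eq_mul]
    ring
  have hqvc : ∀ v, Continuous fun r => q (pt r) v := fun v => by
    simp only [hqv]
    exact (continuous_const.add (hσ.continuous.mul (hzc v).continuous)).add
      (((hσ.continuous.pow 2).mul continuous_snd).mul continuous_const)
  have hqq : ∀ r, q (pt r) (pt r) = σ r ^ 2 * (2 * c * r.2 + (q (z r) (z r) +
      (2 * (σ r * r.2 * q (z r) w) + σ r ^ 2 * r.2 ^ 2 * q w w))) := fun r => by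
    have hxx : q x x = 0 := by rw [hx, hxL, mul_zero]
    have hxz : q x (z r) = 0 := hxs _
    have hxw : q x w = c := by rw [hx, hwL, mul_one]
    conv_lhs => arg 2; simp only [pt]
    simp only [map_add, map_smul, hqv, smul_eq_mul, hxx, hxz, hxw, h.symm (z r) x, h.symm w x,
      h.symm w (z r)]
    ring
  set E := q (∑ i, z₀ i • b i) (∑ i, z₀ i • b i) with hE
  have hz0 : ∀ T, z ((0, z₀), T) = ∑ i, z₀ i • b i := fun T => rfl
  have hσ0 : ∀ T, σ ((0, z₀), T) = 0 := fun T => rfl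
  have hpt0 : ∀ T, pt ((0, z₀), T) = x := fun T => by simp [pt, hσ0]
  obtain ⟨i₀, hi₀⟩ : ∃ i, z₀ i ≠ 0 := by
    by_contra! hcon
    exact hzz₀ (by simp [hE, hcon])
  -- On the quadric `2cT + q z z = 0` to leading order, so `L` has order 2, and with it gradient and
  -- Hessian. The four weights 1 give the equality `4 + 2 = 3 * 2`.
  refine CubicFourfold.lintegral_curvature_of_scaling hB (ι := Fin 4) (by simp) hx0
    (b := b) (bt := w) ?_ (fun _ => 1) (a := 2) (m := 2) (by simp) (Z₀ := z₀) (T₀ := -E / (2 * c))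
    ⟨i₀, one_ne_zero, hi₀⟩ (fun i hi => absurd hi one_ne_zero)
    (τ := fun r => σ r ^ 2 * r.2) ((hσ.continuous.pow 2).mul continuous_snd).continuousAt
    (by simp [hσ0]) (pt := pt) ?_
    (P := fun r => 2 * c * r.2 + (q (z r) (z r) + (2 * (σ r * r.2 * q (z r) w) +
      σ r ^ 2 * r.2 ^ 2 * q w w))) ?_ ?_ (D := 2 * c) ?_ (mul_ne_zero two_ne_zero hc) ?_
    (g := fun i r => 2 / 3 * r.2 * q (pt r) (b i)) ?_ ?_
    (gt := fun r => 2 / 3 * r.2 * q (pt r) w) ?_ ?_ ?_ j k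
    (K := fun r => 1 / 3 * r.2 * ((2 / 3 * r.2 * q (pt r) w) ^ 2 * q (b j) (b k) -
      (2 / 3 * r.2 * q (pt r) w) * (2 / 3 * r.2 * q (pt r) (b k)) * q (b j) w -
      (2 / 3 * r.2 * q (pt r) w) * (2 / 3 * r.2 * q (pt r) (b j)) * q w (b k) +
      (2 / 3 * r.2 * q (pt r) (b j)) * (2 / 3 * r.2 * q (pt r) (b k)) * q w w)) ?_ ?_ ?_
  · intro t s c' hts
    have h1 : s = 0 := by
      have := congrArg L hts
      rw [map_add, map_sum] at this
      simpa [hbL', hwL, hxL] using this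
    rw [h1, zero_smul, add_zero] at hts
    exact ⟨hbi t c' hts, h1⟩
  · intro r
    simp only [pt, z, σ, Finset.smul_sum, smul_smul, pow_one]
  · refine ContDiff.contDiffAt (ContDiff.add (by fun_prop) (hzzc.add ((contDiff_const.mul
      ((hσ.mul contDiff_snd).mul (hzc w))).add
      (((hσ.pow 2).mul (contDiff_snd.pow 2)).mul contDiff_const))))
  · simp only [hσ0, hz0, ← hE]
    field_simp
    ring
  · simp only [hσ0, hz0, ← hE]
    simpa using ((hasDerivAt_id (-E / (2 * c))).const_mul (2 * c)).add_const E
  · intro r hr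
    rw [h.eq, hqq, hr]
    ring
  · intro i
    exact ((continuous_const.mul continuous_snd).mul (hqvc _)).continuousAt
  · intro i r hr
    rw [h.eq, hqq, hr, hLpt]
    simp only [σ]
    ring
  · exact ((continuous_const.mul continuous_snd).mul (hqvc _)).continuousAt
  · intro r hr
    rw [h.eq, hqq, hr, hLpt]
    simp only [σ]
    ring
  · simp only [hpt0, hx, hwL]
    have : E ≠ 0 := hzz₀
    simp [hc, this]
  · have hg := (hqvc w)
    have hj := (hqvc (b j))
    have hk := (hqvc (b k))
    have hT : Continuous fun r : (ℝ × (Fin 4 → ℂ)) × ℂ => r.2 := continuous_snd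
    have hg' := (continuous_const (y := (2 / 3 : ℂ))).mul hT |>.mul hg
    have hj' := (continuous_const (y := (2 / 3 : ℂ))).mul hT |>.mul hj
    have hk' := (continuous_const (y := (2 / 3 : ℂ))).mul hT |>.mul hk
    exact ((continuous_const.mul hT).mul (((((hg'.pow 2).mul continuous_const).sub
      ((hg'.mul hk').mul continuous_const)).sub ((hg'.mul hj').mul continuous_const)).add
      ((hj'.mul hk').mul continuous_const))).continuousAt
  · simp only [hpt0, hx, hwL, hbL']
    have : E ≠ 0 := hzz₀
    simp [hc, this, hjk]
  · intro r hr
    simp only [h.eq, hLpt, σ]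
    ring

/-- Consider `q` on the kernel of `L`. An isotropic vector outside the radical of this restriction
gives a transversal point. If there is none, the restriction has rank at most one. For rank zero,
`F` is divisible by `L²`. For rank one, a vector of the radical of the restriction that is not in
the radical of `q` is a point of tangency. Failing this, `q` is a quadratic form in `L` and one
further linear form, which splits over `ℂ`. -/
theorem lintegral_curvature (hB : IsPolarization F B)
    (hplanes : ¬ IsUnionOfHyperplanes F) (h : IsProduct B L q) :
    ∫⁻ x in regLink F, ENNReal.ofReal (curvature F B x)
      ∂(MeasureTheory.Measure.hausdorffMeasure 9) = ∞ := by
  obtain ⟨w₀, hw₀⟩ : ∃ w, L w ≠ 0 := by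
    by_contra! hcon
    exact h.ne_zero (LinearMap.ext hcon)
  obtain ⟨w, hwL⟩ : ∃ w, L w = 1 := ⟨(L w₀)⁻¹ • w₀, by simp [hw₀]⟩
  have hdec : ∀ v, L (v - L v • w) = 0 := fun v => by simp [hwL]
  have hcube : ∀ v, B v v v = L v * q v v := fun v => by rw [h.eq]; ring
  by_cases h1 : ∃ x y, L x = 0 ∧ L y = 0 ∧ q x x = 0 ∧ q x y ≠ 0
  · obtain ⟨x, y, hx, hy, hxx, hxy⟩ := h1
    let y' : V := (q x y)⁻¹ • (y - (q y y / (2 * q x y)) • x)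
    refine h.lintegral_curvature_of_transversal hB hplanes (x := x) (y := y') hx ?_ hxx ?_ ?_
    · simp [y', hx, hy]
    · simp only [y', map_sub, map_smul, LinearMap.sub_apply, LinearMap.smul_apply, smul_eq_mul, hxx,
        h.symm y x]
      field_simp
      ring
    · simp [y', hxx, hxy]
  push Not at h1
  by_cases h2 : ∃ m, L m = 0 ∧ q m m ≠ 0
  swap
  · push Not at h2
    exfalso
    apply hplanes
    refine isUnionOfHyperplanes_of_eq_mul hB (LinearMap.toContinuousLinearMap L)
      (LinearMap.toContinuousLinearMap L)
      (LinearMap.toContinuousLinearMap ((2 : ℂ) • q w - q w w • L)) fun v => ?_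
    have h3 := h2 _ (hdec v)
    simp only [map_sub, map_smul, LinearMap.sub_apply, LinearMap.smul_apply, smul_eq_mul,
      h.symm v w] at h3
    simp only [LinearMap.coe_toContinuousLinearMap', hcube, LinearMap.sub_apply,
      LinearMap.smul_apply, smul_eq_mul]
    linear_combination L v * h3
  obtain ⟨m, hm, hmm⟩ := h2
  have hiso : ∀ n, L n = 0 → q m n = 0 → q n n = 0 := by
    intro n hn hmn
    by_contra hnn
    -- For non-isotropic `n` perpendicular to `m`, this `s` makes `m + s n` isotropic but not
    -- perpendicular to `m`, contrary to `h1`.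
    obtain ⟨s, hs⟩ := IsAlgClosed.exists_pow_nat_eq (-(q m m) / q n n) two_pos
    refine hmm ?_
    have h3 := h1 (m + s • n) m (by simp [hm, hn]) hm ?_
    · simpa [hmn, h.symm n m] using h3
    · simp only [map_add, map_smul, LinearMap.add_apply, LinearMap.smul_apply, smul_eq_mul, hmn,
        h.symm n m]
      have : s * s * q n n = -(q m m) := by
        rw [← sq, hs]
        field_simp
      linear_combination this
  have hrad : ∀ n, L n = 0 → q m n = 0 → ∀ v, q n v = q n w * L v := by
    intro n hn hmn v
    have h3 := h1 n _ hn (hdec v) (hiso n hn hmn)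
    simp only [map_sub, map_smul, smul_eq_mul] at h3
    linear_combination h3
  by_cases h3 : ∃ n, L n = 0 ∧ q m n = 0 ∧ q n w ≠ 0
  · obtain ⟨n, hn, hmn, hnw⟩ := h3
    exact h.lintegral_curvature_of_tangent hB hn hm hmm hnw (hrad n hn hmn)
  push Not at h3
  exfalso
  apply hplanes
  obtain ⟨δ, hδ⟩ := IsAlgClosed.exists_pow_nat_eq
    ((q m w / q m m) ^ 2 - q w w / q m m) two_pos
  let M : V →ₗ[ℂ] ℂ := (q m m)⁻¹ • (q m - q m w • L)
  refine isUnionOfHyperplanes_of_eq_mul hB (LinearMap.toContinuousLinearMap L)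
    (LinearMap.toContinuousLinearMap (q m m • (M + (q m w / q m m + δ) • L)))
    (LinearMap.toContinuousLinearMap (M + (q m w / q m m - δ) • L)) fun v => ?_
  have hMv : M v = (q m m)⁻¹ * (q m v - q m w * L v) := by simp [M]
  let n : V := v - L v • w - M v • m
  have hnL : L n = 0 := by simp [n, hwL, hm]
  have hmn : q m n = 0 := by
    simp only [n, map_sub, map_smul, smul_eq_mul, hMv]
    field_simp
    ring
  have hn0 : ∀ u, q n u = 0 := fun u => by rw [hrad n hnL hmn, h3 n hnL hmn, zero_mul]
  have hv : v = L v • w + M v • m + n := by simp only [n]; abel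
  have hqv : q v v = L v ^ 2 * q w w + 2 * L v * M v * q m w + M v ^ 2 * q m m := by
    conv_lhs => rw [hv]
    simp only [map_add, map_smul, LinearMap.add_apply, LinearMap.smul_apply, smul_eq_mul, hn0,
      h.symm _ n, h.symm w m]
    ring
  rw [hcube, hqv]
  simp only [LinearMap.coe_toContinuousLinearMap', LinearMap.add_apply, LinearMap.smul_apply,
    smul_eq_mul]
  have hA : q w w = q m m * ((q m w / q m m) ^ 2 - δ ^ 2) := by
    rw [hδ]
    field_simp
    ring
  rw [hA]
  field_simp
  ring

end IsProduct

end CubicFourfold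

/-! ### Hessian of rank one -/

namespace CubicFourfold

variable {F : MvPolynomial (Fin 6) ℂ} {B : V → V → V → ℂ}

theorem finrank_ker_add {n : ℕ} {f : V →ₗ[ℂ] (Fin n → ℂ)} (hf : Function.Surjective f) :
    Module.finrank ℂ (LinearMap.ker f) + n = 6 := by
  have h := f.finrank_range_add_finrank_ker
  rw [LinearMap.range_eq_top.2 hf, finrank_top, Module.finrank_pi, finrank_euclideanSpace,
    Fintype.card_fin, Fintype.card_fin] at h
  omega

theorem exists_cubic_root (a b c : ℂ) {d : ℂ} (hd : d ≠ 0) :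
    ∃ s : ℂ, a + b * s + c * s ^ 2 + d * s ^ 3 = 0 := by
  open Polynomial in
  let P : ℂ[X] := C d * X ^ 3 + C c * X ^ 2 + C b * X + C a
  have hP : P.degree = 3 := Polynomial.degree_cubic hd
  obtain ⟨s, hs⟩ := IsAlgClosed.exists_root P (by rw [hP]; decide)
  refine ⟨s, ?_⟩
  simp only [P, Polynomial.IsRoot, Polynomial.eval_add, Polynomial.eval_mul, Polynomial.eval_C,
    Polynomial.eval_pow, Polynomial.eval_X] at hs
  linear_combination hs

namespace IsPolarization

/-- A cubic form without regular zeros is the cube of a linear form. -/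
theorem exists_regular_zero_or_cube (hB : IsPolarization F B) (S : Submodule ℂ V) :
    (∀ v ∈ S, B v v v = 0) ∨ (∃ p ∈ S, ∃ t ∈ S, B p p p = 0 ∧ B p p t ≠ 0) ∨
      ∃ b ∈ S, B b b b ≠ 0 ∧ ∀ a ∈ S, B a a a = B b b b * (B a b b / B b b b) ^ 3 := by
  by_cases h0 : ∀ v ∈ S, B v v v = 0
  · exact Or.inl h0
  right
  push Not at h0
  obtain ⟨b, hb, hbb⟩ := h0
  by_cases h1 : ∃ p ∈ S, ∃ t ∈ S, B p p p = 0 ∧ B p p t ≠ 0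
  · exact Or.inl h1
  right
  push Not at h1
  refine ⟨b, hb, hbb, fun a ha => ?_⟩
  -- The vector `a` is moved along `b` to a zero `p`, where `B p p b = 0` as no zero is regular. The
  -- further zero `p + r b` on the same line is not regular either, which forces `B p b b = 0`. So
  -- the cubic on this line is a cube.
  obtain ⟨s, hs⟩ := exists_cubic_root (B a a a) (3 * B a a b) (3 * B a b b) hbb
  have hcub : ∀ (a : V) (s : ℂ), B (a + s • b) (a + s • b) (a + s • b) =
      B a a a + 3 * B a a b * s + 3 * B a b b * s ^ 2 + B b b b * s ^ 3 := fun a s => by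
    rw [hB.cube_add]
    simp only [hB.smul_left, hB.smul_mid, hB.smul_right]
    ring
  set p := a + s • b with hp
  have hpS : p ∈ S := S.add_mem ha (S.smul_mem s hb)
  have hpp : B p p p = 0 := by rw [hp, hcub]; exact hs
  have hppb : B p p b = 0 := h1 p hpS b hb hpp
  have hpbb : B p b b = 0 := by
    set r := -3 * B p b b / B b b b with hr
    have hr' : B b b b * r = -3 * B p b b := by rw [hr]; field_simp
    have h2 : B (p + r • b) (p + r • b) (p + r • b) = 0 := by
      rw [hcub, hpp, hppb]
      linear_combination r ^ 2 * hr'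
    have h3 := h1 _ (S.add_mem hpS (S.smul_mem r hb)) b hb h2
    rw [hB.sq_add, hppb] at h3
    simp only [hB.smul_left, hB.smul_mid] at h3
    have h4 : B p b b * r = 0 := by linear_combination r * hr' - h3
    rcases mul_eq_zero.1 h4 with h | h
    · exact h
    · rw [h] at hr'
      linear_combination hr' / 3
  have ha' : a = p + (-s) • b := by rw [hp, neg_smul]; abel
  have h2 : B a b b = -s * B b b b := by
    rw [ha', hB.add_left, hB.smul_left, hpbb, zero_add]
  rw [h2, mul_div_cancel_right₀ _ hbb]
  rw [ha', hcub, hpp, hppb, hpbb]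
  ring

/-- The radical of a cubic form that is a cube. -/
theorem eq_zero_of_cube (hB : IsPolarization F B) {S : Submodule ℂ V} {b : V}
    (hcube : ∀ a ∈ S, B a a a = B b b b * (B a b b / B b b b) ^ 3) {s u v : V} (hs : s ∈ S)
    (hsb : B s b b = 0) (hu : u ∈ S) (hv : v ∈ S) : B s u v = 0 := by
  have hsc : ∀ c : ℂ, B (c • s) b b = 0 := fun c => by rw [hB.smul_left, hsb, mul_zero]
  have h1 : ∀ a ∈ S, ∀ c : ℂ, 3 * B a a s * c + 3 * B a s s * c ^ 2 + B s s s * c ^ 3 = 0 := by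
    intro a ha c
    have h2 := hcube _ (S.add_mem ha (S.smul_mem c hs))
    rw [hB.add_left a _ b b, hsc, add_zero, ← hcube a ha, hB.cube_add] at h2
    simp only [hB.smul_left, hB.smul_mid, hB.smul_right] at h2
    linear_combination h2
  have h2 : ∀ a ∈ S, B a a s = 0 := fun a ha => by
    have e1 := h1 a ha 1
    have e2 := h1 a ha (-1)
    have e3 := h1 a ha 2
    linear_combination e1 / 3 - e2 / 9 - e3 / 18
  have h3 := h2 _ (S.add_mem hu hv)
  rw [hB.sq_add, h2 u hu, h2 v hv] at h3
  rw [hB.swap13, hB.swap12]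
  linear_combination h3 / 2

end IsPolarization

/-- The quadratic form `B x · ·` is of rank one. -/
structure RankOne (B : V → V → V → ℂ) (x u : V) : Prop where
  ne_zero : x ≠ 0
  singular : ∀ v, B x x v = 0
  uu : B x u u = 1
  radical : ∀ v, B x u v = 0 → ∀ w, B x v w = 0

namespace RankOne

variable {x u : V}

/-- The equation is `3n²` plus the cubic, `n` being the coordinate of `u`. For weight 2 of `n` and 1
of the radical, the cubic on the radical is the leading part, and the gradient has order 2 by
regularity of `p`. The Hessian on the tangent vector `u - (…) t` tends to `B x u u = 1`, since `t`
is in the radical. So `a = 2`, `m = 0`, and the weights have sum `5 ≤ 6`. -/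
theorem lintegral_curvature_of_regular_zero (hB : IsPolarization F B) (R : RankOne B x u) {p t : V}
    (hp : B x u p = 0) (ht : B x u t = 0) (hpp : B p p p = 0) (hpt : B p p t ≠ 0) :
    ∫⁻ x in regLink F, ENNReal.ofReal (curvature F B x)
      ∂(MeasureTheory.Measure.hausdorffMeasure 9) = ∞ := by
  let f : V →ₗ[ℂ] (Fin 2 → ℂ) := LinearMap.pi ![hB.lin x u, hB.lin p p]
  have hf0 : ∀ v, f v 0 = B x u v := fun v => rfl
  have hf1 : ∀ v, f v 1 = B p p v := fun v => rfl
  have hsurj : Function.Surjective f := fun c => by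
    refine ⟨c 0 • u + ((c 1 - c 0 * B p p u) / B p p t) • t, ?_⟩
    ext i
    fin_cases i
    · simp only [Fin.zero_eta, hf0, hB.add_right, hB.smul_right, R.uu, ht]
      ring
    · simp only [Fin.mk_one, hf1, hB.add_right, hB.smul_right]
      field_simp
      ring
  have hfin := finrank_ker_add hsurj
  have hmem : ∀ v, v ∈ LinearMap.ker f ↔ B x u v = 0 ∧ B p p v = 0 := fun v => by
    rw [LinearMap.mem_ker, ← hf0, ← hf1, funext_iff, Fin.forall_fin_two]
    rfl
  have hxp : ∀ v, B x p v = 0 := R.radical p hp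
  have hppx : B p p x = 0 := by rw [hB.swap13, hxp]
  have hxO : x ∈ LinearMap.ker f := (hmem x).2 ⟨by rw [hB.swap23, R.singular], hppx⟩
  obtain ⟨ζ, hζ, hζi, hζs⟩ := exists_basis_mod hxO R.ne_zero (n := 3) (by omega)
  obtain ⟨z₀, c, hz⟩ := hζs p ((hmem p).2 ⟨hp, hpp⟩)
  -- `p` is taken modulo `x`. As `p` and `x` both lie in the radical, this does not affect `B p p`.
  set p' := ∑ i, z₀ i • ζ i with hp'
  have hp'v : ∀ v, B p' p' v = B p p v := fun v => by
    have h1 : p' = p + (-c) • x := by rw [hz, neg_smul]; abel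
    rw [h1, hB.sq_add]
    simp only [hB.smul_left, hB.smul_mid, R.singular, hB.swap12 p x, hxp]
    ring
  have hp'p : B p' p' p' = 0 := by
    rw [hp'v, hp', hB.sum_right]
    simp [hB.smul_right, fun i => ((hmem _).1 (hζ i)).2]
  let b : Option (Fin 3) → V := fun o => o.elim u ζ
  let s : (ℝ × (Option (Fin 3) → ℂ)) × ℂ → V := fun y => ∑ i, y.1.2 (some i) • ζ i + y.2 • t
  have hs : ContDiff ℝ 1 s := by fun_prop
  let w : (ℝ × (Option (Fin 3) → ℂ)) × ℂ → V := fun y => s y + ((y.1.1 : ℂ) * y.1.2 none) • u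
  have hw : ContDiff ℝ 1 w := hs.add (by fun_prop)
  let pt : (ℝ × (Option (Fin 3) → ℂ)) × ℂ → V := fun y => x + (y.1.1 : ℂ) • w y
  have hptc : Continuous pt := by
    have := hw.continuous
    fun_prop
  have hw0 : ∀ T, w ((0, fun o => o.elim 1 z₀), T) = p' + T • t := fun T => by simp [w, s, hp']
  have hpt0 : ∀ T, pt ((0, fun o => o.elim 1 z₀), T) = x := fun T => by simp [pt]
  have hxs : ∀ y v, B x (s y) v = 0 := fun y v => by
    refine R.radical _ ?_ v
    simp only [s]
    rw [hB.add_right, hB.sum_right, hB.smul_right, ht]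
    simp [hB.smul_right, fun i => ((hmem _).1 (hζ i)).1]
  have hxw : ∀ y v, B x (w y) v = (y.1.1 : ℂ) * y.1.2 none * B x u v := fun y v => by
    simp only [w]
    rw [hB.add_mid, hB.smul_mid, hxs, zero_add]
  have hpt2 : ∀ y v, B (pt y) (pt y) v =
      (y.1.1 : ℂ) ^ 2 * (2 * y.1.2 none * B x u v + B (w y) (w y) v) := fun y v => by
    simp only [pt]
    rw [hB.sq_singular_add R.singular]
    simp only [hB.smul_mid, hB.smul_left, hxw]
    ring
  have hζu : ∀ i, B x u (ζ i) = 0 := fun i => ((hmem _).1 (hζ i)).1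
  have cw : ∀ v, Continuous fun y => B (w y) (w y) v := fun v =>
    hB.continuous_comp hw.continuous hw.continuous continuous_const
  have cpt : ∀ v v', Continuous fun y => B (pt y) v v' := fun v v' =>
    hB.continuous_comp hptc continuous_const continuous_const
  have cn : Continuous fun y : (ℝ × (Option (Fin 3) → ℂ)) × ℂ => y.1.2 none := by fun_prop
  refine CubicFourfold.lintegral_curvature_of_scaling hB (ι := Option (Fin 3)) (by simp) R.ne_zero
    (b := b) (bt := t) ?_ (fun o => o.elim 2 fun _ => 1) (a := 2) (m := 0)
    (by rw [Fintype.sum_option]; simp) (Z₀ := fun o => o.elim 1 z₀) (T₀ := 0)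
    ⟨none, two_ne_zero, one_ne_zero⟩ ?_ (τ := fun y => (y.1.1 : ℂ) * y.2)
    (Continuous.continuousAt (by fun_prop)) (by simp) (pt := pt) ?_
    (P := fun y => B (w y) (w y) (w y) + 3 * ((y.1.1 : ℂ) * y.1.2 none ^ 2))
    ?_ ?_ (D := 3 * B p p t) ?_ (mul_ne_zero three_ne_zero hpt) ?_
    (g := fun o y => 2 * y.1.2 none * B x u (b o) + B (w y) (w y) (b o)) ?_ ?_
    (gt := fun y => B (w y) (w y) t) (cw t).continuousAt ?_ ?_ none none
    (K := fun y => B (w y) (w y) t ^ 2 * B (pt y) u u -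
      B (w y) (w y) t * (2 * y.1.2 none * B x u u + B (w y) (w y) u) * B (pt y) u t -
      B (w y) (w y) t * (2 * y.1.2 none * B x u u + B (w y) (w y) u) * B (pt y) t u +
      (2 * y.1.2 none * B x u u + B (w y) (w y) u) *
        (2 * y.1.2 none * B x u u + B (w y) (w y) u) * B (pt y) t t) ?_ ?_ ?_
  · intro z T c h
    rw [Fintype.sum_option] at h
    simp only [b, Option.elim_none, Option.elim_some] at h
    have h1 : z none = 0 := by
      have := congrArg (B x u) h
      rw [hB.add_right, hB.add_right, hB.sum_right] at this
      simpa [hB.smul_right, hζu, ht, R.uu, hB.swap23 x u x, R.singular] using this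
    have h2 : T = 0 := by
      have := congrArg (B p p) h
      rw [hB.add_right, hB.add_right, hB.sum_right] at this
      simpa [hB.smul_right, fun i => ((hmem _).1 (hζ i)).2, hppx, h1, hpt, hB.zero_right] using this
    have h3 := hζi (fun i => z (some i)) c (by simpa [h1, h2] using h)
    refine ⟨funext fun o => ?_, h2⟩
    cases o with
    | none => exact h1
    | some i => exact congrFun h3 i
  · rintro (_ | i) h
    · exact absurd h two_ne_zero
    · exact absurd h one_ne_zero
  · intro y
    rw [Fintype.sum_option]
    simp only [pt, w, s, b, Option.elim_none, Option.elim_some, smul_add, Finset.smul_sum, smul_smul,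
      pow_one]
    rw [← mul_assoc, ← sq]
    abel
  · exact ((hB.contDiff_comp hw hw hw).add (by fun_prop)).contDiffAt
  · simp only [hw0]
    simp [hp'p]
  · simp only [hw0]
    have h1 : HasDerivAt (fun T : ℂ => p' + T • t) t 0 := by
      simpa using ((hasDerivAt_id (0 : ℂ)).smul_const t).const_add p'
    have h2 := hB.hasDerivAt_comp h1 h1 h1
    simp only [zero_smul, add_zero] at h2
    convert h2 using 1
    · simp
    · rw [hB.swap12 p' t, hB.swap13 t, hp'v]
      ring
  · intro y hy
    have h1 : B (pt y) (pt y) (pt y) =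
        (y.1.1 : ℂ) ^ 3 * (B (w y) (w y) (w y) + 3 * ((y.1.1 : ℂ) * y.1.2 none ^ 2)) := by
      simp only [pt]
      rw [hB.cube_singular_add R.singular]
      simp only [hB.smul_mid, hB.smul_left, hB.smul_right, hxw, hB.swap23 x u, R.uu]
      ring
    rw [h1, hy, mul_zero]
  · exact fun o => (((continuous_const.mul cn).mul continuous_const).add (cw _)).continuousAt
  · exact fun o y _ => hpt2 y _
  · intro y _
    rw [hpt2, ht]
    ring
  · simpa [hw0, hp'v] using hpt
  · have hg := ((continuous_const (y := (2 : ℂ)).mul cn).mul (continuous_const (y := B x u u))).add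
      (cw u)
    exact ((((((cw t).pow 2).mul (cpt u u)).sub (((cw t).mul hg).mul (cpt u t))).sub
      (((cw t).mul hg).mul (cpt t u))).add ((hg.mul hg).mul (cpt t t))).continuousAt
  · simp only [hpt0, hw0]
    rw [hB.swap23 x t u, ht, R.uu, R.radical t ht t]
    simpa [hp'v] using hpt
  · intro y _
    simp only [b, Option.elim_none]
    ring

/-- Let `n` be the coordinate of `b₀` and `s` that of `u`. The leading part at points with the
remaining coordinates zero is the cusp `3s² + κ n³`; `s` has weight 6, `n` weight 4, and the three
coordinates that do not occur in the cube have weight 3, so that their products with `s` do not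
disturb. The gradient has order 6 and the Hessian near the direction of `b₀` order 4: `4 + 9 + 4 ≤
18`. -/
theorem lintegral_curvature_of_cube (hB : IsPolarization F B) (R : RankOne B x u) {b₀ : V}
    (hb : B x u b₀ = 0) (hbb : B b₀ b₀ b₀ ≠ 0)
    (hcube : ∀ a, B x u a = 0 → B a a a = B b₀ b₀ b₀ * (B a b₀ b₀ / B b₀ b₀ b₀) ^ 3) :
    ∫⁻ x in regLink F, ENNReal.ofReal (curvature F B x)
      ∂(MeasureTheory.Measure.hausdorffMeasure 9) = ∞ := by
  let f : V →ₗ[ℂ] (Fin 2 → ℂ) := LinearMap.pi ![hB.lin x u, hB.lin b₀ b₀]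
  have hf0 : ∀ v, f v 0 = B x u v := fun v => rfl
  have hf1 : ∀ v, f v 1 = B b₀ b₀ v := fun v => rfl
  have hsurj : Function.Surjective f := fun c => by
    refine ⟨c 0 • u + ((c 1 - c 0 * B b₀ b₀ u) / B b₀ b₀ b₀) • b₀, ?_⟩
    ext i
    fin_cases i
    · simp only [Fin.zero_eta, hf0, hB.add_right, hB.smul_right, R.uu, hb]
      ring
    · simp only [Fin.mk_one, hf1, hB.add_right, hB.smul_right]
      field_simp
      ring
  have hfin := finrank_ker_add hsurj
  have hmem : ∀ v, v ∈ LinearMap.ker f ↔ B x u v = 0 ∧ B b₀ b₀ v = 0 := fun v => by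
    rw [LinearMap.mem_ker, ← hf0, ← hf1, funext_iff, Fin.forall_fin_two]
    rfl
  have hxb : ∀ v, B x b₀ v = 0 := R.radical b₀ hb
  have hbbx : B b₀ b₀ x = 0 := by rw [hB.swap13, hxb]
  have hxO : x ∈ LinearMap.ker f := (hmem x).2 ⟨by rw [hB.swap23, R.singular], hbbx⟩
  obtain ⟨ζ, hζ, hζi, hζs⟩ := exists_basis_mod hxO R.ne_zero (n := 3) (by omega)
  have hζu : ∀ i, B x u (ζ i) = 0 := fun i => ((hmem _).1 (hζ i)).1
  have hζb : ∀ i, B b₀ b₀ (ζ i) = 0 := fun i => ((hmem _).1 (hζ i)).2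
  have hrad : ∀ i a a', B x u a = 0 → B x u a' = 0 → B (ζ i) a a' = 0 := fun i a a' ha ha' =>
    hB.eq_zero_of_cube (S := LinearMap.ker (hB.lin x u)) (b := b₀) hcube (hζu i)
      (by rw [hB.swap13]; exact hζb i) ha ha'
  set κ := B b₀ b₀ b₀ with hκ
  -- The point with `n = Z` and `s = 1` on the cusp `3s² + κ n³ = 0`.
  obtain ⟨Z, hZ⟩ := IsAlgClosed.exists_pow_nat_eq (-3 / κ) three_pos
  have hZκ : κ * Z ^ 3 = -3 := by rw [hZ]; field_simp
  have hZ0 : Z ≠ 0 := by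
    rintro rfl
    norm_num at hZκ
  let b : Option (Fin 3) → V := fun o => o.elim b₀ ζ
  let s : (ℝ × (Option (Fin 3) → ℂ)) × ℂ → V := fun y => ∑ i, y.1.2 (some i) • ζ i
  let v : (ℝ × (Option (Fin 3) → ℂ)) × ℂ → V := fun y => s y + ((y.1.1 : ℂ) * y.1.2 none) • b₀
  have hs : ContDiff ℝ 1 s := by fun_prop
  have hv : ContDiff ℝ 1 v := hs.add (by fun_prop)
  let w : (ℝ × (Option (Fin 3) → ℂ)) × ℂ → V := fun y => v y + ((y.1.1 : ℂ) ^ 3 * y.2) • u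
  have hw : ContDiff ℝ 1 w := hv.add (by fun_prop)
  let pt : (ℝ × (Option (Fin 3) → ℂ)) × ℂ → V := fun y => x + (y.1.1 : ℂ) ^ 3 • w y
  have hptc : Continuous pt := by
    have := hw.continuous
    fun_prop
  have hv0 : ∀ T, v ((0, fun o => o.elim Z 0), T) = 0 := fun T => by simp [v, s]
  have hw0 : ∀ T, w ((0, fun o => o.elim Z 0), T) = 0 := fun T => by simp [w, hv0]
  have hpt0 : ∀ T, pt ((0, fun o => o.elim Z 0), T) = x := fun T => by simp [pt]
  have hxuv : ∀ y, B x u (v y) = 0 := fun y => by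
    simp only [v, s]
    rw [hB.add_right, hB.sum_right, hB.smul_right, hb]
    simp [hB.smul_right, hζu]
  have hxw : ∀ y r, B x (w y) r = (y.1.1 : ℂ) ^ 3 * y.2 * B x u r := fun y r => by
    simp only [w]
    rw [hB.add_mid, hB.smul_mid, R.radical _ (hxuv y), zero_add]
  have hsr : ∀ y a a', B x u a = 0 → B x u a' = 0 → B (s y) a a' = 0 := fun y a a' ha ha' => by
    simp only [s]
    rw [hB.sum_left]
    simp [hB.smul_left, fun i => hrad i a a' ha ha']
  have hva : ∀ y a a', B x u a = 0 → B x u a' = 0 →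
      B (v y) a a' = (y.1.1 : ℂ) * y.1.2 none * B b₀ a a' := fun y a a' ha ha' => by
    simp only [v]
    rw [hB.add_left, hsr y a a' ha ha', hB.smul_left, zero_add]
  have hvva : ∀ y a, B x u a = 0 →
      B (v y) (v y) a = (y.1.1 : ℂ) ^ 2 * (y.1.2 none ^ 2 * B b₀ b₀ a) := fun y a ha => by
    rw [hva y _ a (hxuv y) ha, hB.swap12, hva y _ a hb ha]
    ring
  have hvvv : ∀ y, B (v y) (v y) (v y) = (y.1.1 : ℂ) ^ 3 * (y.1.2 none ^ 3 * κ) := fun y => by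
    rw [hvva y _ (hxuv y), hB.swap13, hva y _ _ hb hb]
    ring
  have hpt2 : ∀ y r, B (pt y) (pt y) r =
      (y.1.1 : ℂ) ^ 6 * (2 * y.2 * B x u r + B (w y) (w y) r) := fun y r => by
    simp only [pt]
    rw [hB.sq_singular_add R.singular]
    simp only [hB.smul_mid, hB.smul_left, hxw]
    ring
  have cww : ∀ r, Continuous fun y => B (w y) (w y) r := fun r =>
    hB.continuous_comp hw.continuous hw.continuous continuous_const
  have cw : ∀ r r', Continuous fun y => B (w y) r r' := fun r r' =>
    hB.continuous_comp hw.continuous continuous_const continuous_const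
  have cv : ∀ r r', Continuous fun y => B (v y) r r' := fun r r' =>
    hB.continuous_comp hv.continuous continuous_const continuous_const
  have cpt : ∀ r r', Continuous fun y => B (pt y) r r' := fun r r' =>
    hB.continuous_comp hptc continuous_const continuous_const
  have hρ : Continuous fun y : (ℝ × (Option (Fin 3) → ℂ)) × ℂ => (y.1.1 : ℂ) := by fun_prop
  have cT : Continuous fun y : (ℝ × (Option (Fin 3) → ℂ)) × ℂ => y.2 := continuous_snd
  have cn : Continuous fun y : (ℝ × (Option (Fin 3) → ℂ)) × ℂ => y.1.2 none := by fun_prop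
  let g' : (ℝ × (Option (Fin 3) → ℂ)) × ℂ → ℂ := fun y => y.1.2 none ^ 2 * κ +
    (2 * ((y.1.1 : ℂ) * y.2) * B (v y) u b₀ + (y.1.1 : ℂ) ^ 4 * y.2 ^ 2 * B u u b₀)
  have cg' : Continuous g' := ((cn.pow 2).mul continuous_const).add
    (((continuous_const.mul (hρ.mul cT)).mul (cv _ _)).add
    (((hρ.pow 4).mul (cT.pow 2)).mul continuous_const))
  have hg' : ∀ y, B (w y) (w y) b₀ = (y.1.1 : ℂ) ^ 2 * g' y := fun y => by
    simp only [w, g']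
    rw [hB.sq_add, hvva y _ hb]
    simp only [hB.smul_mid, hB.smul_left]
    ring
  let gt : (ℝ × (Option (Fin 3) → ℂ)) × ℂ → ℂ := fun y => 2 * y.2 + B (w y) (w y) u
  have cgt : Continuous gt := (continuous_const.mul cT).add (cww u)
  refine CubicFourfold.lintegral_curvature_of_scaling hB (ι := Option (Fin 3)) (by simp) R.ne_zero
    (b := b) (bt := u) ?_ (fun o => o.elim 4 fun _ => 3) (a := 6) (m := 4)
    (by rw [Fintype.sum_option]; simp) (Z₀ := fun o => o.elim Z 0) (T₀ := 1)
    ⟨none, four_ne_zero, hZ0⟩ ?_ (τ := fun y => (y.1.1 : ℂ) ^ 6 * y.2)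
    (Continuous.continuousAt (by fun_prop)) (by simp) (pt := pt) ?_
    (P := fun y => 3 * y.2 ^ 2 + y.1.2 none ^ 3 * κ + (3 * y.2 * B (v y) (v y) u +
      (3 * ((y.1.1 : ℂ) ^ 3 * y.2 ^ 2) * B (v y) u u + (y.1.1 : ℂ) ^ 6 * y.2 ^ 3 * B u u u)))
    ?_ ?_ (D := 6) ?_ (by norm_num) ?_
    (g := fun o y => B (w y) (w y) (b o)) (fun o => (cww _).continuousAt) ?_
    (gt := gt) cgt.continuousAt ?_ ?_ none none
    (K := fun y => gt y ^ 2 * (y.1.2 none * κ + (y.1.1 : ℂ) ^ 2 * y.2 * B u b₀ b₀) -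
      2 * ((y.1.1 : ℂ) * (gt y * g' y * B (w y) b₀ u)) + g' y ^ 2 * B (pt y) u u) ?_ ?_ ?_
  · intro z T c h
    rw [Fintype.sum_option] at h
    simp only [b, Option.elim_none, Option.elim_some] at h
    have h2 : T = 0 := by
      have := congrArg (B x u) h
      rw [hB.add_right, hB.add_right, hB.sum_right] at this
      simpa [hB.smul_right, hζu, hb, R.uu, hB.swap23 x u x, R.singular] using this
    have h1 : z none = 0 := by
      have := congrArg (B b₀ b₀) h
      rw [hB.add_right, hB.add_right, hB.sum_right] at this
      simpa [hB.smul_right, hζb, hbbx, h2, hbb, ← hκ, hB.zero_right] using this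
    have h3 := hζi (fun i => z (some i)) c (by simpa [h1, h2] using h)
    refine ⟨funext fun o => ?_, h2⟩
    cases o with
    | none => exact h1
    | some i => exact congrFun h3 i
  · rintro (_ | i) h
    · exact absurd h four_ne_zero
    · exact absurd h three_ne_zero
  · intro y
    rw [Fintype.sum_option]
    simp only [pt, w, v, s, b, Option.elim_none, Option.elim_some, smul_add, Finset.smul_sum,
      smul_smul]
    rw [← mul_assoc, ← mul_assoc, ← pow_succ, ← pow_add]
    abel
  · refine (ContDiff.add (by fun_prop) (((ContDiff.mul (by fun_prop)
      (hB.contDiff_comp hv hv contDiff_const))).add ((ContDiff.mul (by fun_prop)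
      (hB.contDiff_comp hv contDiff_const contDiff_const)).add (by fun_prop)))).contDiffAt
  · simp only [hv0, hB.zero_left]
    simp
    linear_combination hZκ
  · simp only [hv0, hB.zero_left]
    have h1 := ((hasDerivAt_pow 2 (1 : ℂ)).const_mul 3).add_const (Z ^ 3 * κ)
    refine HasDerivAt.congr_deriv (h1.congr_of_eventuallyEq (.of_forall fun T => ?_)) (by norm_num)
    simp
  · intro y hy
    have h1 : B (w y) (w y) (w y) = (y.1.1 : ℂ) ^ 3 * (y.1.2 none ^ 3 * κ +
        (3 * y.2 * B (v y) (v y) u + (3 * ((y.1.1 : ℂ) ^ 3 * y.2 ^ 2) * B (v y) u u +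
        (y.1.1 : ℂ) ^ 6 * y.2 ^ 3 * B u u u))) := by
      simp only [w]
      rw [hB.cube_add, hvvv]
      simp only [hB.smul_mid, hB.smul_left, hB.smul_right]
      ring
    simp only [pt]
    rw [hB.cube_singular_add R.singular]
    simp only [hB.smul_mid, hB.smul_left, hB.smul_right, hxw, hB.swap23 x u, R.uu, h1]
    linear_combination (y.1.1 : ℂ) ^ 12 * hy
  · intro o y _
    rw [hpt2]
    have : B x u (b o) = 0 := by
      rcases o with _ | i
      exacts [hb, hζu i]
    rw [this]
    ring
  · intro y _
    rw [hpt2, R.uu]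
    simp only [gt]
    ring
  · simp only [gt, hw0, hB.zero_left]
    simp
  · exact (((((cgt.pow 2).mul ((cn.mul continuous_const).add
      (((hρ.pow 2).mul cT).mul continuous_const))).sub
      (continuous_const.mul (hρ.mul ((cgt.mul cg').mul (cw b₀ u)))))).add
      ((cg'.pow 2).mul (cpt u u))).continuousAt
  · simp only [gt, g', hw0, hv0, hpt0, hB.zero_left, R.uu]
    -- The limit of `K`, which by `κ Z³ = -3` is just `κ Z`.
    have h1 : κ * Z * (4 + κ * Z ^ 3) ≠ 0 := by
      rw [hZκ]
      norm_num
      exact ⟨hbb, hZ0⟩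
    intro h
    apply h1
    simp at h
    linear_combination h
  · intro y _
    simp only [b, Option.elim_none]
    have hp1 : ∀ r, B (pt y) b₀ r = (y.1.1 : ℂ) ^ 3 * B (w y) b₀ r := fun r => by
      simp only [pt]
      rw [hB.add_left, hB.smul_left, hxb, zero_add]
    have hp2 : B (w y) b₀ b₀ = (y.1.1 : ℂ) * (y.1.2 none * κ + (y.1.1 : ℂ) ^ 2 * y.2 * B u b₀ b₀) := by
      simp only [w]
      rw [hB.add_left, hB.smul_left, hva y _ _ hb hb]
      ring
    rw [hB.swap23 (pt y) u b₀, hp1, hp1, hp2, hg']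
    ring

theorem lintegral_curvature (hB : IsPolarization F B) (R : RankOne B x u)
    (hirr : ¬ ContainsHyperplane B) :
    ∫⁻ x in regLink F, ENNReal.ofReal (curvature F B x)
      ∂(MeasureTheory.Measure.hausdorffMeasure 9) = ∞ := by
  rcases hB.exists_regular_zero_or_cube (LinearMap.ker (hB.lin x u)) with
    h | ⟨p, hp, t, ht, hpp, hpt⟩ | ⟨b, hb, hbb, hcube⟩
  · refine absurd ⟨hB.lin x u, fun h0 => ?_, fun v hv => h v hv⟩ hirr
    have h1 : hB.lin x u u = 0 := by rw [h0]; rfl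
    exact one_ne_zero (R.uu.symm.trans h1)
  · exact R.lintegral_curvature_of_regular_zero hB hp ht hpp hpt
  · exact R.lintegral_curvature_of_cube hB hb hbb hcube

end RankOne

end CubicFourfold

/-! ### Cones -/

namespace CubicFourfold

variable {F : MvPolynomial (Fin 6) ℂ} {B : V → V → V → ℂ}

/-- An irreducible cubic has a regular zero at which the Hessian does not vanish on the kernel of
the differential. -/
theorem exists_regular_zero_hessian_ne_zero (hB : IsPolarization F B)
    (hirr : ¬ ContainsHyperplane B) :
    ∃ q t v, B q q q = 0 ∧ B q q t ≠ 0 ∧ B q q v = 0 ∧ B q v v ≠ 0 := by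
  rcases hB.exists_regular_zero_or_cube ⊤ with h | ⟨p, -, t, -, hpp, hpt⟩ | ⟨b, -, hbb, hcube⟩
  · refine absurd ⟨(EuclideanSpace.proj (𝕜 := ℂ) (0 : Fin 6)).toLinearMap, fun h0 => ?_,
      fun v _ => h v trivial⟩ hirr
    have h1 := LinearMap.congr_fun h0 (EuclideanSpace.single (0 : Fin 6) (1 : ℂ))
    simp at h1
  -- The tangent hyperplane at `p` is not contained in `Y`.
  · obtain ⟨v, hv, hvv⟩ : ∃ v, B p p v = 0 ∧ B v v v ≠ 0 := by
      by_contra! hcon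
      refine hirr ⟨hB.lin p p, fun h0 => hpt ?_, fun v hv => hcon v hv⟩
      change hB.lin p p t = 0
      rw [h0]; rfl
    by_cases hpv : B p v v = 0
    swap
    · exact ⟨p, t, v, hpp, hpt, hv, hpv⟩
    -- If the Hessian at `p` vanishes on `v`, the point is moved in the direction of `v` and
    -- corrected by `s³ T t` so as to stay on `Y`. The Hessian on the corrected tangent vector is
    -- then `s B(v,v,v)` to first order, nonzero for small `s ≠ 0`. In `G` it is multiplied by `B q
    -- q t ^ 2` and divided by `s`.
    let w : ℝ × ℂ → V := fun y => p + (y.1 : ℂ) • v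
    have hw : ContDiff ℝ 1 w := by fun_prop
    let q : ℝ × ℂ → V := fun y => w y + ((y.1 : ℂ) ^ 3 * y.2) • t
    have hq : ContDiff ℝ 1 q := hw.add (by fun_prop)
    have hw0 : ∀ T, w (0, T) = p := fun T => by simp [w]
    have hq0 : ∀ T, q (0, T) = p := fun T => by simp [q, hw0]
    set T₀ := -(B v v v) / (3 * B p p t) with hT₀
    obtain ⟨T, hT, hroot⟩ := exists_continuousAt_root (X := ℝ) (P := fun y => B v v v +
        (3 * y.2 * B (w y) (w y) t + (3 * ((y.1 : ℂ) ^ 3 * y.2 ^ 2) * B (w y) t t +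
        (y.1 : ℂ) ^ 6 * y.2 ^ 3 * B t t t))) (q₀ := 0) (T₀ := T₀) (D := 3 * B p p t)
      (ContDiff.contDiffAt (contDiff_const.add (((ContDiff.mul (by fun_prop)
        (hB.contDiff_comp hw hw contDiff_const))).add ((ContDiff.mul (by fun_prop)
        (hB.contDiff_comp hw contDiff_const contDiff_const)).add (by fun_prop)))))
      (by
        simp only [hw0, hT₀]
        simp only [Complex.ofReal_zero]
        field_simp
        ring)
      (by
        simp only [hw0]
        have h1 := ((hasDerivAt_id T₀).const_mul (3 * B p p t)).const_add (B v v v)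
        refine HasDerivAt.congr_deriv (h1.congr_of_eventuallyEq (.of_forall fun T => ?_))
          (by simp)
        simp
        ring)
      (mul_ne_zero three_ne_zero hpt)
    let γ : ℝ × ℂ → ℂ := fun y => B v v v + (2 * ((y.1 : ℂ) * y.2) * B (w y) t v +
      (y.1 : ℂ) ^ 4 * y.2 ^ 2 * B t t v)
    let G : ℝ × ℂ → ℂ := fun y => B (q y) (q y) t ^ 2 * (B v v v + (y.1 : ℂ) ^ 2 * y.2 * B t v v) -
      2 * ((y.1 : ℂ) * (B (q y) (q y) t * γ y * B (q y) v t)) +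
      (y.1 : ℂ) ^ 3 * γ y ^ 2 * B (q y) t t
    have cρ : Continuous fun y : ℝ × ℂ => (y.1 : ℂ) := by fun_prop
    have cT : Continuous fun y : ℝ × ℂ => y.2 := continuous_snd
    have cqqt : Continuous fun y => B (q y) (q y) t :=
      hB.continuous_comp hq.continuous hq.continuous continuous_const
    have cq : ∀ r r', Continuous fun y => B (q y) r r' := fun r r' =>
      hB.continuous_comp hq.continuous continuous_const continuous_const
    have cγ : Continuous γ := continuous_const.add (((continuous_const.mul (cρ.mul cT)).mul
      (hB.continuous_comp hw.continuous continuous_const continuous_const)).add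
      (((cρ.pow 4).mul (cT.pow 2)).mul continuous_const))
    have cG : Continuous G := (((cqqt.pow 2).mul (continuous_const.add
      (((cρ.pow 2).mul cT).mul continuous_const))).sub (continuous_const.mul (cρ.mul
      ((cqqt.mul cγ).mul (cq v t))))).add (((cρ.pow 3).mul (cγ.pow 2)).mul (cq t t))
    have hY : Filter.Tendsto (fun s : ℝ => (s, T s)) (𝓝 0) (𝓝 (0, T₀)) :=
      Filter.Tendsto.prodMk_nhds Filter.tendsto_id hT
    have hG : ∀ᶠ s : ℝ in 𝓝 0, G (s, T s) ≠ 0 :=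
      hY.eventually (cG.continuousAt.eventually_ne (by simp [G, hq0, hpt, hvv]))
    have hqt : ∀ᶠ s : ℝ in 𝓝 0, B (q (s, T s)) (q (s, T s)) t ≠ 0 :=
      hY.eventually (cqqt.continuousAt.eventually_ne (by simpa [hq0] using hpt))
    obtain ⟨s, ⟨hs1, hs2, hs3⟩, hs0⟩ :=
      (((hroot.and (hG.and hqt)).filter_mono nhdsWithin_le_nhds).and
        (self_mem_nhdsWithin : {s : ℝ | s ≠ 0} ∈ 𝓝[≠] 0)).exists
    set y : ℝ × ℂ := (s, T s) with hy
    have hww : B (w y) (w y) v = (s : ℂ) ^ 2 * B v v v := by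
      simp only [w]
      rw [hB.sq_add, hv]
      simp only [hB.smul_mid, hB.smul_left, hpv]
      ring
    have hqv : B (q y) (q y) v = (s : ℂ) ^ 2 * γ y := by
      simp only [q, γ]
      rw [hB.sq_add, hww]
      simp only [hB.smul_mid, hB.smul_left]
      ring
    have hqvv : B (q y) v v = s * (B v v v + (s : ℂ) ^ 2 * T s * B t v v) := by
      simp only [q, w]
      rw [hB.add_left, hB.add_left, hpv]
      simp only [hB.smul_left]
      ring
    refine ⟨q y, t, v + (-(B (q y) (q y) v / B (q y) (q y) t)) • t, ?_, hs3, ?_, ?_⟩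
    · have h1 : B (w y) (w y) (w y) = (s : ℂ) ^ 3 * B v v v := by
        simp only [w]
        rw [hB.cube_add, hpp]
        simp only [hB.smul_mid, hB.smul_right, hB.smul_left, hpv, hv]
        ring
      have h2 : B (q y) (q y) (q y) = (s : ℂ) ^ 3 * 0 := by
        rw [← hs1]
        simp only [q]
        rw [hB.cube_add, h1]
        simp only [hB.smul_mid, hB.smul_right, hB.smul_left]
        ring
      rw [h2, mul_zero]
    · rw [hB.add_right, hB.smul_right]
      field_simp
      ring
    · intro h0
      rw [hB.add_mid, hB.add_right, hB.add_right] at h0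
      simp only [hB.smul_mid, hB.smul_right] at h0
      rw [hB.swap23 _ t v] at h0
      field_simp at h0
      rw [hqvv, hqv] at h0
      have h3 : (s : ℂ) * G y = 0 := by
        simp only [G]
        linear_combination h0
      rcases mul_eq_zero.1 h3 with h | h
      · exact hs0 (by exact_mod_cast h)
      · exact hs2 h
  · refine absurd ⟨hB.lin b b, fun h0 => hbb ?_, fun v hv => ?_⟩ hirr
    · change hB.lin b b b = 0
      rw [h0]; rfl
    · have hv' : B b b v = 0 := hv
      rw [hcube v trivial, hB.swap13 v, hv']
      simp

/-- Divergence at the vertex of a cone. -/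
theorem lintegral_curvature_of_cone (hB : IsPolarization F B) (hirr : ¬ ContainsHyperplane B)
    {x : V} (hx0 : x ≠ 0) (hx : ∀ v w, B x v w = 0) :
    ∫⁻ x in regLink F, ENNReal.ofReal (curvature F B x)
      ∂(MeasureTheory.Measure.hausdorffMeasure 9) = ∞ := by
  obtain ⟨q, t, v, hqq, hqt, hqv, hvv⟩ := exists_regular_zero_hessian_ne_zero hB hirr
  let f : V →ₗ[ℂ] (Fin 1 → ℂ) := LinearMap.pi fun _ => hB.lin q q
  have hmem : ∀ v, v ∈ LinearMap.ker f ↔ B q q v = 0 := fun v => by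
    rw [LinearMap.mem_ker, funext_iff, Fin.forall_fin_one]
    rfl
  have hsurj : Function.Surjective f := fun c => by
    refine ⟨(c 0 / B q q t) • t, ?_⟩
    ext i
    have : f ((c 0 / B q q t) • t) i = c 0 / B q q t * B q q t := hB.smul_right _ _ _ _
    rw [this, Subsingleton.elim i 0]
    field_simp
  have hfin := finrank_ker_add hsurj
  have hqx : B q q x = 0 := by rw [hB.swap13, hx]
  obtain ⟨ζ, hζ, hζi, hζs⟩ := exists_basis_mod ((hmem x).2 hqx) hx0 (n := 4) (by omega)
  have hζq : ∀ i, B q q (ζ i) = 0 := fun i => (hmem _).1 (hζ i)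
  obtain ⟨z₀, c, hz⟩ := hζs q ((hmem q).2 hqq)
  obtain ⟨z₁, c₁, hz₁⟩ := hζs v ((hmem v).2 hqv)
  set q' := ∑ i, z₀ i • ζ i with hq'
  have hadd : ∀ (c : ℂ) (u r r' : V), B (u + c • x) r r' = B u r r' := fun c u r r' => by
    rw [hB.add_left, hB.smul_left, hx, mul_zero, add_zero]
  have hq'r : ∀ r r', B q r r' = B q' r r' := fun r r' => by rw [hz, hadd]
  have hq'q : ∀ r, B q' q' r = B q q r := fun r => by rw [← hq'r, hB.swap12, ← hq'r]
  obtain ⟨j, k, hjk⟩ : ∃ j k, B q' (ζ j) (ζ k) ≠ 0 := by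
    by_contra! hcon
    apply hvv
    rw [hq'r, hz₁, hB.swap12, hadd, hB.swap13, hadd, hB.swap12, hB.sum_mid]
    simp [hB.smul_mid, hB.sum_right, hB.smul_right, hcon]
  let w : (ℝ × (Fin 4 → ℂ)) × ℂ → V := fun y => ∑ i, y.1.2 i • ζ i + y.2 • t
  have hw : ContDiff ℝ 1 w := by fun_prop
  have hw0 : ∀ T, w ((0, z₀), T) = q' + T • t := fun T => by simp [w, hq']
  let pt : (ℝ × (Fin 4 → ℂ)) × ℂ → V := fun y => x + (y.1.1 : ℂ) • w y
  have hpt1 : ∀ y r r', B (pt y) r r' = y.1.1 * B (w y) r r' := fun y r r' => by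
    simp only [pt]
    rw [hB.add_left, hx, hB.smul_left, zero_add]
  have hpt2 : ∀ y r, B (pt y) (pt y) r = (y.1.1 : ℂ) ^ 2 * B (w y) (w y) r := fun y r => by
    rw [hpt1, hB.swap12, hpt1]
    ring
  have hpt3 : ∀ y, B (pt y) (pt y) (pt y) = (y.1.1 : ℂ) ^ 3 * B (w y) (w y) (w y) := fun y => by
    rw [hpt2, hB.swap13, hpt1]
    ring
  have cww : ∀ r, Continuous fun y => B (w y) (w y) r := fun r =>
    hB.continuous_comp hw.continuous hw.continuous continuous_const
  have cw : ∀ r r', Continuous fun y => B (w y) r r' := fun r r' =>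
    hB.continuous_comp hw.continuous continuous_const continuous_const
  obtain ⟨i₀, hi₀⟩ : ∃ i, z₀ i ≠ 0 := by
    by_contra! hcon
    apply hqt
    have : q' = 0 := by simp [hq', hcon]
    rw [hq'r, this, hB.zero_left]
  -- As `B x` is zero, `F (x + ρ w) = ρ³ F w` exactly: all weights are 1, the gradient has order 2
  -- and the Hessian order 1, and `4 + 1 ≤ 6`.
  refine CubicFourfold.lintegral_curvature_of_scaling hB (ι := Fin 4) (by simp) hx0
    (b := ζ) (bt := t) ?_ (fun _ => 1) (a := 2) (m := 1) (by simp) (Z₀ := z₀) (T₀ := 0)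
    ⟨i₀, one_ne_zero, hi₀⟩ (fun i hi => absurd hi one_ne_zero) (τ := fun y => (y.1.1 : ℂ) * y.2)
    (Continuous.continuousAt (by fun_prop)) (by simp) (pt := pt) ?_
    (P := fun y => B (w y) (w y) (w y)) (hB.contDiff_comp hw hw hw).contDiffAt ?_
    (D := 3 * B q q t) ?_ (mul_ne_zero three_ne_zero hqt) ?_
    (g := fun i y => B (w y) (w y) (ζ i)) (fun i => (cww _).continuousAt) (fun i y _ => hpt2 y _)
    (gt := fun y => B (w y) (w y) t) (cww t).continuousAt (fun y _ => hpt2 y t) ?_ j k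
    (K := fun y => B (w y) (w y) t ^ 2 * B (w y) (ζ j) (ζ k) -
      B (w y) (w y) t * B (w y) (w y) (ζ k) * B (w y) (ζ j) t -
      B (w y) (w y) t * B (w y) (w y) (ζ j) * B (w y) t (ζ k) +
      B (w y) (w y) (ζ j) * B (w y) (w y) (ζ k) * B (w y) t t) ?_ ?_ ?_
  · intro z T c' h
    have h2 : T = 0 := by
      have := congrArg (B q q) h
      rw [hB.add_right, hB.sum_right] at this
      simpa [hB.smul_right, hζq, hqx, hqt] using this
    exact ⟨hζi z c' (by simpa [h2] using h), h2⟩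
  · intro y
    simp only [pt, w, smul_add, Finset.smul_sum, smul_smul, pow_one]
  · simp only [hw0, zero_smul, add_zero]
    rw [hq'q, hB.swap13, ← hq'r, hB.swap13, hqq]
  · simp only [hw0]
    have h1 : HasDerivAt (fun T : ℂ => q' + T • t) t 0 := by
      simpa using ((hasDerivAt_id (0 : ℂ)).smul_const t).const_add q'
    have h2 := hB.hasDerivAt_comp h1 h1 h1
    simp only [zero_smul, add_zero] at h2
    convert h2 using 1
    rw [hB.swap12 q' t, hB.swap13 t, hq'q]
    ring
  · intro y hy
    rw [hpt3, hy, mul_zero]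
  · simpa [hw0, hq'q] using hqt
  · exact ((((((cww t).pow 2).mul (cw _ _)).sub (((cww t).mul (cww _)).mul (cw _ t))).sub
      (((cww t).mul (cww _)).mul (cw t _))).add (((cww _).mul (cww _)).mul (cw t t))).continuousAt
  · simp only [hw0, zero_smul, add_zero, hq'q, hζq]
    simpa using ⟨hqt, hjk⟩
  · intro y _
    simp only [hpt1]
    ring

end CubicFourfold

/-! ### Hessian of rank at least three: curvature, gradient and local equations -/

namespace CubicFourfold

variable {F : MvPolynomial (Fin 6) ℂ} {B : V → V → V → ℂ}

/-- On every hyperplane of a three-dimensional quadratic space the form has norm at least `1/4`. -/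
theorem exists_pair_of_hyperplane (g : Fin 3 → ℂ) : ∃ c d : Fin 3 → ℂ, (∀ i, ‖c i‖ ≤ 1) ∧
    (∀ i, ‖d i‖ ≤ 1) ∧ ∑ i, c i * g i = 0 ∧ ∑ i, d i * g i = 0 ∧ 1 / 4 ≤ ‖∑ i, c i * d i‖ := by
  obtain ⟨k, hk⟩ := Finite.exists_max fun i => ‖g i‖
  by_cases hgk : g k = 0
  · have hg : ∀ i, g i = 0 := fun i => by simpa [hgk] using hk i
    refine ⟨Pi.single 0 1, Pi.single 0 1, ?_, ?_, by simp [hg], by simp [hg], ?_⟩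
    · intro i
      fin_cases i <;> simp
    · intro i
      fin_cases i <;> simp
    · have : ∑ i, (Pi.single 0 1 : Fin 3 → ℂ) i * (Pi.single 0 1 : Fin 3 → ℂ) i = 1 := by
        simp [Pi.single_apply]
      rw [this]
      norm_num
  · have hle : ∀ i, ‖-(g i / g k)‖ ≤ 1 := fun i => by
      rw [norm_neg, norm_div]
      exact (div_le_one (norm_pos_iff.2 hgk)).2 (hk i)
    -- For `l = 1, 2` these vectors `e_{k+l} - (g_{k+l} / g_k) e_k` span the hyperplane, and the
    -- choice of `k` bounds their entries by 1. Their Gram matrix has the entries `1 + a²`, `1 + b²`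
    -- and `ab`. If the first two are small, `a` and `b` have absolute value near 1 and the third is
    -- not small.
    let v : Fin 3 → Fin 3 → ℂ := fun l i => if i = k + l then 1 else
      if i = k then -(g (k + l) / g k) else 0
    have hv1 : ∀ l i, ‖v l i‖ ≤ 1 := by
      intro l i
      simp only [v]
      split_ifs
      · simp
      · exact hle _
      · simp
    have hsum : ∀ h : Fin 3 → ℂ, ∑ i, h i = h k + h (k + 1) + h (k + 2) := fun h => by
      rw [← Equiv.sum_comp (Equiv.addLeft k) h, Fin.sum_univ_three]
      simp
    have h12 : ∀ k : Fin 3, k ≠ k + 1 ∧ k ≠ k + 2 ∧ k + 1 ≠ k + 2 := by decide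
    obtain ⟨h1, h2, h3⟩ := h12 k
    have hv2 : ∀ l, l = 1 ∨ l = 2 → ∑ i, v l i * g i = 0 := by
      rintro l (rfl | rfl)
      · rw [hsum]
        simp only [v, if_neg h1, if_neg h2.symm, if_neg h3.symm, if_pos]
        field_simp
        ring
      · rw [hsum]
        simp only [v, if_neg h1.symm, if_neg h2, if_neg h3, if_pos]
        field_simp
        ring
    set a := g (k + 1) / g k with ha
    set b := g (k + 2) / g k with hb
    have e11 : ∑ i, v 1 i * v 1 i = 1 + a * a := by
      rw [hsum]
      simp only [v, if_neg h1, if_neg h2.symm, if_neg h3.symm, if_pos, ← ha]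
      ring
    have e22 : ∑ i, v 2 i * v 2 i = 1 + b * b := by
      rw [hsum]
      simp only [v, if_neg h1.symm, if_neg h2, if_neg h3, if_pos, ← hb]
      ring
    have e12 : ∑ i, v 1 i * v 2 i = a * b := by
      rw [hsum]
      simp only [v, if_neg h1, if_neg h1.symm, if_neg h2, if_neg h2.symm, if_neg h3,
        if_neg h3.symm, if_pos, ← ha, ← hb]
      ring
    by_cases h11 : 1 / 4 ≤ ‖1 + a * a‖
    · exact ⟨v 1, v 1, hv1 1, hv1 1, hv2 1 (Or.inl rfl), hv2 1 (Or.inl rfl), by rwa [e11]⟩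
    by_cases h22 : 1 / 4 ≤ ‖1 + b * b‖
    · exact ⟨v 2, v 2, hv1 2, hv1 2, hv2 2 (Or.inr rfl), hv2 2 (Or.inr rfl), by rwa [e22]⟩
    refine ⟨v 1, v 2, hv1 1, hv1 2, hv2 1 (Or.inl rfl), hv2 2 (Or.inr rfl), ?_⟩
    rw [e12]
    push Not at h11 h22
    have key : ∀ a : ℂ, ‖1 + a * a‖ < 1 / 4 → 3 / 4 ≤ ‖a‖ ^ 2 := fun a h => by
      have h4 : (1 : ℝ) ≤ ‖1 + a * a‖ + ‖a * a‖ := by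
        have := norm_sub_le (1 + a * a) (a * a)
        simpa using this
      rw [norm_mul a a, ← sq ‖a‖] at h4
      linarith
    have ka := key a h11
    have kb := key b h22
    rw [norm_mul]
    have h5 : (3 / 4 : ℝ) ^ 2 ≤ (‖a‖ * ‖b‖) ^ 2 := by
      rw [mul_pow]
      nlinarith
    have := abs_le_of_sq_le_sq h5 (by positivity)
    have := (abs_le.1 this).2
    linarith

/-- Near a point at which the Hessian has rank at least three, the curvature is bounded below in
terms of the gradient. -/
theorem eventually_le_curvature (hB : IsPolarization F B) {x : V} {u : Fin 3 → V}
    (hu : ∀ i j, B x (u i) (u j) = if i = j then 1 else 0) :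
    ∃ c : ℝ, 0 < c ∧ ∀ᶠ p in 𝓝 x, gradSq F p ≠ 0 → c ≤ gradSq F p ^ 3 * curvature F B p := by
  obtain ⟨M, hM, hBM⟩ := hB.norm_le
  set N := ∑ i, ‖u i‖ + 1 with hN
  have hN0 : 0 < N := by positivity
  have hcomb : ∀ c : Fin 3 → ℂ, (∀ i, ‖c i‖ ≤ 1) → ‖∑ i, c i • u i‖ ≤ N := fun c hc => by
    calc ‖∑ i, c i • u i‖ ≤ ∑ i, ‖c i • u i‖ := norm_sum_le _ _
      _ ≤ ∑ i, ‖u i‖ := Finset.sum_le_sum fun i _ => by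
          rw [norm_smul]
          exact mul_le_of_le_one_left (norm_nonneg _) (hc i)
      _ ≤ N := by linarith
  refine ⟨(1 / 8) ^ 2 / N ^ 4, by positivity, ?_⟩
  have hev : ∀ᶠ p in 𝓝 x, ‖p - x‖ < 1 / (8 * M * N ^ 2) := by
    have : ContinuousAt (fun p => ‖p - x‖) x := by fun_prop
    exact this.eventually (gt_mem_nhds (by simp; positivity))
  filter_upwards [hev] with p hp hg
  -- Two tangent vectors in the span of the `u i` are chosen with bounds that do not depend on the
  -- direction of the gradient, which need not converge as `p` tends to `x`.
  obtain ⟨c, d, hc, hd, hcg, hdg, hcd⟩ := exists_pair_of_hyperplane fun i => B p p (u i)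
  set v := ∑ i, c i • u i with hv
  set w := ∑ i, d i • u i with hw
  have hpv : B p p v = 0 := by
    rw [hv, hB.sum_right]
    simpa [hB.smul_right] using hcg
  have hpw : B p p w = 0 := by
    rw [hw, hB.sum_right]
    simpa [hB.smul_right] using hdg
  have hxvw : B x v w = ∑ i, c i * d i := by
    rw [hv, hw, hB.sum_mid]
    simp [hB.smul_mid, hB.sum_right, hB.smul_right, hu]
  have hsub : B p v w = B x v w + B (p - x) v w := by rw [← hB.add_left, add_sub_cancel]
  have h1 : ‖B (p - x) v w‖ ≤ 1 / 8 := by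
    calc ‖B (p - x) v w‖ ≤ M * ‖p - x‖ * ‖v‖ * ‖w‖ := hBM _ _ _
      _ ≤ M * (1 / (8 * M * N ^ 2)) * N * N := by
          gcongr
          · exact hcomb c hc
          · exact hcomb d hd
      _ = 1 / 8 := by field_simp
  have h2 : 1 / 8 ≤ ‖B p v w‖ := by
    rw [← hxvw] at hcd
    have := norm_sub_le (B p v w) (B (p - x) v w)
    rw [hsub, add_sub_cancel_right, ← hsub] at this
    linarith
  have h3 := sq_le_curvature hB hg hpv hpw
  have hk : 0 ≤ curvature F B p := curvature_nonneg _
  have hs := gradSq_nonneg (F := F) p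
  rw [div_le_iff₀ (by positivity)]
  calc (1 / 8 : ℝ) ^ 2 ≤ ‖B p v w‖ ^ 2 := by gcongr
    _ ≤ gradSq F p ^ 3 * ‖v‖ ^ 2 * ‖w‖ ^ 2 * curvature F B p := h3
    _ ≤ gradSq F p ^ 3 * N ^ 2 * N ^ 2 * curvature F B p := by
        gcongr
        · exact hcomb c hc
        · exact hcomb d hd
    _ = _ := by ring

/-- A linear form that vanishes at `ψ z` is controlled by its pull-back under a parametrization `ψ`
of a neighbourhood of a point of projective space. -/
theorem eventually_norm_le_comp {x : V} (hx : x ≠ 0) {ψ : (Fin 5 → ℂ) → V}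
    (hψ : ContDiffAt ℂ 1 ψ 0) (hψ0 : ψ 0 = x)
    (hinj : ∀ (v : Fin 5 → ℂ) (c : ℂ), fderiv ℂ ψ 0 v = c • x → v = 0) :
    ∃ C : ℝ, 0 ≤ C ∧ ∀ᶠ z in 𝓝 (0 : Fin 5 → ℂ), ∀ l : V →L[ℂ] ℂ, l (ψ z) = 0 →
      ‖l‖ ≤ C * ‖l ∘L fderiv ℂ ψ z‖ := by
  -- Together with `ψ z` the image of the derivative of `ψ` spans `V`. A linear form that kills `ψ
  -- z` is the same on `L z` as on the derivative, and the right inverse of `L 0` serves for nearby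
  -- `z` up to an error absorbed by the factor 2.
  let L : (Fin 5 → ℂ) → (Fin 5 → ℂ) × ℂ →L[ℂ] V := fun z =>
    (fderiv ℂ ψ z).coprod (ContinuousLinearMap.toSpanSingleton ℂ (ψ z))
  have hL : ∀ z v c, L z (v, c) = fderiv ℂ ψ z v + c • ψ z := fun z v c => by
    simp [L, ContinuousLinearMap.toSpanSingleton_apply]
  have hLc : ContinuousAt L 0 := by
    have h1 : ContinuousAt (fderiv ℂ ψ) 0 := hψ.continuousAt_fderiv one_ne_zero
    have h2 : ContinuousAt ψ 0 := hψ.continuousAt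
    have h3 : L = fun z => fderiv ℂ ψ z ∘L ContinuousLinearMap.fst ℂ _ _ +
        (ContinuousLinearMap.toSpanSingletonCLE (𝕜 := ℂ) (ψ z)) ∘L
          ContinuousLinearMap.snd ℂ _ _ := by
      ext z : 1
      ext v <;> simp [L]
    rw [h3]
    exact (h1.clm_comp continuousAt_const).add
      (((ContinuousLinearMap.toSpanSingletonCLE (𝕜 := ℂ) (E := V)).continuous.continuousAt.comp
        h2).clm_comp continuousAt_const)
  have hL0 : Function.Injective (L 0 : (Fin 5 → ℂ) × ℂ →ₗ[ℂ] V) := by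
    rw [injective_iff_map_eq_zero]
    rintro ⟨v, c⟩ h
    change L 0 (v, c) = 0 at h
    rw [hL, hψ0] at h
    have hv : v = 0 := hinj v (-c) (by rw [neg_smul]; exact eq_neg_of_add_eq_zero_left h)
    subst hv
    have hc : c = 0 := by simpa [hx] using h
    rw [hc]; rfl
  have hfin : Module.finrank ℂ ((Fin 5 → ℂ) × ℂ) = Module.finrank ℂ V := by simp
  have hsurj := (LinearMap.injective_iff_surjective_of_finrank_eq_finrank hfin).1 hL0
  obtain ⟨R, hR⟩ := (L 0 : (Fin 5 → ℂ) × ℂ →ₗ[ℂ] V).exists_rightInverse_of_surjective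
    (LinearMap.range_eq_top.2 hsurj)
  let R' : V →L[ℂ] (Fin 5 → ℂ) × ℂ := LinearMap.toContinuousLinearMap R
  have hR' : ∀ v, L 0 (R' v) = v := fun v => LinearMap.congr_fun hR v
  refine ⟨2 * ‖R'‖, by positivity, ?_⟩
  have hev : ∀ᶠ z in 𝓝 0, ‖L z - L 0‖ * ‖R'‖ < 1 / 2 := by
    have : ContinuousAt (fun z => ‖L z - L 0‖ * ‖R'‖) 0 :=
      ((hLc.sub continuousAt_const).norm).mul continuousAt_const
    exact this.eventually (gt_mem_nhds (by simp))
  filter_upwards [hev] with z hz l hl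
  have h1 : ‖l ∘L L z‖ ≤ ‖l ∘L fderiv ℂ ψ z‖ := by
    refine ContinuousLinearMap.opNorm_le_bound _ (norm_nonneg _) ?_
    rintro ⟨v, c⟩
    have : (l ∘L L z) (v, c) = (l ∘L fderiv ℂ ψ z) v := by
      simp [hL, hl]
    rw [this]
    exact (ContinuousLinearMap.le_opNorm _ _).trans
      (mul_le_mul_of_nonneg_left (norm_fst_le (v, c)) (norm_nonneg _))
  have h2 : ‖l‖ ≤ ‖l ∘L L z‖ * ‖R'‖ + ‖l‖ * (‖L z - L 0‖ * ‖R'‖) := by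
    have h3 : l = (l ∘L L z) ∘L R' - (l ∘L (L z - L 0)) ∘L R' := by
      ext v
      simp [hR']
    calc ‖l‖ = ‖(l ∘L L z) ∘L R' - (l ∘L (L z - L 0)) ∘L R'‖ := congrArg _ h3
      _ ≤ ‖(l ∘L L z) ∘L R'‖ + ‖(l ∘L (L z - L 0)) ∘L R'‖ := norm_sub_le _ _
      _ ≤ ‖l ∘L L z‖ * ‖R'‖ + ‖l‖ * ‖L z - L 0‖ * ‖R'‖ := by
          gcongr
          · exact ContinuousLinearMap.opNorm_comp_le _ _
          · exact (ContinuousLinearMap.opNorm_comp_le _ _).trans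
              (mul_le_mul_of_nonneg_right (ContinuousLinearMap.opNorm_comp_le _ _) (norm_nonneg _))
      _ = _ := by ring
  have h3 : ‖l‖ * (‖L z - L 0‖ * ‖R'‖) ≤ ‖l‖ * (1 / 2) :=
    mul_le_mul_of_nonneg_left hz.le (norm_nonneg _)
  have h4 := mul_le_mul_of_nonneg_right h1 (norm_nonneg R')
  linarith

/-- The differential of a local equation. -/
theorem eventually_fderiv_localEquation (hB : IsPolarization F B)
    {ψ : (Fin 5 → ℂ) → V} (hψ : ContDiffAt ℂ 1 ψ 0)
    {u f : (Fin 5 → ℂ) → ℂ} (hu : ContDiffAt ℂ 1 u 0) (hf : ContDiffAt ℂ 1 f 0)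
    (heq : ∀ᶠ z in 𝓝 0, evalAt F (ψ z) = u z * f z) :
    ∀ᶠ z in 𝓝 (0 : Fin 5 → ℂ), ∀ v, 3 * B (ψ z) (ψ z) (fderiv ℂ ψ z v) =
      fderiv ℂ u z v * f z + u z * fderiv ℂ f z v := by
  have hd : ∀ {E : Type} [NormedAddCommGroup E] [NormedSpace ℂ E] {g : (Fin 5 → ℂ) → E},
      ContDiffAt ℂ 1 g 0 → ∀ᶠ z in 𝓝 0, DifferentiableAt ℂ g z := fun hg =>
    (hg.eventually (by simp)).mono fun z hz => hz.differentiableAt one_ne_zero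
  filter_upwards [hd hψ, hd hu, hd hf, heq.eventually_nhds] with z hψz huz hfz hez v
  have hline : HasDerivAt (fun s : ℂ => z + s • v) v 0 := by
    simpa using ((hasDerivAt_id (0 : ℂ)).smul_const v).const_add z
  have hline0 : Filter.Tendsto (fun s : ℂ => z + s • v) (𝓝 0) (𝓝 z) := by
    have : ContinuousAt (fun s : ℂ => z + s • v) 0 := by fun_prop
    simpa [ContinuousAt] using this
  have hz0 : z + (0 : ℂ) • v = z := by simp
  have hcurve : ∀ {E : Type} [NormedAddCommGroup E] [NormedSpace ℂ E] {g : (Fin 5 → ℂ) → E},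
      DifferentiableAt ℂ g z → HasDerivAt (fun s : ℂ => g (z + s • v)) (fderiv ℂ g z v) 0 := by
    intro E _ _ g hg
    refine HasFDerivAt.comp_hasDerivAt (0 : ℂ) ?_ hline
    rw [hz0]
    exact hg.hasFDerivAt
  have h1 := hB.hasDerivAt_comp (hcurve hψz) (hcurve hψz) (hcurve hψz)
  have h2 := (hcurve huz).mul (hcurve hfz)
  have h3 : (fun s : ℂ => B (ψ (z + s • v)) (ψ (z + s • v)) (ψ (z + s • v))) =ᶠ[𝓝 0]
      ((fun s : ℂ => u (z + s • v)) * fun s : ℂ => f (z + s • v)) := by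
    filter_upwards [hline0.eventually hez] with s hs
    rw [← hB.eval_eq, hs]
    rfl
  have h4 := (h1.congr_of_eventuallyEq h3.symm).unique h2
  simp only [hz0] at h4
  rw [hB.swap12 (ψ z) _ (ψ z), hB.swap13 (fderiv ℂ ψ z v)] at h4
  linear_combination h4

/-- The gradient of `F` is controlled by the differential of a local equation. -/
theorem eventually_gradSq_le (hB : IsPolarization F B) {x : V} (hx : x ≠ 0)
    {ψ : (Fin 5 → ℂ) → V} (hψ : ContDiffAt ℂ 1 ψ 0) (hψ0 : ψ 0 = x)
    (hinj : ∀ (v : Fin 5 → ℂ) (c : ℂ), fderiv ℂ ψ 0 v = c • x → v = 0)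
    {u f : (Fin 5 → ℂ) → ℂ} (hu : ContDiffAt ℂ 1 u 0) (hu0 : u 0 ≠ 0) (hf : ContDiffAt ℂ 1 f 0)
    (heq : ∀ᶠ z in 𝓝 0, evalAt F (ψ z) = u z * f z) :
    ∃ C : ℝ, 0 < C ∧ ∀ᶠ z in 𝓝 (0 : Fin 5 → ℂ), f z = 0 →
      gradSq F (ψ z) ≤ C * ‖fderiv ℂ f z‖ ^ 2 ∧ (fderiv ℂ f z ≠ 0 → gradSq F (ψ z) ≠ 0) := by
  obtain ⟨C, hC, hbd⟩ := eventually_norm_le_comp hx hψ hψ0 hinj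
  set N := ‖u 0‖ + 1 with hN
  refine ⟨6 * (C * N) ^ 2 + 1, by positivity, ?_⟩
  have huN : ∀ᶠ z in 𝓝 0, ‖u z‖ < N := hu.continuousAt.norm.eventually (gt_mem_nhds (by simp [hN]))
  filter_upwards [hbd, eventually_fderiv_localEquation hB hψ hu hf heq, heq, huN,
    hu.continuousAt.eventually_ne hu0] with z hz hdz hez huNz huz0 hfz0
  let l : V →L[ℂ] ℂ := LinearMap.toContinuousLinearMap ((3 : ℂ) • hB.lin (ψ z) (ψ z))
  have hl : ∀ v, l v = 3 * B (ψ z) (ψ z) v := fun v => rfl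
  have hFz : B (ψ z) (ψ z) (ψ z) = 0 := by
    rw [← hB.eval_eq, hez, hfz0, mul_zero]
  have hcomp : l ∘L fderiv ℂ ψ z = u z • fderiv ℂ f z := by
    ext1 v
    change l (fderiv ℂ ψ z v) = u z * fderiv ℂ f z v
    rw [hl, hdz, hfz0, mul_zero, zero_add]
  have hpart : ∀ i, partialAt F i (ψ z) = l (EuclideanSpace.single i 1) := fun i => by
    rw [hl, hB.partial_eq]
  have hle : ‖l‖ ≤ C * N * ‖fderiv ℂ f z‖ := by
    have := hz l (by rw [hl, hFz, mul_zero])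
    rw [hcomp, norm_smul] at this
    calc ‖l‖ ≤ C * (‖u z‖ * ‖fderiv ℂ f z‖) := this
      _ ≤ C * (N * ‖fderiv ℂ f z‖) := by gcongr
      _ = _ := by ring
  refine ⟨?_, fun hne h0 => hne ?_⟩
  · calc gradSq F (ψ z) ≤ ∑ _i : Fin 6, ‖l‖ ^ 2 := Finset.sum_le_sum fun i _ => by
          rw [hpart]
          gcongr
          simpa using l.le_opNorm (EuclideanSpace.single i 1)
      _ = 6 * ‖l‖ ^ 2 := by simp
      _ ≤ 6 * (C * N * ‖fderiv ℂ f z‖) ^ 2 := by gcongr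
      _ ≤ _ := by nlinarith [sq_nonneg ‖fderiv ℂ f z‖]
  · have hp0 : ∀ i, partialAt F i (ψ z) = 0 := fun i => by
      have := sq_le_gradSq (F := F) (ψ z) i
      rw [h0] at this
      simpa using le_antisymm this (sq_nonneg _)
    have hl0 : l = 0 := by
      ext v
      rw [hl, hB.eq_sum_partial]
      simp [hp0]
    rw [hl0, ContinuousLinearMap.zero_comp] at hcomp
    exact (smul_eq_zero.1 hcomp.symm).resolve_left huz0

/-- Divergence of the integral of the curvature at a point at which the Hessian has rank at least
three, in terms of a local equation. -/
theorem lintegral_curvature_of_localEquation (hB : IsPolarization F B) {x : V} (hx : x ≠ 0)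
    {e : Fin 3 → V} (he : ∀ i j, B x (e i) (e j) = if i = j then 1 else 0)
    {ψ : (Fin 5 → ℂ) → V} (hψ : ContDiffAt ℂ 1 ψ 0) (hψ0 : ψ 0 = x)
    (hinj : ∀ (v : Fin 5 → ℂ) (c : ℂ), fderiv ℂ ψ 0 v = c • x → v = 0)
    {u f : (Fin 5 → ℂ) → ℂ} (hu : ContDiffAt ℂ 1 u 0) (hu0 : u 0 ≠ 0) (hf : ContDiffAt ℂ 1 f 0)
    (heq : ∀ᶠ z in 𝓝 0, evalAt F (ψ z) = u z * f z)
    {ι : Type*} [Fintype ι] (hι : Fintype.card ι = 4) {κ : (ι → ℂ) × ℂ → Fin 5 → ℂ}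
    {κ' : (ι → ℂ) × ℂ →L[ℂ] Fin 5 → ℂ} (hκ : HasStrictFDerivAt κ κ' 0) (hκ0 : κ 0 = 0)
    (hκi : Function.Injective κ')
    (h : ∀ ε : ℝ, 0 < ε → ∃ (W : ι → ℝ) (Z₀ : ι → ℂ) (C : ℝ), (∃ i, 0 < W i ∧ Z₀ i ≠ 0) ∧
      ∀ᶠ q : ℝ × (ι → ℂ) in 𝓝[>] 0 ×ˢ 𝓝 Z₀, ∃ t : ℂ,
        ‖((fun i => ((q.1 ^ W i : ℝ) : ℂ) * q.2 i, t) : (ι → ℂ) × ℂ)‖ < ε ∧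
        f (κ (fun i => ((q.1 ^ W i : ℝ) : ℂ) * q.2 i, t)) = 0 ∧
        fderiv ℂ f (κ (fun i => ((q.1 ^ W i : ℝ) : ℂ) * q.2 i, t)) ≠ 0 ∧
        ‖fderiv ℂ f (κ (fun i => ((q.1 ^ W i : ℝ) : ℂ) * q.2 i, t))‖ ^ 6 ≤
          C * q.1 ^ (2 * ∑ i, W i)) :
    ∫⁻ x in regLink F, ENNReal.ofReal (curvature F B x)
      ∂(MeasureTheory.Measure.hausdorffMeasure 9) = ∞ := by
  obtain ⟨c, hc, hcurv⟩ := eventually_le_curvature hB he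
  obtain ⟨C₁, hC₁, hgrad⟩ := eventually_gradSq_le hB hx hψ hψ0 hinj hu hu0 hf heq
  have hκt : Filter.Tendsto κ (𝓝 0) (𝓝 0) := by
    have := hκ.hasFDerivAt.continuousAt
    rwa [ContinuousAt, hκ0] at this
  have hψt : Filter.Tendsto ψ (𝓝 0) (𝓝 x) := by
    have := hψ.continuousAt
    rwa [ContinuousAt, hψ0] at this
  have hψs : HasStrictFDerivAt ψ (fderiv ℂ ψ 0) (κ 0) := by
    rw [hκ0]
    exact hψ.hasStrictFDerivAt one_ne_zero
  refine lintegral_curvature_eq_top hB hι hx (Φ := ψ ∘ κ) (hψs.comp 0 hκ)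
    (by simp [hκ0, hψ0]) (fun v c hv => ?_) fun ε hε => ?_
  · exact (injective_iff_map_eq_zero κ').1 hκi v (hinj _ c hv)
  have hall : ∀ᶠ y in 𝓝 (0 : (ι → ℂ) × ℂ), (gradSq F (ψ (κ y)) ≠ 0 →
      c ≤ gradSq F (ψ (κ y)) ^ 3 * curvature F B (ψ (κ y))) ∧
      (f (κ y) = 0 → gradSq F (ψ (κ y)) ≤ C₁ * ‖fderiv ℂ f (κ y)‖ ^ 2 ∧
        (fderiv ℂ f (κ y) ≠ 0 → gradSq F (ψ (κ y)) ≠ 0)) ∧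
      evalAt F (ψ (κ y)) = u (κ y) * f (κ y) :=
    (hκt.eventually (hψt.eventually hcurv)).and ((hκt.eventually hgrad).and (hκt.eventually heq))
  obtain ⟨δ, hδ, hall⟩ := Metric.eventually_nhds_iff_ball.1 hall
  obtain ⟨W, Z₀, C, hW, hev⟩ := h (min ε δ) (lt_min hε hδ)
  refine ⟨W, Z₀, c / (C₁ ^ 3 * (|C| + 1)), hW, by positivity, ?_⟩
  have hpos : ∀ᶠ q : ℝ × (ι → ℂ) in 𝓝[>] 0 ×ˢ 𝓝 Z₀, 0 < q.1 :=
    Filter.tendsto_fst.eventually (self_mem_nhdsWithin : Set.Ioi (0 : ℝ) ∈ 𝓝[>] 0)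
  filter_upwards [hev, hpos] with q ⟨t, htε, hft, hdt, hle⟩ hq
  set y : (ι → ℂ) × ℂ := (fun i => ((q.1 ^ W i : ℝ) : ℂ) * q.2 i, t) with hy
  obtain ⟨h1, h2, h3⟩ := hall y (by
    rw [mem_ball_zero_iff]
    exact htε.trans_le (min_le_right _ _))
  obtain ⟨h4, h5⟩ := h2 hft
  have hg0 := h5 hdt
  refine ⟨t, htε.trans_le (min_le_left _ _), ?_, ?_, ?_⟩
  · change evalAt F (ψ (κ y)) = 0
    rw [h3, hft, mul_zero]
  · by_contra! hcon
    apply hg0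
    change ∑ j, ‖partialAt F j (ψ (κ y))‖ ^ 2 = 0
    exact Finset.sum_eq_zero fun j _ => by
      have := hcon j
      change partialAt F j (ψ (κ y)) = 0 at this
      rw [this]; simp
  change _ ≤ _ * curvature F B (ψ (κ y))
  have hk : 0 ≤ curvature F B (ψ (κ y)) := curvature_nonneg _
  have hρ : 0 < q.1 ^ (2 * ∑ i, W i) := Real.rpow_pos_of_pos hq _
  rw [div_le_iff₀ (by positivity)]
  -- The curvature is at least of order `|grad F|⁻⁶`, hence of order `|df|⁻⁶`, so the bound of
  -- `|df|⁶` by the volume of the box is what is needed.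
  calc c ≤ gradSq F (ψ (κ y)) ^ 3 * curvature F B (ψ (κ y)) := h1 hg0
    _ ≤ (C₁ * ‖fderiv ℂ f (κ y)‖ ^ 2) ^ 3 * curvature F B (ψ (κ y)) := by
        gcongr
        exact gradSq_nonneg _
    _ = C₁ ^ 3 * ‖fderiv ℂ f (κ y)‖ ^ 6 * curvature F B (ψ (κ y)) := by ring
    _ ≤ C₁ ^ 3 * ((|C| + 1) * q.1 ^ (2 * ∑ i, W i)) * curvature F B (ψ (κ y)) := by
        gcongr
        refine hle.trans ?_
        gcongr
        have := le_abs_self C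
        linarith
    _ = _ := by ring

end CubicFourfold

/-! ### Symmetric matrices and weights -/

namespace CubicFourfold

variable {n : Type*} [Fintype n] [DecidableEq n]

/-- A symmetric matrix of rank at least three has a nondegenerate principal minor of maximal size,
which is at least three. -/
theorem exists_nondegenerate_principal_minor {M : n → n → ℂ} (hM : ∀ i j, M i j = M j i)
    {u : Fin 3 → n → ℂ} {c : ℂ} (hc : c ≠ 0)
    (hu : ∀ i j, ∑ k, u i k * ∑ l, M k l * u j l = if i = j then c else 0) :
    ∃ P : Finset n, 3 ≤ P.card ∧ ∀ v : n → ℂ, (∀ i ∉ P, v i = 0) →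
      (∀ i ∈ P, ∑ j, M i j * v j = 0) → v = 0 := by
  classical
  -- The rows in a maximal independent set determine the kernel of `M`; by symmetry, independence of
  -- these rows is nondegeneracy of the principal minor.
  obtain ⟨s, hs, hmax⟩ := exists_maximal_linearIndepOn ℂ M
  obtain ⟨P, rfl⟩ : ∃ P : Finset n, s = ↑P := ⟨s.toFinset, by simp⟩
  have hall : ∀ v : n → ℂ, (∀ i ∈ P, ∑ j, M i j * v j = 0) → ∀ i, ∑ j, M i j * v j = 0 := by
    intro v hv i
    by_cases hi : i ∈ P
    · exact hv i hi
    let l : (n → ℂ) →ₗ[ℂ] ℂ := Fintype.linearCombination ℂ v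
    have hl : ∀ r, l r = ∑ j, r j * v j := fun r => by
      simp [l, Fintype.linearCombination_apply]
    obtain ⟨a, ha, hai⟩ := hmax i (by simpa using hi)
    have hle : Submodule.span ℂ (M '' ↑P) ≤ LinearMap.ker l := by
      rw [Submodule.span_le]
      rintro _ ⟨j, hj, rfl⟩
      change l (M j) = 0
      rw [hl]
      exact hv j hj
    have h1 : l (a • M i) = 0 := hle hai
    rw [map_smul, hl] at h1
    exact (smul_eq_zero.1 h1).resolve_left ha
  refine ⟨P, ?_, fun v hv0 hv => ?_⟩
  -- With fewer than three rows, some nontrivial combination of the `u j` would lie in the kernel of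
  -- `M`, although their Gram matrix is `c` times the identity.
  · by_contra hcard
    let T : (Fin 3 → ℂ) →ₗ[ℂ] (P → ℂ) := LinearMap.pi fun i =>
      (Fintype.linearCombination ℂ (M i)).comp (Fintype.linearCombination ℂ u)
    have hT : ∀ a i, T a i = ∑ l, M i l * (∑ k, a k • u k) l := fun a i => by
      simp only [T, LinearMap.pi_apply, LinearMap.comp_apply, Fintype.linearCombination_apply,
        smul_eq_mul]
      exact Finset.sum_congr rfl fun l _ => mul_comm _ _
    have hker := T.ker_ne_bot_of_finrank_lt (by
      rw [Module.finrank_pi, Module.finrank_pi, Fintype.card_coe, Fintype.card_fin]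
      omega)
    obtain ⟨a, ha, ha0⟩ := (Submodule.ne_bot_iff _).1 hker
    apply ha0
    have h1 := hall (∑ k, a k • u k) fun i hi => by
      rw [← hT a ⟨i, hi⟩, LinearMap.mem_ker.1 ha]; rfl
    ext i
    have h2 : ∑ k, u i k * ∑ l, M k l * (∑ j, a j • u j) l = a i * c := by
      calc ∑ k, u i k * ∑ l, M k l * (∑ j, a j • u j) l
          = ∑ j, a j * ∑ k, u i k * ∑ l, M k l * u j l := by
            simp only [Finset.sum_apply, Pi.smul_apply, smul_eq_mul, Finset.mul_sum]
            rw [Finset.sum_comm' (t' := Finset.univ) (s' := fun _ => Finset.univ) (by simp)]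
            rw [Finset.sum_congr rfl fun y _ => Finset.sum_comm]
            rw [Finset.sum_comm]
            refine (Finset.sum_congr rfl fun j _ => ?_)
            rw [Finset.sum_comm]
            exact Finset.sum_congr rfl fun _ _ => Finset.sum_congr rfl fun _ _ => by ring
        _ = a i * c := by simp [hu]
    simp only [h1, mul_zero, Finset.sum_const_zero] at h2
    exact (mul_eq_zero.1 h2.symm).resolve_right hc
  · have h1 := hall v hv
    have h2 : ∑ i ∈ P, v i • M i = 0 := by
      ext j
      rw [Finset.sum_apply, Pi.zero_apply, ← h1 j]
      rw [← Finset.sum_subset (Finset.subset_univ P) fun i _ hi => by simp [hv0 i hi]]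
      exact Finset.sum_congr rfl fun i _ => by simp [hM i j, mul_comm]
    have h3 := linearIndepOn_finset_iff.1 hs v h2
    ext i
    by_cases hi : i ∈ P
    · exact h3 i hi
    · exact hv0 i hi

/-- The weights of the indices of a nondegenerate principal minor have mean `d / 2`. -/
theorem two_mul_sum_weights {M : n → n → ℂ} {P : Finset n}
    (hP : ∀ v : n → ℂ, (∀ i ∉ P, v i = 0) → (∀ i ∈ P, ∑ j, M i j * v j = 0) → v = 0)
    {w : n → ℝ} {d : ℝ} (hw : ∀ i j, M i j ≠ 0 → w i + w j = d) :
    2 * ∑ i ∈ P, w i = P.card * d := by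
  let A : Matrix P P ℂ := fun i j => M i j
  have hdet : A.det ≠ 0 := by
    intro h0
    obtain ⟨v, hv, hAv⟩ := Matrix.exists_mulVec_eq_zero_iff.2 h0
    apply hv
    let v' : n → ℂ := fun i => if h : i ∈ P then v ⟨i, h⟩ else 0
    have h1 := hP v' (fun i hi => dif_neg hi) fun i hi => by
      rw [← Finset.sum_subset (Finset.subset_univ P) fun j _ hj => by simp [v', hj],
        ← Finset.sum_coe_sort]
      have := congrFun hAv ⟨i, hi⟩
      simpa [Matrix.mulVec, dotProduct, A, v'] using this
    ext i
    simpa [v'] using congrFun h1 i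
  rw [Matrix.det_apply] at hdet
  -- A nonzero determinant has a nonzero term in its Leibniz expansion; its permutation satisfies `w
  -- (σ i) + w i = d` for all `i` in `P`.
  obtain ⟨σ, -, hσ⟩ := Finset.exists_ne_zero_of_sum_ne_zero hdet
  have h1 : ∀ i, w (σ i) + w i = d := fun i => hw _ _ fun h0 => hσ (by
    rw [Finset.prod_eq_zero (Finset.mem_univ i) h0, smul_zero])
  have h2 : ∑ i : P, (w (σ i) + w i) = P.card * d := by simp [h1]
  rw [Finset.sum_add_distrib, Equiv.sum_comp σ fun i : P => w i, Finset.sum_coe_sort] at h2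
  linarith

/-- By polarization, if the form vanished on all vectors supported in `P`, then so would every `M i
k` with `i` and `k` in `P`, and a basis vector would contradict nondegeneracy. -/
theorem exists_quadraticForm_ne_zero {M : n → n → ℂ} (hM : ∀ i j, M i j = M j i) {P : Finset n}
    (hP0 : P.Nonempty)
    (hP : ∀ v : n → ℂ, (∀ i ∉ P, v i = 0) → (∀ i ∈ P, ∑ j, M i j * v j = 0) → v = 0) :
    ∃ η : n → ℂ, (∀ i ∉ P, η i = 0) ∧ ∑ i, η i * ∑ j, M i j * η j ≠ 0 := by
  by_contra! hcon
  obtain ⟨k, hk⟩ := hP0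
  have hs : ∀ i j, ∑ l, M i l * (Pi.single j 1 : n → ℂ) l = M i j := fun i j => by
    simp [Pi.single_apply]
  have hq : ∀ i j, ∑ l, (Pi.single i 1 : n → ℂ) l * ∑ m, M l m * (Pi.single j 1 : n → ℂ) m =
      M i j := fun i j => by
    simp [Pi.single_apply]
  have h0 : ∀ i ∈ P, M i i = 0 := fun i hi => by
    rw [← hq i i]
    exact hcon _ fun j hj => Pi.single_eq_of_ne (by rintro rfl; exact hj hi) _
  have h1 : ∀ i ∈ P, M i k = 0 := fun i hi => by
    have h2 := hcon (Pi.single i 1 + Pi.single k 1) fun j hj => by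
      rw [Pi.add_apply, Pi.single_eq_of_ne (by rintro rfl; exact hj hi),
        Pi.single_eq_of_ne (by rintro rfl; exact hj hk), add_zero]
    simp only [Pi.add_apply, mul_add, add_mul, Finset.sum_add_distrib, hs] at h2
    simpa [Pi.single_apply, h0 i hi, h0 k hk, hM k i] using h2
  have h2 := hP (Pi.single k 1)
    (fun i hi => Pi.single_eq_of_ne (by rintro rfl; exact hi hk) _) fun i hi => by
      rw [hs, h1 i hi]
  have h3 := congrFun h2 k
  simp at h3

end CubicFourfold

/-! ### Weighted homogeneous germs and gradient charts -/

namespace CubicFourfold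

section coordinates

variable {n : Type*}

/-- The weighted scaling of the coordinates. -/
noncomputable def weightScale (w : n → ℝ) (t : ℝ) (z : n → ℂ) : n → ℂ :=
  fun i => ((t ^ w i : ℝ) : ℂ) * z i

theorem weightScale_single [DecidableEq n] (w : n → ℝ) (t : ℝ) (i : n) (c : ℂ) :
    weightScale w t (Pi.single i c) = ((t ^ w i : ℝ) : ℂ) • Pi.single i c := by
  ext j
  by_cases h : j = i
  · subst h
    simp [weightScale]
  · simp [weightScale, h]

theorem weightScale_add (w : n → ℝ) (t : ℝ) (z z' : n → ℂ) :
    weightScale w t (z + z') = weightScale w t z + weightScale w t z' := by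
  ext i
  simp [weightScale, mul_add]

theorem weightScale_smul (w : n → ℝ) (t : ℝ) (c : ℂ) (z : n → ℂ) :
    weightScale w t (c • z) = c • weightScale w t z := by
  ext i
  simp [weightScale, mul_left_comm]

variable [Fintype n]

theorem norm_weightScale_le {w : n → ℝ} (hw : ∀ i, 0 ≤ w i) {t : ℝ} (ht : 0 < t) (ht1 : t ≤ 1)
    (z : n → ℂ) : ‖weightScale w t z‖ ≤ ‖z‖ := by
  refine (pi_norm_le_iff_of_nonneg (norm_nonneg _)).2 fun i => ?_
  rw [weightScale, norm_mul, Complex.norm_real, Real.norm_of_nonneg (Real.rpow_nonneg ht.le _)]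
  exact (mul_le_of_le_one_left (norm_nonneg _) (Real.rpow_le_one ht.le ht1 (hw i))).trans
    (norm_le_pi_norm z i)

variable [DecidableEq n]

/-- The partial derivatives of a function of several complex variables. -/
noncomputable def coordDeriv (f : (n → ℂ) → ℂ) (i : n) (z : n → ℂ) : ℂ :=
  fderiv ℂ f z (Pi.single i 1)

theorem sum_coordDeriv_mul (f : (n → ℂ) → ℂ) (z v : n → ℂ) :
    fderiv ℂ f z v = ∑ i, coordDeriv f i z * v i := by
  conv_lhs => rw [pi_eq_sum_univ' v]
  simp only [map_sum, map_smul, coordDeriv, smul_eq_mul]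
  refine Finset.sum_congr rfl fun i _ => ?_
  rw [mul_comm]

theorem norm_fderiv_le (f : (n → ℂ) → ℂ) (z : n → ℂ) :
    ‖fderiv ℂ f z‖ ≤ ∑ i, ‖coordDeriv f i z‖ := by
  refine ContinuousLinearMap.opNorm_le_bound _ (Finset.sum_nonneg fun _ _ => norm_nonneg _)
    fun v => ?_
  rw [sum_coordDeriv_mul, Finset.sum_mul]
  refine (norm_sum_le _ _).trans (Finset.sum_le_sum fun i _ => ?_)
  rw [norm_mul]
  exact mul_le_mul_of_nonneg_left (norm_le_pi_norm v i) (norm_nonneg _)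

end coordinates

/-- The partial derivatives of a weighted homogeneous germ are weighted homogeneous. -/
theorem exists_weighted_homogeneous_coordDeriv {f : (Fin 5 → ℂ) → ℂ} {w : Fin 5 → ℝ} {d : ℝ}
    (hf : ContDiffAt ℂ 1 f 0) (hw : ∀ i, 0 ≤ w i) (hhom : IsWeightedHomogeneousGerm w d f) :
    ∃ δ : ℝ, 0 < δ ∧ ∀ z : Fin 5 → ℂ, ‖z‖ < δ → DifferentiableAt ℂ f z ∧
      ∀ t : ℝ, 0 < t → t ≤ 1 → f (weightScale w t z) = ((t ^ d : ℝ) : ℂ) * f z ∧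
        ∀ i, ((t ^ w i : ℝ) : ℂ) * coordDeriv f i (weightScale w t z) =
          ((t ^ d : ℝ) : ℂ) * coordDeriv f i z := by
  have hd : ∀ᶠ z in 𝓝 0, DifferentiableAt ℂ f z :=
    (hf.eventually (by simp)).mono fun z hz => hz.differentiableAt one_ne_zero
  obtain ⟨δ, hδ, hall⟩ := Metric.eventually_nhds_iff_ball.1 (hd.and hhom)
  refine ⟨δ, hδ, fun z hz => ⟨(hall z (by simpa using hz)).1, fun t ht ht1 =>
    ⟨(hall z (by simpa using hz)).2 t ht ht1, fun i => ?_⟩⟩⟩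
  have hz' : ‖weightScale w t z‖ < δ := (norm_weightScale_le hw ht ht1 z).trans_lt hz
  have hline : ∀ (z v : Fin 5 → ℂ), HasDerivAt (fun s : ℂ => z + s • v) v 0 := fun z v => by
    simpa using ((hasDerivAt_id (0 : ℂ)).smul_const v).const_add z
  have hcurve : ∀ (z v : Fin 5 → ℂ), ‖z‖ < δ →
      HasDerivAt (fun s : ℂ => f (z + s • v)) (fderiv ℂ f z v) 0 := by
    intro z v hz
    refine HasFDerivAt.comp_hasDerivAt (0 : ℂ) ?_ (hline z v)
    rw [zero_smul, add_zero]
    exact (hall z (by simpa using hz)).1.hasFDerivAt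
  have h1 := hcurve (weightScale w t z) (((t ^ w i : ℝ) : ℂ) • Pi.single i 1) hz'
  have h2 := (hcurve z (Pi.single i 1) hz).const_mul ((t ^ d : ℝ) : ℂ)
  have h3 : (fun s : ℂ => f (weightScale w t z + s • ((t ^ w i : ℝ) : ℂ) • Pi.single i 1)) =ᶠ[𝓝 0]
      fun s : ℂ => ((t ^ d : ℝ) : ℂ) * f (z + s • Pi.single i 1) := by
    have hb : ∀ᶠ s : ℂ in 𝓝 0, z + s • Pi.single i 1 ∈ Metric.ball (0 : Fin 5 → ℂ) δ := by
      have hc : ContinuousAt (fun s : ℂ => z + s • (Pi.single i 1 : Fin 5 → ℂ)) 0 := by fun_prop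
      exact hc.eventually_mem (Metric.isOpen_ball.mem_nhds (by simpa using hz))
    filter_upwards [hb] with s hs
    rw [← (hall _ hs).2 t ht ht1]
    change _ = f (weightScale w t _)
    rw [weightScale_add, weightScale_smul, weightScale_single]
  have h4 := (h2.congr_of_eventuallyEq h3).unique h1
  rw [map_smul, smul_eq_mul] at h4
  exact h4.symm

/-- The second derivatives of a weighted homogeneous germ at the origin. -/
theorem weights_of_hessian_ne_zero {f : (Fin 5 → ℂ) → ℂ} {w : Fin 5 → ℝ} {d : ℝ}
    (hf : ContDiffAt ℂ 1 f 0) (hf' : ∀ i, DifferentiableAt ℂ (coordDeriv f i) 0)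
    (hw : ∀ i, 0 ≤ w i) (hhom : IsWeightedHomogeneousGerm w d f) {i j : Fin 5}
    (h : fderiv ℂ (coordDeriv f i) 0 (Pi.single j 1) ≠ 0) : w i + w j = d := by
  obtain ⟨δ, hδ, hall⟩ := exists_weighted_homogeneous_coordDeriv hf hw hhom
  have hcurve : ∀ v : Fin 5 → ℂ, HasDerivAt (fun s : ℂ => coordDeriv f i (s • v))
      (fderiv ℂ (coordDeriv f i) 0 v) 0 := by
    intro v
    have hline : HasDerivAt (fun s : ℂ => s • v) v 0 := by
      simpa using (hasDerivAt_id (0 : ℂ)).smul_const v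
    have h0 : HasFDerivAt (coordDeriv f i) (fderiv ℂ (coordDeriv f i) 0) ((0 : ℂ) • v) := by
      rw [zero_smul]
      exact (hf' i).hasFDerivAt
    exact h0.comp_hasDerivAt (0 : ℂ) hline
  -- Any `t` between 0 and 1 would do: comparing the logarithms of `t ^ d` and `t ^ (w i + w j)`
  -- suffices.
  set t : ℝ := 1 / 2 with ht
  have ht0 : 0 < t := by norm_num
  have ht1 : t ≤ 1 := by norm_num
  have h1 := (hcurve (((t ^ w j : ℝ) : ℂ) • Pi.single j 1)).const_mul ((t ^ w i : ℝ) : ℂ)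
  have h2 := (hcurve (Pi.single j 1)).const_mul ((t ^ d : ℝ) : ℂ)
  have h3 : (fun s : ℂ => ((t ^ w i : ℝ) : ℂ) *
      coordDeriv f i (s • ((t ^ w j : ℝ) : ℂ) • Pi.single j 1)) =ᶠ[𝓝 0]
      fun s : ℂ => ((t ^ d : ℝ) : ℂ) * coordDeriv f i (s • Pi.single j 1) := by
    have hb : ∀ᶠ s : ℂ in 𝓝 0, s • Pi.single j 1 ∈ Metric.ball (0 : Fin 5 → ℂ) δ := by
      have hc : ContinuousAt (fun s : ℂ => s • (Pi.single j 1 : Fin 5 → ℂ)) 0 := by fun_prop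
      exact hc.eventually_mem (Metric.isOpen_ball.mem_nhds (by simpa using hδ))
    filter_upwards [hb] with s hs
    rw [← ((hall _ (by simpa using hs)).2 t ht0 ht1).2 i, weightScale_smul, weightScale_single]
  have h4 := (h2.congr_of_eventuallyEq h3).unique h1
  rw [map_smul, smul_eq_mul, ← mul_assoc] at h4
  have h5 := mul_right_cancel₀ h h4
  have h6 : t ^ d = t ^ w i * t ^ w j := by exact_mod_cast h5
  rw [← Real.rpow_add ht0] at h6
  have h7 := congrArg Real.log h6
  rw [Real.log_rpow ht0, Real.log_rpow ht0] at h7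
  have h8 : Real.log t ≠ 0 := (Real.log_neg ht0 (by norm_num)).ne
  exact (mul_right_cancel₀ h8 h7).symm

/-- Coordinates in which the partial derivatives of `f` with indices in `P` replace the
coordinates with these indices; `κ` is the inverse of the coordinate system, on a ball of
radius `r`. -/
structure GradientChart (f : (Fin 5 → ℂ) → ℂ) (P : Finset (Fin 5)) (w : Fin 5 → ℝ) (d : ℝ)
    (κ : (Fin 5 → ℂ) → Fin 5 → ℂ) (κ' : (Fin 5 → ℂ) →L[ℂ] Fin 5 → ℂ) (r Λ : ℝ) : Prop where
  pos : 0 < r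
  map_zero : κ 0 = 0
  strict : HasStrictFDerivAt κ κ' 0
  injective : Function.Injective κ'
  apply : ∀ η, (∀ i ∉ P, η i = 0) →
    κ' (fun i => if i ∈ P then fderiv ℂ (coordDeriv f i) 0 η else 0) = η
  continuousAt_fderiv : ContinuousAt (fderiv ℂ κ) 0
  differentiableAt : ∀ y ∈ Metric.ball 0 r, DifferentiableAt ℂ κ y
  differentiableAt_apply : ∀ y ∈ Metric.ball 0 r, DifferentiableAt ℂ f (κ y)
  coordDeriv_apply : ∀ y ∈ Metric.ball 0 r, ∀ i ∈ P, coordDeriv f i (κ y) = y i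
  fderiv_apply : ∀ y ∈ Metric.ball 0 r, ∀ v : Fin 5 → ℂ, (∀ i ∉ P, v i = 0) →
    ∀ i ∉ P, fderiv ℂ κ y v i = 0
  lipschitz : ∀ y ∈ Metric.ball 0 r, ∀ y' ∈ Metric.ball 0 r, ∀ i,
    ‖coordDeriv f i (κ y) - coordDeriv f i (κ y')‖ ≤ Λ * ‖y - y'‖
  homogeneous : ∀ y ∈ Metric.ball 0 r, (∀ i ∈ P, y i = 0) → ∀ t : ℝ, 0 < t → t ≤ 1 →
    f (κ (weightScale w t y)) = ((t ^ d : ℝ) : ℂ) * f (κ y) ∧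
    ∀ i, ((t ^ w i : ℝ) : ℂ) * coordDeriv f i (κ (weightScale w t y)) =
      ((t ^ d : ℝ) : ℂ) * coordDeriv f i (κ y)

/-- The inverse function theorem for `Θ`, which puts the partial derivatives of `f` in place of the
coordinates in `P`; its derivative is injective because the minor is nondegenerate. This is a
substitute for the splitting lemma: where the coordinates in `P` vanish, weighted scaling preserves
the vanishing of the `∂ᵢf`, so the scaled point and the image of the scaled coordinates agree under
`Θ`, and `κ` commutes with scaling. -/
theorem exists_gradientChart {f : (Fin 5 → ℂ) → ℂ} {P : Finset (Fin 5)} (hf : AnalyticAt ℂ f 0)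
    (hdf : fderiv ℂ f 0 = 0) {w : Fin 5 → ℝ} {d : ℝ} (hw : ∀ i, 0 ≤ w i)
    (hhom : IsWeightedHomogeneousGerm w d f)
    (hP : ∀ v : Fin 5 → ℂ, (∀ i ∉ P, v i = 0) →
      (∀ i ∈ P, fderiv ℂ (coordDeriv f i) 0 v = 0) → v = 0) :
    ∃ κ κ' r Λ, GradientChart f P w d κ κ' r Λ := by
  have hfc : ContDiffAt ℂ 1 f 0 := hf.contDiffAt
  have hp : ∀ i, ContDiffAt ℂ 1 (coordDeriv f i) 0 := fun i =>
    (AnalyticAt.contDiffAt hf.fderiv).clm_apply contDiffAt_const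
  have hp0 : ∀ i, coordDeriv f i 0 = 0 := fun i => by simp [coordDeriv, hdf]
  let Θ : (Fin 5 → ℂ) → Fin 5 → ℂ := fun z i => if i ∈ P then coordDeriv f i z else z i
  have hΘ0 : Θ 0 = 0 := by
    ext i
    simp [Θ, hp0]
  have hΘ : ContDiffAt ℂ 1 Θ 0 := by
    refine contDiffAt_pi.2 fun i => ?_
    by_cases hi : i ∈ P
    · simpa [Θ, hi] using hp i
    · simp only [Θ, hi, if_false]
      fun_prop
  let N : (Fin 5 → ℂ) →L[ℂ] Fin 5 → ℂ := ContinuousLinearMap.pi fun i =>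
    if i ∈ P then fderiv ℂ (coordDeriv f i) 0 else ContinuousLinearMap.proj i
  have hN : ∀ v i, N v i = if i ∈ P then fderiv ℂ (coordDeriv f i) 0 v else v i := fun v i => by
    simp only [N, ContinuousLinearMap.pi_apply]
    split_ifs <;> rfl
  have hΘN : HasFDerivAt Θ N 0 := by
    refine hasFDerivAt_pi'.2 fun i => ?_
    by_cases hi : i ∈ P
    · have : (ContinuousLinearMap.proj i ∘L N : (Fin 5 → ℂ) →L[ℂ] ℂ) =
          fderiv ℂ (coordDeriv f i) 0 := by
        ext1 v
        change N v i = _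
        rw [hN, if_pos hi]
      rw [this]
      simpa [Θ, hi] using ((hp i).differentiableAt one_ne_zero).hasFDerivAt
    · have : (ContinuousLinearMap.proj i ∘L N : (Fin 5 → ℂ) →L[ℂ] ℂ) =
          ContinuousLinearMap.proj i := by
        ext1 v
        change N v i = _
        rw [hN, if_neg hi]
        rfl
      rw [this]
      simp only [Θ, hi, if_false]
      exact hasFDerivAt_apply i 0
  have hNi : Function.Injective (N : (Fin 5 → ℂ) →ₗ[ℂ] Fin 5 → ℂ) := by
    rw [injective_iff_map_eq_zero]
    intro v hv
    have hv' : ∀ i, N v i = 0 := fun i => congrFun hv i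
    refine hP v (fun i hi => ?_) fun i hi => ?_
    · have := hv' i
      rwa [hN, if_neg hi] at this
    · have := hv' i
      rwa [hN, if_pos hi] at this
  let e : (Fin 5 → ℂ) ≃L[ℂ] Fin 5 → ℂ :=
    (LinearEquiv.ofInjectiveEndo (N : (Fin 5 → ℂ) →ₗ[ℂ] Fin 5 → ℂ) hNi).toContinuousLinearEquiv
  have he : (e : (Fin 5 → ℂ) →L[ℂ] Fin 5 → ℂ) = N := by
    ext1 v
    rfl
  have hΘe : HasFDerivAt Θ (e : (Fin 5 → ℂ) →L[ℂ] Fin 5 → ℂ) 0 := by rw [he]; exact hΘN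
  have hs := hΘ.hasStrictFDerivAt' hΘe one_ne_zero
  let κ : (Fin 5 → ℂ) → Fin 5 → ℂ := hs.localInverse Θ e 0
  have hκ0 : κ 0 = 0 := by
    have := hs.localInverse_apply_image
    rwa [hΘ0] at this
  have hκc : ContDiffAt ℂ 1 κ 0 := by
    have := hΘ.to_localInverse hΘe one_ne_zero
    rwa [hΘ0] at this
  have hκs : HasStrictFDerivAt κ (e.symm : (Fin 5 → ℂ) →L[ℂ] Fin 5 → ℂ) 0 := by
    have := hs.to_localInverse
    rwa [hΘ0] at this
  have hκt : Filter.Tendsto κ (𝓝 0) (𝓝 0) := by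
    have := hκc.continuousAt
    rwa [ContinuousAt, hκ0] at this
  have hright : ∀ᶠ y in 𝓝 0, Θ (κ y) = y := by
    have := hs.eventually_right_inverse
    rwa [hΘ0] at this
  obtain ⟨δ, hδ, hleft⟩ := Metric.eventually_nhds_iff_ball.1 hs.eventually_left_inverse
  obtain ⟨δ', hδ', hhom'⟩ := exists_weighted_homogeneous_coordDeriv hfc hw hhom
  have hlip : ∃ Λ : ℝ, ∀ᶠ q : (Fin 5 → ℂ) × (Fin 5 → ℂ) in 𝓝 (0, 0), ∀ i,
      ‖coordDeriv f i (κ q.1) - coordDeriv f i (κ q.2)‖ ≤ Λ * ‖q.1 - q.2‖ := by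
    have h1 : HasStrictFDerivAt (fun y i => coordDeriv f i (κ y))
        (fderiv ℂ (fun y i => coordDeriv f i (κ y)) 0) 0 := by
      refine ContDiffAt.hasStrictFDerivAt (n := 1) (contDiffAt_pi.2 fun i => ?_) one_ne_zero
      have h0 : ContDiffAt ℂ 1 (coordDeriv f i) (κ 0) := by
        rw [hκ0]
        exact hp i
      exact h0.comp (0 : Fin 5 → ℂ) hκc
    obtain ⟨K, s, hs, hK⟩ := h1.exists_lipschitzOnWith
    refine ⟨K, ?_⟩
    filter_upwards [prod_mem_nhds hs hs] with q hq i
    have h2 := hK.dist_le_mul q.1 hq.1 q.2 hq.2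
    rw [dist_eq_norm, dist_eq_norm] at h2
    exact (norm_le_pi_norm (fun i => coordDeriv f i (κ q.1) - coordDeriv f i (κ q.2)) i).trans h2
  obtain ⟨Λ, hlip⟩ := hlip
  rw [nhds_prod_eq, Filter.eventually_prod_self_iff'] at hlip
  obtain ⟨U, hU, hUlip⟩ := hlip
  have hκd : ∀ᶠ y in 𝓝 0, DifferentiableAt ℂ κ y :=
    (hκc.eventually (by simp)).mono fun z hz => hz.differentiableAt one_ne_zero
  have hκδ : ∀ᶠ y in 𝓝 0, κ y ∈ Metric.ball (0 : Fin 5 → ℂ) (min δ δ') :=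
    hκt.eventually_mem (Metric.ball_mem_nhds 0 (lt_min hδ hδ'))
  obtain ⟨r, hr, hall⟩ := Metric.eventually_nhds_iff_ball.1
    (hright.eventually_nhds.and (hκd.and (hκδ.and (Filter.eventually_mem_set.2 hU))))
  have hball : ∀ y ∈ Metric.ball 0 r, ‖κ y‖ < δ ∧ ‖κ y‖ < δ' := fun y hy => by
    have := (hall y hy).2.2.1
    rw [mem_ball_zero_iff, lt_min_iff] at this
    exact this
  refine ⟨κ, e.symm, r, Λ, hr, hκ0, hκs, e.symm.injective, fun η hη => ?_,
    hκc.continuousAt_fderiv one_ne_zero, fun y hy => (hall y hy).2.1,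
    fun y hy => (hhom' _ (hball y hy).2).1, fun y hy i hi => ?_, fun y hy v hv i hi => ?_,
    fun y hy y' hy' => hUlip y (hall y hy).2.2.2 y' (hall y' hy').2.2.2, fun y hy hyP t ht ht1 => ?_⟩
  · have : (fun i => if i ∈ P then fderiv ℂ (coordDeriv f i) 0 η else 0) = e η := by
      ext i
      change _ = N η i
      rw [hN]
      split_ifs with hi
      · rfl
      · rw [hη i hi]
    rw [this]
    exact e.symm_apply_apply η
  · have := congrFun (hall y hy).1.self_of_nhds i
    simpa [Θ, hi] using this
  · have h1 : (fun y => κ y i) =ᶠ[𝓝 y] fun y => y i := by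
      filter_upwards [(hall y hy).1] with y' hy'
      have := congrFun hy' i
      simpa [Θ, hi] using this
    have h2 : HasFDerivAt (fun y => κ y i) (ContinuousLinearMap.proj i ∘L fderiv ℂ κ y) y :=
      hasFDerivAt_pi'.1 (hall y hy).2.1.hasFDerivAt i
    have h3 := (h2.congr_of_eventuallyEq h1.symm).unique (hasFDerivAt_apply i y)
    have h4 := DFunLike.congr_fun h3 v
    change fderiv ℂ κ y v i = v i at h4
    rw [h4, hv i hi]
  · obtain ⟨-, h1⟩ := hhom' _ (hball y hy).2
    obtain ⟨h2, h3⟩ := h1 t ht ht1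
    have hΘκ := (hall y hy).1.self_of_nhds
    have h4 : Θ (weightScale w t (κ y)) = weightScale w t y := by
      ext i
      have h5 := congrFun hΘκ i
      by_cases hi : i ∈ P
      · simp only [Θ, hi, if_true] at h5 ⊢
        have h6 := h3 i
        rw [h5, hyP i hi, mul_zero] at h6
        have h7 : ((t ^ w i : ℝ) : ℂ) ≠ 0 := by exact_mod_cast (Real.rpow_pos_of_pos ht _).ne'
        rw [(mul_eq_zero.1 h6).resolve_left h7, weightScale, hyP i hi, mul_zero]
      · simp only [Θ, hi, if_false] at h5 ⊢
        rw [weightScale, weightScale, h5]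
    have h5 : κ (weightScale w t y) = weightScale w t (κ y) := by
      rw [← h4]
      refine hleft _ ?_
      rw [mem_ball_zero_iff]
      exact (norm_weightScale_le hw ht ht1 _).trans_lt (hball y hy).1
    rw [h5]
    exact ⟨h2, h3⟩

end CubicFourfold

/-! ### Existence of zeros, and expansion along gradient coordinates -/

namespace CubicFourfold

/-- A holomorphic function that is larger on the boundary of a disc than at the centre has a zero
in the disc. -/
theorem exists_zero_of_norm_lt {G : ℂ → ℂ} {R A : ℝ} (hR : 0 < R)
    (hG : DifferentiableOn ℂ G (Metric.closedBall 0 R)) (hA : ∀ T, ‖T‖ = R → A ≤ ‖G T‖)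
    (h0 : ‖G 0‖ < A) : ∃ T, ‖T‖ ≤ R ∧ G T = 0 := by
  by_contra! hcon
  have hne : ∀ T ∈ closure (Metric.ball (0 : ℂ) R), G T ≠ 0 := fun T hT => by
    rw [closure_ball _ hR.ne'] at hT
    exact hcon T (by simpa using hT)
  have hd : DiffContOnCl ℂ G (Metric.ball 0 R) := by
    refine DifferentiableOn.diffContOnCl ?_
    rwa [closure_ball _ hR.ne']
  have hA0 : 0 < A := (norm_nonneg _).trans_lt h0
  -- Without a zero, the maximum principle would apply to `1 / G`.
  have h1 := Complex.norm_le_of_forall_mem_frontier_norm_le Metric.isBounded_ball (hd.inv hne)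
    (C := A⁻¹) (fun T hT => by
      rw [frontier_ball _ hR.ne'] at hT
      rw [Pi.inv_apply, norm_inv]
      exact inv_anti₀ hA0 (hA T (by simpa using hT)))
    (subset_closure (Metric.mem_ball_self hR))
  rw [Pi.inv_apply, norm_inv] at h1
  have h2 : 0 < ‖G 0‖ := norm_pos_iff.2 (hcon 0 (by simpa using hR.le))
  exact absurd ((inv_le_inv₀ h2 hA0).1 h1) (not_le.2 h0)

namespace GradientChart

variable {f : (Fin 5 → ℂ) → ℂ} {P : Finset (Fin 5)} {w : Fin 5 → ℝ} {d : ℝ}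
  {κ : (Fin 5 → ℂ) → Fin 5 → ℂ} {κ' : (Fin 5 → ℂ) →L[ℂ] Fin 5 → ℂ} {r Λ : ℝ}

/-- Moving the coordinates in `P` alone changes only the components of `κ` in `P`, and there the
partial derivatives of `f` are the coordinates themselves. -/
theorem hasDerivAt_line (h : GradientChart f P w d κ κ' r Λ) {y v : Fin 5 → ℂ}
    (hv : ∀ i ∉ P, v i = 0) {s : ℝ} (hs : y + (s : ℂ) • v ∈ Metric.ball 0 r) :
    HasDerivAt (fun s : ℝ => f (κ (y + (s : ℂ) • v)))
      (∑ i ∈ P, (y i + s * v i) * fderiv ℂ κ (y + (s : ℂ) • v) v i) s := by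
  have h1 : HasDerivAt (fun s : ℂ => y + s • v) v (s : ℂ) := by
    simpa using ((hasDerivAt_id (s : ℂ)).smul_const v).const_add y
  have h2 := (h.differentiableAt _ hs).hasFDerivAt.comp_hasDerivAt (s : ℂ) h1
  have h3 := (h.differentiableAt_apply _ hs).hasFDerivAt.comp_hasDerivAt (s : ℂ) h2
  have h4 := h3.comp_ofReal
  refine h4.congr_deriv ?_
  rw [sum_coordDeriv_mul, ← Finset.sum_subset (Finset.subset_univ P) fun i _ hi => by
    rw [h.fderiv_apply _ hs v hv i hi, mul_zero]]
  refine Finset.sum_congr rfl fun i hi => ?_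
  rw [h.coordDeriv_apply _ hs i hi]
  rfl

theorem norm_sum_le {P : Finset (Fin 5)} {a b : Fin 5 → ℂ} {A B : ℝ} (hA : 0 ≤ A)
    (ha : ∀ i ∈ P, ‖a i‖ ≤ A) (hb : ‖b‖ ≤ B) : ‖∑ i ∈ P, a i * b i‖ ≤ 5 * A * B := by
  have hB : 0 ≤ B := (norm_nonneg _).trans hb
  calc ‖∑ i ∈ P, a i * b i‖ ≤ ∑ i ∈ P, ‖a i * b i‖ := _root_.norm_sum_le _ _
    _ ≤ ∑ _i ∈ P, A * B := Finset.sum_le_sum fun i hi => by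
        rw [norm_mul]
        exact mul_le_mul (ha i hi) ((norm_le_pi_norm b i).trans hb) (norm_nonneg _) hA
    _ = P.card * (A * B) := by rw [Finset.sum_const, nsmul_eq_mul]
    _ ≤ 5 * (A * B) := by
        gcongr
        have := P.card_le_univ
        rw [Fintype.card_fin] at this
        exact_mod_cast this
    _ = 5 * A * B := by ring

theorem norm_sub_le (h : GradientChart f P w d κ κ' r Λ) {y v : Fin 5 → ℂ}
    (hv : ∀ i ∉ P, v i = 0) {r₁ K m : ℝ} (hr : r₁ ≤ r) (hm : 0 ≤ m)
    (hK : ∀ y ∈ Metric.ball 0 r₁, ‖fderiv ℂ κ y‖ ≤ K)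
    (hs : ∀ s : ℝ, 0 ≤ s → s ≤ 1 → ‖y + (s : ℂ) • v‖ < r₁ ∧ ∀ i ∈ P, ‖y i + s * v i‖ ≤ m) :
    ‖f (κ (y + v)) - f (κ y)‖ ≤ 5 * m * (K * ‖v‖) := by
  have hmem : ∀ s : ℝ, 0 ≤ s → s ≤ 1 → y + (s : ℂ) • v ∈ Metric.ball 0 r₁ := fun s h0 h1 => by
    simpa using (hs s h0 h1).1
  have h1 := norm_image_sub_le_of_norm_deriv_le_segment_01' (C := 5 * m * (K * ‖v‖))
    (fun s hs' => (h.hasDerivAt_line hv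
      (Metric.ball_subset_ball hr (hmem s hs'.1 hs'.2))).hasDerivWithinAt)
    (fun s hs' => norm_sum_le hm (hs s hs'.1 hs'.2.le).2
      ((ContinuousLinearMap.le_opNorm _ _).trans
        (mul_le_mul_of_nonneg_right (hK _ (hmem s hs'.1 hs'.2.le)) (norm_nonneg _))))
  simpa using h1

/-- If the derivative of `κ` is replaced by its value `κ'` at 0, the derivative along the line
integrates to the quadratic polynomial in `T`. The error is controlled by the continuity of the
derivative of `κ` and the size `m` of the coordinates in `P`. -/
theorem norm_sub_quadratic_le (h : GradientChart f P w d κ κ' r Λ) {y ξ η : Fin 5 → ℂ}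
    (hξ : ∀ i ∉ P, ξ i = 0) (hη : κ' ξ = η) {r₁ ω m : ℝ} (hr : r₁ ≤ r) (hm : 0 ≤ m)
    (hω : ∀ y ∈ Metric.ball 0 r₁, ‖fderiv ℂ κ y - κ'‖ ≤ ω) {T : ℂ}
    (hs : ∀ s : ℝ, 0 ≤ s → s ≤ 1 → ‖y + (s : ℂ) • T • ξ‖ < r₁ ∧
      ∀ i ∈ P, ‖y i + s * (T • ξ) i‖ ≤ m) :
    ‖f (κ (y + T • ξ)) - f (κ y) -
      (T * ∑ i ∈ P, y i * η i + T ^ 2 / 2 * ∑ i ∈ P, ξ i * η i)‖ ≤ 5 * m * (ω * (‖T‖ * ‖ξ‖)) := by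
  have hv : ∀ i ∉ P, (T • ξ) i = 0 := fun i hi => by simp [hξ i hi]
  have hmem : ∀ s : ℝ, 0 ≤ s → s ≤ 1 → y + (s : ℂ) • T • ξ ∈ Metric.ball 0 r₁ := fun s h0 h1 => by
    simpa using (hs s h0 h1).1
  have hq : ∀ s : ℝ, HasDerivAt (fun s : ℝ => (s : ℂ) * (T * ∑ i ∈ P, y i * η i) +
      (s : ℂ) ^ 2 * (T ^ 2 / 2 * ∑ i ∈ P, ξ i * η i))
      (∑ i ∈ P, (y i + s * (T • ξ) i) * (T • η) i) s := by
    intro s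
    have h1 : HasDerivAt (fun s : ℂ => s * (T * ∑ i ∈ P, y i * η i) +
        s ^ 2 * (T ^ 2 / 2 * ∑ i ∈ P, ξ i * η i)) (1 * (T * ∑ i ∈ P, y i * η i) +
        ((2 : ℕ) * (s : ℂ) ^ (2 - 1)) * (T ^ 2 / 2 * ∑ i ∈ P, ξ i * η i)) (s : ℂ) :=
      ((hasDerivAt_id (s : ℂ)).mul_const _).add ((hasDerivAt_pow 2 (s : ℂ)).mul_const _)
    refine h1.comp_ofReal.congr_deriv ?_
    simp only [Finset.mul_sum, ← Finset.sum_add_distrib]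
    refine Finset.sum_congr rfl fun i _ => ?_
    simp only [Pi.smul_apply, smul_eq_mul]
    push_cast
    ring
  have h1 := norm_image_sub_le_of_norm_deriv_le_segment_01' (C := 5 * m * (ω * (‖T‖ * ‖ξ‖)))
    (fun s hs' => ((h.hasDerivAt_line hv
      (Metric.ball_subset_ball hr (hmem s hs'.1 hs'.2))).sub (hq s)).hasDerivWithinAt)
    (fun s hs' => by
      rw [← Finset.sum_sub_distrib]
      simp only [← mul_sub]
      refine norm_sum_le (b := fun i => fderiv ℂ κ (y + (s : ℂ) • T • ξ) (T • ξ) i - (T • η) i) hm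
        (hs s hs'.1 hs'.2.le).2 ?_
      have h2 : (fun i => fderiv ℂ κ (y + (s : ℂ) • T • ξ) (T • ξ) i - (T • η) i) =
          (fderiv ℂ κ (y + (s : ℂ) • T • ξ) - κ') (T • ξ) := by
        rw [← hη, ← map_smul]
        rfl
      rw [h2, ← norm_smul]
      exact (ContinuousLinearMap.le_opNorm _ _).trans
        (mul_le_mul_of_nonneg_right (hω _ (hmem s hs'.1 hs'.2.le)) (norm_nonneg _)))
  refine le_trans (le_of_eq ?_) h1
  congr 1
  simp only [Pi.sub_apply]
  simp
  ring

end GradientChart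

end CubicFourfold

/-! ### Zeros of f at scaled points of a gradient chart -/

namespace CubicFourfold

/-- Extension of a vector by zero in the coordinate `e`. -/
noncomputable def extendZero (e : Fin 5) : ({i // i ≠ e} → ℂ) →L[ℂ] Fin 5 → ℂ :=
  ContinuousLinearMap.pi fun i => if h : i ≠ e then ContinuousLinearMap.proj ⟨i, h⟩ else 0

theorem extendZero_of_ne {e i : Fin 5} (h : i ≠ e) (z : {i // i ≠ e} → ℂ) :
    extendZero e z i = z ⟨i, h⟩ := by
  simp [extendZero, h]

theorem extendZero_self (e : Fin 5) (z : {i // i ≠ e} → ℂ) : extendZero e z e = 0 := by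
  simp [extendZero]

namespace GradientChart

variable {f : (Fin 5 → ℂ) → ℂ} {P : Finset (Fin 5)} {w : Fin 5 → ℝ} {d : ℝ}
  {κ : (Fin 5 → ℂ) → Fin 5 → ℂ} {κ' : (Fin 5 → ℂ) →L[ℂ] Fin 5 → ℂ} {r Λ : ℝ}

theorem norm_coordDeriv_le (h : GradientChart f P w d κ κ' r Λ) {y : Fin 5 → ℂ}
    (hy : y ∈ Metric.ball 0 r) (i : Fin 5) :
    ‖coordDeriv f i (κ y)‖ ≤ ∑ i, ‖coordDeriv f i (κ 0)‖ + |Λ| * r := by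
  have h1 := h.lipschitz y hy 0 (Metric.mem_ball_self h.pos) i
  have h2 : ‖coordDeriv f i (κ 0)‖ ≤ ∑ i, ‖coordDeriv f i (κ 0)‖ :=
    Finset.single_le_sum (f := fun i => ‖coordDeriv f i (κ 0)‖) (fun _ _ => norm_nonneg _)
      (Finset.mem_univ i)
  have h3 : Λ * ‖y - 0‖ ≤ |Λ| * r := by
    rw [sub_zero]
    exact mul_le_mul (le_abs_self _) (mem_ball_zero_iff.1 hy).le (norm_nonneg _) (abs_nonneg _)
  have h4 := norm_sub_norm_le (coordDeriv f i (κ y)) (coordDeriv f i (κ 0))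
  linarith

/-- Near the scaled points of a gradient chart there are zeros of `f` at which the differential
of `f` is of the order of `t ^ (d / 2)`. -/
theorem exists_zero (h : GradientChart f P w d κ κ' r Λ) (hw : ∀ i, 0 ≤ w i) (hd : 0 < d)
    (hwP : ∀ i ∉ P, w i ≤ d / 2) {η ξ : Fin 5 → ℂ} (hξ : ∀ i ∉ P, ξ i = 0) (hη : κ' ξ = η)
    (hne : ∑ i ∈ P, ξ i * η i ≠ 0) {e i₀ : Fin 5} (he : e ∈ P) (hξe : ξ e ≠ 0) (hi₀ : i₀ ∈ P)
    (hi₀e : i₀ ≠ e) :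
    ∃ C : ℝ, ∀ ε : ℝ, 0 < ε → ∀ᶠ q : ℝ × ({i // i ≠ e} → ℂ) in
        𝓝[>] 0 ×ˢ 𝓝 (fun i : {i // i ≠ e} => if (i : Fin 5) ∈ P then (1 : ℂ) else 0),
      ∃ T : ℂ, ‖T‖ < ε ∧
        f (κ (extendZero e (fun i => ((q.1 ^ (if (i : Fin 5) ∈ P then d / 2 else w i) : ℝ) : ℂ) *
          q.2 i) + T • ξ)) = 0 ∧
        fderiv ℂ f (κ (extendZero e (fun i =>
          ((q.1 ^ (if (i : Fin 5) ∈ P then d / 2 else w i) : ℝ) : ℂ) * q.2 i) + T • ξ)) ≠ 0 ∧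
        ‖fderiv ℂ f (κ (extendZero e (fun i =>
          ((q.1 ^ (if (i : Fin 5) ∈ P then d / 2 else w i) : ℝ) : ℂ) * q.2 i) + T • ξ))‖ ≤
          C * q.1 ^ (d / 2) := by
  set s := ∑ i ∈ P, ξ i * η i with hs
  have hs0 : 0 < ‖s‖ := norm_pos_iff.2 hne
  have hκ'0 : fderiv ℂ κ 0 = κ' := h.strict.hasFDerivAt.fderiv
  set K₀ := ‖κ'‖ + 1 with hK₀
  have hK₀p : 0 < K₀ := by positivity
  set C₀ := ‖f (κ 0)‖ + 1 with hC₀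
  have hC₀p : 0 < C₀ := by positivity
  set C₃ := C₀ + 20 * K₀ with hC₃
  have hC₃p : 0 < C₃ := by positivity
  -- With `σ = ρ ^ (d / 2)`, on the circle `|T| = K σ` the quadratic term `T² s / 2` has to exceed
  -- the sum of the linear term `10 ‖η‖ K σ²`, the error `K σ²` and the value `C₃ σ²` at the centre
  -- by more than another `C₃ σ²`.
  set K := 1 + 2 / ‖s‖ * (10 * ‖η‖ + 1 + 2 * C₃ + 2) with hK
  have hK1 : 1 ≤ K := by
    have : 0 ≤ 2 / ‖s‖ * (10 * ‖η‖ + 1 + 2 * C₃ + 2) := by positivity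
    linarith
  have hKp : 0 < K := one_pos.trans_le hK1
  have hKs : 10 * ‖η‖ + 1 + 2 * C₃ + 2 ≤ K * ‖s‖ / 2 := by
    have : K * ‖s‖ / 2 = ‖s‖ / 2 + (10 * ‖η‖ + 1 + 2 * C₃ + 2) := by
      rw [hK]
      field_simp
    linarith
  set K₂ := 2 + K * ‖ξ‖ with hK₂
  have hK₂p : 0 < K₂ := by positivity
  -- The admissible deviation of the derivative of `κ` from `κ'`; it makes the error of the
  -- quadratic expansion at most `K σ²`.
  set ω := 1 / (5 * K₂ * (‖ξ‖ + 1)) with hω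
  have hωp : 0 < ω := by positivity
  have hωK : 5 * K₂ * (ω * ‖ξ‖) ≤ 1 := by
    rw [hω]
    field_simp
    linarith [norm_nonneg ξ]
  set C₁ := ∑ i, ‖coordDeriv f i (κ 0)‖ + |Λ| * r with hC₁
  have hC₁p : 0 ≤ C₁ :=
    add_nonneg (Finset.sum_nonneg fun _ _ => norm_nonneg _) (mul_nonneg (abs_nonneg _) h.pos.le)
  obtain ⟨r₁, hr₁, hr₁r, hball⟩ : ∃ r₁ : ℝ, 0 < r₁ ∧ r₁ ≤ r ∧ ∀ y ∈ Metric.ball 0 r₁,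
      ‖fderiv ℂ κ y‖ ≤ K₀ ∧ ‖fderiv ℂ κ y - κ'‖ ≤ ω ∧ ‖f (κ y)‖ ≤ C₀ := by
    have h1 : ∀ᶠ y in 𝓝 0, ‖fderiv ℂ κ y‖ < K₀ :=
      h.continuousAt_fderiv.norm.eventually (gt_mem_nhds (by simp [hκ'0, hK₀]))
    have h2 : ∀ᶠ y in 𝓝 0, ‖fderiv ℂ κ y - κ'‖ < ω :=
      (h.continuousAt_fderiv.sub continuousAt_const).norm.eventually
        (gt_mem_nhds (by simpa [hκ'0] using hωp))
    have h3 : ∀ᶠ y in 𝓝 0, ‖f (κ y)‖ < C₀ := by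
      have hc : ContinuousAt (fun y => f (κ y)) 0 :=
        ((h.differentiableAt_apply 0 (Metric.mem_ball_self h.pos)).continuousAt).comp
          (h.differentiableAt 0 (Metric.mem_ball_self h.pos)).continuousAt
      exact hc.norm.eventually (gt_mem_nhds (by rw [hC₀]; linarith))
    obtain ⟨r', hr', hall⟩ := Metric.eventually_nhds_iff_ball.1 (h1.and (h2.and h3))
    refine ⟨min r r', lt_min h.pos hr', min_le_left _ _, fun y hy => ?_⟩
    obtain ⟨h1, h2, h3⟩ := hall y (Metric.ball_subset_ball (min_le_right _ _) hy)
    exact ⟨h1.le, h2.le, h3.le⟩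
  refine ⟨5 * (K₂ + |Λ| * K₂ + C₁), fun ε hε => ?_⟩
  have hσ0 : Filter.Tendsto (fun ρ : ℝ => ρ ^ (d / 2)) (𝓝[>] 0) (𝓝 0) := by
    have : ContinuousAt (fun ρ : ℝ => ρ ^ (d / 2)) 0 :=
      Real.continuousAt_rpow_const _ _ (Or.inr (by positivity))
    have h1 := this.tendsto
    rw [Real.zero_rpow (by positivity)] at h1
    exact h1.mono_left nhdsWithin_le_nhds
  have hρ : ∀ᶠ ρ : ℝ in 𝓝[>] 0, (0 < ρ ∧ ρ < 1) ∧ K₂ * ρ ^ (d / 2) < r₁ / 2 ∧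
      K * ρ ^ (d / 2) < ε := by
    refine (Filter.Eventually.and (Ioo_mem_nhdsGT one_pos) ?_)
    have h1 := (hσ0.const_mul K₂).eventually (gt_mem_nhds (show K₂ * 0 < r₁ / 2 by simpa using hr₁))
    have h2 := (hσ0.const_mul K).eventually (gt_mem_nhds (show K * 0 < ε by simpa using hε))
    exact h1.and h2
  have hZ : ∀ᶠ Z : {i // i ≠ e} → ℂ in
      𝓝 (fun i : {i // i ≠ e} => if (i : Fin 5) ∈ P then (1 : ℂ) else 0),
      ∀ i : {i // i ≠ e}, ‖Z i - if (i : Fin 5) ∈ P then (1 : ℂ) else 0‖ < min 1 (r₁ / 2) := by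
    refine Filter.eventually_all.2 fun i => ?_
    have hc : Continuous fun Z : {i // i ≠ e} → ℂ =>
      ‖Z i - if (i : Fin 5) ∈ P then (1 : ℂ) else 0‖ := by fun_prop
    exact hc.continuousAt.eventually (gt_mem_nhds (by simp [hr₁]))
  filter_upwards [Filter.prod_mem_prod hρ hZ] with q hq
  obtain ⟨⟨⟨hρ0, hρ1⟩, hσr, hσε⟩, hZ⟩ := hq
  change ∀ i : {i // i ≠ e}, ‖q.2 i - if (i : Fin 5) ∈ P then (1 : ℂ) else 0‖ < min 1 (r₁ / 2) at hZ
  obtain ⟨ρ, Z⟩ := q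
  simp only at hρ0 hρ1 hσr hσε hZ ⊢
  set σ := ρ ^ (d / 2) with hσ
  have hσp : 0 < σ := Real.rpow_pos_of_pos hρ0 _
  have hσ2 : ρ ^ d = σ ^ 2 := by
    rw [hσ, ← Real.rpow_natCast, ← Real.rpow_mul hρ0.le]
    congr 1
    push_cast
    ring
  set y' := extendZero e (fun i => ((ρ ^ (if (i : Fin 5) ∈ P then d / 2 else w i) : ℝ) : ℂ) * Z i)
    with hy'
  set ζ := extendZero e Z with hζ
  have hζP : ∀ i ∈ P, ‖ζ i‖ ≤ 2 := fun i hi => by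
    by_cases hie : i = e
    · subst hie
      rw [hζ, extendZero_self]
      simp
    · rw [hζ, extendZero_of_ne hie]
      have h1 := (hZ ⟨i, hie⟩).trans_le (min_le_left _ _)
      simp only [hi, if_true] at h1
      have h2 := norm_sub_norm_le (Z ⟨i, hie⟩) 1
      rw [norm_one] at h2
      linarith
  have hζR : ∀ i ∉ P, ‖ζ i‖ ≤ r₁ / 2 := fun i hi => by
    have hie : i ≠ e := by rintro rfl; exact hi he
    rw [hζ, extendZero_of_ne hie]
    have h1 := (hZ ⟨i, hie⟩).trans_le (min_le_right _ _)
    simp only [hi, if_false, sub_zero] at h1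
    exact h1.le
  set yZ : Fin 5 → ℂ := fun i => if i ∈ P then 0 else ζ i with hyZ
  -- At `y₀` the coordinates in `P` are zero and homogeneity applies: `f` is `O(ρ ^ d) = O(σ²)`, and
  -- the partial derivatives outside `P` are `O(ρ ^ (d - w i)) = O(σ)` because `w i ≤ d / 2`. The
  -- point `y'` differs from `y₀` by `O(σ)` in the directions of `P`.
  set y₀ := weightScale w ρ yZ with hy₀
  set v : Fin 5 → ℂ := fun i => if i ∈ P then (σ : ℂ) * ζ i else 0 with hv
  have hy'v : y' = y₀ + v := by
    ext i
    simp only [hy', Pi.add_apply, hy₀, weightScale, hyZ, hv]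
    by_cases hie : i = e
    · subst hie
      rw [extendZero_self, hζ, extendZero_self]
      simp
    · rw [extendZero_of_ne hie, hζ, extendZero_of_ne hie]
      split_ifs <;> simp [hσ]
  have hy₀P : ∀ i ∈ P, y₀ i = 0 := fun i hi => by simp [hy₀, weightScale, hyZ, hi]
  have hvR : ∀ i ∉ P, v i = 0 := fun i hi => by simp [hv, hi]
  have hvP : ∀ i, ‖v i‖ ≤ 2 * σ := fun i => by
    by_cases hi : i ∈ P
    · simp only [hv, hi, if_true]
      rw [norm_mul, Complex.norm_real, Real.norm_of_nonneg hσp.le, mul_comm]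
      exact mul_le_mul_of_nonneg_right (hζP i hi) hσp.le
    · rw [hvR i hi, norm_zero]
      positivity
  have hvn : ‖v‖ ≤ 2 * σ := (pi_norm_le_iff_of_nonneg (by positivity)).2 hvP
  have hyZn : ‖yZ‖ ≤ r₁ / 2 := (pi_norm_le_iff_of_nonneg (by positivity)).2 fun i => by
    by_cases hi : i ∈ P
    · simp only [hyZ, hi, if_true, norm_zero]
      positivity
    · simp only [hyZ, hi, if_false]
      exact hζR i hi
  have hy₀n : ‖y₀‖ ≤ r₁ / 2 := (norm_weightScale_le hw hρ0 hρ1.le yZ).trans hyZn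
  have hyZb : yZ ∈ Metric.ball 0 r₁ := by
    rw [mem_ball_zero_iff]
    linarith
  have hbr : ∀ {y : Fin 5 → ℂ}, ‖y‖ < r₁ → y ∈ Metric.ball 0 r₁ ∧ y ∈ Metric.ball 0 r :=
    fun hy => ⟨mem_ball_zero_iff.2 hy, mem_ball_zero_iff.2 (hy.trans_le hr₁r)⟩
  have h2K : 2 ≤ K₂ := by
    rw [hK₂]
    have : 0 ≤ K * ‖ξ‖ := by positivity
    linarith
  have hyZP : ∀ i ∈ P, yZ i = 0 := fun i hi => by simp [hyZ, hi]
  obtain ⟨hf₀, hp₀⟩ := h.homogeneous yZ (Metric.ball_subset_ball hr₁r hyZb) hyZP ρ hρ0 hρ1.le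
  rw [← hy₀] at hf₀ hp₀
  have hf₀n : ‖f (κ y₀)‖ ≤ C₀ * σ ^ 2 := by
    rw [hf₀, norm_mul, Complex.norm_real, Real.norm_of_nonneg (Real.rpow_nonneg hρ0.le _), hσ2,
      mul_comm]
    exact mul_le_mul_of_nonneg_right (hball yZ hyZb).2.2 (by positivity)
  have hp₀n : ∀ i ∉ P, ‖coordDeriv f i (κ y₀)‖ ≤ C₁ * σ := fun i hi => by
    have h1 := hp₀ i
    have hpos : 0 < ρ ^ w i := Real.rpow_pos_of_pos hρ0 _
    have h2 := congrArg norm h1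
    rw [norm_mul, norm_mul, Complex.norm_real, Complex.norm_real, Real.norm_of_nonneg hpos.le,
      Real.norm_of_nonneg (Real.rpow_nonneg hρ0.le _), hσ2] at h2
    have h3 : σ ≤ ρ ^ w i := Real.rpow_le_rpow_of_exponent_ge hρ0 hρ1.le (hwP i hi)
    have h4 := h.norm_coordDeriv_le (Metric.ball_subset_ball hr₁r hyZb) i
    rw [← hC₁] at h4
    refine le_of_mul_le_mul_left ?_ hσp
    calc σ * ‖coordDeriv f i (κ y₀)‖ ≤ ρ ^ w i * ‖coordDeriv f i (κ y₀)‖ := by gcongr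
      _ = σ ^ 2 * ‖coordDeriv f i (κ yZ)‖ := h2
      _ ≤ σ ^ 2 * C₁ := by gcongr
      _ = σ * (C₁ * σ) := by ring
  have hfy' : ‖f (κ y')‖ ≤ C₃ * σ ^ 2 := by
    have h1 := h.norm_sub_le hvR hr₁r (m := 2 * σ) (by positivity) (fun y hy => (hball y hy).1)
      (y := y₀) (fun s hs0 hs1 => ⟨?_, fun i hi => ?_⟩)
    · rw [← hy'v] at h1
      have h2 := norm_sub_norm_le (f (κ y')) (f (κ y₀))
      have h3 : 5 * (2 * σ) * (K₀ * ‖v‖) ≤ 5 * (2 * σ) * (K₀ * (2 * σ)) := by gcongr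
      rw [hC₃]
      linarith
    · calc ‖y₀ + (s : ℂ) • v‖ ≤ ‖y₀‖ + ‖(s : ℂ) • v‖ := norm_add_le _ _
        _ ≤ r₁ / 2 + 1 * (2 * σ) := by
            rw [norm_smul, Complex.norm_real, Real.norm_of_nonneg hs0]
            gcongr
        _ < r₁ := by
            have := mul_le_mul_of_nonneg_right h2K hσp.le
            linarith
    · rw [hy₀P i hi, zero_add, norm_mul, Complex.norm_real, Real.norm_of_nonneg hs0]
      exact (mul_le_of_le_one_left (norm_nonneg _) hs1).trans (hvP i)
  have hT : ∀ T : ℂ, ‖T‖ ≤ K * σ → ∀ s : ℝ, 0 ≤ s → s ≤ 1 → ‖y' + (s : ℂ) • T • ξ‖ < r₁ ∧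
      ∀ i ∈ P, ‖y' i + s * (T • ξ) i‖ ≤ K₂ * σ := by
    intro T hT s hs0 hs1
    have h1 : ‖(s : ℂ) • T • ξ‖ ≤ 1 * (K * σ * ‖ξ‖) := by
      rw [norm_smul, norm_smul, Complex.norm_real, Real.norm_of_nonneg hs0]
      gcongr
    constructor
    · calc ‖y' + (s : ℂ) • T • ξ‖ ≤ ‖y₀‖ + ‖v‖ + ‖(s : ℂ) • T • ξ‖ := by
            rw [hy'v]
            exact norm_add₃_le
        _ ≤ r₁ / 2 + 2 * σ + 1 * (K * σ * ‖ξ‖) := by gcongr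
        _ = r₁ / 2 + K₂ * σ := by rw [hK₂]; ring
        _ < r₁ := by linarith
    · intro i hi
      have h2 : y' i = v i := by rw [hy'v, Pi.add_apply, hy₀P i hi, zero_add]
      calc ‖y' i + s * (T • ξ) i‖ ≤ ‖v i‖ + ‖((s : ℂ) • T • ξ) i‖ := by
            rw [h2]
            exact norm_add_le _ _
        _ ≤ 2 * σ + 1 * (K * σ * ‖ξ‖) := add_le_add (hvP i) ((norm_le_pi_norm _ i).trans h1)
        _ = K₂ * σ := by rw [hK₂]; ring
  obtain ⟨T, hTn, hTf⟩ := exists_zero_of_norm_lt (G := fun T => f (κ (y' + T • ξ))) (R := K * σ)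
    (A := (C₃ + 2) * σ ^ 2) (by positivity)
    (by
      intro T hTb
      rw [mem_closedBall_zero_iff] at hTb
      have h1 := (hT T hTb 1 zero_le_one le_rfl).1
      rw [Complex.ofReal_one, one_smul] at h1
      have h2 : DifferentiableAt ℂ (fun T : ℂ => y' + T • ξ) T := by fun_prop
      have h3 := (h.differentiableAt _ (hbr h1).2).comp T h2
      exact ((h.differentiableAt_apply _ (hbr h1).2).comp T h3).differentiableWithinAt)
    (by
      intro T hTn
      have h1 := h.norm_sub_quadratic_le hξ hη hr₁r (m := K₂ * σ) (by positivity)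
        (fun y hy => (hball y hy).2.1) (hT T hTn.le)
      rw [← hs] at h1
      have h2 : ‖∑ i ∈ P, y' i * η i‖ ≤ 5 * (2 * σ) * ‖η‖ :=
        norm_sum_le (by positivity) (fun i hi => by
          rw [hy'v, Pi.add_apply, hy₀P i hi, zero_add]
          exact hvP i) le_rfl
      have h3 : ‖T ^ 2 / 2 * s‖ = (K * σ) ^ 2 / 2 * ‖s‖ := by
        rw [norm_mul, norm_div, norm_pow, hTn]
        norm_num
      have h4 : ‖T * ∑ i ∈ P, y' i * η i‖ ≤ K * σ * (5 * (2 * σ) * ‖η‖) := by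
        rw [norm_mul, hTn]
        gcongr
      have h5 : 5 * (K₂ * σ) * (ω * (‖T‖ * ‖ξ‖)) ≤ K * σ ^ 2 := by
        rw [hTn]
        calc 5 * (K₂ * σ) * (ω * (K * σ * ‖ξ‖)) = 5 * K₂ * (ω * ‖ξ‖) * (K * σ ^ 2) := by ring
          _ ≤ 1 * (K * σ ^ 2) := by gcongr
          _ = _ := one_mul _
      have h6 : ‖T ^ 2 / 2 * s‖ ≤ ‖f (κ (y' + T • ξ))‖ + ‖f (κ y')‖ +
          ‖T * ∑ i ∈ P, y' i * η i‖ + 5 * (K₂ * σ) * (ω * (‖T‖ * ‖ξ‖)) := by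
        have e1 : T ^ 2 / 2 * s = f (κ (y' + T • ξ)) - f (κ y') - T * ∑ i ∈ P, y' i * η i -
          (f (κ (y' + T • ξ)) - f (κ y') - (T * ∑ i ∈ P, y' i * η i + T ^ 2 / 2 * s)) := by ring
        calc ‖T ^ 2 / 2 * s‖ = _ := congrArg norm e1
          _ ≤ _ := _root_.norm_sub_le _ _
          _ ≤ _ := add_le_add ((_root_.norm_sub_le _ _).trans
              (add_le_add_left (_root_.norm_sub_le _ _) _)) h1
      have h7 : (10 * ‖η‖ + 1 + 2 * C₃ + 2) * (K * σ ^ 2) ≤ K * ‖s‖ / 2 * (K * σ ^ 2) := by gcongr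
      have h8 : (2 * C₃ + 2) * σ ^ 2 * 1 ≤ (2 * C₃ + 2) * σ ^ 2 * K := by gcongr
      rw [h3] at h6
      linarith)
    (by
      rw [zero_smul, add_zero]
      have : 0 < σ ^ 2 := by positivity
      linarith)
  have hTr := hT T hTn 1 zero_le_one le_rfl
  rw [Complex.ofReal_one, one_smul] at hTr
  obtain ⟨hyr, hyP⟩ := hTr
  simp only [one_mul] at hyP
  set y := y' + T • ξ with hy
  refine ⟨T, hTn.trans_lt hσε, hTf, fun hzero => ?_, ?_⟩
  -- A zero differential would annihilate all coordinates in `P`. The coordinate `e` is `T ξ e`, so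
  -- `T = 0`; but then the coordinate `i₀` is `σ Z i₀` with `Z i₀` near 1.
  · have h1 : ∀ i ∈ P, y i = 0 := fun i hi => by
      rw [← h.coordDeriv_apply y (hbr hyr).2 i hi, coordDeriv, hzero]
      rfl
    have hT0 : T = 0 := by
      have h2 := h1 e he
      rw [hy, Pi.add_apply, hy', extendZero_self, zero_add] at h2
      exact (mul_eq_zero.1 h2).resolve_right hξe
    have h2 := h1 i₀ hi₀
    rw [hy, hT0, zero_smul, add_zero, hy', extendZero_of_ne hi₀e] at h2
    simp only [hi₀, if_true] at h2
    have h3 : ((ρ ^ (d / 2) : ℝ) : ℂ) ≠ 0 := by exact_mod_cast hσp.ne'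
    have h4 := (mul_eq_zero.1 h2).resolve_left h3
    have h5 := (hZ ⟨i₀, hi₀e⟩).trans_le (min_le_left _ _)
    simp [hi₀, h4] at h5
  · refine (norm_fderiv_le f (κ y)).trans ?_
    have hy₀r : ‖y₀‖ < r₁ := by linarith
    have hdist : ‖y - y₀‖ ≤ K₂ * σ := by
      have e1 : y - y₀ = v + T • ξ := by rw [hy, hy'v]; abel
      rw [e1]
      calc ‖v + T • ξ‖ ≤ ‖v‖ + ‖T‖ * ‖ξ‖ := by
            rw [← norm_smul]
            exact norm_add_le _ _
        _ ≤ 2 * σ + K * σ * ‖ξ‖ := by gcongr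
        _ = K₂ * σ := by rw [hK₂]; ring
    have hall : ∀ i, ‖coordDeriv f i (κ y)‖ ≤ (K₂ + |Λ| * K₂ + C₁) * σ := by
      intro i
      by_cases hi : i ∈ P
      · rw [h.coordDeriv_apply y (hbr hyr).2 i hi]
        have e1 := hyP i hi
        have e2 : 0 ≤ (|Λ| * K₂ + C₁) * σ := by positivity
        have e3 : ‖y i‖ ≤ K₂ * σ := e1
        linarith
      · have e1 := h.lipschitz y (hbr hyr).2 y₀ (hbr hy₀r).2 i
        have e2 : Λ * ‖y - y₀‖ ≤ |Λ| * (K₂ * σ) :=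
          mul_le_mul (le_abs_self _) hdist (norm_nonneg _) (abs_nonneg _)
        have e3 := norm_sub_norm_le (coordDeriv f i (κ y)) (coordDeriv f i (κ y₀))
        have e4 := hp₀n i hi
        have e5 : 0 ≤ K₂ * σ := by positivity
        linarith
    calc ∑ i, ‖coordDeriv f i (κ y)‖ ≤ ∑ _i : Fin 5, (K₂ + |Λ| * K₂ + C₁) * σ :=
          Finset.sum_le_sum fun i _ => hall i
      _ = 5 * (K₂ + |Λ| * K₂ + C₁) * σ := by
          rw [Finset.sum_const, Finset.card_univ, Fintype.card_fin, nsmul_eq_mul]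
          push_cast
          ring

end GradientChart

end CubicFourfold

/-! ### Hessian of rank at least three: divergence -/

namespace CubicFourfold

variable {F : MvPolynomial (Fin 6) ℂ} {B : V → V → V → ℂ}

/-- A parametrization of a neighbourhood of `[x]` in projective space is a submersion modulo `x`. -/
theorem exists_eq_apply_add_smul {x : V} (hx : x ≠ 0) {T : (Fin 5 → ℂ) →L[ℂ] V}
    (hinj : ∀ (v : Fin 5 → ℂ) (c : ℂ), T v = c • x → v = 0) (y : V) :
    ∃ (v : Fin 5 → ℂ) (c : ℂ), y = T v + c • x := by
  let L : (Fin 5 → ℂ) × ℂ →ₗ[ℂ] V :=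
    (T.coprod (ContinuousLinearMap.toSpanSingleton ℂ x)).toLinearMap
  have hL : ∀ v c, L (v, c) = T v + c • x := fun v c => by
    simp [L]
  have hL0 : Function.Injective L := by
    rw [injective_iff_map_eq_zero]
    rintro ⟨v, c⟩ h
    rw [hL] at h
    have hv : v = 0 := hinj v (-c) (by rw [neg_smul]; exact eq_neg_of_add_eq_zero_left h)
    subst hv
    have hc : c = 0 := by simpa [hx] using h
    rw [hc]; rfl
  have hfin : Module.finrank ℂ ((Fin 5 → ℂ) × ℂ) = Module.finrank ℂ V := by simp
  obtain ⟨⟨v, c⟩, h⟩ := (LinearMap.injective_iff_surjective_of_finrank_eq_finrank hfin).1 hL0 y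
  exact ⟨v, c, by rw [← h, hL]⟩

/-- A local equation of a polynomial is analytic. -/
theorem analyticAt_localEquation {ψ : (Fin 5 → ℂ) → V} (hψ : AnalyticAt ℂ ψ 0)
    {u f : (Fin 5 → ℂ) → ℂ} (hu : AnalyticAt ℂ u 0) (hu0 : u 0 ≠ 0)
    (heq : ∀ᶠ z in 𝓝 0, evalAt F (ψ z) = u z * f z) : AnalyticAt ℂ f 0 := by
  have h1 : AnalyticAt ℂ (fun z => evalAt F (ψ z)) 0 :=
    AnalyticAt.aeval_mvPolynomial (fun i =>
      ((EuclideanSpace.proj i : V →L[ℂ] ℂ).analyticAt (ψ 0)).comp hψ) F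
  refine (h1.div hu hu0).congr ?_
  filter_upwards [heq, hu.continuousAt.eventually_ne hu0] with z hz huz
  change evalAt F (ψ z) / u z = f z
  rw [hz, mul_div_cancel_left₀ _ huz]

/-- At a singular point the differential of a local equation vanishes, and its Hessian is the
Hessian of `F` up to a unit. -/
theorem hessian_localEquation (hB : IsPolarization F B) {x : V} (hx : ∀ v, B x x v = 0)
    {ψ : (Fin 5 → ℂ) → V} (hψ : AnalyticAt ℂ ψ 0) (hψ0 : ψ 0 = x)
    {u f : (Fin 5 → ℂ) → ℂ} (hu : AnalyticAt ℂ u 0) (hu0 : u 0 ≠ 0) (hf : AnalyticAt ℂ f 0)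
    (heq : ∀ᶠ z in 𝓝 0, evalAt F (ψ z) = u z * f z) :
    f 0 = 0 ∧ fderiv ℂ f 0 = 0 ∧ ∀ i v, u 0 * fderiv ℂ (coordDeriv f i) 0 v =
      6 * B x (fderiv ℂ ψ 0 v) (fderiv ℂ ψ 0 (Pi.single i 1)) := by
  have hev := eventually_fderiv_localEquation hB hψ.contDiffAt hu.contDiffAt hf.contDiffAt heq
  have hf0 : f 0 = 0 := by
    have h := heq.self_of_nhds
    rw [hψ0, hB.eval_eq, hx] at h
    exact (mul_eq_zero.1 h.symm).resolve_left hu0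
  have hdf : fderiv ℂ f 0 = 0 := by
    ext1 v
    have h := hev.self_of_nhds v
    rw [hψ0, hx, hf0, mul_zero, mul_zero, zero_add] at h
    simpa using (mul_eq_zero.1 h.symm).resolve_left hu0
  refine ⟨hf0, hdf, fun i v => ?_⟩
  have hline : HasDerivAt (fun s : ℂ => s • v) v 0 := by
    simpa using (hasDerivAt_id (0 : ℂ)).smul_const v
  have hz0 : (0 : ℂ) • v = 0 := zero_smul _ _
  have hcurve : ∀ {E : Type} [NormedAddCommGroup E] [NormedSpace ℂ E] {g : (Fin 5 → ℂ) → E},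
      AnalyticAt ℂ g 0 → HasDerivAt (fun s : ℂ => g (s • v)) (fderiv ℂ g 0 v) 0 := by
    intro E _ _ g hg
    refine HasFDerivAt.comp_hasDerivAt (0 : ℂ) ?_ hline
    rw [hz0]
    exact hg.differentiableAt.hasFDerivAt
  have hpart : ∀ {E : Type} [NormedAddCommGroup E] [NormedSpace ℂ E] [CompleteSpace E]
      {g : (Fin 5 → ℂ) → E},
      AnalyticAt ℂ g 0 → AnalyticAt ℂ (fun z => fderiv ℂ g z (Pi.single i 1)) 0 := by
    intro E _ _ _ g hg
    exact ((ContinuousLinearMap.apply ℂ E (Pi.single i 1 : Fin 5 → ℂ)).analyticAt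
      (fderiv ℂ g 0)).comp hg.fderiv
  -- The first-order identity `3 B(ψ, ψ, ∂ᵢψ) = f ∂ᵢu + u ∂ᵢf` is differentiated at 0 in the
  -- direction `v`; all terms with `f 0`, `df 0` or `B x x` vanish.
  have h1 := (hB.hasDerivAt_comp (hcurve hψ) (hcurve hψ) (hcurve (hpart hψ))).const_mul 3
  have h2 := ((hcurve (hpart hu)).mul (hcurve hf)).add ((hcurve hu).mul (hcurve (hpart hf)))
  have hline0 : Filter.Tendsto (fun s : ℂ => s • v) (𝓝 0) (𝓝 0) := by
    have := hline.continuousAt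
    rwa [ContinuousAt, hz0] at this
  have h3 := (h1.congr_of_eventuallyEq
    ((hline0.eventually hev).mono fun s hs => (hs (Pi.single i 1)).symm)).unique h2
  simp only [hz0, hψ0, hf0, hx, hdf, zero_apply] at h3
  rw [hB.swap12 (fderiv ℂ ψ 0 v) x] at h3
  change u 0 * fderiv ℂ (fun z => fderiv ℂ f z (Pi.single i 1)) 0 v = _
  linear_combination -h3

/-- The Hessian of `f` at 0 is that of `F` up to a unit, so it has a nondegenerate principal minor
on some `P` with at least three indices, of total weight `card P * d / 2`. Evening out these weights
to `d / 2` makes all partial derivatives in `P` have the same order `d / 2`, and all others have at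
least this order. -/
theorem lintegral_curvature_of_rank_three (hB : IsPolarization F B) {x : V} (hx0 : x ≠ 0)
    (hx : ∀ v, B x x v = 0) {e : Fin 3 → V}
    (he : ∀ i j, B x (e i) (e j) = if i = j then 1 else 0) (h : HasGoodWeightedEquation F x) :
    ∫⁻ x in regLink F, ENNReal.ofReal (curvature F B x)
      ∂(MeasureTheory.Measure.hausdorffMeasure 9) = ∞ := by
  obtain ⟨f, w, d, hw, ⟨k, hk⟩, hhom, hwd, ψ, u, hψ, hψ0, hinj, hu, hu0, heq⟩ := h
  have hf := analyticAt_localEquation hψ hu hu0 heq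
  obtain ⟨hf0, hdf, hH⟩ := hessian_localEquation hB hx hψ hψ0 hu hu0 hf heq
  have hd : 0 < d := by
    have h1 : 0 < w k := (hw k).lt_of_ne' hk
    have h2 := Finset.single_le_sum (fun i _ => hw i) (Finset.mem_univ k)
    linarith
  let M : Fin 5 → Fin 5 → ℂ := fun i j => fderiv ℂ (coordDeriv f i) 0 (Pi.single j 1)
  have hMv : ∀ i v, fderiv ℂ (coordDeriv f i) 0 v = ∑ j, M i j * v j := fun i v =>
    sum_coordDeriv_mul _ _ _
  have hM : ∀ i j, M i j = M j i := fun i j => mul_left_cancel₀ hu0 (by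
    rw [hH, hH, hB.swap23])
  choose a c hac using fun i => exists_eq_apply_add_smul hx0 hinj (e i)
  have hBa : ∀ i j, B x (fderiv ℂ ψ 0 (a i)) (fderiv ℂ ψ 0 (a j)) = if i = j then 1 else 0 := by
    intro i j
    rw [← he, hac i, hac j]
    simp only [hB.add_mid, hB.add_right, hB.smul_mid, hB.smul_right, hx, hB.swap23 x _ x]
    ring
  have haM : ∀ i j, ∑ k, a i k * ∑ l, M k l * a j l = if i = j then 6 / u 0 else 0 := by
    intro i j
    have h1 : u 0 * ∑ k, a i k * ∑ l, M k l * a j l = 6 * if i = j then 1 else 0 := by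
      rw [← hBa, hB.swap23]
      conv_rhs => rw [pi_eq_sum_univ' (a i)]
      rw [map_sum, hB.sum_right, Finset.mul_sum, Finset.mul_sum]
      refine Finset.sum_congr rfl fun k _ => ?_
      rw [map_smul, hB.smul_right, ← hMv]
      linear_combination a i k * hH k (a j)
    split_ifs at h1 ⊢
    · rw [eq_div_iff hu0]
      linear_combination h1
    · simpa [hu0] using h1
  obtain ⟨P, hP3, hP⟩ := exists_nondegenerate_principal_minor hM (div_ne_zero (by norm_num) hu0) haM
  have hcoord : ∀ i, AnalyticAt ℂ (coordDeriv f i) 0 := fun i =>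
    ((ContinuousLinearMap.apply ℂ ℂ (Pi.single i 1 : Fin 5 → ℂ)).analyticAt
      (fderiv ℂ f 0)).comp hf.fderiv
  have hPw := two_mul_sum_weights hP fun i j hij => weights_of_hessian_ne_zero hf.contDiffAt
    (fun i => (hcoord i).differentiableAt) hw hhom hij
  -- The indices of `P` take up at least `3d/2` of a total weight of at most `2d`.
  have hwP : ∀ i ∉ P, w i ≤ d / 2 := by
    intro i hi
    have h1 : ∑ j ∈ insert i P, w j ≤ ∑ j, w j :=
      Finset.sum_le_sum_of_subset_of_nonneg (Finset.subset_univ _) fun j _ _ => hw j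
    rw [Finset.sum_insert hi] at h1
    have h2 : (3 : ℝ) ≤ P.card := by exact_mod_cast hP3
    nlinarith
  let D : Fin 5 → ℝ := fun i => if i ∈ P then d / 2 else w i
  have hD : ∑ i, D i ≤ 2 * d := by
    have h1 : ∑ i, D i = ∑ i, w i := by
      rw [← Finset.sum_add_sum_compl P D, ← Finset.sum_add_sum_compl P w]
      congr 1
      · rw [Finset.sum_congr rfl fun i hi => if_pos hi, Finset.sum_const, nsmul_eq_mul]
        linarith
      · exact Finset.sum_congr rfl fun i hi => if_neg (Finset.mem_compl.1 hi)
    rw [h1]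
    exact hwd
  obtain ⟨η, hη0, hη⟩ := exists_quadraticForm_ne_zero hM (Finset.card_pos.1 (by omega)) hP
  obtain ⟨κ, κ', r, Λ, hχ⟩ := exists_gradientChart hf hdf hw hhom (P := P)
    (fun v hv hv' => hP v hv fun i hi => by rw [← hMv]; exact hv' i hi)
  set ξ : Fin 5 → ℂ := fun i => if i ∈ P then fderiv ℂ (coordDeriv f i) 0 η else 0 with hξ
  have hκξ : κ' ξ = η := hχ.apply η hη0
  have hne : ∑ i ∈ P, ξ i * η i ≠ 0 := by
    have h1 : ∑ i ∈ P, ξ i * η i = ∑ i, η i * ∑ j, M i j * η j := by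
      rw [← Finset.sum_subset (Finset.subset_univ P) fun i _ hi => by rw [hη0 i hi, zero_mul]]
      refine Finset.sum_congr rfl fun i hi => ?_
      rw [hξ, ← hMv]
      simp only [if_pos hi]
      ring
    rw [h1]
    exact hη
  obtain ⟨k₀, hk₀, hξk⟩ := Finset.exists_ne_zero_of_sum_ne_zero hne
  have hξk₀ : ξ k₀ ≠ 0 := left_ne_zero_of_mul hξk
  -- The coordinate `k₀` is exchanged for the parameter `T` along `ξ`; a second index of `P` serves
  -- to keep the differential of `f` nonzero and the box away from the origin.
  obtain ⟨i₀, hi₀, hi₀k⟩ := Finset.exists_mem_ne (by omega : 1 < P.card) k₀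
  obtain ⟨C, hC⟩ := hχ.exists_zero hw hd hwP (fun i hi => by simp [hξ, hi]) hκξ hne hk₀ hξk₀
    hi₀ hi₀k
  let A : ({i // i ≠ k₀} → ℂ) × ℂ →L[ℂ] Fin 5 → ℂ :=
    (extendZero k₀).coprod (ContinuousLinearMap.toSpanSingleton ℂ ξ)
  have hA : ∀ y, A y = extendZero k₀ y.1 + y.2 • ξ := fun y => by
    simp [A, ContinuousLinearMap.toSpanSingleton_apply]
  have hAinj : Function.Injective A := by
    rw [injective_iff_map_eq_zero]
    rintro ⟨z, t⟩ hzt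
    rw [hA] at hzt
    have ht : t = 0 := by
      have := congrFun hzt k₀
      simpa [extendZero_self, hξk₀] using this
    subst ht
    have hz : z = 0 := by
      ext i
      have := congrFun hzt i
      simpa [extendZero_of_ne i.2] using this
    rw [hz]; rfl
  -- Dropping `k₀`, of weight `d / 2`, leaves at most `3d/2`. So the box has volume at least of
  -- order `ρ ^ (3d)`, the order that bounds `|df|⁶`.
  have hsumD : ∑ i : {i // i ≠ k₀}, D i ≤ 3 * d / 2 := by
    have h1 := Fintype.sum_eq_add_sum_subtype_ne D k₀
    have h2 : D k₀ = d / 2 := if_pos hk₀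
    linarith
  refine lintegral_curvature_of_localEquation hB hx0 he hψ.contDiffAt hψ0 hinj hu.contDiffAt hu0
    hf.contDiffAt heq (ι := {i // i ≠ k₀}) (by simp) (κ := fun y => κ (A y)) (κ' := κ' ∘L A)
    ?_ ?_ (hχ.injective.comp hAinj) fun ε hε => ?_
  · have h1 : HasStrictFDerivAt κ κ' (A 0) := by rw [map_zero]; exact hχ.strict
    exact h1.comp 0 A.hasStrictFDerivAt
  · rw [map_zero, hχ.map_zero]
  refine ⟨fun i => D i, fun i => if (i : Fin 5) ∈ P then 1 else 0, C ^ 6,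
    ⟨⟨i₀, hi₀k⟩, ?_, by simp [hi₀]⟩, ?_⟩
  · change 0 < if i₀ ∈ P then d / 2 else w i₀
    rw [if_pos hi₀]
    positivity
  have hpos : ∀ᶠ q : ℝ × ({i // i ≠ k₀} → ℂ) in 𝓝[>] 0 ×ˢ
      𝓝 (fun i : {i // i ≠ k₀} => if (i : Fin 5) ∈ P then (1 : ℂ) else 0), 0 < q.1 :=
    Filter.tendsto_fst.eventually (self_mem_nhdsWithin : Set.Ioi (0 : ℝ) ∈ 𝓝[>] 0)
  have hone : ∀ᶠ q : ℝ × ({i // i ≠ k₀} → ℂ) in 𝓝[>] 0 ×ˢ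
      𝓝 (fun i : {i // i ≠ k₀} => if (i : Fin 5) ∈ P then (1 : ℂ) else 0), q.1 ≤ 1 :=
    Filter.tendsto_fst.eventually (mem_nhdsWithin_of_mem_nhds (Iic_mem_nhds one_pos))
  have hsmall : ∀ᶠ q : ℝ × ({i // i ≠ k₀} → ℂ) in 𝓝[>] 0 ×ˢ
      𝓝 (fun i : {i // i ≠ k₀} => if (i : Fin 5) ∈ P then (1 : ℂ) else 0),
      ∀ i : {i // i ≠ k₀}, ‖((q.1 ^ D i : ℝ) : ℂ) * q.2 i‖ < ε := by
    rw [Filter.eventually_all]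
    intro i
    have hZ : Filter.Tendsto (fun q : ℝ × ({i // i ≠ k₀} → ℂ) => ‖q.2 i‖)
        (𝓝[>] 0 ×ˢ 𝓝 (fun i : {i // i ≠ k₀} => if (i : Fin 5) ∈ P then (1 : ℂ) else 0))
        (𝓝 ‖if (i : Fin 5) ∈ P then (1 : ℂ) else 0‖) :=
      (((continuous_apply i).tendsto _).comp Filter.tendsto_snd).norm
    by_cases hi : (i : Fin 5) ∈ P
    · have hρ : Filter.Tendsto (fun q : ℝ × ({i // i ≠ k₀} → ℂ) => q.1 ^ (d / 2))
          (𝓝[>] 0 ×ˢ 𝓝 (fun i : {i // i ≠ k₀} => if (i : Fin 5) ∈ P then (1 : ℂ) else 0))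
          (𝓝 0) := by
        have h1 := (Real.continuousAt_rpow_const 0 (d / 2) (Or.inr (by positivity))).tendsto
        rw [Real.zero_rpow (by positivity)] at h1
        exact (h1.mono_left nhdsWithin_le_nhds).comp Filter.tendsto_fst
      have h2 := hρ.mul hZ
      rw [zero_mul] at h2
      filter_upwards [h2.eventually (gt_mem_nhds hε), hpos] with q hq hq0
      rw [norm_mul, Complex.norm_real, Real.norm_of_nonneg (Real.rpow_nonneg hq0.le _)]
      simpa [D, hi] using hq
    · rw [if_neg hi, norm_zero] at hZ
      filter_upwards [hZ.eventually (gt_mem_nhds hε), hpos, hone] with q hq hq0 hq1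
      rw [norm_mul, Complex.norm_real, Real.norm_of_nonneg (Real.rpow_nonneg hq0.le _)]
      refine (mul_le_of_le_one_left (norm_nonneg _) ?_).trans_lt hq
      refine Real.rpow_le_one hq0.le hq1 ?_
      simp only [D, if_neg hi]
      exact hw i
  filter_upwards [hC ε hε, hpos, hone, hsmall] with q ⟨T, hT, hfT, hdT, hle⟩ hq0 hq1 hsm
  refine ⟨T, ?_, ?_, ?_, ?_⟩
  · rw [Prod.norm_def, max_lt_iff]
    exact ⟨(pi_norm_lt_iff hε).2 hsm, hT⟩
  · simp only [hA]
    exact hfT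
  · simp only [hA]
    exact hdT
  · simp only [hA]
    refine (pow_le_pow_left₀ (norm_nonneg _) hle 6).trans ?_
    rw [mul_pow]
    refine mul_le_mul_of_nonneg_left ?_ (by positivity)
    rw [← Real.rpow_natCast, ← Real.rpow_mul hq0.le]
    refine Real.rpow_le_rpow_of_exponent_ge hq0 hq1 ?_
    push_cast
    linarith

end CubicFourfold

/-! ### The cases by rank, and the conclusion -/

namespace CubicFourfold

variable {F : MvPolynomial (Fin 6) ℂ} {B : V → V → V → ℂ}

/-- Divergence at a singular point of an irreducible cubic. -/
theorem lintegral_curvature_of_singular (hB : IsPolarization F B) (hirr : ¬ ContainsHyperplane B)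
    {x : V} (hx0 : x ≠ 0) (hx : ∀ v, B x x v = 0) (h : HasGoodWeightedEquation F x) :
    ∫⁻ x in regLink F, ENNReal.ofReal (curvature F B x)
      ∂(MeasureTheory.Measure.hausdorffMeasure 9) = ∞ := by
  have hrad : ∀ {n : ℕ} {ζ : Fin n → V}, (∀ i v, B x (ζ i) v = 0) → ∀ (z : Fin n → ℂ) (c : ℂ) w,
      B x (∑ i, z i • ζ i + c • x) w = 0 := fun hζ z c w => by
    rw [hB.add_mid, hB.sum_mid, hB.smul_mid, hx]
    simp [hB.smul_mid, hζ]
  -- Orthonormal vectors for `B x` are found one after the other. If the process stops after 0, 1 or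
  -- 2 vectors, their orthogonal complement is the radical and the rank is known; otherwise the rank
  -- is at least three.
  rcases exists_adapted_basis hB hx0 hx (u := (![] : Fin 0 → V)) (fun i => i.elim0) (n := 5)
    (by simp) with ⟨v₀, -, h00⟩ | ⟨ζ, hζ, -, hspan⟩
  swap
  · refine lintegral_curvature_of_cone hB hirr hx0 fun v w => ?_
    obtain ⟨z, c, rfl⟩ := hspan v fun i => i.elim0
    exact hrad hζ z c w
  rcases exists_adapted_basis hB hx0 hx (u := ![v₀]) (by simpa using h00) (n := 4)
    (by simp) with ⟨v₁, h1, h11⟩ | ⟨ζ, hζ, -, hspan⟩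
  swap
  · refine RankOne.lintegral_curvature hB ⟨hx0, hx, h00, fun v hv w => ?_⟩ hirr
    obtain ⟨z, c, rfl⟩ := hspan v (by simpa using hv)
    exact hrad hζ z c w
  have h01 : B x v₀ v₁ = 0 := h1 0
  have h10 : B x v₁ v₀ = 0 := by rw [hB.swap23, h01]
  rcases exists_adapted_basis hB hx0 hx (u := ![v₀, v₁])
    (by simp [Fin.forall_fin_two, h00, h01, h10, h11]) (n := 3)
    (by simp) with ⟨v₂, h2, h22⟩ | ⟨ζ, hζ, hind, hspan⟩
  swap
  · have hI := Complex.I_mul_I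
    -- The isotropic vectors `v₀ ± i v₁`, with the factor `1/2` to make `B x p q = 1`.
    refine RankTwo.lintegral_curvature hB (ζ := ζ) (p := v₀ + Complex.I • v₁)
      (q := (1 / 2 : ℂ) • (v₀ + (-Complex.I) • v₁)) ⟨hx0, hx, hζ, ?_, ?_, ?_, ?_, ?_⟩ hirr
    · simp only [hB.add_mid, hB.add_right, hB.smul_mid, hB.smul_right, h00, h01, h10, h11]
      linear_combination hI
    · simp only [hB.add_mid, hB.add_right, hB.smul_mid, hB.smul_right, h00, h01, h10, h11]
      linear_combination hI / 4
    · simp only [hB.add_mid, hB.add_right, hB.smul_mid, hB.smul_right, h00, h01, h10, h11]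
      linear_combination -hI / 2
    · intro z s t c hz
      obtain ⟨hz0, ht⟩ := hind z ![s + t / 2, Complex.I * (s - t / 2)] c (by
        rw [← hz, Fin.sum_univ_two]
        simp only [Matrix.cons_val_zero, Matrix.cons_val_one]
        module)
      have ht0 : s + t / 2 = 0 := congrFun ht 0
      have ht1 : Complex.I * (s - t / 2) = 0 := congrFun ht 1
      have ht2 := (mul_eq_zero.1 ht1).resolve_left Complex.I_ne_zero
      exact ⟨hz0, by linear_combination (ht0 + ht2) / 2, by linear_combination ht0 - ht2⟩
    · intro v hp hq
      simp only [hB.add_mid, hB.smul_mid] at hp hq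
      have hv0 : B x v₀ v = 0 := by linear_combination hp / 2 + hq
      have hv1 : B x v₁ v = 0 := by
        refine (mul_eq_zero.1 ?_).resolve_left Complex.I_ne_zero
        linear_combination hp / 2 - hq
      exact hspan v (by simp [Fin.forall_fin_two, hv0, hv1])
  have h02 : B x v₀ v₂ = 0 := h2 0
  have h12 : B x v₁ v₂ = 0 := h2 1
  have h20 : B x v₂ v₀ = 0 := by rw [hB.swap23, h02]
  have h21 : B x v₂ v₁ = 0 := by rw [hB.swap23, h12]
  refine lintegral_curvature_of_rank_three hB hx0 hx (e := ![v₀, v₁, v₂]) (fun i j => ?_) h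
  fin_cases i <;> fin_cases j <;> simp [h00, h01, h02, h10, h11, h12, h20, h21, h22]

/-- Condition (B1) for a cubic with a singular point that has a good weighted homogeneous local
equation. -/
theorem conditionB1_of_weighted (hF : F.IsHomogeneous 3) (hplanes : ¬ IsUnionOfHyperplanes F)
    {μ : V [⋀^Fin 6]→L[ℂ] ℂ} (hμ : μ ≠ 0) {x : V} (hx : IsSingularPoint F x)
    (h : HasGoodWeightedEquation F x) : ConditionB1 F μ := by
  obtain ⟨B, hB⟩ := exists_isPolarization hF
  refine conditionB1_of_lintegral_curvature hB hμ ?_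
  by_cases hirr : ContainsHyperplane B
  · obtain ⟨L, q, h⟩ := hirr.exists_isProduct hB
    exact h.lintegral_curvature hB hplanes
  refine lintegral_curvature_of_singular hB hirr hx.1 (fun v => ?_) h
  have h1 := hB.eq_sum_partial x v
  simpa [hx.2.2] using h1

end CubicFourfold

theorem lemma4p3
    (F : MvPolynomial (Fin 6) ℂ) (hF : F.IsHomogeneous 3)
    (hplanes : ¬ CubicFourfold.IsUnionOfHyperplanes F)
    (μ : CubicFourfold.V [⋀^Fin 6]→L[ℂ] ℂ) (hμ : μ ≠ 0)
    (hsing : ∃ x, CubicFourfold.IsSingularPoint F x ∧ ¬ CubicFourfold.IsOfTypeADE F x)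
    (hweights : ∀ x, CubicFourfold.IsSingularPoint F x → ¬ CubicFourfold.IsOfTypeADE F x →
      CubicFourfold.HasGoodWeightedEquation F x) :
    CubicFourfold.ConditionB1 F μ := by
  obtain ⟨x, hx, hADE⟩ := hsing
  exact CubicFourfold.conditionB1_of_weighted hF hplanes hμ hx (hweights x hx hADE)
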